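/- Let $p$ be a prime, let $G=\mathrm{GSp}_4$ be the similitude group of the symplectic matrix with rows $(0,0,0,1)$, $(0,0,1,0)$, $(0,-1,0,0)$, $(-1,0,0,0)$, and let $\mathrm{Sieg}(p)$, $\mathrm{Kl}(p)$, $\mathrm{Iw}(p)\subset G(\mathbf{Z}_p)$ be the preimages of the standard upper (block-)triangular Siegel parabolic (blocks of size $2,2$), Klingen parabolic (blocks of size $1,2,1$) and Borel subgroup of $G(\mathbf{Z}/p)$. Let $r_1\ge r_2\ge 0$ be integers. Let $\psi$ be an additive character of $\mathbf{Q}_p$ that is trivial on $\mathbf{Z}_p$ but not on $p^{-1}\mathbf{Z}_p$, and regard it as the character $n\mapsto\psi(n_{12}+n_{23})$ of the group $N(\mathbf{Q}_p)$ of upper triangular unipotent matrices in $G(\mathbf{Q}_p)$. Let $\pi$ be an irreducible smooth complex representation of $G(\mathbf{Q}_p)$ that is unramified (it has a nonzero $G(\mathbf{Z}_p)$-fixed vector) and generic, identified with a Whittaker model, i.e. a space of functions $W$ on $G(\mathbf{Q}_p)$ with $W(ng)=\psi(n)W(g)$ for $n \in N(\mathbf{Q}_p)$, on which $G(\mathbf{Q}_p)$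 acts by right translation. Let $w=r_1+r_2+3$, let $P(X)$ be the polynomial with $L(\pi,s-\tfrac{w}{2})=P(p^{-s})^{-1}$ (spin $L$-factor), and let $\alpha,\beta,\gamma,\delta$ be the Hecke parameters: $P(X)=(1-\alpha X)(1-\beta X)(1-\gamma X)(1-\delta X)$ and $\alpha\delta=\beta\gamma=p^{w}\chi_\pi(p)$, where $\chi_\pi$ is the central character of $\pi$. For $K$ one of the three groups above, let $U_{1,K}=p^{(r_1+r_2)/2}[K\,\mathrm{diag}(p,p,1,1)\,K]$ and $U_{2,K}=p^{r_1}[K\,\mathrm{diag}(p^2,p,p,1)\,K]$, acting on $\pi^K$, where $[KgK]v=\sum_{xK\subset KgK}\pi(x)v$. The normalised generator of a one-dimensional space of Whittaker functions is the element that spans it and takes the value $1$ at the identity. Then there is a unique $w^{\mathrm{sph}}\in\pi^{G(\mathbf{Z}_p)}$ with $w^{\mathrm{sph}}(1)=1$; the operators $U_{1,\mathrm{Sieg}}$, $U_{2,\mathrm{Kl}}$, $U_{1,\mathrm{Iw}}$, $U_{2,\mathrm{Iw}}$ are invertible; and the following hold. 1. The $U_{1,\mathrm{Sieg}}=\alpha$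 eigenspace of $\pi^{\mathrm{Sieg}(p)}$ is one-dimensional, with normalised generator $$w^{\mathrm{Sieg}}_\alpha=\Bigl(1-\frac{\beta}{U_{1,\mathrm{Sieg}}}\Bigr)\Bigl(1-\frac{\gamma}{U_{1,\mathrm{Sieg}}}\Bigr)\Bigl(1-\frac{\delta}{U_{1,\mathrm{Sieg}}}\Bigr)w^{\mathrm{sph}}.$$ 2. If $\alpha+\gamma\ne0$, the $U_{2,\mathrm{Kl}}=\frac{\alpha\beta}{p^{r_2+1}}$ eigenspace of $\pi^{\mathrm{Kl}(p)}$ is one-dimensional, with normalised generator $$w^{\mathrm{Kl}}_{\alpha\beta}=\frac{1}{1+\frac{\gamma}{\alpha}}\Bigl(1-\frac{\gamma\delta}{p^{r_2+1}U_{2,\mathrm{Kl}}}\Bigr)\Bigl(1-\frac{\alpha\gamma}{p^{r_2+1}U_{2,\mathrm{Kl}}}\Bigr)\Bigl(1-\frac{\beta\delta}{p^{r_2+1}U_{2,\mathrm{Kl}}}\Bigr)w^{\mathrm{sph}}.$$ 3. The joint eigenspace $(U_{1,\mathrm{Iw}}=\alpha,\ U_{2,\mathrm{Iw}}=\frac{\alpha\beta}{p^{r_2+1}})$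 in $\pi^{\mathrm{Iw}(p)}$ is one-dimensional, with normalised generator $$w^{\mathrm{Iw}}_{\alpha,\beta}=\Bigl(1-\frac{\alpha\gamma}{p^{r_2+1}U_{2,\mathrm{Iw}}}\Bigr)w^{\mathrm{Sieg}}_\alpha,$$ and if $\alpha+\gamma\ne0$ this vector is also equal to $\bigl(1-\frac{\beta}{U_{1,\mathrm{Iw}}}\bigr)w^{\mathrm{Kl}}_{\alpha\beta}$. -/

import Mathlib

open Polynomial Matrix

noncomputable section

namespace GSpFour

/-! ### Generalities on representations of a (topological) group -/

section Reps

variable {G : Type*} [Group G]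

/-- Right translation of functions: `(g • f)(x) = f (x g)`. -/
def rightTranslation (G : Type*) [Group G] : Representation ℂ G (G → ℂ) where
  toFun g :=
    { toFun := fun f x => f (x * g)
      map_add' := fun _ _ => rfl
      map_smul' := fun _ _ => rfl }
  map_one' := by ext f x; simp
  map_mul' g h := by ext f x; simp [mul_assoc]

variable {V : Type*} [AddCommGroup V] [Module ℂ V]

/-- A vector is smooth if it is fixed by an open subgroup. -/
def IsSmoothVector [TopologicalSpace G] (ρ : Representation ℂ G V) (v : V) : Prop :=
  ∃ U : Subgroup G, IsOpen (U : Set G) ∧ ∀ g ∈ U, ρ g v = v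

/-- A representation is smooth if all its vectors are. -/
def IsSmooth [TopologicalSpace G] (ρ : Representation ℂ G V) : Prop :=
  ∀ v, IsSmoothVector ρ v

/-- The subspace of vectors fixed by a subgroup `K`. -/
def fixedVectors (ρ : Representation ℂ G V) (K : Subgroup G) : Submodule ℂ V where
  carrier := {v | ∀ k ∈ K, ρ k v = v}
  zero_mem' := fun k _ => map_zero (ρ k)
  add_mem' := fun {v w} hv hw k hk => by rw [map_add, hv k hk, hw k hk]
  smul_mem' := fun c v hv k hk => by rw [map_smul, hv k hk]

/-- For `K' ≤ K`, the inclusion of the `K`-fixed vectors in the `K'`-fixed vectors. -/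
def fixedInclusion (ρ : Representation ℂ G V) {K' K : Subgroup G} (h : K' ≤ K) :
    fixedVectors ρ K →ₗ[ℂ] fixedVectors ρ K' :=
  Submodule.inclusion fun _ hv k hk => hv k (h hk)

/-- The action of a left coset `x = gK` on `K`-fixed vectors, `v ↦ ρ(g) v`. -/
def cosetAction (ρ : Representation ℂ G V) (K : Subgroup G) (x : G ⧸ K) :
    fixedVectors ρ K →ₗ[ℂ] V :=
  Quotient.liftOn' x (fun g => (ρ g).comp (fixedVectors ρ K).subtype) (by
    intro g h hgh
    rw [QuotientGroup.leftRel_apply] at hgh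
    ext v
    have hv := v.2 _ hgh
    have : ρ h v.1 = ρ g (ρ (g⁻¹ * h) v.1) := by
      rw [← Module.End.mul_apply, ← map_mul, mul_inv_cancel_left]
    simp only [LinearMap.comp_apply, Submodule.subtype_apply]
    rw [this, hv])

theorem cosetAction_smul (ρ : Representation ℂ G V) (K : Subgroup G) (k : G) (x : G ⧸ K) :
    cosetAction ρ K (k • x) = (ρ k).comp (cosetAction ρ K x) := by
  induction x using QuotientGroup.induction_on with
  | H g =>
    ext v
    change ρ (k * g) v.1 = ρ k (ρ g v.1)
    rw [map_mul, Module.End.mul_apply]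

/-- The sum over the left cosets `xK ⊆ K g K` of the action of `x`; these cosets form the
`K`-orbit of `gK` in `G ⧸ K`, which is finite when `K` is compact and open. -/
def heckeSum (ρ : Representation ℂ G V) (K : Subgroup G) (g : G) : fixedVectors ρ K →ₗ[ℂ] V :=
  ∑ᶠ x : MulAction.orbit K (g : G ⧸ K), cosetAction ρ K x.1

theorem heckeSum_mem (ρ : Representation ℂ G V) (K : Subgroup G) (g : G)
    (v : fixedVectors ρ K) : heckeSum ρ K g v ∈ fixedVectors ρ K := by
  intro k hk
  let e : V ≃ₗ[ℂ] V :=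
    LinearEquiv.ofLinearMap (ρ k) (ρ k⁻¹)
      (by rw [← Module.End.mul_eq_comp, ← map_mul, mul_inv_cancel, map_one]; rfl)
      (by rw [← Module.End.mul_eq_comp, ← map_mul, inv_mul_cancel, map_one]; rfl)
  let E : (fixedVectors ρ K →ₗ[ℂ] V) ≃+ (fixedVectors ρ K →ₗ[ℂ] V) :=
    { toFun := fun f => e.toLinearMap.comp f
      invFun := fun f => e.symm.toLinearMap.comp f
      left_inv := fun f => by ext x; simp
      right_inv := fun f => by ext x; simp
      map_add' := fun f f' => by ext x; simp }
  have h1 : E (heckeSum ρ K g) = heckeSum ρ K g := by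
    unfold heckeSum
    rw [AddEquiv.map_finsum]
    rw [← finsum_comp_equiv
      (MulAction.toPerm (⟨k, hk⟩ : K) : Equiv.Perm (MulAction.orbit K (g : G ⧸ K)))
      (f := fun x => cosetAction ρ K x.1)]
    refine finsum_congr fun x => ?_
    exact (cosetAction_smul ρ K k x.1).symm
  exact congrArg (fun f => f v) h1

/-- The double coset operator `[K g K]` on `K`-fixed vectors: `v ↦ ∑ ρ(x) v`, the sum over
`xK ∈ KgK/K`. -/
def heckeOp (ρ : Representation ℂ G V) (K : Subgroup G) (g : G) :
    Module.End ℂ (fixedVectors ρ K) :=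
  (heckeSum ρ K g).codRestrict (fixedVectors ρ K) (heckeSum_mem ρ K g)

end Reps

/-! ### The group `GSp₄` and its subgroups -/

section Group

/-- The Gram matrix of the symplectic form. -/
def J (R : Type*) [CommRing R] : Matrix (Fin 4) (Fin 4) R :=
  !![0, 0, 0, 1; 0, 0, 1, 0; 0, -1, 0, 0; -1, 0, 0, 0]

/-- The similitude group `GSp₄(R)` of `J`. -/
def GSp4 (R : Type*) [CommRing R] : Subgroup (GL (Fin 4) R) where
  carrier := {g | ∃ μ : Rˣ, (g : Matrix (Fin 4) (Fin 4) R)ᵀ * J R * g = (μ : R) • J R}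
  one_mem' := ⟨1, by simp⟩
  mul_mem' := by
    rintro g h ⟨μ, hg⟩ ⟨ν, hh⟩
    refine ⟨μ * ν, ?_⟩
    calc ((g * h : GL (Fin 4) R) : Matrix (Fin 4) (Fin 4) R)ᵀ * J R * (g * h : GL (Fin 4) R)
        = (h : Matrix (Fin 4) (Fin 4) R)ᵀ *
          ((g : Matrix (Fin 4) (Fin 4) R)ᵀ * J R * g) * h := by
          simp [Matrix.transpose_mul, Matrix.mul_assoc]
      _ = ((μ * ν : Rˣ) : R) • J R := by
          rw [hg, Matrix.mul_smul, Matrix.smul_mul, hh, smul_smul, Units.val_mul]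
  inv_mem' := by
    rintro g ⟨μ, hg⟩
    refine ⟨μ⁻¹, ?_⟩
    have h1 : (g : Matrix (Fin 4) (Fin 4) R) * (g⁻¹ : GL (Fin 4) R).val = 1 := by
      rw [← Units.val_mul, mul_inv_cancel, Units.val_one]
    change (g⁻¹ : GL (Fin 4) R).valᵀ * J R * (g⁻¹ : GL (Fin 4) R).val = _
    generalize (g⁻¹ : GL (Fin 4) R).val = A at h1
    generalize (g : Matrix (Fin 4) (Fin 4) R) = M at h1 hg
    have h2 : Aᵀ * Mᵀ = 1 := by rw [← Matrix.transpose_mul, h1, Matrix.transpose_one]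
    have h3 : J R = (μ : R) • (Aᵀ * J R * A) := by
      calc J R = (Aᵀ * Mᵀ) * J R * (M * A) := by
            rw [h1, h2, Matrix.one_mul, Matrix.mul_one]
        _ = Aᵀ * (Mᵀ * J R * M) * A := by
            simp only [Matrix.mul_assoc]
        _ = _ := by rw [hg, Matrix.mul_smul, Matrix.smul_mul]
    conv_rhs => rw [h3]
    rw [smul_smul, Units.inv_mul, one_smul]

/-- The underlying matrix of an element of `GSp₄(R)`. -/
def toMat {R : Type*} [CommRing R] (g : GSp4 R) : Matrix (Fin 4) (Fin 4) R :=
  ((g : GL (Fin 4) R) : Matrix (Fin 4) (Fin 4) R)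

theorem toMat_mul {R : Type*} [CommRing R] (g h : GSp4 R) :
    toMat (g * h) = toMat g * toMat h := rfl

theorem toMat_one {R : Type*} [CommRing R] : toMat (1 : GSp4 R) = 1 := rfl

/-- Functoriality of `GSp₄` in the ring. -/
def GSp4.map {R S : Type*} [CommRing R] [CommRing S] (f : R →+* S) : GSp4 R →* GSp4 S :=
  ((Matrix.GeneralLinearGroup.map (n := Fin 4) f).comp (GSp4 R).subtype).codRestrict (GSp4 S) (by
    rintro ⟨g, μ, hg⟩
    refine ⟨Units.map f.toMonoidHom μ, ?_⟩
    have hJ : (J R).map f = J S := by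
      ext i j
      fin_cases i <;> fin_cases j <;> simp [J]
    have h := congrArg (fun M : Matrix (Fin 4) (Fin 4) R => M.map f) hg
    simp only [Matrix.map_mul, Matrix.transpose_map, hJ] at h
    have h2 : ((μ : R) • J R).map f = f μ • J S := by
      rw [← hJ]; ext i j; simp
    rw [h2] at h
    exact h)

/-- The subgroup of `GSp₄(R)` of matrices that are block upper triangular with respect to the
partition of the indices given by the levels of `b`. -/
def parabolic (R : Type*) [CommRing R] (b : Fin 4 → ℕ) : Subgroup (GSp4 R) where
  carrier := {g | (toMat g).BlockTriangular b}
  one_mem' := by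
    change (toMat (1 : GSp4 R)).BlockTriangular b
    rw [toMat_one]; exact Matrix.blockTriangular_one
  mul_mem' := by
    intro g h hg hh
    change (toMat (g * h)).BlockTriangular b
    rw [toMat_mul]; exact Matrix.BlockTriangular.mul hg hh
  inv_mem' := by
    intro g hg
    have hi : toMat g⁻¹ = (toMat g)⁻¹ := by
      refine (Matrix.inv_eq_right_inv ?_).symm
      rw [← toMat_mul, mul_inv_cancel, toMat_one]
    let _ : Invertible (toMat g) := ⟨toMat g⁻¹,
      by rw [← toMat_mul, inv_mul_cancel, toMat_one],
      by rw [← toMat_mul, mul_inv_cancel, toMat_one]⟩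
    change (toMat g⁻¹).BlockTriangular b
    rw [hi]; exact Matrix.blockTriangular_inv_of_blockTriangular hg

/-- Blocks `{1,2}, {3,4}`: the Siegel parabolic. -/
def siegelBlocks : Fin 4 → ℕ := ![0, 0, 1, 1]

/-- Blocks `{1}, {2,3}, {4}`: the Klingen parabolic. -/
def klingenBlocks : Fin 4 → ℕ := ![0, 1, 1, 2]

/-- Blocks `{1}, {2}, {3}, {4}`: the Borel subgroup. -/
def borelBlocks : Fin 4 → ℕ := ![0, 1, 2, 3]

/-- The unipotent radical of the Borel subgroup: upper triangular matrices with `1` on the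
diagonal. -/
def IsUpperUnipotent {R : Type*} [CommRing R] (g : GSp4 R) : Prop :=
  g ∈ parabolic R borelBlocks ∧ ∀ i, toMat g i i = 1

/-- The diagonal element `diag(d₀, d₁, d₂, d₃)`, where `d₀ d₃ = d₁ d₂`. -/
def diagElt {R : Type*} [CommRing R] (d : Fin 4 → Rˣ) (h : d 0 * d 3 = d 1 * d 2) : GSp4 R :=
  ⟨⟨Matrix.diagonal fun i => (d i : R), Matrix.diagonal fun i => ((d i)⁻¹ : Rˣ),
    by simp [Matrix.diagonal_mul_diagonal], by simp [Matrix.diagonal_mul_diagonal]⟩, by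
    refine ⟨d 0 * d 3, ?_⟩
    have h' : (d 0 : R) * d 3 = d 1 * d 2 := by exact_mod_cast congrArg Units.val h
    ext i j
    fin_cases i <;> fin_cases j <;>
      simp [J, Matrix.mul_apply, Matrix.diagonal_apply, h'] <;>
      first | ring1 | linear_combination h'⟩

variable (p : ℕ) [Fact p.Prime]

/-- The hyperspecial maximal compact subgroup `GSp₄(ℤ_p)` of `GSp₄(ℚ_p)`. -/
def hyperspecial : Subgroup (GSp4 ℚ_[p]) :=
  (GSp4.map (algebraMap ℤ_[p] ℚ_[p])).range

/-- The parahoric subgroup attached to a block decomposition: the preimage in `GSp₄(ℤ_p)` of the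
corresponding parabolic subgroup of `GSp₄(ℤ/p)`. -/
def parahoric (b : Fin 4 → ℕ) : Subgroup (GSp4 ℚ_[p]) :=
  ((parabolic (ZMod p) b).comap (GSp4.map (PadicInt.toZMod (p := p)))).map
    (GSp4.map (algebraMap ℤ_[p] ℚ_[p]))

/-- The Siegel parahoric `Sieg(p)`. -/
abbrev Sieg : Subgroup (GSp4 ℚ_[p]) := parahoric p siegelBlocks

/-- The Klingen parahoric `Kl(p)`. -/
abbrev Kl : Subgroup (GSp4 ℚ_[p]) := parahoric p klingenBlocks

/-- The Iwahori subgroup `Iw(p)`. -/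
abbrev Iw : Subgroup (GSp4 ℚ_[p]) := parahoric p borelBlocks

theorem parahoric_le_hyperspecial (b : Fin 4 → ℕ) : parahoric p b ≤ hyperspecial p := by
  rintro _ ⟨g, _, rfl⟩
  exact ⟨g, rfl⟩

theorem Iw_le_Sieg : Iw p ≤ Sieg p := by
  rintro _ ⟨g, hg, rfl⟩
  refine ⟨g, fun i j hij => hg ?_, rfl⟩
  revert hij
  fin_cases i <;> fin_cases j <;> simp [siegelBlocks, borelBlocks]

theorem Iw_le_Kl : Iw p ≤ Kl p := by
  rintro _ ⟨g, hg, rfl⟩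
  refine ⟨g, fun i j hij => hg ?_, rfl⟩
  revert hij
  fin_cases i <;> fin_cases j <;> simp [klingenBlocks, borelBlocks]

/-- `p` as an element of `ℚ_pˣ`. -/
def pUnit : ℚ_[p]ˣ :=
  Units.mk0 (p : ℚ_[p]) (Nat.cast_ne_zero.mpr (Fact.out : p.Prime).ne_zero)

/-- `diag(p, p, 1, 1)`. -/
def d1 : GSp4 ℚ_[p] := diagElt ![pUnit p, pUnit p, 1, 1] (by simp)

/-- `diag(p², p, p, 1)`. -/
def d2 : GSp4 ℚ_[p] := diagElt ![pUnit p ^ 2, pUnit p, pUnit p, 1] (by simp [sq])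

/-- The central element `diag(p, p, p, p)`. -/
def centralP : GSp4 ℚ_[p] := diagElt ![pUnit p, pUnit p, pUnit p, pUnit p] (by simp)

/-- The complex number `p ^ (n / 2)`. -/
def halfPow (n : ℕ) : ℂ := (((p : ℝ) ^ ((n : ℝ) / 2) : ℝ) : ℂ)

end Group

/-! ### Whittaker models, unramified principal series and Hecke parameters -/

section Local

variable {p : ℕ} [Fact p.Prime]

/-- An additive character of `ℚ_p` is unramified if it is trivial on `ℤ_p` but not on
`p⁻¹ ℤ_p`. -/
def IsUnramifiedAddChar (ψ : AddChar ℚ_[p] ℂ) : Prop :=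
  (∀ x, ‖x‖ ≤ 1 → ψ x = 1) ∧ ∃ x, ‖x‖ ≤ p ∧ ψ x ≠ 1

/-- Elements of `Ind_N^G(ψ)`: smooth functions with `f(n g) = ψ(n₁₂ + n₂₃) f(g)` for `n ∈ N`. -/
def IsWhittakerFunction (ψ : AddChar ℚ_[p] ℂ) (f : GSp4 ℚ_[p] → ℂ) : Prop :=
  (∀ n, IsUpperUnipotent n → ∀ g, f (n * g) = ψ (toMat n 0 1 + toMat n 1 2) * f g) ∧
    IsSmoothVector (rightTranslation (GSp4 ℚ_[p])) f

/-- A Whittaker model of `π`: an isomorphism `v ↦ W v` of `π` onto a subrepresentation of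
`Ind_N^G(ψ)`, i.e. an injective intertwining map from `π` to the functions on `GSp₄(ℚ_p)`, all of
whose values are Whittaker functions. -/
def IsWhittakerModel {V : Type*} [AddCommGroup V] [Module ℂ V] (ψ : AddChar ℚ_[p] ℂ)
    {π : Representation ℂ (GSp4 ℚ_[p]) V}
    (W : Representation.IntertwiningMap π (rightTranslation (GSp4 ℚ_[p]))) : Prop :=
  Function.Injective W ∧ ∀ v, IsWhittakerFunction ψ (W v)

/-- An unramified character of `ℚ_pˣ`, extended by `0` to `ℚ_p`. -/
def IsUnramifiedChar (χ : ℚ_[p] →*₀ ℂ) : Prop :=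
  ∀ x, ‖x‖ = 1 → χ x = 1

/-- Elements of the normalised principal series `χ₁ × χ₂ ⋊ σ`: the smooth functions `f` such that,
for `t` in the Borel subgroup with diagonal `(a, b, c b⁻¹, c a⁻¹)`,
`f(t g) = χ₁(a) χ₂(b) σ(c) |a² b| |c|^(-3/2) f(g)`. -/
def IsPrincipalSeriesFunction (χ₁ χ₂ σ : ℚ_[p] →*₀ ℂ) (f : GSp4 ℚ_[p] → ℂ) : Prop :=
  (∀ t ∈ parabolic ℚ_[p] borelBlocks, ∀ g,
    let a := toMat t 0 0
    let b := toMat t 1 1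
    let c := toMat t 0 0 * toMat t 3 3
    f (t * g) =
      χ₁ a * χ₂ b * σ c * ((‖a ^ 2 * b‖ * ‖c‖ ^ (-(3 / 2) : ℝ) : ℝ) : ℂ) * f g) ∧
    IsSmoothVector (rightTranslation (GSp4 ℚ_[p])) f

/-- `π` is a subquotient of the principal series `χ₁ × χ₂ ⋊ σ`. -/
def IsSubquotientOfPrincipalSeries {V : Type*} [AddCommGroup V] [Module ℂ V]
    (π : Representation ℂ (GSp4 ℚ_[p]) V) (χ₁ χ₂ σ : ℚ_[p] →*₀ ℂ) : Prop :=
  ∃ N : Subrepresentation (rightTranslation (GSp4 ℚ_[p])),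
    (∀ f ∈ N, IsPrincipalSeriesFunction χ₁ χ₂ σ f) ∧
    ∃ φ : Representation.IntertwiningMap N.toRepresentation π, Function.Surjective φ

/-- `π` is unramified (spherical): it has a nonzero vector fixed by `GSp₄(ℤ_p)`. -/
def IsUnramified {V : Type*} [AddCommGroup V] [Module ℂ V]
    (π : Representation ℂ (GSp4 ℚ_[p]) V) : Prop :=
  fixedVectors π (hyperspecial p) ≠ ⊥

/-- For `π` irreducible and unramified, the spin `L`-factor of `π` is `L(π, s) = Q(p^(-s))⁻¹`:
if `π` is the unramified subquotient of `χ₁ × χ₂ ⋊ σ` with `χ₁, χ₂, σ` unramified, then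
`Q = (1 - σ(p)X)(1 - σχ₁(p)X)(1 - σχ₂(p)X)(1 - σχ₁χ₂(p)X)`. -/
def HasSpinEulerFactor {V : Type*} [AddCommGroup V] [Module ℂ V]
    (π : Representation ℂ (GSp4 ℚ_[p]) V) (Q : ℂ[X]) : Prop :=
  ∃ χ₁ χ₂ σ : ℚ_[p] →*₀ ℂ,
    IsUnramifiedChar χ₁ ∧ IsUnramifiedChar χ₂ ∧ IsUnramifiedChar σ ∧
    IsSubquotientOfPrincipalSeries π χ₁ χ₂ σ ∧
    Q = (1 - C (σ p) * X) * (1 - C (σ p * χ₁ p) * X) * (1 - C (σ p * χ₂ p) * X) *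
      (1 - C (σ p * χ₁ p * χ₂ p) * X)

/-- `(α, β, γ, δ)` are the Hecke parameters attached to `π` and the weights `(r₁, r₂)`. With
`w = r₁ + r₂ + 3`, the Hecke polynomial `P` is given by `L(π, s - w/2) = P(p^(-s))⁻¹`, and the
conditions are `P = (1 - αX)(1 - βX)(1 - γX)(1 - δX)` and `αδ = βγ = p^w χ_π(p)`, where `χ_π` is
the central character. -/
def IsHeckeParameters {V : Type*} [AddCommGroup V] [Module ℂ V]
    (π : Representation ℂ (GSp4 ℚ_[p]) V) (r₁ r₂ : ℕ) (α β γ δ : ℂ) : Prop :=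
  (∃ Q : ℂ[X], HasSpinEulerFactor π Q ∧
    Q.comp (C (halfPow p (r₁ + r₂ + 3)) * X) =
      (1 - C α * X) * (1 - C β * X) * (1 - C γ * X) * (1 - C δ * X)) ∧
  ∃ ω : ℂ, (∀ v, π (centralP p) v = ω • v) ∧
    α * δ = (p : ℂ) ^ (r₁ + r₂ + 3) * ω ∧ β * γ = (p : ℂ) ^ (r₁ + r₂ + 3) * ω

variable {V : Type*} [AddCommGroup V] [Module ℂ V]

/-- `U₁ = p^((r₁ + r₂)/2) [K diag(p,p,1,1) K]` on `K`-fixed vectors. -/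
def U1 (ρ : Representation ℂ (GSp4 ℚ_[p]) V) (K : Subgroup (GSp4 ℚ_[p])) (r₁ r₂ : ℕ) :
    Module.End ℂ (fixedVectors ρ K) :=
  halfPow p (r₁ + r₂) • heckeOp ρ K (d1 p)

/-- `U₂ = p^(r₁) [K diag(p²,p,p,1) K]` on `K`-fixed vectors. -/
def U2 (ρ : Representation ℂ (GSp4 ℚ_[p]) V) (K : Subgroup (GSp4 ℚ_[p])) (r₁ : ℕ) :
    Module.End ℂ (fixedVectors ρ K) :=
  (p : ℂ) ^ r₁ • heckeOp ρ K (d2 p)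

/-- The operator `1 - x / U`. It is only used for invertible `U`. -/
def oneSubDiv {M : Type*} [AddCommGroup M] [Module ℂ M] (x : ℂ) (U : Module.End ℂ M) :
    Module.End ℂ M :=
  1 - x • Ring.inverse U

/-- `(1 - β/U₁)(1 - γ/U₁)(1 - δ/U₁) w` at Siegel level, for `w` spherical. -/
def wSieg (ρ : Representation ℂ (GSp4 ℚ_[p]) V) (r₁ r₂ : ℕ) (β γ δ : ℂ)
    (w : fixedVectors ρ (hyperspecial p)) : fixedVectors ρ (Sieg p) :=
  (oneSubDiv β (U1 ρ (Sieg p) r₁ r₂) * oneSubDiv γ (U1 ρ (Sieg p) r₁ r₂) *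
    oneSubDiv δ (U1 ρ (Sieg p) r₁ r₂))
      (fixedInclusion ρ (parahoric_le_hyperspecial p siegelBlocks) w)

/-- `(1 + γ/α)⁻¹ (1 - γδ/(p^(r₂+1) U₂)) (1 - αγ/(p^(r₂+1) U₂)) (1 - βδ/(p^(r₂+1) U₂)) w` at
Klingen level, for `w` spherical. -/
def wKl (ρ : Representation ℂ (GSp4 ℚ_[p]) V) (r₁ r₂ : ℕ) (α β γ δ : ℂ)
    (w : fixedVectors ρ (hyperspecial p)) : fixedVectors ρ (Kl p) :=
  (1 / (1 + γ / α)) •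
    (oneSubDiv (γ * δ / (p : ℂ) ^ (r₂ + 1)) (U2 ρ (Kl p) r₁) *
      oneSubDiv (α * γ / (p : ℂ) ^ (r₂ + 1)) (U2 ρ (Kl p) r₁) *
      oneSubDiv (β * δ / (p : ℂ) ^ (r₂ + 1)) (U2 ρ (Kl p) r₁))
        (fixedInclusion ρ (parahoric_le_hyperspecial p klingenBlocks) w)

/-- `w` is the normalised generator of the subspace `E` of the `K`-fixed vectors of `π`, with
respect to the Whittaker model `W`: it spans `E`, and its Whittaker function takes the value `1` at
the identity. -/
def IsNormalisedGenerator {π : Representation ℂ (GSp4 ℚ_[p]) V}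
    (W : Representation.IntertwiningMap π (rightTranslation (GSp4 ℚ_[p])))
    {K : Subgroup (GSp4 ℚ_[p])} (E : Submodule ℂ (fixedVectors π K)) (w : fixedVectors π K) :
    Prop :=
  E = Submodule.span ℂ {w} ∧ W (w : V) 1 = 1

end Local

end GSpFour

end

open GSpFour

open Polynomial Matrix
noncomputable section
-- Everything takes place in the space `M` of Iwahori-fixed vectors of π. On it the operators T₁, T₂
-- of the two finite simple reflections and the operator E of length zero satisfy the Iwahori–Hecke
-- relations (`iwahoriRelations`). In Bernstein form these give two commuting invertible operators a
-- and b with a = U₁ and ab = p^(r₂+1) U₂ (`IwahoriRelations.exists_torus`). Put ν = αδ = βγ. The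
-- Weyl group of type C₂ permutes a, b, ν/b, ν/a, and correspondingly T₁ commutes with a and b +
-- ν/b, while T₂ commutes with a + b and ab. The operators at Siegel and Klingen level are
-- restrictions of those at Iwahori level (`fixedInclusion_U1`, `fixedInclusion_U2`).
--
-- Two functionals carry the proof. The first is ε, the value of Whittaker functions at
-- `whittakerElt`. It satisfies ε∘Tᵢ = -ε, and ε(a²b v) is a nonzero multiple of W_v(1). A spherical
-- vector w has Tᵢ w = p w, so ε(aᵐbⁿ w) is alternating in (m, n) under the Weyl group, up to powers
-- of ν; in particular it vanishes on the walls. If W_w(1) ≠ 0, this makes the eight vectors aⁱbʲw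
-- (i < 4, j < 2) independent (`linearIndependent_orbit`). Since π is a subquotient of a principal
-- series and G is a union of eight double cosets of Borel and Iwahori
-- (`exists_borel_weyl_iwahori`), dim M ≤ 8. Hence w generates M over the algebra of a and b, and a
-- vector v with ε(aᵐbⁿ v) = 0 for all m, n ≥ 0 is zero (`eq_zero_of_forall_smul`).
--
-- The second functional is evaluation at the identity on the principal series. It is an
-- eigenfunctional of U₁ and U₂, and it is injective on spherical vectors. The symmetric functions
-- of a, b, ν/b, ν/a preserve spherical vectors, so they act on them by the scalars prescribed by
-- the Hecke parameters (`satakeRelations_of_subquotient`), and by cyclicity they do so on all of M.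
--
-- The theorem follows. If W_w(1) = 0 for w spherical, these relations force ε(aᵐ⁺ⁿbⁿ w) = 0 for all
-- m, n, so W_w vanishes on dominant torus elements and w = 0 (`spherical_eq_zero`). An eigenvector
-- of one of the three kinds is determined in the same way by W_v(1), since the eigenvalue equations
-- make the sequences ε(aᵐbⁿ v) recurrent; so each eigenspace is at most a line. The displayed
-- products are eigenvectors because the missing linear factor completes a quartic that kills w.
-- Their value at 1 is found by expanding a²b times the product: the other terms lie on walls,
-- except that at Klingen level a⁻¹b⁻² lies in the Weyl orbit of a²b and adds γ/α, whence the factor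
-- 1 + γ/α.
namespace GSpFour

/-! ### Residue classes modulo p, their lifts, and sums over them. -/

section Lift
variable {p : ℕ} [Fact p.Prime]

/-- The lift of a residue class to its least non-negative representative. -/
def lift (x : ZMod p) : ℚ_[p] := ((x.val : ℕ) : ℚ_[p])

theorem norm_lift_le (x : ZMod p) : ‖lift x‖ ≤ 1 := by
  exact (((x.val : ℕ) : ℤ_[p])).2

theorem norm_lt_one_iff_toZMod (a : ℤ_[p]) : ‖(a : ℚ_[p])‖ < 1 ↔ PadicInt.toZMod a = 0 := by
  rw [← RingHom.mem_ker, PadicInt.ker_toZMod, IsLocalRing.mem_maximalIdeal, PadicInt.mem_nonunits]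
  rfl

theorem exists_lift {a : ℚ_[p]} (ha : ‖a‖ ≤ 1) : ∃ x : ZMod p, ‖a - lift x‖ < 1 := by
  let b : ℤ_[p] := ⟨a, ha⟩
  refine ⟨PadicInt.toZMod b, ?_⟩
  have h : a - lift (PadicInt.toZMod b) = ((b - ((PadicInt.toZMod b).val : ℕ) : ℤ_[p]) : ℚ_[p]) := by
    rw [PadicInt.coe_sub, PadicInt.coe_natCast]; rfl
  rw [h, norm_lt_one_iff_toZMod, map_sub, map_natCast, ZMod.natCast_val, ZMod.cast_id', id, sub_self]

theorem lift_inj {x y : ZMod p} (h : ‖lift x - lift y‖ < 1) : x = y := by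
  have h' : lift x - lift y = (((x.val : ℕ) - (y.val : ℕ) : ℤ_[p]) : ℚ_[p]) := by
    rw [PadicInt.coe_sub, PadicInt.coe_natCast, PadicInt.coe_natCast]; rfl
  rw [h', norm_lt_one_iff_toZMod, map_sub, map_natCast, map_natCast] at h
  simpa [sub_eq_zero] using h

theorem lift_zero : lift (0 : ZMod p) = 0 := by simp [lift]

theorem norm_lift_of_ne_zero {x : ZMod p} (h : x ≠ 0) : ‖lift x‖ = 1 := by
  refine le_antisymm (norm_lift_le x) (not_lt.mp fun h' => h ?_)
  apply lift_inj
  simpa [lift_zero] using h'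

theorem norm_sub_le_one {a b : ℚ_[p]} (ha : ‖a‖ ≤ 1) (hb : ‖b‖ ≤ 1) : ‖a - b‖ ≤ 1 := by
  rw [sub_eq_add_neg]
  exact (Padic.nonarchimedean _ _).trans (max_le ha (by rwa [norm_neg]))

theorem norm_add_le_one {a b : ℚ_[p]} (ha : ‖a‖ ≤ 1) (hb : ‖b‖ ≤ 1) : ‖a + b‖ ≤ 1 :=
  (Padic.nonarchimedean _ _).trans (max_le ha hb)

theorem norm_add_lt_one {a b : ℚ_[p]} (ha : ‖a‖ < 1) (hb : ‖b‖ < 1) : ‖a + b‖ < 1 :=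
  (Padic.nonarchimedean _ _).trans_lt (max_lt ha hb)

theorem norm_sub_lt_one {a b : ℚ_[p]} (ha : ‖a‖ < 1) (hb : ‖b‖ < 1) : ‖a - b‖ < 1 := by
  rw [sub_eq_add_neg]
  exact norm_add_lt_one ha (by rwa [norm_neg])

theorem norm_mul_le_one {a b : ℚ_[p]} (ha : ‖a‖ ≤ 1) (hb : ‖b‖ ≤ 1) : ‖a * b‖ ≤ 1 := by
  rw [norm_mul]; exact mul_le_one₀ ha (norm_nonneg _) hb

theorem norm_mul_lt_one {a b : ℚ_[p]} (ha : ‖a‖ ≤ 1) (hb : ‖b‖ < 1) : ‖a * b‖ < 1 := by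
  rw [norm_mul]; exact mul_lt_one_of_nonneg_of_lt_one_right ha (norm_nonneg _) hb

theorem norm_mul_lt_one' {a b : ℚ_[p]} (ha : ‖a‖ < 1) (hb : ‖b‖ ≤ 1) : ‖a * b‖ < 1 := by
  rw [mul_comm]; exact norm_mul_lt_one hb ha

/-- A sum of values of a function of residue classes may be taken over any family of
representatives. -/
theorem sum_reindex {X : Type*} [AddCommMonoid X] (F : ℚ_[p] → X)
    (hF : ∀ a b, ‖a‖ ≤ 1 → ‖b‖ ≤ 1 → ‖a - b‖ < 1 → F a = F b)
    (σ : ZMod p → ℚ_[p]) (hσ : ∀ x, ‖σ x‖ ≤ 1) (hi : ∀ x y, ‖σ x - σ y‖ < 1 → x = y) :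
    ∑ x, F (σ x) = ∑ x : ZMod p, F (lift x) := by
  choose τ hτ using fun x => exists_lift (hσ x)
  have hinj : Function.Injective τ := by
    intro x y hxy
    apply hi
    have := norm_sub_lt_one (hτ x) (hτ y)
    rw [hxy] at this
    simpa using this
  rw [← (Equiv.ofBijective τ (Finite.injective_iff_bijective.mp hinj)).sum_comp
    (fun x => F (lift x))]
  exact Finset.sum_congr rfl fun x _ => hF _ _ (hσ x) (norm_lift_le _) (hτ x)

theorem sum_add_const {X : Type*} [AddCommMonoid X] (F : ℚ_[p] → X)
    (hF : ∀ a b, ‖a‖ ≤ 1 → ‖b‖ ≤ 1 → ‖a - b‖ < 1 → F a = F b) {c : ℚ_[p]} (hc : ‖c‖ ≤ 1) :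
    ∑ x : ZMod p, F (lift x + c) = ∑ x : ZMod p, F (lift x) :=
  sum_reindex F hF (fun x => lift x + c) (fun x => norm_add_le_one (norm_lift_le x) hc)
    fun x y h => lift_inj (by simpa using h)

theorem sum_neg_lift {X : Type*} [AddCommMonoid X] (F : ℚ_[p] → X)
    (hF : ∀ a b, ‖a‖ ≤ 1 → ‖b‖ ≤ 1 → ‖a - b‖ < 1 → F a = F b) :
    ∑ x : ZMod p, F (-lift x) = ∑ x : ZMod p, F (lift x) :=
  sum_reindex F hF (fun x => -lift x) (fun x => by simpa using norm_lift_le x)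
    fun x y h => lift_inj (by rwa [neg_sub_neg, norm_sub_rev] at h)

/-- With the convention 0⁻¹ = 0, inversion permutes all residue classes. This re-sums the cosets
after the Bruhat relation, which replaces x by x⁻¹. -/
theorem sum_inv_lift {X : Type*} [AddCommMonoid X] (F : ℚ_[p] → X)
    (hF : ∀ a b, ‖a‖ ≤ 1 → ‖b‖ ≤ 1 → ‖a - b‖ < 1 → F a = F b) :
    ∑ x : ZMod p, F (lift x)⁻¹ = ∑ x : ZMod p, F (lift x) := by
  have key : ∀ x : ZMod p, ‖(lift x)⁻¹‖ ≤ 1 := fun x => by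
    by_cases hx : x = 0
    · simp [hx, lift_zero]
    · rw [norm_inv, norm_lift_of_ne_zero hx, inv_one]
  refine sum_reindex F hF (fun x => (lift x)⁻¹) key fun x y h => ?_
  by_cases hx : x = 0
  · by_cases hy : y = 0
    · rw [hx, hy]
    · simp [hx, lift_zero, norm_lift_of_ne_zero hy] at h
  · by_cases hy : y = 0
    · simp [hy, lift_zero, norm_lift_of_ne_zero hx] at h
    · apply lift_inj
      have nx := norm_lift_of_ne_zero hx
      have ny := norm_lift_of_ne_zero hy
      have hx0 : lift x ≠ 0 := fun h0 => by simp [h0] at nx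
      have hy0 : lift y ≠ 0 := fun h0 => by simp [h0] at ny
      have : lift x - lift y = -(lift x * lift y * ((lift x)⁻¹ - (lift y)⁻¹)) := by
        field_simp; ring
      rw [this, norm_neg, norm_mul, norm_mul, nx, ny]
      simpa using h

end Lift

/-! ### Double coset operators through representatives, and averaging. -/

section Reps
variable {G : Type*} [Group G] {V : Type*} [AddCommGroup V] [Module ℂ V]

/-- The double coset operator as a sum over explicit coset representatives. -/
theorem heckeOp_eq_sum (ρ : Representation ℂ G V) (K : Subgroup G) (g : G) {ι : Type*} [Fintype ι]
    (r : ι → G) (hr : ∀ i, ∃ k ∈ K, g⁻¹ * k * r i ∈ K)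
    (hinj : ∀ i j, (r i)⁻¹ * r j ∈ K → i = j)
    (hsurj : ∀ k ∈ K, ∃ i, (r i)⁻¹ * (k * g) ∈ K) (v : fixedVectors ρ K) :
    (heckeOp ρ K g v : V) = ∑ i, ρ (r i) v := by
  have hmem : ∀ i, ((r i : G) : G ⧸ K) ∈ MulAction.orbit K (g : G ⧸ K) := by
    intro i
    obtain ⟨k, hk, h⟩ := hr i
    refine ⟨⟨k, hk⟩⁻¹, ?_⟩
    change ((k⁻¹ * g : G) : G ⧸ K) = (r i : G ⧸ K)
    rw [QuotientGroup.eq]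
    simpa [mul_assoc] using h
  let e : ι → MulAction.orbit K (g : G ⧸ K) := fun i => ⟨(r i : G ⧸ K), hmem i⟩
  have he : Function.Bijective e := by
    constructor
    · intro i j h
      apply hinj
      rw [← QuotientGroup.eq]
      exact congrArg Subtype.val h
    · rintro ⟨_, k, rfl⟩
      obtain ⟨i, hi⟩ := hsurj k k.2
      refine ⟨i, Subtype.ext ?_⟩
      change (r i : G ⧸ K) = ((k * g : G) : G ⧸ K)
      rw [QuotientGroup.eq]; exact hi
  have h1 : heckeSum ρ K g = ∑ i, cosetAction ρ K (r i : G ⧸ K) := by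
    unfold heckeSum
    rw [← finsum_comp_equiv (Equiv.ofBijective e he), finsum_eq_sum_of_fintype]
    rfl
  change heckeSum ρ K g v = _
  rw [h1, LinearMap.sum_apply]
  rfl

/-- Along a surjective intertwining map of which the source is smooth enough, fixed vectors
lift to fixed vectors. -/
theorem exists_fixed_lift {V' : Type*} [AddCommGroup V'] [Module ℂ V']
    {ρ : Representation ℂ G V} {ρ' : Representation ℂ G V'}
    (φ : Representation.IntertwiningMap ρ ρ') (K : Subgroup G) (f : V)
    (hfin : (U : Subgroup G) → (∀ g, g ∈ U ↔ ρ g f = f) → Finite (K ⧸ U.subgroupOf K))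
    (hf : φ f ∈ fixedVectors ρ' K) : ∃ f' ∈ fixedVectors ρ K, φ f' = φ f := by
  let U : Subgroup G :=
    { carrier := {g | ρ g f = f}
      one_mem' := by simp
      mul_mem' := fun {a b} ha hb => by
        change ρ (a * b) f = f
        rw [map_mul, Module.End.mul_apply, hb, ha]
      inv_mem' := fun {a} ha => by
        change ρ a⁻¹ f = f
        conv_lhs => rw [← (ha : ρ a f = f)]
        rw [← Module.End.mul_apply, ← map_mul, inv_mul_cancel, map_one]; rfl }
  have := hfin U fun _ => Iff.rfl
  let H := U.subgroupOf K
  have : Finite (K ⧸ H) := this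
  let _ : Fintype (K ⧸ H) := Fintype.ofFinite _
  let F : K ⧸ H → V := fun x => Quotient.liftOn' x (fun k => ρ (k : G) f) (by
    intro a b hab
    rw [QuotientGroup.leftRel_apply] at hab
    have hab' : ρ ((a⁻¹ * b : K) : G) f = f := hab
    conv_lhs => rw [← hab']
    rw [← Module.End.mul_apply, ← map_mul]
    simp)
  have hF : ∀ (k : K) (x : K ⧸ H), F (k • x) = ρ (k : G) (F x) := by
    intro k x
    induction x using QuotientGroup.induction_on with
    | H a =>
      change ρ ((k * a : K) : G) f = ρ (k : G) (ρ (a : G) f)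
      rw [← Module.End.mul_apply, ← map_mul]; rfl
  have hφ : ∀ x, φ (F x) = φ f := by
    intro x
    induction x using QuotientGroup.induction_on with
    | H a =>
      change φ (ρ (a : G) f) = φ f
      rw [φ.isIntertwining]
      exact hf _ a.2
  -- The average of the finitely many K-translates of f is K-fixed, and φ f, being K-fixed already,
  -- is not changed by averaging.
  refine ⟨((Fintype.card (K ⧸ H) : ℂ)⁻¹) • ∑ x, F x, ?_, ?_⟩
  · intro k hk
    rw [map_smul, map_sum]
    congr 1
    rw [← Equiv.sum_comp (MulAction.toPerm (⟨k, hk⟩ : K) : Equiv.Perm (K ⧸ H)) F]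
    exact Finset.sum_congr rfl fun x _ => (hF ⟨k, hk⟩ x).symm
  · rw [map_smul, map_sum, Finset.sum_congr rfl fun x _ => hφ x, Finset.sum_const,
      Finset.card_univ, ← Nat.cast_smul_eq_nsmul ℂ, smul_smul, inv_mul_cancel₀, one_smul]
    exact Nat.cast_ne_zero.mpr Fintype.card_ne_zero

end Reps

/-! ### Explicit 4 × 4 matrices and the symplectic relations. -/

section MatrixFour

theorem eq_of_entries {S : Type*} {M N : Matrix (Fin 4) (Fin 4) S}
    (h00 : M 0 0 = N 0 0) (h01 : M 0 1 = N 0 1) (h02 : M 0 2 = N 0 2) (h03 : M 0 3 = N 0 3)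
    (h10 : M 1 0 = N 1 0) (h11 : M 1 1 = N 1 1) (h12 : M 1 2 = N 1 2) (h13 : M 1 3 = N 1 3)
    (h20 : M 2 0 = N 2 0) (h21 : M 2 1 = N 2 1) (h22 : M 2 2 = N 2 2) (h23 : M 2 3 = N 2 3)
    (h30 : M 3 0 = N 3 0) (h31 : M 3 1 = N 3 1) (h32 : M 3 2 = N 3 2) (h33 : M 3 3 = N 3 3) :
    M = N := by
  ext i j
  fin_cases i <;> fin_cases j <;> assumption

/-- Together with `mul_four`, this turns every matrix identity below into sixteen scalar goals. -/
theorem lit_congr {S : Type*}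
    {a00 a01 a02 a03 a10 a11 a12 a13 a20 a21 a22 a23 a30 a31 a32 a33
    b00 b01 b02 b03 b10 b11 b12 b13 b20 b21 b22 b23 b30 b31 b32 b33 : S}
    (h00 : a00 = b00) (h01 : a01 = b01) (h02 : a02 = b02) (h03 : a03 = b03)
    (h10 : a10 = b10) (h11 : a11 = b11) (h12 : a12 = b12) (h13 : a13 = b13)
    (h20 : a20 = b20) (h21 : a21 = b21) (h22 : a22 = b22) (h23 : a23 = b23)
    (h30 : a30 = b30) (h31 : a31 = b31) (h32 : a32 = b32) (h33 : a33 = b33) :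
    !![a00, a01, a02, a03; a10, a11, a12, a13; a20, a21, a22, a23; a30, a31, a32, a33] =
    !![b00, b01, b02, b03; b10, b11, b12, b13; b20, b21, b22, b23; b30, b31, b32, b33] := by
  subst_vars; rfl

theorem transpose_four {S : Type*} (a00 a01 a02 a03 a10 a11 a12 a13 a20 a21 a22 a23 a30 a31 a32 a33 : S) :
    !![a00, a01, a02, a03; a10, a11, a12, a13; a20, a21, a22, a23; a30, a31, a32, a33]ᵀ =
    !![a00, a10, a20, a30; a01, a11, a21, a31; a02, a12, a22, a32; a03, a13, a23, a33] := by
  apply eq_of_entries <;> simp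

theorem eta_four {S : Type*} (M : Matrix (Fin 4) (Fin 4) S) :
    M = !![M 0 0, M 0 1, M 0 2, M 0 3; M 1 0, M 1 1, M 1 2, M 1 3; M 2 0, M 2 1, M 2 2, M 2 3;
      M 3 0, M 3 1, M 3 2, M 3 3] := by
  apply eq_of_entries <;> rfl

variable {R : Type*} [CommRing R]

theorem mul_four (a00 a01 a02 a03 a10 a11 a12 a13 a20 a21 a22 a23 a30 a31 a32 a33
    b00 b01 b02 b03 b10 b11 b12 b13 b20 b21 b22 b23 b30 b31 b32 b33 : R) :
    !![a00, a01, a02, a03; a10, a11, a12, a13; a20, a21, a22, a23; a30, a31, a32, a33] *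
    !![b00, b01, b02, b03; b10, b11, b12, b13; b20, b21, b22, b23; b30, b31, b32, b33] =
    !![a00 * b00 + a01 * b10 + a02 * b20 + a03 * b30, a00 * b01 + a01 * b11 + a02 * b21 + a03 * b31,
       a00 * b02 + a01 * b12 + a02 * b22 + a03 * b32, a00 * b03 + a01 * b13 + a02 * b23 + a03 * b33;
       a10 * b00 + a11 * b10 + a12 * b20 + a13 * b30, a10 * b01 + a11 * b11 + a12 * b21 + a13 * b31,
       a10 * b02 + a11 * b12 + a12 * b22 + a13 * b32, a10 * b03 + a11 * b13 + a12 * b23 + a13 * b33;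
       a20 * b00 + a21 * b10 + a22 * b20 + a23 * b30, a20 * b01 + a21 * b11 + a22 * b21 + a23 * b31,
       a20 * b02 + a21 * b12 + a22 * b22 + a23 * b32, a20 * b03 + a21 * b13 + a22 * b23 + a23 * b33;
       a30 * b00 + a31 * b10 + a32 * b20 + a33 * b30, a30 * b01 + a31 * b11 + a32 * b21 + a33 * b31,
       a30 * b02 + a31 * b12 + a32 * b22 + a33 * b32,
       a30 * b03 + a31 * b13 + a32 * b23 + a33 * b33] := by
  apply eq_of_entries <;> simp [Matrix.mul_apply, Fin.sum_univ_four]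

theorem one_four : (1 : Matrix (Fin 4) (Fin 4) R) =
    !![1, 0, 0, 0; 0, 1, 0, 0; 0, 0, 1, 0; 0, 0, 0, 1] := by
  apply eq_of_entries <;> simp

theorem diagonal_four (d : Fin 4 → R) : Matrix.diagonal d =
    !![d 0, 0, 0, 0; 0, d 1, 0, 0; 0, 0, d 2, 0; 0, 0, 0, d 3] := by
  apply eq_of_entries <;> simp

theorem J_mul_J : J R * J R = -1 := by
  rw [J, mul_four, eta_four (-1)]
  apply lit_congr <;> simp

theorem det_J : (J R).det = 1 := by
  simp [J, Matrix.det_succ_row_zero, Fin.sum_univ_succ, Fin.succAbove]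
  ring

theorem toMat_injective : Function.Injective (toMat (R := R)) := fun _ _ h =>
  Subtype.ext (Units.ext h)

/-- An element of `GSp₄(R)` from its matrix. -/
def ofMat (M : Matrix (Fin 4) (Fin 4) R) (μ : Rˣ) (h : Mᵀ * J R * M = (μ : R) • J R) : GSp4 R :=
  have h1 : (-((μ⁻¹ : Rˣ) : R) • (J R * Mᵀ * J R)) * M = 1 := by
    rw [Matrix.smul_mul, Matrix.mul_assoc, Matrix.mul_assoc, ← Matrix.mul_assoc Mᵀ, h,
      Matrix.mul_smul, J_mul_J, smul_smul, smul_neg, ← neg_smul, neg_mul, neg_neg, Units.inv_mul,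
      one_smul]
  ⟨⟨M, -((μ⁻¹ : Rˣ) : R) • (J R * Mᵀ * J R), mul_eq_one_comm.mp h1, h1⟩, μ, h⟩

@[simp]
theorem toMat_ofMat (M : Matrix (Fin 4) (Fin 4) R) (μ : Rˣ) (h : Mᵀ * J R * M = (μ : R) • J R) :
    toMat (ofMat M μ h) = M := rfl

theorem J_smul (c : R) : c • J R = !![0, 0, 0, c; 0, 0, c, 0; 0, -c, 0, 0; -c, 0, 0, 0] := by
  apply eq_of_entries <;> simp [J]

/-- The symplectic relations between the columns of an element of `GSp₄`. -/
theorem exists_multiplier (g : GSp4 R) : ∃ μ : Rˣ, (toMat g)ᵀ * J R * toMat g = (μ : R) • J R :=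
  g.2

theorem col_rel (g : GSp4 R) (i j : Fin 4) (h : J R i j = 0) :
    toMat g 0 i * toMat g 3 j + toMat g 1 i * toMat g 2 j - toMat g 2 i * toMat g 1 j
      - toMat g 3 i * toMat g 0 j = 0 := by
  obtain ⟨μ, hμ⟩ := exists_multiplier g
  have := congrFun (congrFun hμ i) j
  rw [Matrix.smul_apply, h, smul_zero] at this
  rw [← this]
  simp [Matrix.mul_apply, Fin.sum_univ_four, J]
  ring

theorem det_ne_zero {F : Type*} [Field F] (g : GSp4 F) : (toMat g).det ≠ 0 := by
  have : (toMat g).det * (toMat g⁻¹).det = 1 := by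
    rw [← Matrix.det_mul, ← toMat_mul, mul_inv_cancel, toMat_one, Matrix.det_one]
  exact left_ne_zero_of_mul_eq_one this

theorem det_sq {M : Matrix (Fin 4) (Fin 4) R} {μ : R} (h : Mᵀ * J R * M = μ • J R) :
    M.det ^ 2 = μ ^ 4 := by
  have := congrArg Matrix.det h
  rw [Matrix.det_mul, Matrix.det_mul, Matrix.det_transpose, det_J, Matrix.det_smul, det_J] at this
  simpa [sq] using this

end MatrixFour

/-! ### Parahoric subgroups described by norms of matrix entries. -/

section Membership
variable {p : ℕ} [Fact p.Prime]

/-- Taking determinants of the defining relation gives det² = μ⁴. -/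
theorem norm_det_of_multiplier {M : Matrix (Fin 4) (Fin 4) ℚ_[p]} {μ : ℚ_[p]}
    (h : Mᵀ * J _ * M = μ • J _) : ‖M.det‖ = 1 ↔ ‖μ‖ = 1 := by
  have h1 := congrArg norm (det_sq h)
  rw [norm_pow, norm_pow] at h1
  constructor <;> intro h2 <;> rw [h2, one_pow] at h1
  · exact (pow_eq_one_iff_of_nonneg (norm_nonneg _) (by norm_num)).mp h1.symm
  · exact (pow_eq_one_iff_of_nonneg (norm_nonneg _) (by norm_num)).mp h1

/-- A unit determinant forces a unit multiplier, so an integral matrix satisfying the symplectic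
relation over ℚ_p descends to an element of GSp₄(ℤ_p). From here on parahorics are handled only
through norms of entries. -/
theorem mem_parahoric_iff (b : Fin 4 → ℕ) (g : GSp4 ℚ_[p]) :
    g ∈ parahoric p b ↔ (∀ i j, ‖toMat g i j‖ ≤ 1) ∧ ‖(toMat g).det‖ = 1 ∧
      ∀ i j, b j < b i → ‖toMat g i j‖ < 1 := by
  constructor
  · rintro ⟨k, hk, rfl⟩
    obtain ⟨μ, hμ⟩ := exists_multiplier (GSp4.map (algebraMap ℤ_[p] ℚ_[p]) k)
    obtain ⟨ν, hν⟩ := exists_multiplier k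
    have hent : ∀ i j, toMat (GSp4.map (algebraMap ℤ_[p] ℚ_[p]) k) i j =
      ((toMat k i j : ℤ_[p]) : ℚ_[p]) := fun i j => rfl
    refine ⟨fun i j => ?_, ?_, fun i j hij => ?_⟩
    · rw [hent]; exact PadicInt.norm_le_one _
    · have h1 : (toMat (GSp4.map (algebraMap ℤ_[p] ℚ_[p]) k)).det
          = (((toMat k).det : ℤ_[p]) : ℚ_[p]) :=
        (RingHom.map_det (algebraMap ℤ_[p] ℚ_[p]) (toMat k)).symm
      rw [h1]
      have h2 : IsUnit (toMat k).det := by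
        rw [← Matrix.isUnit_iff_isUnit_det]
        exact (k : GL (Fin 4) ℤ_[p]).isUnit
      exact PadicInt.isUnit_iff.mp h2
    · rw [hent, norm_lt_one_iff_toZMod]
      exact hk hij
  · rintro ⟨h1, h2, h3⟩
    obtain ⟨μ, hμ⟩ := exists_multiplier g
    have hμ1 := (norm_det_of_multiplier hμ).mp h2
    let M : Matrix (Fin 4) (Fin 4) ℤ_[p] := fun i j => ⟨toMat g i j, h1 i j⟩
    let m₀ : ℤ_[p] := ⟨(μ : ℚ_[p]), hμ1.le⟩
    let m : ℤ_[p]ˣ := (PadicInt.isUnit_iff.mpr (show ‖m₀‖ = 1 from hμ1)).unit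
    have hM : M.map (algebraMap ℤ_[p] ℚ_[p]) = toMat g := rfl
    have hm : algebraMap ℤ_[p] ℚ_[p] (m : ℤ_[p]) = μ := rfl
    have hJ : (J ℤ_[p]).map (algebraMap ℤ_[p] ℚ_[p]) = J ℚ_[p] := by
      apply eq_of_entries <;> simp [J]
    have hrel : Mᵀ * J _ * M = (m : ℤ_[p]) • J _ := by
      apply Matrix.map_injective (IsFractionRing.injective ℤ_[p] ℚ_[p])
      dsimp only
      rw [Matrix.map_mul, Matrix.map_mul, Matrix.transpose_map, hM, hJ, hμ]
      rw [Matrix.map_smul' (algebraMap ℤ_[p] ℚ_[p]) _ _ (map_mul _), hJ, hm]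
    refine ⟨ofMat M m hrel, fun i j hij => ?_, toMat_injective rfl⟩
    have := h3 i j hij
    rwa [show toMat g i j = ((M i j : ℤ_[p]) : ℚ_[p]) from rfl, norm_lt_one_iff_toZMod] at this

theorem mem_hyperspecial_iff (g : GSp4 ℚ_[p]) :
    g ∈ hyperspecial p ↔ (∀ i j, ‖toMat g i j‖ ≤ 1) ∧ ‖(toMat g).det‖ = 1 := by
  have : hyperspecial p = parahoric p (fun _ => 0) := by
    ext g
    constructor
    · rintro ⟨k, rfl⟩
      exact ⟨k, fun i j hij => absurd hij (lt_irrefl 0), rfl⟩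
    · exact fun h => parahoric_le_hyperspecial p _ h
  rw [this, mem_parahoric_iff]
  simp

end Membership

/-! ### Root subgroups, simple reflections, torus and Atkin–Lehner elements. -/

section Elements
variable {R : Type*} [CommRing R]

/-- The root subgroup of the short simple root. -/
def n1 (x : R) : GSp4 R := ofMat !![1, x, 0, 0; 0, 1, 0, 0; 0, 0, 1, -x; 0, 0, 0, 1] 1 (by
  rw [J_smul, J, transpose_four, mul_four, mul_four]; apply lit_congr <;> simp)

/-- The root subgroup of the long simple root. -/
def n2 (x : R) : GSp4 R := ofMat !![1, 0, 0, 0; 0, 1, x, 0; 0, 0, 1, 0; 0, 0, 0, 1] 1 (by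
  rw [J_smul, J, transpose_four, mul_four, mul_four]; apply lit_congr <;> simp)

/-- The root subgroup of the short non-simple positive root. -/
def n13 (x : R) : GSp4 R := ofMat !![1, 0, x, 0; 0, 1, 0, x; 0, 0, 1, 0; 0, 0, 0, 1] 1 (by
  rw [J_smul, J, transpose_four, mul_four, mul_four]; apply lit_congr <;> simp)

/-- The root subgroup of the highest root. -/
def n14 (x : R) : GSp4 R := ofMat !![1, 0, 0, x; 0, 1, 0, 0; 0, 0, 1, 0; 0, 0, 0, 1] 1 (by
  rw [J_smul, J, transpose_four, mul_four, mul_four]; apply lit_congr <;> simp)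

/-- The root subgroup opposite to `n1`. -/
def m1 (x : R) : GSp4 R := ofMat !![1, 0, 0, 0; x, 1, 0, 0; 0, 0, 1, 0; 0, 0, -x, 1] 1 (by
  rw [J_smul, J, transpose_four, mul_four, mul_four]; apply lit_congr <;> simp)

/-- The root subgroup opposite to `n2`. -/
def m2 (x : R) : GSp4 R := ofMat !![1, 0, 0, 0; 0, 1, 0, 0; 0, x, 1, 0; 0, 0, 0, 1] 1 (by
  rw [J_smul, J, transpose_four, mul_four, mul_four]; apply lit_congr <;> simp)

/-- A representative of the reflection in the short simple root. -/
def s1 : GSp4 R := ofMat !![0, 1, 0, 0; 1, 0, 0, 0; 0, 0, 0, 1; 0, 0, 1, 0] 1 (by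
  rw [J_smul, J, transpose_four, mul_four, mul_four]; apply lit_congr <;> simp)

/-- A representative of the reflection in the long simple root. -/
def s2 : GSp4 R := ofMat !![1, 0, 0, 0; 0, 0, -1, 0; 0, 1, 0, 0; 0, 0, 0, 1] 1 (by
  rw [J_smul, J, transpose_four, mul_four, mul_four]; apply lit_congr <;> simp)

/-- The diagonal element with diagonal `(a, b, c b⁻¹, c a⁻¹)`, for `b' = c b⁻¹` and
`a' = c a⁻¹`. -/
def tor (a b b' a' : Rˣ) (h : a * a' = b * b') : GSp4 R :=
  ofMat !![(a : R), 0, 0, 0; 0, (b : R), 0, 0; 0, 0, (b' : R), 0; 0, 0, 0, (a' : R)] (a * a') (by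
  have h' : (a : R) * a' = b * b' := by exact_mod_cast congrArg Units.val h
  rw [J_smul, J, transpose_four, mul_four, mul_four]
  apply lit_congr <;> simp [h'] <;> first | exact mul_comm _ _ | (rw [mul_comm, h']))

end Elements

section PadicElements
variable (p : ℕ) [Fact p.Prime]

/-- The Atkin–Lehner element normalising the Iwahori subgroup. -/
def etaElt : GSp4 ℚ_[p] :=
  ofMat !![0, 0, 1, 0; 0, 0, 0, 1; (p : ℚ_[p]), 0, 0, 0; 0, (p : ℚ_[p]), 0, 0] (-pUnit p) (by
  rw [J_smul, J, transpose_four, mul_four, mul_four]; apply lit_congr <;> simp [pUnit])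

variable {p}

theorem toMat_d1 : toMat (d1 p) = !![(p : ℚ_[p]), 0, 0, 0; 0, (p : ℚ_[p]), 0, 0; 0, 0, 1, 0;
    0, 0, 0, 1] := by
  change Matrix.diagonal _ = _
  rw [diagonal_four]; simp [pUnit]

theorem toMat_d2 : toMat (d2 p) = !![(p : ℚ_[p]) ^ 2, 0, 0, 0; 0, (p : ℚ_[p]), 0, 0;
    0, 0, (p : ℚ_[p]), 0; 0, 0, 0, 1] := by
  change Matrix.diagonal _ = _
  rw [diagonal_four]; simp [pUnit]

theorem toMat_centralP : toMat (centralP p) = !![(p : ℚ_[p]), 0, 0, 0; 0, (p : ℚ_[p]), 0, 0;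
    0, 0, (p : ℚ_[p]), 0; 0, 0, 0, (p : ℚ_[p])] := by
  change Matrix.diagonal _ = _
  rw [diagonal_four]; simp [pUnit]

end PadicElements

section Norms
variable {p : ℕ} [Fact p.Prime]

theorem p_ne_zero : (p : ℚ_[p]) ≠ 0 := Nat.cast_ne_zero.mpr (Fact.out : p.Prime).ne_zero

theorem norm_div_p_le_iff {a : ℚ_[p]} : ‖a / p‖ ≤ 1 ↔ ‖a‖ < 1 := by
  have hp : (0 : ℝ) < p := Nat.cast_pos.mpr (Fact.out : p.Prime).pos
  have h := Padic.norm_le_pow_iff_norm_lt_pow_add_one a (-1)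
  rw [neg_add_cancel, _root_.zpow_zero, _root_.zpow_neg_one] at h
  rw [norm_div, Padic.norm_p, div_inv_eq_mul, ← h, ← le_div_iff₀ hp, one_div]

theorem norm_p_mul_lt_one {a : ℚ_[p]} (ha : ‖a‖ ≤ 1) : ‖(p : ℚ_[p]) * a‖ < 1 :=
  norm_mul_lt_one' Padic.norm_p_lt_one ha

theorem norm_one_sub {e : ℚ_[p]} (he : ‖e‖ < 1) : ‖1 - e‖ = 1 := by
  refine le_antisymm (norm_sub_le_one (by simp) he.le) (not_lt.mp fun h => ?_)
  have := norm_add_lt_one h he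
  simp at this

theorem norm_eq_one_of_mul {a b e : ℚ_[p]} (ha : ‖a‖ ≤ 1) (hb : ‖b‖ ≤ 1) (he : ‖e‖ < 1)
    (h : a * b = 1 - e) : ‖a‖ = 1 := by
  refine le_antisymm ha (not_lt.mp fun h' => ?_)
  have := norm_mul_lt_one' h' hb
  rw [h, norm_one_sub he] at this
  exact lt_irrefl _ this

theorem norm_div_unit {a u : ℚ_[p]} (hu : ‖u‖ = 1) : ‖a / u‖ = ‖a‖ := by
  rw [norm_div, hu, div_one]

theorem ne_zero_of_norm_eq_one {u : ℚ_[p]} (hu : ‖u‖ = 1) : u ≠ 0 := fun h => by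
  simp [h] at hu

end Norms

section MembershipLit
variable {p : ℕ} [Fact p.Prime]

theorem mem_Iw_of_lit {g : GSp4 ℚ_[p]}
    {a00 a01 a02 a03 a10 a11 a12 a13 a20 a21 a22 a23 a30 a31 a32 a33 : ℚ_[p]}
    (hg : toMat g = !![a00, a01, a02, a03; a10, a11, a12, a13; a20, a21, a22, a23;
      a30, a31, a32, a33]) (hd : ‖(toMat g).det‖ = 1)
    (h00 : ‖a00‖ ≤ 1) (h01 : ‖a01‖ ≤ 1) (h02 : ‖a02‖ ≤ 1) (h03 : ‖a03‖ ≤ 1)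
    (h11 : ‖a11‖ ≤ 1) (h12 : ‖a12‖ ≤ 1) (h13 : ‖a13‖ ≤ 1)
    (h22 : ‖a22‖ ≤ 1) (h23 : ‖a23‖ ≤ 1) (h33 : ‖a33‖ ≤ 1)
    (h10 : ‖a10‖ < 1) (h20 : ‖a20‖ < 1) (h21 : ‖a21‖ < 1)
    (h30 : ‖a30‖ < 1) (h31 : ‖a31‖ < 1) (h32 : ‖a32‖ < 1) : g ∈ Iw p := by
  rw [mem_parahoric_iff]
  refine ⟨fun i j => ?_, hd, fun i j hij => ?_⟩ <;> rw [hg]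
  · fin_cases i <;> fin_cases j <;> simp [*, le_of_lt]
  · revert hij
    fin_cases i <;> fin_cases j <;> simp [borelBlocks, *]

theorem mem_parahoric_of_lit {b : Fin 4 → ℕ} {g : GSp4 ℚ_[p]}
    {a00 a01 a02 a03 a10 a11 a12 a13 a20 a21 a22 a23 a30 a31 a32 a33 : ℚ_[p]}
    (hg : toMat g = !![a00, a01, a02, a03; a10, a11, a12, a13; a20, a21, a22, a23;
      a30, a31, a32, a33]) (hd : ‖(toMat g).det‖ = 1)
    (h00 : ‖a00‖ ≤ 1) (h01 : ‖a01‖ ≤ 1) (h02 : ‖a02‖ ≤ 1) (h03 : ‖a03‖ ≤ 1)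
    (h10 : ‖a10‖ ≤ 1) (h11 : ‖a11‖ ≤ 1) (h12 : ‖a12‖ ≤ 1) (h13 : ‖a13‖ ≤ 1)
    (h20 : ‖a20‖ ≤ 1) (h21 : ‖a21‖ ≤ 1) (h22 : ‖a22‖ ≤ 1) (h23 : ‖a23‖ ≤ 1)
    (h30 : ‖a30‖ ≤ 1) (h31 : ‖a31‖ ≤ 1) (h32 : ‖a32‖ ≤ 1) (h33 : ‖a33‖ ≤ 1)
    (l01 : b 1 < b 0 → ‖a01‖ < 1) (l02 : b 2 < b 0 → ‖a02‖ < 1) (l03 : b 3 < b 0 → ‖a03‖ < 1)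
    (l10 : b 0 < b 1 → ‖a10‖ < 1) (l12 : b 2 < b 1 → ‖a12‖ < 1) (l13 : b 3 < b 1 → ‖a13‖ < 1)
    (l20 : b 0 < b 2 → ‖a20‖ < 1) (l21 : b 1 < b 2 → ‖a21‖ < 1) (l23 : b 3 < b 2 → ‖a23‖ < 1)
    (l30 : b 0 < b 3 → ‖a30‖ < 1) (l31 : b 1 < b 3 → ‖a31‖ < 1) (l32 : b 2 < b 3 → ‖a32‖ < 1) :
    g ∈ parahoric p b := by
  rw [mem_parahoric_iff]
  refine ⟨fun i j => ?_, hd, fun i j hij => ?_⟩ <;> rw [hg]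
  · fin_cases i <;> fin_cases j <;> simp [*]
  · fin_cases i <;> fin_cases j
    · exact absurd hij (lt_irrefl _)
    · exact l01 hij
    · exact l02 hij
    · exact l03 hij
    · exact l10 hij
    · exact absurd hij (lt_irrefl _)
    · exact l12 hij
    · exact l13 hij
    · exact l20 hij
    · exact l21 hij
    · exact absurd hij (lt_irrefl _)
    · exact l23 hij
    · exact l30 hij
    · exact l31 hij
    · exact l32 hij
    · exact absurd hij (lt_irrefl _)

theorem norm_le_of_mem {b : Fin 4 → ℕ} {g : GSp4 ℚ_[p]} (h : g ∈ parahoric p b) (i j : Fin 4) :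
    ‖toMat g i j‖ ≤ 1 := ((mem_parahoric_iff b g).mp h).1 i j

theorem norm_det_of_mem {b : Fin 4 → ℕ} {g : GSp4 ℚ_[p]} (h : g ∈ parahoric p b) :
    ‖(toMat g).det‖ = 1 := ((mem_parahoric_iff b g).mp h).2.1

theorem norm_lt_of_mem {b : Fin 4 → ℕ} {g : GSp4 ℚ_[p]} (h : g ∈ parahoric p b) {i j : Fin 4}
    (hij : b j < b i) : ‖toMat g i j‖ < 1 := ((mem_parahoric_iff b g).mp h).2.2 i j hij

theorem norm_det_ofMat {M : Matrix (Fin 4) (Fin 4) ℚ_[p]} {μ : ℚ_[p]ˣ}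
    {h : Mᵀ * J _ * M = (μ : ℚ_[p]) • J _} (hμ : ‖(μ : ℚ_[p])‖ = 1) :
    ‖(toMat (ofMat M μ h)).det‖ = 1 := (norm_det_of_multiplier h).mpr hμ

theorem n1_mem {x : ℚ_[p]} (hx : ‖x‖ ≤ 1) : n1 x ∈ Iw p := by
  apply mem_Iw_of_lit rfl (norm_det_ofMat (by simp)) <;> simp [hx]

theorem n2_mem {x : ℚ_[p]} (hx : ‖x‖ ≤ 1) : n2 x ∈ Iw p := by
  apply mem_Iw_of_lit rfl (norm_det_ofMat (by simp)) <;> simp [hx]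

theorem n13_mem {x : ℚ_[p]} (hx : ‖x‖ ≤ 1) : n13 x ∈ Iw p := by
  apply mem_Iw_of_lit rfl (norm_det_ofMat (by simp)) <;> simp [hx]

theorem n14_mem {x : ℚ_[p]} (hx : ‖x‖ ≤ 1) : n14 x ∈ Iw p := by
  apply mem_Iw_of_lit rfl (norm_det_ofMat (by simp)) <;> simp [hx]

theorem tor_mem {a b b' a' : ℚ_[p]ˣ} (h : a * a' = b * b') (ha : ‖(a : ℚ_[p])‖ = 1)
    (hb : ‖(b : ℚ_[p])‖ = 1) (hb' : ‖(b' : ℚ_[p])‖ = 1) (ha' : ‖(a' : ℚ_[p])‖ = 1) :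
    tor a b b' a' h ∈ Iw p := by
  apply mem_Iw_of_lit rfl (norm_det_ofMat (by simp [ha, ha'])) <;> simp [*]

end MembershipLit

section Inverses
variable {R : Type*} [CommRing R]

theorem toMat_inv_eq {g : GSp4 R} {N : Matrix (Fin 4) (Fin 4) R} (h : toMat g * N = 1) :
    toMat g⁻¹ = N := by
  have h1 : toMat g⁻¹ * toMat g = 1 := by rw [← toMat_mul, inv_mul_cancel, toMat_one]
  rw [← Matrix.mul_one (toMat g⁻¹), ← h, ← Matrix.mul_assoc, h1, Matrix.one_mul]

theorem toMat_n1 (x : R) : toMat (n1 x) = !![1, x, 0, 0; 0, 1, 0, 0; 0, 0, 1, -x; 0, 0, 0, 1] := rfl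
theorem toMat_n2 (x : R) : toMat (n2 x) = !![1, 0, 0, 0; 0, 1, x, 0; 0, 0, 1, 0; 0, 0, 0, 1] := rfl
theorem toMat_n13 (x : R) :
    toMat (n13 x) = !![1, 0, x, 0; 0, 1, 0, x; 0, 0, 1, 0; 0, 0, 0, 1] := rfl
theorem toMat_n14 (x : R) :
    toMat (n14 x) = !![1, 0, 0, x; 0, 1, 0, 0; 0, 0, 1, 0; 0, 0, 0, 1] := rfl
theorem toMat_m1 (x : R) : toMat (m1 x) = !![1, 0, 0, 0; x, 1, 0, 0; 0, 0, 1, 0; 0, 0, -x, 1] := rfl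
theorem toMat_m2 (x : R) : toMat (m2 x) = !![1, 0, 0, 0; 0, 1, 0, 0; 0, x, 1, 0; 0, 0, 0, 1] := rfl
theorem toMat_s1 : toMat (s1 : GSp4 R) = !![0, 1, 0, 0; 1, 0, 0, 0; 0, 0, 0, 1; 0, 0, 1, 0] := rfl
theorem toMat_s2 : toMat (s2 : GSp4 R) = !![1, 0, 0, 0; 0, 0, -1, 0; 0, 1, 0, 0; 0, 0, 0, 1] := rfl
theorem toMat_tor {a b b' a' : Rˣ} (h : a * a' = b * b') : toMat (tor a b b' a' h) =
    !![(a : R), 0, 0, 0; 0, (b : R), 0, 0; 0, 0, (b' : R), 0; 0, 0, 0, (a' : R)] := rfl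
theorem toMat_etaElt {p : ℕ} [Fact p.Prime] : toMat (etaElt p) =
    !![0, 0, 1, 0; 0, 0, 0, 1; (p : ℚ_[p]), 0, 0, 0; 0, (p : ℚ_[p]), 0, 0] := rfl

theorem n1_add (x y : R) : n1 (x + y) = n1 x * n1 y := by
  apply toMat_injective
  rw [toMat_mul, toMat_n1, toMat_n1, toMat_n1, mul_four]
  apply lit_congr <;> ring

theorem n2_add (x y : R) : n2 (x + y) = n2 x * n2 y := by
  apply toMat_injective
  rw [toMat_mul, toMat_n2, toMat_n2, toMat_n2, mul_four]
  apply lit_congr <;> ring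

theorem n13_add (x y : R) : n13 (x + y) = n13 x * n13 y := by
  apply toMat_injective
  rw [toMat_mul, toMat_n13, toMat_n13, toMat_n13, mul_four]
  apply lit_congr <;> ring

theorem n14_add (x y : R) : n14 (x + y) = n14 x * n14 y := by
  apply toMat_injective
  rw [toMat_mul, toMat_n14, toMat_n14, toMat_n14, mul_four]
  apply lit_congr <;> ring

theorem n1_zero : n1 (0 : R) = 1 := by
  apply toMat_injective
  rw [toMat_n1, toMat_one, one_four]; simp

theorem n2_zero : n2 (0 : R) = 1 := by
  apply toMat_injective
  rw [toMat_n2, toMat_one, one_four]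

theorem n1_inv (x : R) : (n1 x)⁻¹ = n1 (-x) :=
  inv_eq_of_mul_eq_one_right (by rw [← n1_add, add_neg_cancel, n1_zero])

theorem n2_inv (x : R) : (n2 x)⁻¹ = n2 (-x) :=
  inv_eq_of_mul_eq_one_right (by rw [← n2_add, add_neg_cancel, n2_zero])

theorem toMat_s1_inv : toMat (s1 : GSp4 R)⁻¹ =
    !![0, 1, 0, 0; 1, 0, 0, 0; 0, 0, 0, 1; 0, 0, 1, 0] := by
  apply toMat_inv_eq
  rw [toMat_s1, mul_four, one_four]; apply lit_congr <;> ring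

theorem toMat_s2_inv : toMat (s2 : GSp4 R)⁻¹ =
    !![1, 0, 0, 0; 0, 0, 1, 0; 0, -1, 0, 0; 0, 0, 0, 1] := by
  apply toMat_inv_eq
  rw [toMat_s2, mul_four, one_four]; apply lit_congr <;> ring

variable {p : ℕ} [Fact p.Prime]

theorem toMat_etaElt_inv : toMat (etaElt p)⁻¹ =
    !![0, 0, (p : ℚ_[p])⁻¹, 0; 0, 0, 0, (p : ℚ_[p])⁻¹; 1, 0, 0, 0; 0, 1, 0, 0] := by
  have := p_ne_zero (p := p)
  apply toMat_inv_eq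
  rw [toMat_etaElt, mul_four, one_four]; apply lit_congr <;> simp [this]

theorem toMat_d1_inv : toMat (d1 p)⁻¹ =
    !![(p : ℚ_[p])⁻¹, 0, 0, 0; 0, (p : ℚ_[p])⁻¹, 0, 0; 0, 0, 1, 0; 0, 0, 0, 1] := by
  have := p_ne_zero (p := p)
  apply toMat_inv_eq
  rw [toMat_d1, mul_four, one_four]; apply lit_congr <;> simp [this]

theorem toMat_d2_inv : toMat (d2 p)⁻¹ =
    !![((p : ℚ_[p]) ^ 2)⁻¹, 0, 0, 0; 0, (p : ℚ_[p])⁻¹, 0, 0; 0, 0, (p : ℚ_[p])⁻¹, 0;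
      0, 0, 0, 1] := by
  have := p_ne_zero (p := p)
  apply toMat_inv_eq
  rw [toMat_d2, mul_four, one_four]; apply lit_congr <;> simp [this]

end Inverses

/-! ### Conjugates by the elements defining the double cosets. -/

section Conjugation
variable {p : ℕ} [Fact p.Prime]

theorem norm_det_conj (g h : GSp4 ℚ_[p]) : (toMat (g⁻¹ * h * g)).det = (toMat h).det := by
  have : (toMat g⁻¹).det * (toMat g).det = 1 := by
    rw [← Matrix.det_mul, ← toMat_mul, inv_mul_cancel, toMat_one, Matrix.det_one]
  rw [toMat_mul, toMat_mul, Matrix.det_mul, Matrix.det_mul]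
  linear_combination (toMat h).det * this

theorem toMat_conj_s1 (h : GSp4 ℚ_[p]) : toMat (s1⁻¹ * h * s1) =
    !![toMat h 1 1, toMat h 1 0, toMat h 1 3, toMat h 1 2;
       toMat h 0 1, toMat h 0 0, toMat h 0 3, toMat h 0 2;
       toMat h 3 1, toMat h 3 0, toMat h 3 3, toMat h 3 2;
       toMat h 2 1, toMat h 2 0, toMat h 2 3, toMat h 2 2] := by
  rw [toMat_mul, toMat_mul, toMat_s1_inv, toMat_s1, eta_four (toMat h), mul_four, mul_four]
  apply lit_congr <;> simp

theorem toMat_conj_s2 (h : GSp4 ℚ_[p]) : toMat (s2⁻¹ * h * s2) =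
    !![toMat h 0 0, toMat h 0 2, -toMat h 0 1, toMat h 0 3;
       toMat h 2 0, toMat h 2 2, -toMat h 2 1, toMat h 2 3;
       -toMat h 1 0, -toMat h 1 2, toMat h 1 1, -toMat h 1 3;
       toMat h 3 0, toMat h 3 2, -toMat h 3 1, toMat h 3 3] := by
  rw [toMat_mul, toMat_mul, toMat_s2_inv, toMat_s2, eta_four (toMat h), mul_four, mul_four]
  apply lit_congr <;> simp

theorem toMat_conj_eta (h : GSp4 ℚ_[p]) : toMat ((etaElt p)⁻¹ * h * etaElt p) =
    !![toMat h 2 2, toMat h 2 3, toMat h 2 0 / p, toMat h 2 1 / p;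
       toMat h 3 2, toMat h 3 3, toMat h 3 0 / p, toMat h 3 1 / p;
       p * toMat h 0 2, p * toMat h 0 3, toMat h 0 0, toMat h 0 1;
       p * toMat h 1 2, p * toMat h 1 3, toMat h 1 0, toMat h 1 1] := by
  have := p_ne_zero (p := p)
  rw [toMat_mul, toMat_mul, toMat_etaElt_inv, toMat_etaElt, eta_four (toMat h), mul_four, mul_four]
  apply lit_congr <;> simp <;> field_simp

theorem toMat_conj_d1 (h : GSp4 ℚ_[p]) : toMat ((d1 p)⁻¹ * h * d1 p) =
    !![toMat h 0 0, toMat h 0 1, toMat h 0 2 / p, toMat h 0 3 / p;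
       toMat h 1 0, toMat h 1 1, toMat h 1 2 / p, toMat h 1 3 / p;
       p * toMat h 2 0, p * toMat h 2 1, toMat h 2 2, toMat h 2 3;
       p * toMat h 3 0, p * toMat h 3 1, toMat h 3 2, toMat h 3 3] := by
  have := p_ne_zero (p := p)
  rw [toMat_mul, toMat_mul, toMat_d1_inv, toMat_d1, eta_four (toMat h), mul_four, mul_four]
  apply lit_congr <;> simp <;> field_simp

theorem toMat_conj_d2 (h : GSp4 ℚ_[p]) : toMat ((d2 p)⁻¹ * h * d2 p) =
    !![toMat h 0 0, toMat h 0 1 / p, toMat h 0 2 / p, toMat h 0 3 / p / p;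
       p * toMat h 1 0, toMat h 1 1, toMat h 1 2, toMat h 1 3 / p;
       p * toMat h 2 0, toMat h 2 1, toMat h 2 2, toMat h 2 3 / p;
       p * (p * toMat h 3 0), p * toMat h 3 1, p * toMat h 3 2, toMat h 3 3] := by
  have := p_ne_zero (p := p)
  rw [toMat_mul, toMat_mul, toMat_d2_inv, toMat_d2, eta_four (toMat h), mul_four, mul_four]
  apply lit_congr <;> simp <;> field_simp

end Conjugation

section CosetSums
variable {G : Type*} [Group G] {V : Type*} [AddCommGroup V] [Module ℂ V]

theorem heckeOp_eq_sum_mul (ρ : Representation ℂ G V) (K : Subgroup G) (g : G) {ι : Type*}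
    [Fintype ι] (n : ι → G) (hn : ∀ i, n i ∈ K)
    (hinj : ∀ i j, g⁻¹ * ((n i)⁻¹ * n j) * g ∈ K → i = j)
    (hsurj : ∀ k ∈ K, ∃ i, g⁻¹ * ((n i)⁻¹ * k) * g ∈ K) (v : fixedVectors ρ K) :
    (heckeOp ρ K g v : V) = ∑ i, ρ (n i) (ρ g v) := by
  rw [heckeOp_eq_sum ρ K g (fun i => n i * g)]
  · simp only [map_mul, Module.End.mul_apply]
  · intro i
    refine ⟨(n i)⁻¹, K.inv_mem (hn i), ?_⟩
    simp only [mul_assoc, inv_mul_cancel_left, inv_mul_cancel]; exact K.one_mem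
  · intro i j h
    exact hinj i j (by simpa [mul_assoc] using h)
  · intro k hk
    obtain ⟨i, hi⟩ := hsurj k hk
    exact ⟨i, by simpa [mul_assoc] using hi⟩

theorem apply_eq_of_mem {ρ : Representation ℂ G V} {K : Subgroup G} {v : V}
    (hv : v ∈ fixedVectors ρ K) {g g' k : G} (hk : k ∈ K) (h : g = g' * k) : ρ g v = ρ g' v := by
  rw [h, map_mul, Module.End.mul_apply, hv k hk]

end CosetSums

/-! ### Coset representatives for the Hecke operators. -/

section Reps
variable {p : ℕ} [Fact p.Prime]

/-- Modulo p both g and g⁻¹ are upper triangular, so in the diagonal entry of g g⁻¹ = 1 every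
product except that of the two diagonal entries is small. -/
theorem norm_diag_of_mem_Iw {g : GSp4 ℚ_[p]} (hg : g ∈ Iw p) (i : Fin 4) :
    ‖toMat g i i‖ = 1 := by
  have hgi : g⁻¹ ∈ Iw p := (Iw p).inv_mem hg
  have h : ∀ j, ‖toMat g i j * toMat g⁻¹ j i‖ ≤ 1 := fun j =>
    norm_mul_le_one (norm_le_of_mem hg i j) (norm_le_of_mem hgi j i)
  have h1 : ∀ j, j ≠ i → ‖toMat g i j * toMat g⁻¹ j i‖ < 1 := by
    intro j hj
    have hb : borelBlocks j < borelBlocks i ∨ borelBlocks i < borelBlocks j := by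
      revert hj; fin_cases i <;> fin_cases j <;> simp [borelBlocks]
    rcases hb with hb | hb
    · exact norm_mul_lt_one' (norm_lt_of_mem hg hb) (norm_le_of_mem hgi j i)
    · exact norm_mul_lt_one (norm_le_of_mem hg i j) (norm_lt_of_mem hgi hb)
  have h2 : ∑ j, toMat g i j * toMat g⁻¹ j i = 1 := by
    rw [← Matrix.mul_apply, ← toMat_mul, mul_inv_cancel, toMat_one, Matrix.one_apply_eq]
  rw [← Finset.add_sum_erase _ _ (Finset.mem_univ i)] at h2
  refine norm_eq_one_of_mul (norm_le_of_mem hg i i) (norm_le_of_mem hgi i i)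
    (e := ∑ j ∈ Finset.univ.erase i, toMat g i j * toMat g⁻¹ j i) ?_ (by linear_combination h2)
  refine Finset.sum_induction _ (fun x => ‖x‖ < 1) (fun _ _ => norm_add_lt_one) (by simp) ?_
  exact fun j hj => h1 j (Finset.ne_of_mem_erase hj)

theorem norm_last_of_mem_Kl {b : Fin 4 → ℕ} (hb : ∀ j, j ≠ 3 → b j < b 3) {g : GSp4 ℚ_[p]}
    (hg : g ∈ parahoric p b) : ‖toMat g 3 3‖ = 1 := by
  have hgi : g⁻¹ ∈ parahoric p b := (parahoric p b).inv_mem hg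
  have h2 : ∑ j, toMat g 3 j * toMat g⁻¹ j 3 = 1 := by
    rw [← Matrix.mul_apply, ← toMat_mul, mul_inv_cancel, toMat_one, Matrix.one_apply_eq]
  rw [← Finset.add_sum_erase _ _ (Finset.mem_univ 3)] at h2
  refine norm_eq_one_of_mul (norm_le_of_mem hg 3 3) (norm_le_of_mem hgi 3 3)
    (e := ∑ j ∈ Finset.univ.erase 3, toMat g 3 j * toMat g⁻¹ j 3) ?_ (by linear_combination h2)
  refine Finset.sum_induction _ (fun x => ‖x‖ < 1) (fun _ _ => norm_add_lt_one) (by simp) ?_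
  exact fun j hj => norm_mul_lt_one' (norm_lt_of_mem hg (hb j (Finset.ne_of_mem_erase hj)))
    (norm_le_of_mem hgi j 3)

/-- The determinant of the lower right block is a unit at Siegel level. -/
theorem norm_block_of_mem {b : Fin 4 → ℕ} (hb : ∀ i j : Fin 4, 2 ≤ i → j < 2 → b j < b i)
    {g : GSp4 ℚ_[p]} (hg : g ∈ parahoric p b) :
    ‖toMat g 2 2 * toMat g 3 3 - toMat g 2 3 * toMat g 3 2‖ = 1 := by
  have hgi : g⁻¹ ∈ parahoric p b := (parahoric p b).inv_mem hg
  have h : ∀ i j, ∑ l, toMat g i l * toMat g⁻¹ l j = (1 : Matrix (Fin 4) (Fin 4) ℚ_[p]) i j := by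
    intro i j
    rw [← Matrix.mul_apply, ← toMat_mul, mul_inv_cancel, toMat_one]
  have e : ∀ i j, 2 ≤ i → ‖toMat g i 0 * toMat g⁻¹ 0 j + toMat g i 1 * toMat g⁻¹ 1 j‖ < 1 :=
    fun i j hi => norm_add_lt_one
      (norm_mul_lt_one' (norm_lt_of_mem hg (hb i 0 hi (by decide))) (norm_le_of_mem hgi 0 j))
      (norm_mul_lt_one' (norm_lt_of_mem hg (hb i 1 hi (by decide))) (norm_le_of_mem hgi 1 j))
  have h22 := h 2 2
  have h23 := h 2 3
  have h32 := h 3 2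
  have h33 := h 3 3
  simp only [Fin.sum_univ_four] at h22 h23 h32 h33
  rw [Matrix.one_apply_eq] at h22 h33
  rw [Matrix.one_apply_ne (by decide)] at h23 h32
  have e22 := e 2 2 (by decide)
  have e23 := e 2 3 (by decide)
  have e32 := e 3 2 (by decide)
  have e33 := e 3 3 (by decide)
  have hD : ∀ {k : GSp4 ℚ_[p]}, k ∈ parahoric p b →
      ‖toMat k 2 2 * toMat k 3 3 - toMat k 2 3 * toMat k 3 2‖ ≤ 1 := fun {k} hk =>
    norm_sub_le_one (norm_mul_le_one (norm_le_of_mem hk _ _) (norm_le_of_mem hk _ _))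
      (norm_mul_le_one (norm_le_of_mem hk _ _) (norm_le_of_mem hk _ _))
  set x22 := toMat g 2 0 * toMat g⁻¹ 0 2 + toMat g 2 1 * toMat g⁻¹ 1 2
  set x23 := toMat g 2 0 * toMat g⁻¹ 0 3 + toMat g 2 1 * toMat g⁻¹ 1 3
  set x32 := toMat g 3 0 * toMat g⁻¹ 0 2 + toMat g 3 1 * toMat g⁻¹ 1 2
  set x33 := toMat g 3 0 * toMat g⁻¹ 0 3 + toMat g 3 1 * toMat g⁻¹ 1 3
  refine norm_eq_one_of_mul (hD hg) (hD hgi) (e := x22 + x33 - x22 * x33 + x23 * x32) ?_ ?_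
  · exact norm_add_lt_one (norm_sub_lt_one (norm_add_lt_one e22 e33) (norm_mul_lt_one e22.le e33))
      (norm_mul_lt_one e23.le e32)
  · have a22 : toMat g 2 2 * toMat g⁻¹ 2 2 + toMat g 2 3 * toMat g⁻¹ 3 2 = 1 - x22 := by
      linear_combination h22
    have a33 : toMat g 3 2 * toMat g⁻¹ 2 3 + toMat g 3 3 * toMat g⁻¹ 3 3 = 1 - x33 := by
      linear_combination h33
    have a23 : toMat g 2 2 * toMat g⁻¹ 2 3 + toMat g 2 3 * toMat g⁻¹ 3 3 = - x23 := by
      linear_combination h23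
    have a32 : toMat g 3 2 * toMat g⁻¹ 2 2 + toMat g 3 3 * toMat g⁻¹ 3 2 = - x32 := by
      linear_combination h32
    clear_value x22 x23 x32 x33
    calc _ = (toMat g 2 2 * toMat g⁻¹ 2 2 + toMat g 2 3 * toMat g⁻¹ 3 2) *
          (toMat g 3 2 * toMat g⁻¹ 2 3 + toMat g 3 3 * toMat g⁻¹ 3 3) -
          (toMat g 2 2 * toMat g⁻¹ 2 3 + toMat g 2 3 * toMat g⁻¹ 3 3) *
          (toMat g 3 2 * toMat g⁻¹ 2 2 + toMat g 3 3 * toMat g⁻¹ 3 2) := by ring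
      _ = _ := by rw [a22, a33, a23, a32]; ring

variable {V : Type*} [AddCommGroup V] [Module ℂ V] (ρ : Representation ℂ (GSp4 ℚ_[p]) V)

theorem borel_lt {i j : Fin 4} (h : j < i) : borelBlocks j < borelBlocks i := by
  revert h; fin_cases i <;> fin_cases j <;> simp [borelBlocks]

/-- Conjugation by `s1` preserves Iwahori membership exactly when the coordinate along the simple
root vanishes modulo p; the representative n₁(x) is chosen to cancel that coordinate. -/
theorem heckeOp_s1 (v : fixedVectors ρ (Iw p)) :
    (heckeOp ρ (Iw p) s1 v : V) = ∑ x : ZMod p, ρ (n1 (lift x)) (ρ s1 v) := by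
  refine heckeOp_eq_sum_mul ρ (Iw p) s1 (fun x : ZMod p => n1 (lift x))
    (fun x => n1_mem (norm_lift_le x)) ?_ ?_ v
  · intro x y h
    rw [n1_inv, ← n1_add] at h
    have := norm_lt_of_mem h (borel_lt (show (0 : Fin 4) < 1 by decide))
    rw [toMat_conj_s1] at this
    exact (lift_inj (by simpa [toMat_n1, neg_add_eq_sub] using this)).symm
  · intro k hk
    have u := norm_diag_of_mem_Iw hk
    have hl : ∀ i j : Fin 4, j < i → ‖toMat k i j‖ < 1 := fun i j hij =>
      norm_lt_of_mem hk (borel_lt hij)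
    have hi := norm_le_of_mem hk
    obtain ⟨x, hx⟩ := exists_lift (a := toMat k 0 1 / toMat k 1 1)
      (by rw [norm_div_unit (u 1)]; exact hi _ _)
    refine ⟨x, ?_⟩
    set h := (n1 (lift x))⁻¹ * k
    have hh : h ∈ Iw p := (Iw p).mul_mem ((Iw p).inv_mem (n1_mem (norm_lift_le x))) hk
    have lh : ∀ i j : Fin 4, j < i → ‖toMat h i j‖ < 1 := fun i j hij =>
      norm_lt_of_mem hh (borel_lt hij)
    have ih := norm_le_of_mem hh
    have h01 : ‖toMat h 0 1‖ < 1 := by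
      have : toMat h 0 1 = (toMat k 0 1 / toMat k 1 1 - lift x) * toMat k 1 1 := by
        have := ne_zero_of_norm_eq_one (u 1)
        simp only [h, n1_inv, toMat_mul, toMat_n1, Matrix.mul_apply, Fin.sum_univ_four]
        simp; field_simp; ring
      rw [this]
      exact norm_mul_lt_one' hx (hi _ _)
    -- The second copy of the simple root coordinate needs no separate choice: it is tied to the
    -- first by the symplectic relation between two columns.
    have h23 : ‖toMat h 2 3‖ < 1 := by
      have c := col_rel h 1 3 rfl
      have u1 := norm_diag_of_mem_Iw hh 1
      have : toMat h 2 3 = (toMat h 2 1 * toMat h 1 3 + toMat h 3 1 * toMat h 0 3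
          - toMat h 0 1 * toMat h 3 3) / toMat h 1 1 := by
        have := ne_zero_of_norm_eq_one u1
        field_simp; linear_combination c
      rw [this, norm_div_unit u1]
      exact norm_sub_lt_one (norm_add_lt_one (norm_mul_lt_one' (lh _ _ (by decide)) (ih _ _))
        (norm_mul_lt_one' (lh _ _ (by decide)) (ih _ _))) (norm_mul_lt_one' h01 (ih _ _))
    exact mem_Iw_of_lit (toMat_conj_s1 _) (by rw [norm_det_conj]; exact norm_det_of_mem hh)
      (ih 1 1) (ih 1 0) (ih 1 3) (ih 1 2) (ih 0 0) (ih 0 3) (ih 0 2) (ih 3 3) (ih 3 2) (ih 2 2)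
      h01 (lh 3 1 (by decide)) (lh 3 0 (by decide)) (lh 2 1 (by decide)) (lh 2 0 (by decide)) h23

theorem heckeOp_s2 (v : fixedVectors ρ (Iw p)) :
    (heckeOp ρ (Iw p) s2 v : V) = ∑ x : ZMod p, ρ (n2 (lift x)) (ρ s2 v) := by
  refine heckeOp_eq_sum_mul ρ (Iw p) s2 (fun x : ZMod p => n2 (lift x))
    (fun x => n2_mem (norm_lift_le x)) ?_ ?_ v
  · intro x y h
    rw [n2_inv, ← n2_add] at h
    have := norm_lt_of_mem h (borel_lt (show (1 : Fin 4) < 2 by decide))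
    rw [toMat_conj_s2] at this
    replace this : ‖-toMat (n2 (-lift x + lift y)) 1 2‖ < 1 := this
    rw [norm_neg] at this
    exact (lift_inj (by simpa [toMat_n2, neg_add_eq_sub] using this)).symm
  · intro k hk
    have u := norm_diag_of_mem_Iw hk
    have hi := norm_le_of_mem hk
    obtain ⟨x, hx⟩ := exists_lift (a := toMat k 1 2 / toMat k 2 2)
      (by rw [norm_div_unit (u 2)]; exact hi _ _)
    refine ⟨x, ?_⟩
    set h := (n2 (lift x))⁻¹ * k
    have hh : h ∈ Iw p := (Iw p).mul_mem ((Iw p).inv_mem (n2_mem (norm_lift_le x))) hk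
    have lh : ∀ i j : Fin 4, j < i → ‖toMat h i j‖ < 1 := fun i j hij =>
      norm_lt_of_mem hh (borel_lt hij)
    have ih := norm_le_of_mem hh
    have h12 : ‖toMat h 1 2‖ < 1 := by
      have : toMat h 1 2 = (toMat k 1 2 / toMat k 2 2 - lift x) * toMat k 2 2 := by
        have := ne_zero_of_norm_eq_one (u 2)
        simp only [h, n2_inv, toMat_mul, toMat_n2, Matrix.mul_apply, Fin.sum_univ_four]
        simp; field_simp; ring
      rw [this]
      exact norm_mul_lt_one' hx (hi _ _)
    have nih : ∀ i j, ‖-toMat h i j‖ ≤ 1 := fun i j => by rw [norm_neg]; exact ih i j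
    exact mem_Iw_of_lit (toMat_conj_s2 _) (by rw [norm_det_conj]; exact norm_det_of_mem hh)
      (ih 0 0) (ih 0 2) (nih 0 1) (ih 0 3) (ih 2 2) (nih 2 1) (ih 2 3) (ih 1 1) (nih 1 3) (ih 3 3)
      (lh 2 0 (by decide)) (by rw [norm_neg]; exact lh 1 0 (by decide)) (by rwa [norm_neg])
      (lh 3 0 (by decide)) (lh 3 2 (by decide)) (by rw [norm_neg]; exact lh 3 1 (by decide))

/-- The Atkin–Lehner element normalises the Iwahori subgroup, so its double coset is a single coset.
-/
theorem heckeOp_eta (v : fixedVectors ρ (Iw p)) :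
    (heckeOp ρ (Iw p) (etaElt p) v : V) = ρ (etaElt p) v := by
  rw [heckeOp_eq_sum_mul ρ (Iw p) (etaElt p) (fun _ : Unit => 1) (fun _ => (Iw p).one_mem)
    (fun _ _ _ => rfl) ?_ v]
  · simp
  · intro k hk
    refine ⟨(), ?_⟩
    rw [inv_one, one_mul]
    have lh : ∀ i j : Fin 4, j < i → ‖toMat k i j‖ < 1 := fun i j hij =>
      norm_lt_of_mem hk (borel_lt hij)
    have ih := norm_le_of_mem hk
    have dv : ∀ i j : Fin 4, j < i → ‖toMat k i j / p‖ ≤ 1 := fun i j hij =>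
      norm_div_p_le_iff.mpr (lh i j hij)
    exact mem_Iw_of_lit (toMat_conj_eta _) (by rw [norm_det_conj]; exact norm_det_of_mem hk)
      (ih 2 2) (ih 2 3) (dv 2 0 (by decide)) (dv 2 1 (by decide)) (ih 3 3) (dv 3 0 (by decide))
      (dv 3 1 (by decide)) (ih 0 0) (ih 0 1) (ih 1 1) (lh 3 2 (by decide))
      (norm_p_mul_lt_one (ih 0 2)) (norm_p_mul_lt_one (ih 0 3)) (norm_p_mul_lt_one (ih 1 2))
      (norm_p_mul_lt_one (ih 1 3)) (lh 1 0 (by decide))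

/-- Elements of the unipotent radical of the Siegel parabolic. -/
def siegelElt (x y z : ℚ_[p]) : GSp4 ℚ_[p] := n2 x * n13 y * n14 z

theorem toMat_siegelElt (x y z : ℚ_[p]) : toMat (siegelElt x y z) =
    !![1, 0, y, z; 0, 1, x, y; 0, 0, 1, 0; 0, 0, 0, 1] := by
  rw [siegelElt, toMat_mul, toMat_mul, toMat_n2, toMat_n13, toMat_n14, mul_four, mul_four]
  apply lit_congr <;> ring

theorem siegelElt_inv (x y z : ℚ_[p]) : (siegelElt x y z)⁻¹ = siegelElt (-x) (-y) (-z) := by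
  refine inv_eq_of_mul_eq_one_right (toMat_injective ?_)
  rw [toMat_mul, toMat_siegelElt, toMat_siegelElt, mul_four, toMat_one, one_four]
  apply lit_congr <;> ring

theorem siegelElt_mem {x y z : ℚ_[p]} (hx : ‖x‖ ≤ 1) (hy : ‖y‖ ≤ 1) (hz : ‖z‖ ≤ 1) :
    siegelElt x y z ∈ Iw p :=
  (Iw p).mul_mem ((Iw p).mul_mem (n2_mem hx) (n13_mem hy)) (n14_mem hz)

theorem siegelElt_conj_inj {b : Fin 4 → ℕ} {x y z x' y' z' : ZMod p}
    (h : (d1 p)⁻¹ * ((siegelElt (lift x) (lift y) (lift z))⁻¹ *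
      siegelElt (lift x') (lift y') (lift z')) * d1 p ∈ parahoric p b) :
    x = x' ∧ y = y' ∧ z = z' := by
  have e : toMat ((siegelElt (lift x) (lift y) (lift z))⁻¹ *
      siegelElt (lift x') (lift y') (lift z')) = !![1, 0, lift y' - lift y,
      lift z' - lift z; 0, 1, lift x' - lift x, lift y' - lift y; 0, 0, 1, 0; 0, 0, 0, 1] := by
    rw [siegelElt_inv, toMat_mul, toMat_siegelElt, toMat_siegelElt, mul_four]
    apply lit_congr <;> ring
  have hm := norm_le_of_mem h
  rw [toMat_conj_d1, e] at hm
  have h1 : ‖(lift x' - lift x) / p‖ ≤ 1 := hm 1 2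
  have h2 : ‖(lift y' - lift y) / p‖ ≤ 1 := hm 0 2
  have h3 : ‖(lift z' - lift z) / p‖ ≤ 1 := hm 0 3
  exact ⟨(lift_inj (norm_div_p_le_iff.mp h1)).symm, (lift_inj (norm_div_p_le_iff.mp h2)).symm,
    (lift_inj (norm_div_p_le_iff.mp h3)).symm⟩

theorem cramer_left {F : Type*} [Field F] {a b c d e f D : F} (hD : D = c * f - d * e)
    (h0 : D ≠ 0) : (a * f - b * e) / D * c + (b * c - a * d) / D * e = a := by
  field_simp; rw [hD]; ring

theorem cramer_right {F : Type*} [Field F] {a b c d e f D : F} (hD : D = c * f - d * e)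
    (h0 : D ≠ 0) : (a * f - b * e) / D * d + (b * c - a * d) / D * f = b := by
  field_simp; rw [hD]; ring

/-- If B and D are the upper and lower right blocks of k, the matrix B D⁻¹ is integral because det D
is a unit, and its entries modulo p are the parameters of the representative. The argument covers
Siegel and Iwahori level at once. -/
theorem exists_siegelElt_conj_mem {b : Fin 4 → ℕ}
    (hb : ∀ i j : Fin 4, 2 ≤ i → j < 2 → b j < b i) (hI : Iw p ≤ parahoric p b)
    {k : GSp4 ℚ_[p]} (hk : k ∈ parahoric p b) : ∃ x y z : ZMod p,
    (d1 p)⁻¹ * ((siegelElt (lift x) (lift y) (lift z))⁻¹ * k) * d1 p ∈ parahoric p b := by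
  have uD := norm_block_of_mem hb hk
  have hi := norm_le_of_mem hk
  set D := toMat k 2 2 * toMat k 3 3 - toMat k 2 3 * toMat k 3 2 with hD
  have hD0 := ne_zero_of_norm_eq_one uD
  have c := col_rel k 2 3 rfl
  obtain ⟨x, hx⟩ := exists_lift (a := (toMat k 1 2 * toMat k 3 3 - toMat k 1 3 * toMat k 3 2) / D)
    (by rw [norm_div_unit uD]
        exact norm_sub_le_one (norm_mul_le_one (hi _ _) (hi _ _))
          (norm_mul_le_one (hi _ _) (hi _ _)))
  obtain ⟨y, hy⟩ := exists_lift (a := (toMat k 0 2 * toMat k 3 3 - toMat k 0 3 * toMat k 3 2) / D)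
    (by rw [norm_div_unit uD]
        exact norm_sub_le_one (norm_mul_le_one (hi _ _) (hi _ _))
          (norm_mul_le_one (hi _ _) (hi _ _)))
  obtain ⟨z, hz⟩ := exists_lift (a := (toMat k 0 3 * toMat k 2 2 - toMat k 0 2 * toMat k 2 3) / D)
    (by rw [norm_div_unit uD]
        exact norm_sub_le_one (norm_mul_le_one (hi _ _) (hi _ _))
          (norm_mul_le_one (hi _ _) (hi _ _)))
  refine ⟨x, y, z, ?_⟩
  set h := (siegelElt (lift x) (lift y) (lift z))⁻¹ * k with hh0
  have hh : h ∈ parahoric p b :=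
    (parahoric p b).mul_mem ((parahoric p b).inv_mem (hI (siegelElt_mem (norm_lift_le x)
      (norm_lift_le y) (norm_lift_le z)))) hk
  have ih := norm_le_of_mem hh
  have en : ∀ i j, toMat h i j = ∑ l, !![1, 0, -lift y, -lift z; 0, 1, -lift x, -lift y;
      0, 0, 1, 0; 0, 0, 0, 1] i l * toMat k l j := by
    intro i j
    rw [hh0, siegelElt_inv, toMat_mul, toMat_siegelElt, Matrix.mul_apply]
  have small : ∀ {a b u v : ℚ_[p]}, ‖a‖ < 1 → ‖b‖ < 1 → ‖u‖ ≤ 1 → ‖v‖ ≤ 1 →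
      ‖(a * u + b * v) / p‖ ≤ 1 := fun ha hb hu hv =>
    norm_div_p_le_iff.mpr (norm_add_lt_one (norm_mul_lt_one' ha hu) (norm_mul_lt_one' hb hv))
  have a02 := en 0 2
  have a03 := en 0 3
  have a12 := en 1 2
  have a13 := en 1 3
  simp [Fin.sum_univ_four] at a02 a03 a12 a13
  have t02 := small hy hz (hi 2 2) (hi 3 2)
  have t03 := small hy hz (hi 2 3) (hi 3 3)
  have t12 := small hx hy (hi 2 2) (hi 3 2)
  have t13 := small hx hy (hi 2 3) (hi 3 3)
  -- The two entries of B D⁻¹ that should both equal y agree by the symplectic relation between the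
  -- last two columns.
  have q1 : (toMat k 1 3 * toMat k 2 2 - toMat k 1 2 * toMat k 2 3) / D =
      (toMat k 0 2 * toMat k 3 3 - toMat k 0 3 * toMat k 3 2) / D := by
    rw [show toMat k 1 3 * toMat k 2 2 - toMat k 1 2 * toMat k 2 3 =
      toMat k 0 2 * toMat k 3 3 - toMat k 0 3 * toMat k 3 2 by linear_combination -c]
  have g02 : ((toMat k 0 2 * toMat k 3 3 - toMat k 0 3 * toMat k 3 2) / D - lift y)
      * toMat k 2 2 + ((toMat k 0 3 * toMat k 2 2 - toMat k 0 2 * toMat k 2 3) / D - lift z)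
      * toMat k 3 2 = toMat h 0 2 := by
    linear_combination cramer_left hD hD0 (a := toMat k 0 2) (b := toMat k 0 3) - a02
  have g03 : ((toMat k 0 2 * toMat k 3 3 - toMat k 0 3 * toMat k 3 2) / D - lift y)
      * toMat k 2 3 + ((toMat k 0 3 * toMat k 2 2 - toMat k 0 2 * toMat k 2 3) / D - lift z)
      * toMat k 3 3 = toMat h 0 3 := by
    linear_combination cramer_right hD hD0 (a := toMat k 0 2) (b := toMat k 0 3) - a03
  have g12 : ((toMat k 1 2 * toMat k 3 3 - toMat k 1 3 * toMat k 3 2) / D - lift x)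
      * toMat k 2 2 + ((toMat k 0 2 * toMat k 3 3 - toMat k 0 3 * toMat k 3 2) / D - lift y)
      * toMat k 3 2 = toMat h 1 2 := by
    rw [← q1]
    linear_combination cramer_left hD hD0 (a := toMat k 1 2) (b := toMat k 1 3) - a12
  have g13 : ((toMat k 1 2 * toMat k 3 3 - toMat k 1 3 * toMat k 3 2) / D - lift x)
      * toMat k 2 3 + ((toMat k 0 2 * toMat k 3 3 - toMat k 0 3 * toMat k 3 2) / D - lift y)
      * toMat k 3 3 = toMat h 1 3 := by
    rw [← q1]
    linear_combination cramer_right hD hD0 (a := toMat k 1 2) (b := toMat k 1 3) - a13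
  rw [g02] at t02
  rw [g03] at t03
  rw [g12] at t12
  rw [g13] at t13
  have hnot : ∀ i j : Fin 4, 2 ≤ i → j < 2 → ¬ b i < b j := fun i j h1 h2 =>
    not_lt.mpr (hb i j h1 h2).le
  have lh : ∀ i j, b j < b i → ‖toMat h i j‖ < 1 := fun i j hij => norm_lt_of_mem hh hij
  have pih : ∀ i j, ‖p * toMat h i j‖ < 1 := fun i j => norm_p_mul_lt_one (ih i j)
  exact mem_parahoric_of_lit (toMat_conj_d1 _) (by rw [norm_det_conj]; exact norm_det_of_mem hh)
    (ih 0 0) (ih 0 1) t02 t03 (ih 1 0) (ih 1 1) t12 t13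
    (pih 2 0).le (pih 2 1).le (ih 2 2) (ih 2 3) (pih 3 0).le (pih 3 1).le (ih 3 2) (ih 3 3)
    (lh 0 1) (fun h => absurd h (hnot 2 0 (by decide) (by decide)))
    (fun h => absurd h (hnot 3 0 (by decide) (by decide)))
    (lh 1 0) (fun h => absurd h (hnot 2 1 (by decide) (by decide)))
    (fun h => absurd h (hnot 3 1 (by decide) (by decide)))
    (fun _ => pih 2 0) (fun _ => pih 2 1) (lh 2 3) (fun _ => pih 3 0) (fun _ => pih 3 1) (lh 3 2)

/-- `[K diag(p,p,1,1) K]` at Siegel or Iwahori level. -/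
theorem heckeOp_d1 {b : Fin 4 → ℕ} (hb : ∀ i j : Fin 4, 2 ≤ i → j < 2 → b j < b i)
    (hI : Iw p ≤ parahoric p b) (v : fixedVectors ρ (parahoric p b)) :
    (heckeOp ρ (parahoric p b) (d1 p) v : V) = ∑ x : ZMod p × ZMod p × ZMod p,
      ρ (siegelElt (lift x.1) (lift x.2.1) (lift x.2.2)) (ρ (d1 p) v) := by
  refine heckeOp_eq_sum_mul ρ (parahoric p b) (d1 p) (fun x : ZMod p × ZMod p × ZMod p =>
    siegelElt (lift x.1) (lift x.2.1) (lift x.2.2))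
    (fun x => hI (siegelElt_mem (norm_lift_le _) (norm_lift_le _) (norm_lift_le _))) ?_ ?_ v
  · rintro ⟨x, y, z⟩ ⟨x', y', z'⟩ h
    obtain ⟨rfl, rfl, rfl⟩ := siegelElt_conj_inj h
    rfl
  · intro k hk
    obtain ⟨x, y, z, h⟩ := exists_siegelElt_conj_mem hb hI hk
    exact ⟨(x, y, z), h⟩

/-- Elements of the unipotent radical of the Klingen parabolic. -/
def klingenElt (x z t : ℚ_[p]) : GSp4 ℚ_[p] := n1 x * n13 z * n14 t

theorem toMat_klingenElt (x z t : ℚ_[p]) : toMat (klingenElt x z t) =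
    !![1, x, z, t + x * z; 0, 1, 0, z; 0, 0, 1, -x; 0, 0, 0, 1] := by
  rw [klingenElt, toMat_mul, toMat_mul, toMat_n1, toMat_n13, toMat_n14, mul_four, mul_four]
  apply lit_congr <;> ring

theorem toMat_klingenElt_inv (x z t : ℚ_[p]) : toMat (klingenElt x z t)⁻¹ =
    !![1, -x, -z, -t - x * z; 0, 1, 0, -z; 0, 0, 1, x; 0, 0, 0, 1] := by
  apply toMat_inv_eq
  rw [toMat_klingenElt, mul_four, one_four]
  apply lit_congr <;> ring

theorem klingenElt_mem {x z t : ℚ_[p]} (hx : ‖x‖ ≤ 1) (hz : ‖z‖ ≤ 1) (ht : ‖t‖ ≤ 1) :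
    klingenElt x z t ∈ Iw p :=
  (Iw p).mul_mem ((Iw p).mul_mem (n1_mem hx) (n13_mem hz)) (n14_mem ht)

/-- Conjugation by `d2` divides the corner entry by p², so that parameter counts modulo p². It is
written through two digits as y - pw; the sign is the one that appears in `klingen_factor`. -/
theorem klingenElt_conj_inj {b : Fin 4 → ℕ} {x z y w x' z' y' w' : ZMod p}
    (h : (d2 p)⁻¹ * ((klingenElt (lift x) (lift z) (lift y - p * lift w))⁻¹ *
      klingenElt (lift x') (lift z') (lift y' - p * lift w')) * d2 p ∈ parahoric p b) :
    x = x' ∧ z = z' ∧ y = y' ∧ w = w' := by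
  have e : toMat ((klingenElt (lift x) (lift z) (lift y - p * lift w))⁻¹ *
      klingenElt (lift x') (lift z') (lift y' - p * lift w')) = !![1, lift x' - lift x,
      lift z' - lift z, lift y' - lift y - p * (lift w' - lift w) + (lift x' - lift x) * (lift z' + lift z);
      0, 1, 0, lift z' - lift z; 0, 0, 1, lift x - lift x'; 0, 0, 0, 1] := by
    rw [toMat_mul, toMat_klingenElt, toMat_klingenElt_inv, mul_four]
    apply lit_congr <;> ring
  have hm := norm_le_of_mem h
  rw [toMat_conj_d2, e] at hm
  have h1 : ‖(lift x' - lift x) / p‖ ≤ 1 := hm 0 1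
  have h2 : ‖(lift z' - lift z) / p‖ ≤ 1 := hm 0 2
  have h3 : ‖(lift y' - lift y - p * (lift w' - lift w) + (lift x' - lift x) * (lift z' + lift z)) / p / p‖ ≤ 1 :=
    hm 0 3
  have hx : x' = x := lift_inj (norm_div_p_le_iff.mp h1)
  have hz : z' = z := lift_inj (norm_div_p_le_iff.mp h2)
  subst hx hz
  have hp := p_ne_zero (p := p)
  rw [norm_div_p_le_iff] at h3
  have hy : y' = y := by
    apply lift_inj
    have e1 := norm_div_p_le_iff.mp h3.le
    have e2 : ‖(p : ℚ_[p]) * (lift w' - lift w)‖ < 1 :=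
      norm_p_mul_lt_one (norm_sub_le_one (norm_lift_le _) (norm_lift_le _))
    convert norm_add_lt_one e1 e2 using 2
    ring
  subst hy
  refine ⟨rfl, rfl, rfl, lift_inj ?_⟩
  convert h3 using 2
  field_simp
  ring

theorem exists_klingenElt_conj_mem {b : Fin 4 → ℕ} (h0 : ∀ j, j ≠ 0 → b 0 < b j)
    (h3 : ∀ j, j ≠ 3 → b j < b 3) (hI : Iw p ≤ parahoric p b)
    {k : GSp4 ℚ_[p]} (hk : k ∈ parahoric p b) : ∃ x z y w : ZMod p,
    (d2 p)⁻¹ * ((klingenElt (lift x) (lift z) (lift y - p * lift w))⁻¹ * k) * d2 p ∈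
      parahoric p b := by
  have hp := p_ne_zero (p := p)
  have u := norm_last_of_mem_Kl h3 hk
  have u0 := ne_zero_of_norm_eq_one u
  have hi := norm_le_of_mem hk
  obtain ⟨x, hx⟩ := exists_lift (a := -toMat k 2 3 / toMat k 3 3)
    (by rw [norm_div_unit u, norm_neg]; exact hi _ _)
  obtain ⟨z, hz⟩ := exists_lift (a := toMat k 1 3 / toMat k 3 3)
    (by rw [norm_div_unit u]; exact hi _ _)
  have lx := norm_lift_le x
  have lz := norm_lift_le z
  set T := (toMat k 0 3 - lift x * toMat k 1 3 - lift z * toMat k 2 3) / toMat k 3 3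
    - lift x * lift z with hT
  have hT1 : ‖T‖ ≤ 1 := by
    refine norm_sub_le_one ?_ (norm_mul_le_one lx lz)
    rw [norm_div_unit u]
    exact norm_sub_le_one (norm_sub_le_one (hi _ _) (norm_mul_le_one lx (hi _ _)))
      (norm_mul_le_one lz (hi _ _))
  obtain ⟨y, hy⟩ := exists_lift hT1
  have hy' : ‖(lift y - T) / p‖ ≤ 1 := by
    rw [norm_div_p_le_iff, norm_sub_rev]; exact hy
  obtain ⟨w, hw⟩ := exists_lift hy'
  refine ⟨x, z, y, w, ?_⟩
  have lt : ‖lift y - p * lift w‖ ≤ 1 :=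
    norm_sub_le_one (norm_lift_le _) (norm_p_mul_lt_one (norm_lift_le _)).le
  set h := (klingenElt (lift x) (lift z) (lift y - p * lift w))⁻¹ * k with hh0
  have hh : h ∈ parahoric p b :=
    (parahoric p b).mul_mem ((parahoric p b).inv_mem (hI (klingenElt_mem lx lz lt))) hk
  have ih := norm_le_of_mem hh
  have en : ∀ i j, toMat h i j = ∑ l, !![1, -lift x, -lift z,
      -(lift y - p * lift w) - lift x * lift z; 0, 1, 0, -lift z; 0, 0, 1, lift x; 0, 0, 0, 1] i l
      * toMat k l j := by
    intro i j
    rw [hh0, toMat_mul, toMat_klingenElt_inv, Matrix.mul_apply]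
  have a03 := en 0 3
  have a13 := en 1 3
  have a23 := en 2 3
  simp [Fin.sum_univ_four] at a03 a13 a23
  have t13 : ‖toMat h 1 3‖ < 1 := by
    have : toMat h 1 3 = (toMat k 1 3 / toMat k 3 3 - lift z) * toMat k 3 3 := by
      rw [a13]; field_simp; ring
    rw [this]
    exact norm_mul_lt_one' hz (hi _ _)
  have t23 : ‖toMat h 2 3‖ < 1 := by
    have : toMat h 2 3 = -((-toMat k 2 3 / toMat k 3 3 - lift x) * toMat k 3 3) := by
      rw [a23]; field_simp; ring
    rw [this, norm_neg]
    exact norm_mul_lt_one' hx (hi _ _)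
  have t03 : ‖toMat h 0 3 / p / p‖ ≤ 1 := by
    rw [norm_div_p_le_iff]
    have : toMat h 0 3 / p = -(((lift y - T) / p - lift w) * toMat k 3 3) := by
      rw [a03, hT]; field_simp; ring
    rw [this, norm_neg]
    exact norm_mul_lt_one' hw (hi _ _)
  have u' := norm_last_of_mem_Kl h3 hh
  have u0' := ne_zero_of_norm_eq_one u'
  have lh : ∀ i j, b j < b i → ‖toMat h i j‖ < 1 := fun i j hij => norm_lt_of_mem hh hij
  -- Only the last column has been normalised; smallness of the two remaining entries of the first
  -- row follows from the symplectic relations with that column.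
  have t01 : ‖toMat h 0 1‖ < 1 := by
    have c := col_rel h 1 3 rfl
    have : toMat h 0 1 = (toMat h 2 1 * toMat h 1 3 + toMat h 3 1 * toMat h 0 3
        - toMat h 1 1 * toMat h 2 3) / toMat h 3 3 := by
      field_simp; linear_combination c
    rw [this, norm_div_unit u']
    exact norm_sub_lt_one (norm_add_lt_one (norm_mul_lt_one (ih _ _) t13)
      (norm_mul_lt_one' (lh 3 1 (h3 1 (by decide))) (ih _ _))) (norm_mul_lt_one (ih _ _) t23)
  have t02 : ‖toMat h 0 2‖ < 1 := by
    have c := col_rel h 2 3 rfl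
    have : toMat h 0 2 = (toMat h 2 2 * toMat h 1 3 + toMat h 3 2 * toMat h 0 3
        - toMat h 1 2 * toMat h 2 3) / toMat h 3 3 := by
      field_simp; linear_combination c
    rw [this, norm_div_unit u']
    exact norm_sub_lt_one (norm_add_lt_one (norm_mul_lt_one (ih _ _) t13)
      (norm_mul_lt_one' (lh 3 2 (h3 2 (by decide))) (ih _ _))) (norm_mul_lt_one (ih _ _) t23)
  have pih : ∀ i j, ‖p * toMat h i j‖ < 1 := fun i j => norm_p_mul_lt_one (ih i j)
  have ppih : ‖p * (p * toMat h 3 0)‖ < 1 := norm_p_mul_lt_one (pih 3 0).le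
  have n0 : ∀ j, j ≠ 0 → ¬ b j < b 0 := fun j hj => (h0 j hj).le.not_gt
  have n3 : ∀ j, j ≠ 3 → ¬ b 3 < b j := fun j hj => (h3 j hj).le.not_gt
  exact mem_parahoric_of_lit (toMat_conj_d2 _) (by rw [norm_det_conj]; exact norm_det_of_mem hh)
    (ih 0 0) (norm_div_p_le_iff.mpr t01) (norm_div_p_le_iff.mpr t02) t03
    (pih 1 0).le (ih 1 1) (ih 1 2) (norm_div_p_le_iff.mpr t13)
    (pih 2 0).le (ih 2 1) (ih 2 2) (norm_div_p_le_iff.mpr t23)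
    ppih.le (pih 3 1).le (pih 3 2).le (ih 3 3)
    (fun h => absurd h (n0 1 (by decide))) (fun h => absurd h (n0 2 (by decide)))
    (fun h => absurd h (n0 3 (by decide))) (fun _ => pih 1 0) (lh 1 2)
    (fun h => absurd h (n3 1 (by decide))) (fun _ => pih 2 0) (lh 2 1)
    (fun h => absurd h (n3 2 (by decide))) (fun _ => ppih) (fun _ => pih 3 1) (fun _ => pih 3 2)

/-- `[K diag(p²,p,p,1) K]` at Klingen or Iwahori level. -/
theorem heckeOp_d2 {b : Fin 4 → ℕ} (h0 : ∀ j, j ≠ 0 → b 0 < b j) (h3 : ∀ j, j ≠ 3 → b j < b 3)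
    (hI : Iw p ≤ parahoric p b) (v : fixedVectors ρ (parahoric p b)) :
    (heckeOp ρ (parahoric p b) (d2 p) v : V) = ∑ x : ZMod p × ZMod p × ZMod p × ZMod p,
      ρ (klingenElt (lift x.1) (lift x.2.1) (lift x.2.2.1 - p * lift x.2.2.2)) (ρ (d2 p) v) := by
  refine heckeOp_eq_sum_mul ρ (parahoric p b) (d2 p) (fun x : ZMod p × ZMod p × ZMod p × ZMod p =>
    klingenElt (lift x.1) (lift x.2.1) (lift x.2.2.1 - p * lift x.2.2.2))
    (fun x => hI (klingenElt_mem (norm_lift_le _) (norm_lift_le _)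
      (norm_sub_le_one (norm_lift_le _) (norm_p_mul_lt_one (norm_lift_le _)).le))) ?_ ?_ v
  · rintro ⟨x, z, y, w⟩ ⟨x', z', y', w'⟩ h
    obtain ⟨rfl, rfl, rfl, rfl⟩ := klingenElt_conj_inj h
    rfl
  · intro k hk
    obtain ⟨x, z, y, w, h⟩ := exists_klingenElt_conj_mem h0 h3 hI hk
    exact ⟨(x, z, y, w), h⟩

end Reps

/-- The relations between the two finite simple reflections and the element of length zero in the
Iwahori–Hecke algebra of `GSp₄`, with central character `ω`. -/
structure IwahoriRelations {A : Type*} [Ring A] [Algebra ℂ A] (q ω : ℂ) (T₁ T₂ E : A) :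
    Prop where
  quad₁ : T₁ * T₁ = (q - 1) • T₁ + q • 1
  quad₂ : T₂ * T₂ = (q - 1) • T₂ + q • 1
  braid : T₁ * T₂ * T₁ * T₂ = T₂ * T₁ * T₂ * T₁
  comm₁ : E * T₁ = T₁ * E
  sq : E * E = ω • 1
  comm₀ : T₂ * (E * T₂ * E) = (E * T₂ * E) * T₂

/-! ### The relations of the Iwahori–Hecke algebra. -/

section Relations
variable {p : ℕ} [Fact p.Prime] {V : Type*} [AddCommGroup V] [Module ℂ V]
  (ρ : Representation ℂ (GSp4 ℚ_[p]) V)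

theorem Iw_le_hyperspecial {g : GSp4 ℚ_[p]} (hg : g ∈ Iw p) : g ∈ hyperspecial p :=
  parahoric_le_hyperspecial p _ hg

theorem s1_mem : s1 ∈ hyperspecial p := by
  rw [mem_hyperspecial_iff]
  refine ⟨fun i j => ?_, norm_det_ofMat (by simp)⟩
  fin_cases i <;> fin_cases j <;> simp [toMat_s1]

theorem s2_mem : s2 ∈ hyperspecial p := by
  rw [mem_hyperspecial_iff]
  refine ⟨fun i j => ?_, norm_det_ofMat (by simp)⟩
  fin_cases i <;> fin_cases j <;> simp [toMat_s2]

/-- The principal congruence subgroup is normalised by GSp₄(ℤ_p) and lies inside the Iwahori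
subgroup. -/
theorem conj_mem_Iw {h k : GSp4 ℚ_[p]} (hk : k ∈ hyperspecial p) (hh : ‖(toMat h).det‖ = 1)
    (h1 : ∀ i j, ‖toMat h i j - (1 : Matrix (Fin 4) (Fin 4) ℚ_[p]) i j‖ < 1) :
    k⁻¹ * h * k ∈ Iw p := by
  have e : toMat (k⁻¹ * h * k) = 1 + toMat k⁻¹ * (toMat h - 1) * toMat k := by
    rw [Matrix.mul_sub, Matrix.sub_mul, Matrix.mul_one, ← toMat_mul, ← toMat_mul, ← toMat_mul,
      inv_mul_cancel, toMat_one]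
    simp
  have hki := ((mem_hyperspecial_iff _).mp ((hyperspecial p).inv_mem hk)).1
  have hk' := ((mem_hyperspecial_iff _).mp hk).1
  have small : ∀ i j, ‖(toMat k⁻¹ * (toMat h - 1) * toMat k) i j‖ < 1 := by
    intro i j
    rw [Matrix.mul_apply]
    refine Finset.sum_induction _ (fun x => ‖x‖ < 1) (fun _ _ => norm_add_lt_one) (by simp) ?_
    intro l _
    refine norm_mul_lt_one' ?_ (hk' _ _)
    rw [Matrix.mul_apply]
    refine Finset.sum_induction _ (fun x => ‖x‖ < 1) (fun _ _ => norm_add_lt_one) (by simp) ?_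
    exact fun m _ => norm_mul_lt_one (hki _ _) (h1 m l)
  have one_le : ∀ i j, ‖(1 : Matrix (Fin 4) (Fin 4) ℚ_[p]) i j‖ ≤ 1 := by
    intro i j
    rw [Matrix.one_apply]; split_ifs <;> simp
  rw [mem_parahoric_iff, norm_det_conj, e]
  refine ⟨fun i j => norm_add_le_one (one_le i j) (small i j).le, hh, fun i j hij => ?_⟩
  have : i ≠ j := fun h => by subst h; exact lt_irrefl _ hij
  rw [Matrix.add_apply, Matrix.one_apply_ne this, zero_add]
  exact small i j

/-- The translate of an Iwahori fixed vector by `n(x) k`, for a one-parameter unipotent group `n`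
and `k` integral, only depends on the class of `x` modulo `p`. -/
theorem apply_congr_of_near {n : ℚ_[p] → GSp4 ℚ_[p]} (hadd : ∀ x y, n (x + y) = n x * n y)
    (hdet : ∀ x, (toMat (n x)).det = 1)
    (hsm : ∀ x, ‖x‖ < 1 → ∀ i j, ‖toMat (n x) i j - (1 : Matrix (Fin 4) (Fin 4) ℚ_[p]) i j‖ < 1)
    (g : GSp4 ℚ_[p]) {k : GSp4 ℚ_[p]} (hk : k ∈ hyperspecial p) (v : fixedVectors ρ (Iw p))
    (a b : ℚ_[p]) (hab : ‖a - b‖ < 1) : ρ (g * n a * k) v = ρ (g * n b * k) v := by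
  refine apply_eq_of_mem v.2 (conj_mem_Iw hk (by rw [hdet, norm_one]) (hsm (a - b) hab)) ?_
  conv_lhs => rw [← add_sub_cancel b a, hadd]
  group

theorem det_n1 (x : ℚ_[p]) : (toMat (n1 x)).det = 1 := by
  rw [Matrix.det_of_isUpperTriangular, Fin.prod_univ_four]
  · simp [toMat_n1]
  · intro i j hij; revert hij
    fin_cases i <;> fin_cases j <;> simp [toMat_n1]

theorem det_n2 (x : ℚ_[p]) : (toMat (n2 x)).det = 1 := by
  rw [Matrix.det_of_isUpperTriangular, Fin.prod_univ_four]
  · simp [toMat_n2]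
  · intro i j hij; revert hij
    fin_cases i <;> fin_cases j <;> simp [toMat_n2]

theorem det_n13 (x : ℚ_[p]) : (toMat (n13 x)).det = 1 := by
  rw [Matrix.det_of_isUpperTriangular, Fin.prod_univ_four]
  · simp [toMat_n13]
  · intro i j hij; revert hij
    fin_cases i <;> fin_cases j <;> simp [toMat_n13]

theorem det_n14 (x : ℚ_[p]) : (toMat (n14 x)).det = 1 := by
  rw [Matrix.det_of_isUpperTriangular, Fin.prod_univ_four]
  · simp [toMat_n14]
  · intro i j hij; revert hij
    fin_cases i <;> fin_cases j <;> simp [toMat_n14]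

theorem n1_congr (g : GSp4 ℚ_[p]) {k : GSp4 ℚ_[p]} (hk : k ∈ hyperspecial p)
    (v : fixedVectors ρ (Iw p)) (a b : ℚ_[p]) (hab : ‖a - b‖ < 1) :
    ρ (g * n1 a * k) v = ρ (g * n1 b * k) v :=
  apply_congr_of_near ρ n1_add det_n1 (fun x hx i j => by
    fin_cases i <;> fin_cases j <;> simp [toMat_n1, hx]) g hk v a b hab

theorem n2_congr (g : GSp4 ℚ_[p]) {k : GSp4 ℚ_[p]} (hk : k ∈ hyperspecial p)
    (v : fixedVectors ρ (Iw p)) (a b : ℚ_[p]) (hab : ‖a - b‖ < 1) :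
    ρ (g * n2 a * k) v = ρ (g * n2 b * k) v :=
  apply_congr_of_near ρ n2_add det_n2 (fun x hx i j => by
    fin_cases i <;> fin_cases j <;> simp [toMat_n2, hx]) g hk v a b hab

theorem n13_congr (g : GSp4 ℚ_[p]) {k : GSp4 ℚ_[p]} (hk : k ∈ hyperspecial p)
    (v : fixedVectors ρ (Iw p)) (a b : ℚ_[p]) (hab : ‖a - b‖ < 1) :
    ρ (g * n13 a * k) v = ρ (g * n13 b * k) v :=
  apply_congr_of_near ρ n13_add det_n13 (fun x hx i j => by
    fin_cases i <;> fin_cases j <;> simp [toMat_n13, hx]) g hk v a b hab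

theorem n14_congr (g : GSp4 ℚ_[p]) {k : GSp4 ℚ_[p]} (hk : k ∈ hyperspecial p)
    (v : fixedVectors ρ (Iw p)) (a b : ℚ_[p]) (hab : ‖a - b‖ < 1) :
    ρ (g * n14 a * k) v = ρ (g * n14 b * k) v :=
  apply_congr_of_near ρ n14_add det_n14 (fun x hx i j => by
    fin_cases i <;> fin_cases j <;> simp [toMat_n14, hx]) g hk v a b hab

theorem heckeOp_s1' (v : fixedVectors ρ (Iw p)) :
    (heckeOp ρ (Iw p) s1 v : V) = ∑ x : ZMod p, ρ (n1 (lift x) * s1) v := by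
  simp only [heckeOp_s1, map_mul, Module.End.mul_apply]

theorem heckeOp_s2' (v : fixedVectors ρ (Iw p)) :
    (heckeOp ρ (Iw p) s2 v : V) = ∑ x : ZMod p, ρ (n2 (lift x) * s2) v := by
  simp only [heckeOp_s2, map_mul, Module.End.mul_apply]

theorem heckeOp_s1_eq_smul {u : fixedVectors ρ (Iw p)} (hu : ρ s1 u = u) :
    heckeOp ρ (Iw p) s1 u = (p : ℂ) • u := by
  apply Subtype.ext
  rw [heckeOp_s1, hu]
  simp_rw [fun x : ZMod p => u.2 _ (n1_mem (norm_lift_le x))]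
  rw [Finset.sum_const, Finset.card_univ, ZMod.card, ← Nat.cast_smul_eq_nsmul ℂ]
  rfl

theorem heckeOp_s2_eq_smul {u : fixedVectors ρ (Iw p)} (hu : ρ s2 u = u) :
    heckeOp ρ (Iw p) s2 u = (p : ℂ) • u := by
  apply Subtype.ext
  rw [heckeOp_s2, hu]
  simp_rw [fun x : ZMod p => u.2 _ (n2_mem (norm_lift_le x))]
  rw [Finset.sum_const, Finset.card_univ, ZMod.card, ← Nat.cast_smul_eq_nsmul ℂ]
  rfl

theorem s1_mul_s1 {R : Type*} [CommRing R] : (s1 * s1 : GSp4 R) = 1 := by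
  apply toMat_injective
  rw [toMat_mul, toMat_s1, mul_four, toMat_one, one_four]; simp

theorem s2_mul_s2 {R : Type*} [CommRing R] :
    (s2 * s2 : GSp4 R) = tor 1 (-1) (-1) 1 (by simp) := by
  apply toMat_injective
  rw [toMat_mul, toMat_s2, mul_four, toMat_tor]; simp

/-- The Bruhat relation for the short simple root. -/
theorem m1_eq {x : ℚ_[p]} (hx : x ≠ 0) : m1 x = n1 x⁻¹ * s1 *
    (tor (Units.mk0 x hx) (-(Units.mk0 x hx)⁻¹) (-Units.mk0 x hx) (Units.mk0 x hx)⁻¹ (by simp)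
      * n1 x⁻¹) := by
  apply toMat_injective
  rw [toMat_mul, toMat_mul, toMat_mul, toMat_tor, toMat_n1, toMat_s1, mul_four, mul_four, mul_four,
    toMat_m1]
  apply lit_congr <;> simp [hx]

/-- The Bruhat relation for the long simple root. -/
theorem m2_eq {x : ℚ_[p]} (hx : x ≠ 0) : m2 x = n2 x⁻¹ * s2 *
    (tor 1 (Units.mk0 x hx) (Units.mk0 x hx)⁻¹ 1 (by simp) * n2 x⁻¹) := by
  apply toMat_injective
  rw [toMat_mul, toMat_mul, toMat_mul, toMat_tor, toMat_n2, toMat_s2, mul_four, mul_four, mul_four,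
    toMat_m2]
  apply lit_congr <;> simp [hx]

theorem s1_mul_n1_mul_s1 (x : ℚ_[p]) : s1 * (n1 x * s1) = m1 x := by
  apply toMat_injective
  rw [toMat_mul, toMat_mul, toMat_n1, toMat_s1, mul_four, mul_four, toMat_m1]
  apply lit_congr <;> simp

theorem s2_mul_n2_mul_s2 (x : ℚ_[p]) :
    s2 * (n2 x * s2) = m2 (-x) * tor 1 (-1) (-1) 1 (by simp) := by
  apply toMat_injective
  rw [toMat_mul, toMat_mul, toMat_mul, toMat_n2, toMat_s2, toMat_tor, mul_four, mul_four, toMat_m2,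
    mul_four]
  apply lit_congr <;> simp

theorem apply_m1 (v : fixedVectors ρ (Iw p)) {x : ℚ_[p]} (hx : ‖x‖ = 1) (g : GSp4 ℚ_[p]) :
    ρ (g * m1 x) v = ρ (g * (n1 x⁻¹ * s1)) v := by
  have hx0 := ne_zero_of_norm_eq_one hx
  refine apply_eq_of_mem v.2 ?_ (by rw [m1_eq hx0, mul_assoc g])
  exact (Iw p).mul_mem (tor_mem _ (by simp [hx]) (by simp [hx]) (by simp [hx]) (by simp [hx]))
    (n1_mem (by simp [hx]))

theorem apply_m2 (v : fixedVectors ρ (Iw p)) {x : ℚ_[p]} (hx : ‖x‖ = 1) (g : GSp4 ℚ_[p]) :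
    ρ (g * m2 x) v = ρ (g * (n2 x⁻¹ * s2)) v := by
  have hx0 := ne_zero_of_norm_eq_one hx
  refine apply_eq_of_mem v.2 ?_ (by rw [m2_eq hx0, mul_assoc g])
  exact (Iw p).mul_mem (tor_mem _ (by simp) (by simp [hx]) (by simp [hx]) (by simp))
    (n2_mem (by simp [hx]))

theorem sum_eq_add_ne_zero {X : Type*} [AddCommMonoid X] (F : ZMod p → X) :
    ∑ x, F x = F 0 + ∑ x ∈ Finset.univ.erase 0, F x :=
  (Finset.add_sum_erase _ _ (Finset.mem_univ 0)).symm

/-- T₁v + v is the sum of the translates of v over all p + 1 points of a projective line over 𝔽_p,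
which the reflection permutes: it exchanges 0 and ∞, and on the other points it acts by inversion
through the Bruhat relation. -/
theorem apply_s1_heckeOp (v : fixedVectors ρ (Iw p)) :
    ρ s1 (heckeOp ρ (Iw p) s1 v + v : fixedVectors ρ (Iw p)) =
      (heckeOp ρ (Iw p) s1 v + v : fixedVectors ρ (Iw p)) := by
  have hinv := sum_inv_lift (p := p) (fun x => ρ (n1 x * s1) v)
    (fun a b _ _ hab => by simpa using n1_congr ρ 1 s1_mem v a b hab)
  rw [sum_eq_add_ne_zero] at hinv
  have h : ρ s1 (∑ x : ZMod p, ρ (n1 (lift x) * s1) v) =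
      v + ∑ x ∈ Finset.univ.erase (0 : ZMod p), ρ (n1 (lift x)⁻¹ * s1) v := by
    rw [map_sum, sum_eq_add_ne_zero]
    congr 1
    · rw [lift_zero, n1_zero, one_mul, ← Module.End.mul_apply, ← map_mul, s1_mul_s1, map_one,
        Module.End.one_apply]
    · refine Finset.sum_congr rfl fun x hx => ?_
      have hx' := norm_lift_of_ne_zero (Finset.ne_of_mem_erase hx)
      rw [← Module.End.mul_apply, ← map_mul, s1_mul_n1_mul_s1]
      simpa using apply_m1 ρ v hx' 1
  rw [Submodule.coe_add, map_add, heckeOp_s1', h, ← hinv, lift_zero, GroupWithZero.inv_zero,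
    n1_zero, one_mul]
  abel

theorem apply_s2_heckeOp (v : fixedVectors ρ (Iw p)) :
    ρ s2 (heckeOp ρ (Iw p) s2 v + v : fixedVectors ρ (Iw p)) =
      (heckeOp ρ (Iw p) s2 v + v : fixedVectors ρ (Iw p)) := by
  have hcongr : ∀ a b : ℚ_[p], ‖a‖ ≤ 1 → ‖b‖ ≤ 1 → ‖a - b‖ < 1 →
      ρ (n2 a * s2) v = ρ (n2 b * s2) v := fun a b _ _ hab => by
    simpa using n2_congr ρ 1 s2_mem v a b hab
  have hinv := sum_inv_lift (p := p) (fun x => ρ (n2 (-x) * s2) v)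
    (fun a b ha hb hab => hcongr _ _ (by rwa [norm_neg]) (by rwa [norm_neg])
      (by rwa [neg_sub_neg, norm_sub_rev]))
  rw [sum_neg_lift (fun x => ρ (n2 x * s2) v) hcongr, sum_eq_add_ne_zero] at hinv
  have ht : (tor 1 (-1) (-1) 1 (by simp) : GSp4 ℚ_[p]) ∈ Iw p :=
    tor_mem _ (by simp) (by simp) (by simp) (by simp)
  have h : ρ s2 (∑ x : ZMod p, ρ (n2 (lift x) * s2) v) =
      v + ∑ x ∈ Finset.univ.erase (0 : ZMod p), ρ (n2 (-(lift x)⁻¹) * s2) v := by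
    rw [map_sum, sum_eq_add_ne_zero]
    congr 1
    · rw [lift_zero, n2_zero, one_mul, ← Module.End.mul_apply, ← map_mul, s2_mul_s2, v.2 _ ht]
    · refine Finset.sum_congr rfl fun x hx => ?_
      have hx' := norm_lift_of_ne_zero (Finset.ne_of_mem_erase hx)
      rw [← Module.End.mul_apply, ← map_mul, s2_mul_n2_mul_s2, apply_eq_of_mem v.2 ht rfl]
      simpa [inv_neg] using apply_m2 ρ v (x := -lift x) (by rwa [norm_neg]) 1
  rw [Submodule.coe_add, map_add, heckeOp_s2', h, ← hinv, lift_zero, GroupWithZero.inv_zero,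
    neg_zero, n2_zero, one_mul]
  abel

/-- Since T₁v + v is fixed by `s1` and by Iwahori, T₁ multiplies it by p, that is T₁(T₁ + 1) = p(T₁
+ 1). -/
theorem heckeOp_s1_quad : heckeOp ρ (Iw p) s1 * heckeOp ρ (Iw p) s1 =
    ((p : ℂ) - 1) • heckeOp ρ (Iw p) s1 + (p : ℂ) • 1 := by
  ext1 v
  have h := heckeOp_s1_eq_smul ρ (apply_s1_heckeOp ρ v)
  rw [map_add, smul_add] at h
  simp only [Module.End.mul_apply, LinearMap.add_apply, LinearMap.smul_apply, Module.End.one_apply]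
  rw [eq_sub_of_add_eq h]
  module

theorem heckeOp_s2_quad : heckeOp ρ (Iw p) s2 * heckeOp ρ (Iw p) s2 =
    ((p : ℂ) - 1) • heckeOp ρ (Iw p) s2 + (p : ℂ) • 1 := by
  ext1 v
  have h := heckeOp_s2_eq_smul ρ (apply_s2_heckeOp ρ v)
  rw [map_add, smul_add] at h
  simp only [Module.End.mul_apply, LinearMap.add_apply, LinearMap.smul_apply, Module.End.one_apply]
  rw [eq_sub_of_add_eq h]
  module

theorem heckeOp_eta_comm_s1 : heckeOp ρ (Iw p) (etaElt p) * heckeOp ρ (Iw p) s1 =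
    heckeOp ρ (Iw p) s1 * heckeOp ρ (Iw p) (etaElt p) := by
  ext v
  have e : ∀ x : ℚ_[p], etaElt p * (n1 x * s1) = n1 (-x) * s1 * etaElt p := by
    intro x
    apply toMat_injective
    rw [toMat_mul, toMat_mul, toMat_mul, toMat_mul, toMat_n1, toMat_n1, toMat_s1, toMat_etaElt,
      mul_four, mul_four, mul_four, mul_four]
    apply lit_congr <;> simp [mul_comm]
  rw [Module.End.mul_apply, Module.End.mul_apply, heckeOp_eta, heckeOp_s1', heckeOp_s1', map_sum,
    ← sum_neg_lift (fun x => ρ (n1 x * s1) (heckeOp ρ (Iw p) (etaElt p) v))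
      (fun a b _ _ hab => by simpa using n1_congr ρ 1 s1_mem _ a b hab)]
  refine Finset.sum_congr rfl fun x _ => ?_
  rw [heckeOp_eta, ← Module.End.mul_apply, ← Module.End.mul_apply, ← map_mul, ← map_mul, e]

theorem etaElt_sq : etaElt p * etaElt p = centralP p := by
  apply toMat_injective
  rw [toMat_mul, toMat_etaElt, toMat_centralP, mul_four]
  apply lit_congr <;> simp

theorem heckeOp_eta_sq {ω : ℂ} (hω : ∀ v, ρ (centralP p) v = ω • v) :
    heckeOp ρ (Iw p) (etaElt p) * heckeOp ρ (Iw p) (etaElt p) = ω • 1 := by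
  ext v
  rw [Module.End.mul_apply, heckeOp_eta, heckeOp_eta, ← Module.End.mul_apply, ← map_mul, etaElt_sq,
    hω]
  rfl

/-- The first factor acts only on the middle coordinate plane, while the second acts as the scalar p
there and nontrivially only on the outer plane. -/
theorem eta_s2_eta_comm (x y : ℚ_[p]) : n2 x * s2 * (etaElt p * (n2 y * s2) * etaElt p) =
    etaElt p * (n2 y * s2) * etaElt p * (n2 x * s2) := by
  have e : ∀ z : ℚ_[p], toMat (n2 z * s2) = !![1, 0, 0, 0; 0, z, -1, 0; 0, 1, 0, 0; 0, 0, 0, 1] := by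
    intro z
    rw [toMat_mul, toMat_n2, toMat_s2, mul_four]
    apply lit_congr <;> simp
  have e' : toMat (etaElt p * (n2 y * s2) * etaElt p) =
      !![0, 0, 0, 1; 0, (p : ℚ_[p]), 0, 0; 0, 0, (p : ℚ_[p]), 0; -(p : ℚ_[p]) ^ 2, 0, 0, p * y] := by
    rw [toMat_mul, toMat_mul, e, toMat_etaElt, mul_four, mul_four]
    apply lit_congr <;> simp <;> ring
  apply toMat_injective
  rw [toMat_mul (n2 x * s2), toMat_mul _ (n2 x * s2), e, e', mul_four, mul_four]
  apply lit_congr <;> simp [mul_comm]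

theorem heckeOp_comm₀ : heckeOp ρ (Iw p) s2 *
    (heckeOp ρ (Iw p) (etaElt p) * heckeOp ρ (Iw p) s2 * heckeOp ρ (Iw p) (etaElt p)) =
    heckeOp ρ (Iw p) (etaElt p) * heckeOp ρ (Iw p) s2 * heckeOp ρ (Iw p) (etaElt p) *
      heckeOp ρ (Iw p) s2 := by
  ext v
  simp only [Module.End.mul_apply, heckeOp_eta, heckeOp_s2', map_sum]
  rw [Finset.sum_comm]
  refine Finset.sum_congr rfl fun y _ => Finset.sum_congr rfl fun x _ => ?_
  simp only [← Module.End.mul_apply, ← map_mul]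
  have := eta_s2_eta_comm (lift x : ℚ_[p]) (lift y)
  simp only [mul_assoc] at this ⊢
  rw [this]

end Relations

section Relations
variable {p : ℕ} [Fact p.Prime] {V : Type*} [AddCommGroup V] [Module ℂ V]
  (ρ : Representation ℂ (GSp4 ℚ_[p]) V)

/-- Both sides of the braid relation are brought to the Bruhat form n · w₀; `braid_right` gives the
same form with parameters changed by a triangular polynomial substitution. -/
theorem braid_left (x y z w : ℚ_[p]) :
    n1 x * s1 * (n2 y * s2 * (n1 z * s1 * (n2 w * s2))) =
      n1 x * n14 y * n13 z * n2 w * (s1 * s2 * s1 * s2) := by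
  have e : ∀ x y : ℚ_[p], toMat (n1 x * s1 * (n2 y * s2)) =
      !![x, y, -1, 0; 1, 0, 0, 0; 0, -x, 0, 1; 0, 1, 0, 0] := by
    intro x y
    rw [toMat_mul, toMat_mul, toMat_mul, toMat_n1, toMat_n2, toMat_s1, toMat_s2, mul_four, mul_four,
      mul_four]
    apply lit_congr <;> simp
  have e0 : toMat (s1 * s2 * s1 * s2 : GSp4 ℚ_[p]) =
      !![0, 0, 0, -1; 0, 0, -1, 0; 0, 1, 0, 0; 1, 0, 0, 0] := by
    rw [toMat_mul, toMat_mul, toMat_mul, toMat_s1, toMat_s2, mul_four, mul_four, mul_four]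
    apply lit_congr <;> simp
  apply toMat_injective
  rw [← mul_assoc, toMat_mul, e, e, toMat_mul, e0, toMat_mul, toMat_mul, toMat_mul, toMat_n1,
    toMat_n14, toMat_n13, toMat_n2, mul_four, mul_four, mul_four, mul_four, mul_four]
  apply lit_congr <;> ring

theorem braid_right (x y z w : ℚ_[p]) :
    n2 x * s2 * (n1 y * s1 * (n2 z * s2 * (n1 w * s1))) =
      n1 (-w) * n14 (z + (2 * w * y + w ^ 2 * x)) * n13 (y + w * x) * n2 x
        * (s1 * s2 * s1 * s2) := by
  have e : ∀ x y : ℚ_[p], toMat (n2 x * s2 * (n1 y * s1)) =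
      !![y, 1, 0, 0; x, 0, y, -1; 1, 0, 0, 0; 0, 0, 1, 0] := by
    intro x y
    rw [toMat_mul, toMat_mul, toMat_mul, toMat_n1, toMat_n2, toMat_s1, toMat_s2, mul_four, mul_four,
      mul_four]
    apply lit_congr <;> simp
  have e0 : toMat (s1 * s2 * s1 * s2 : GSp4 ℚ_[p]) =
      !![0, 0, 0, -1; 0, 0, -1, 0; 0, 1, 0, 0; 1, 0, 0, 0] := by
    rw [toMat_mul, toMat_mul, toMat_mul, toMat_s1, toMat_s2, mul_four, mul_four, mul_four]
    apply lit_congr <;> simp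
  apply toMat_injective
  rw [← mul_assoc, toMat_mul, e, e, toMat_mul, e0, toMat_mul, toMat_mul, toMat_mul, toMat_n1,
    toMat_n14, toMat_n13, toMat_n2, mul_four, mul_four, mul_four, mul_four, mul_four]
  apply lit_congr <;> ring

/-- After the normal forms, both sides are sums of F over four residue classes, and the substitution
relating them consists of shifts and a sign, which permute residue classes one variable at a time.
-/
theorem heckeOp_braid : heckeOp ρ (Iw p) s1 * heckeOp ρ (Iw p) s2 * heckeOp ρ (Iw p) s1 *
    heckeOp ρ (Iw p) s2 = heckeOp ρ (Iw p) s2 * heckeOp ρ (Iw p) s1 * heckeOp ρ (Iw p) s2 *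
    heckeOp ρ (Iw p) s1 := by
  ext v
  simp only [Module.End.mul_apply, heckeOp_s1', heckeOp_s2', map_sum]
  simp only [← Module.End.mul_apply, ← map_mul]
  set F : ℚ_[p] → ℚ_[p] → ℚ_[p] → ℚ_[p] → V := fun a Z Y X =>
    ρ (n1 a * n14 Z * n13 Y * n2 X * (s1 * s2 * s1 * s2)) v with hF
  have hl : ∀ x y z w : ℚ_[p],
      ρ (n1 x * s1 * (n2 y * s2 * (n1 z * s1 * (n2 w * s2)))) v = F x y z w := fun x y z w =>
    congrArg (fun g => ρ g v.1) (braid_left x y z w)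
  have hr : ∀ x y z w : ℚ_[p],
      ρ (n2 x * s2 * (n1 y * s1 * (n2 z * s2 * (n1 w * s1)))) v =
        F (-w) (z + (2 * w * y + w ^ 2 * x)) (y + w * x) x := fun x y z w =>
    congrArg (fun g => ρ g v.1) (braid_right x y z w)
  have hw0 : s1 * s2 * s1 * s2 ∈ hyperspecial p :=
    (hyperspecial p).mul_mem ((hyperspecial p).mul_mem ((hyperspecial p).mul_mem s1_mem s2_mem)
      s1_mem) s2_mem
  simp only [mul_assoc] at hl hr ⊢
  simp only [hl, hr]
  have hN : ∀ {x : ZMod p}, n2 (lift x) ∈ hyperspecial p := fun {x} =>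
    Iw_le_hyperspecial (n2_mem (norm_lift_le x))
  have hN' : ∀ {x : ZMod p}, n13 (lift x) ∈ hyperspecial p := fun {x} =>
    Iw_le_hyperspecial (n13_mem (norm_lift_le x))
  have hN'' : ∀ {x : ZMod p}, n14 (lift x) ∈ hyperspecial p := fun {x} =>
    Iw_le_hyperspecial (n14_mem (norm_lift_le x))
  -- The shift of Z depends only on the remaining variables, so it is removed by summing over z
  -- first; then the shift of Y is removed in the same way.
  have hX : ∀ x w : ZMod p, ∑ y : ZMod p, ∑ z : ZMod p,
      F (-lift w) (lift z + (2 * lift w * lift y + lift w ^ 2 * lift x))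
        (lift y + lift w * lift x) (lift x) =
      ∑ z : ZMod p, ∑ y : ZMod p, F (-lift w) (lift z) (lift y) (lift x) := by
    intro x w
    have hc : ∀ y : ZMod p, ‖2 * lift w * lift y + lift w ^ 2 * lift x‖ ≤ 1 := fun y =>
      norm_add_le_one (norm_mul_le_one (norm_mul_le_one (Padic.norm_int_le_one 2)
        (norm_lift_le w)) (norm_lift_le y))
        (norm_mul_le_one (by rw [sq]; exact norm_mul_le_one (norm_lift_le w) (norm_lift_le w))
          (norm_lift_le x))
    have h1 : ∀ y : ZMod p, ∑ z : ZMod p,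
        F (-lift w) (lift z + (2 * lift w * lift y + lift w ^ 2 * lift x))
          (lift y + lift w * lift x) (lift x) =
        ∑ z : ZMod p, F (-lift w) (lift z) (lift y + lift w * lift x) (lift x) := fun y =>
      sum_add_const (fun Z => F (-lift w) Z (lift y + lift w * lift x) (lift x))
        (fun a b _ _ hab => by
          have := n14_congr ρ (n1 (-lift w)) (k := n13 (lift y + lift w * lift x) *
            (n2 (lift x) * (s1 * s2 * s1 * s2)))
            ((hyperspecial p).mul_mem (Iw_le_hyperspecial (n13_mem (norm_add_le_one
              (norm_lift_le y) (norm_mul_le_one (norm_lift_le w) (norm_lift_le x)))))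
              ((hyperspecial p).mul_mem hN hw0)) v a b hab
          simpa only [hF, mul_assoc] using this) (hc y)
    rw [Finset.sum_congr rfl fun y _ => h1 y, Finset.sum_comm]
    refine Finset.sum_congr rfl fun z _ => ?_
    exact sum_add_const (fun Y => F (-lift w) (lift z) Y (lift x))
        (fun a b _ _ hab => by
          have := n13_congr ρ (n1 (-lift w) * n14 (lift z)) (k :=
            (n2 (lift x) * (s1 * s2 * s1 * s2)))
            ((hyperspecial p).mul_mem hN hw0) v a b hab
          simpa only [hF, mul_assoc] using this)
        (norm_mul_le_one (norm_lift_le w) (norm_lift_le x))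
  have hA : ∀ x : ZMod p, ∑ w : ZMod p, ∑ z : ZMod p, ∑ y : ZMod p,
      F (-lift w) (lift z) (lift y) (lift x) =
      ∑ w : ZMod p, ∑ z : ZMod p, ∑ y : ZMod p, F (lift w) (lift z) (lift y) (lift x) := fun x =>
    sum_neg_lift (fun A => ∑ z : ZMod p, ∑ y : ZMod p, F A (lift z) (lift y) (lift x))
      (fun a b _ _ hab => Finset.sum_congr rfl fun z _ => Finset.sum_congr rfl fun y _ => by
        have := n1_congr ρ 1 (k := n14 (lift z) * (n13 (lift y) *
            (n2 (lift x) * (s1 * s2 * s1 * s2))))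
            ((hyperspecial p).mul_mem hN'' ((hyperspecial p).mul_mem hN'
              ((hyperspecial p).mul_mem hN hw0))) v a b hab
        simpa only [hF, mul_assoc, one_mul] using this)
  symm
  calc _ = ∑ x : ZMod p, ∑ w : ZMod p, ∑ y : ZMod p, ∑ z : ZMod p,
      F (-lift w) (lift z + (2 * lift w * lift y + lift w ^ 2 * lift x))
        (lift y + lift w * lift x) (lift x) := by
        refine Finset.sum_congr rfl fun x _ => ?_
        rw [Finset.sum_congr rfl fun y _ => Finset.sum_comm, Finset.sum_comm]
        simp only [mul_assoc]
    _ = ∑ x : ZMod p, ∑ w : ZMod p, ∑ z : ZMod p, ∑ y : ZMod p,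
          F (lift w) (lift z) (lift y) (lift x) :=
      Finset.sum_congr rfl fun x _ => by
        rw [Finset.sum_congr rfl fun w _ => hX x w, hA]
    _ = _ := by
      rw [Finset.sum_comm]
      refine Finset.sum_congr rfl fun w _ => ?_
      rw [Finset.sum_comm]
      refine Finset.sum_congr rfl fun z _ => ?_
      rw [Finset.sum_comm]

/-- The product of the coset representatives along the word T₂T₁T₂E is a representative for `d1`, up
to a sign matrix in the Iwahori subgroup. With `klingen_factor` this expresses the operators of `d1`
and `d2` as words in T₁, T₂, E. -/
theorem siegel_factor (x y z : ℚ_[p]) :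
    n2 x * s2 * (n1 y * s1 * (n2 z * s2 * etaElt p)) =
      siegelElt x y z * d1 p * tor (-1) (-1) 1 1 (by simp) := by
  have e0 : toMat (n2 z * s2 * etaElt p) =
      !![0, 0, 1, 0; -(p : ℚ_[p]), 0, 0, z; 0, 0, 0, 1; 0, p, 0, 0] := by
    rw [toMat_mul, toMat_mul, toMat_n2, toMat_s2, toMat_etaElt, mul_four, mul_four]
    apply lit_congr <;> simp
  have e : toMat (n2 x * s2 * (n1 y * s1)) =
      !![y, 1, 0, 0; x, 0, y, -1; 1, 0, 0, 0; 0, 0, 1, 0] := by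
    rw [toMat_mul, toMat_mul, toMat_mul, toMat_n1, toMat_n2, toMat_s1, toMat_s2, mul_four, mul_four,
      mul_four]
    apply lit_congr <;> simp
  apply toMat_injective
  rw [← mul_assoc, toMat_mul, e, e0, toMat_mul, toMat_mul, toMat_siegelElt, toMat_d1, toMat_tor,
    mul_four, mul_four, mul_four]
  apply lit_congr <;> simp

theorem klingen_factor (x y z w : ℚ_[p]) :
    n1 x * s1 * (n2 y * s2 * (n1 z * s1 * (etaElt p * (n2 w * s2 * etaElt p)))) =
      klingenElt x z (y - p * w) * d2 p := by
  have e0 : toMat (n2 w * s2 * etaElt p) =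
      !![0, 0, 1, 0; -(p : ℚ_[p]), 0, 0, w; 0, 0, 0, 1; 0, p, 0, 0] := by
    rw [toMat_mul, toMat_mul, toMat_n2, toMat_s2, toMat_etaElt, mul_four, mul_four]
    apply lit_congr <;> simp
  have e : toMat (n1 x * s1 * (n2 y * s2)) =
      !![x, y, -1, 0; 1, 0, 0, 0; 0, -x, 0, 1; 0, 1, 0, 0] := by
    rw [toMat_mul, toMat_mul, toMat_mul, toMat_n1, toMat_n2, toMat_s1, toMat_s2, mul_four, mul_four,
      mul_four]
    apply lit_congr <;> simp
  have e2 : toMat (n1 z * s1) = !![z, 1, 0, 0; 1, 0, 0, 0; 0, 0, -z, 1; 0, 0, 1, 0] := by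
    rw [toMat_mul, toMat_n1, toMat_s1, mul_four]
    apply lit_congr <;> simp
  apply toMat_injective
  rw [← mul_assoc, toMat_mul, toMat_mul (n1 z * s1), toMat_mul (etaElt p), e, e0, e2, toMat_etaElt,
    toMat_mul, toMat_klingenElt, toMat_d2, mul_four, mul_four, mul_four, mul_four]
  apply lit_congr <;> simp <;> ring

end Relations

/-! ### U₁ and U₂ as words in the generators, and compatibility between levels. -/

section HeckeStructure
variable {p : ℕ} [Fact p.Prime] {V : Type*} [AddCommGroup V] [Module ℂ V]
  (ρ : Representation ℂ (GSp4 ℚ_[p]) V)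

theorem heckeOp_iwahori_d1 : heckeOp ρ (Iw p) (d1 p) = heckeOp ρ (Iw p) s2 * heckeOp ρ (Iw p) s1 *
    heckeOp ρ (Iw p) s2 * heckeOp ρ (Iw p) (etaElt p) := by
  ext v
  rw [heckeOp_d1 ρ (by decide) le_rfl]
  simp only [Module.End.mul_apply, heckeOp_s1', heckeOp_s2', heckeOp_eta, map_sum]
  simp only [← Module.End.mul_apply, ← map_mul]
  rw [Fintype.sum_prod_type]
  refine Finset.sum_congr rfl fun x _ => ?_
  rw [Fintype.sum_prod_type]
  refine Finset.sum_congr rfl fun y _ => Finset.sum_congr rfl fun z _ => ?_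
  rw [siegel_factor, apply_eq_of_mem v.2 (tor_mem _ (by simp) (by simp) (by simp) (by simp)) rfl]

theorem heckeOp_iwahori_d2 : heckeOp ρ (Iw p) (d2 p) = heckeOp ρ (Iw p) s1 * heckeOp ρ (Iw p) s2 *
    heckeOp ρ (Iw p) s1 * heckeOp ρ (Iw p) (etaElt p) * heckeOp ρ (Iw p) s2 *
      heckeOp ρ (Iw p) (etaElt p) := by
  ext v
  rw [heckeOp_d2 ρ (by decide) (by decide) le_rfl]
  simp only [Module.End.mul_apply, heckeOp_s1', heckeOp_s2', heckeOp_eta, map_sum]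
  simp only [← Module.End.mul_apply, ← map_mul]
  rw [Fintype.sum_prod_type]
  refine Finset.sum_congr rfl fun x _ => ?_
  rw [Fintype.sum_prod_type, Finset.sum_congr rfl fun z _ => Fintype.sum_prod_type _,
    Finset.sum_comm]
  refine Finset.sum_congr rfl fun y _ => Finset.sum_congr rfl fun z _ =>
    Finset.sum_congr rfl fun w _ => ?_
  have := klingen_factor (lift x : ℚ_[p]) (lift y) (lift z) (lift w)
  simp only [mul_assoc] at this ⊢
  rw [this]

theorem iwahoriRelations {ω : ℂ} (hω : ∀ v, ρ (centralP p) v = ω • v) :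
    IwahoriRelations (p : ℂ) ω (heckeOp ρ (Iw p) s1) (heckeOp ρ (Iw p) s2)
      (heckeOp ρ (Iw p) (etaElt p)) where
  quad₁ := heckeOp_s1_quad ρ
  quad₂ := heckeOp_s2_quad ρ
  braid := heckeOp_braid ρ
  comm₁ := heckeOp_eta_comm_s1 ρ
  sq := heckeOp_eta_sq ρ hω
  comm₀ := heckeOp_comm₀ ρ

theorem coe_fixedInclusion {G V : Type*} [Group G] [AddCommGroup V] [Module ℂ V] (ρ : Representation ℂ G V) {K' K : Subgroup G}
    (h : K' ≤ K) (v : fixedVectors ρ K) : (fixedInclusion ρ h v : V) = v := rfl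

theorem coe_U1 (K : Subgroup (GSp4 ℚ_[p])) (r₁ r₂ : ℕ) (v : fixedVectors ρ K) :
    (U1 ρ K r₁ r₂ v : V) = halfPow p (r₁ + r₂) • (heckeOp ρ K (d1 p) v : V) := rfl

theorem coe_U2 (K : Subgroup (GSp4 ℚ_[p])) (r₁ : ℕ) (v : fixedVectors ρ K) :
    (U2 ρ K r₁ v : V) = (p : ℂ) ^ r₁ • (heckeOp ρ K (d2 p) v : V) := rfl

/-- The same unipotent representatives serve at Siegel and at Iwahori level, so the operator at
Siegel level is a restriction. The analogous statement for U₂ concerns the Klingen level. -/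
theorem fixedInclusion_U1 (r₁ r₂ : ℕ) (v : fixedVectors ρ (Sieg p)) :
    fixedInclusion ρ (Iw_le_Sieg p) (U1 ρ (Sieg p) r₁ r₂ v) =
      U1 ρ (Iw p) r₁ r₂ (fixedInclusion ρ (Iw_le_Sieg p) v) := by
  apply Subtype.ext
  rw [coe_fixedInclusion, coe_U1, coe_U1, heckeOp_d1 ρ (by decide) (Iw_le_Sieg p),
    heckeOp_d1 ρ (by decide) le_rfl, coe_fixedInclusion]

theorem fixedInclusion_U2 (r₁ : ℕ) (v : fixedVectors ρ (Kl p)) :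
    fixedInclusion ρ (Iw_le_Kl p) (U2 ρ (Kl p) r₁ v) =
      U2 ρ (Iw p) r₁ (fixedInclusion ρ (Iw_le_Kl p) v) := by
  apply Subtype.ext
  rw [coe_fixedInclusion, coe_U2, coe_U2, heckeOp_d2 ρ (by decide) (by decide) (Iw_le_Kl p),
    heckeOp_d2 ρ (by decide) (by decide) le_rfl, coe_fixedInclusion]

theorem s1_mem_Sieg : s1 ∈ Sieg p := by
  rw [mem_parahoric_iff]
  refine ⟨fun i j => ?_, norm_det_ofMat (by simp), fun i j => ?_⟩ <;>
  fin_cases i <;> fin_cases j <;> simp [toMat_s1, siegelBlocks]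

theorem s2_mem_Kl : s2 ∈ Kl p := by
  rw [mem_parahoric_iff]
  refine ⟨fun i j => ?_, norm_det_ofMat (by simp), fun i j => ?_⟩ <;>
  fin_cases i <;> fin_cases j <;> simp [toMat_s2, klingenBlocks]

theorem heckeOp_s1_of_Sieg (v : fixedVectors ρ (Sieg p)) :
    heckeOp ρ (Iw p) s1 (fixedInclusion ρ (Iw_le_Sieg p) v) =
      (p : ℂ) • fixedInclusion ρ (Iw_le_Sieg p) v :=
  heckeOp_s1_eq_smul ρ (by rw [coe_fixedInclusion]; exact v.2 _ s1_mem_Sieg)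

theorem heckeOp_s2_of_Kl (v : fixedVectors ρ (Kl p)) :
    heckeOp ρ (Iw p) s2 (fixedInclusion ρ (Iw_le_Kl p) v) =
      (p : ℂ) • fixedInclusion ρ (Iw_le_Kl p) v :=
  heckeOp_s2_eq_smul ρ (by rw [coe_fixedInclusion]; exact v.2 _ s2_mem_Kl)

end HeckeStructure

/-! ### Alternating functionals and the action of the torus algebra on a spherical vector. -/

section TorusAlgebra

variable {R M : Type*} [CommRing R] [Algebra ℂ R] [AddCommGroup M] [Module ℂ M] [Module R M]
  [IsScalarTower ℂ R M]

/-- The elements of `R` whose action commutes with the operator `T`. -/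
def commutantIn (R : Type*) {M : Type*} [CommRing R] [Algebra ℂ R] [AddCommGroup M] [Module ℂ M]
    [Module R M] [IsScalarTower ℂ R M] (T : Module.End ℂ M) : Subalgebra ℂ R where
  carrier := {x | ∀ v, T (x • v) = x • T v}
  mul_mem' {x y} hx hy v := by rw [mul_smul, hx, hy, mul_smul]
  add_mem' {x y} hx hy v := by rw [add_smul, map_add, hx, hy, add_smul]
  algebraMap_mem' c v := by simp

theorem inv_mem_commutantIn {T : Module.End ℂ M} {x : Rˣ} (hx : (x : R) ∈ commutantIn R T) :
    ((x⁻¹ : Rˣ) : R) ∈ commutantIn R T := by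
  intro v
  have h := hx ((x⁻¹ : Rˣ) • v)
  rw [← Units.smul_def, ← Units.smul_def, smul_inv_smul] at h
  rw [← Units.smul_def, ← Units.smul_def, h, inv_smul_smul]

theorem zpow_mem_commutantIn {T : Module.End ℂ M} {x : Rˣ} (hx : (x : R) ∈ commutantIn R T)
    (n : ℤ) : ((x ^ n : Rˣ) : R) ∈ commutantIn R T := by
  obtain ⟨k, rfl | rfl⟩ := n.eq_nat_or_neg
  · rw [zpow_natCast, Units.val_pow_eq_pow_val]
    exact pow_mem hx k
  · rw [_root_.zpow_neg, zpow_natCast]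
    refine inv_mem_commutantIn ?_
    rw [Units.val_pow_eq_pow_val]
    exact pow_mem hx k

theorem pow_add_pow_mem {S : Subalgebra ℂ R} {a b : R} (hs : a + b ∈ S) (hp : a * b ∈ S) (n : ℕ) :
    a ^ n + b ^ n ∈ S := by
  induction n using Nat.twoStepInduction with
  | zero => simpa using S.add_mem S.one_mem S.one_mem
  | one => simpa using hs
  | more n h1 h2 =>
    have : a ^ (n + 2) + b ^ (n + 2) =
        (a + b) * (a ^ (n + 1) + b ^ (n + 1)) - a * b * (a ^ n + b ^ n) := by ring
    rw [this]
    exact S.sub_mem (S.mul_mem hs h2) (S.mul_mem hp h1)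

theorem zpow_add_zpow_mem {T : Module.End ℂ M} {a b : Rˣ} (hs : (a + b : R) ∈ commutantIn R T)
    (hp : ((a * b : Rˣ) : R) ∈ commutantIn R T) (n : ℤ) :
    ((a ^ n : Rˣ) + (b ^ n : Rˣ) : R) ∈ commutantIn R T := by
  have key : ∀ k : ℕ, ((a ^ k : Rˣ) + (b ^ k : Rˣ) : R) ∈ commutantIn R T := fun k => by
    rw [Units.val_pow_eq_pow_val, Units.val_pow_eq_pow_val]
    exact pow_add_pow_mem hs (by simpa using hp) k
  obtain ⟨k, rfl | rfl⟩ := n.eq_nat_or_neg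
  · simpa using key k
  -- Negative exponents reduce to positive ones through a⁻ᵏ + b⁻ᵏ = (ab)⁻ᵏ(aᵏ + bᵏ).
  · have : ((a ^ (-(k : ℤ)) : Rˣ) + (b ^ (-(k : ℤ)) : Rˣ) : R) =
        (((a * b) ^ (-(k : ℤ)) : Rˣ) : R) * ((a ^ k : Rˣ) + (b ^ k : Rˣ)) := by
      rw [_root_.mul_add, ← Units.val_mul, ← Units.val_mul, add_comm]
      congr 2
      · rw [mul_zpow, mul_right_comm, ← zpow_natCast, ← _root_.zpow_add, neg_add_cancel,
          _root_.zpow_zero, one_mul]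
      · rw [mul_zpow, mul_assoc, ← zpow_natCast, ← _root_.zpow_add, neg_add_cancel,
          _root_.zpow_zero, mul_one]
    rw [this]
    exact (commutantIn R T).mul_mem (zpow_mem_commutantIn hp _) (key k)

/-- The Bernstein-type commutation relations between two operators `T₁, T₂` and the action of two
units `a, b`, in the form needed for invariants. -/
structure TorusRelations (ν : ℂ) (a b : Rˣ) (T₁ T₂ : Module.End ℂ M) : Prop where
  ne_zero : ν ≠ 0
  comm₁ : (a : R) ∈ commutantIn R T₁
  sum₁ : (b + ν • (b⁻¹ : Rˣ) : R) ∈ commutantIn R T₁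
  sum₂ : (a + b : R) ∈ commutantIn R T₂
  prod₂ : ((a * b : Rˣ) : R) ∈ commutantIn R T₂

/-- T multiplies x • w by q, whereas ε∘T = -ε; hence (q + 1) ε(x • w) = 0. -/
theorem apply_smul_eq_zero {q : ℂ} (hq : q ≠ -1) {T : Module.End ℂ M} {ε : M →ₗ[ℂ] ℂ}
    (hε : ∀ v, ε (T v) = -ε v) {w : M} (hw : T w = q • w) {x : R} (hx : x ∈ commutantIn R T) :
    ε (x • w) = 0 := by
  have h := hε (x • w)
  rw [hx, hw, smul_comm, map_smul, smul_eq_mul] at h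
  have : (q + 1) * ε (x • w) = 0 := by linear_combination h
  exact (mul_eq_zero.mp this).resolve_left fun h => hq (eq_neg_of_add_eq_zero_left h)

section Spherical

variable {q ν : ℂ} {a b : Rˣ} {T₁ T₂ : Module.End ℂ M} (hT : TorusRelations ν a b T₁ T₂)
  (hq : q ≠ -1) {ε : M →ₗ[ℂ] ℂ} (hε₁ : ∀ v, ε (T₁ v) = -ε v) (hε₂ : ∀ v, ε (T₂ v) = -ε v)
  {w : M} (hw₁ : T₁ w = q • w) (hw₂ : T₂ w = q • w)

include hT hq hε₂ hw₂ in
-- The sum of the monomial and its image under a ↔ b is symmetric, hence commutes with T₂, so ε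
-- kills it on w.
theorem alternating_swap (m n : ℤ) :
    ε ((a ^ m * b ^ n) • w) = -ε ((a ^ n * b ^ m) • w) := by
  have h1 := (commutantIn R T₂).mul_mem (zpow_mem_commutantIn hT.prod₂ m)
    (zpow_add_zpow_mem hT.sum₂ hT.prod₂ (n - m))
  have h2 := apply_smul_eq_zero hq hε₂ hw₂ h1
  have e1 : (a * b) ^ m * a ^ (n - m) = a ^ n * b ^ m := by
    rw [mul_zpow, mul_right_comm, ← _root_.zpow_add]; congr 2; ring
  have e2 : (a * b) ^ m * b ^ (n - m) = a ^ m * b ^ n := by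
    rw [mul_zpow, mul_assoc, ← _root_.zpow_add]; congr 2; ring
  rw [_root_.mul_add, ← Units.val_mul, ← Units.val_mul, e1, e2, add_smul, map_add] at h2
  exact eq_neg_of_add_eq_zero_right h2

include hT hq hε₁ hw₁ in
-- The same argument for T₁, whose reflection is b ↔ ν/b; this is where powers of ν enter.
theorem alternating_inv (m n : ℤ) :
    ε ((a ^ m * b ^ n) • w) = -(ν ^ n * ε ((a ^ m * b ^ (-n)) • w)) := by
  set c : Rˣ := Units.map (algebraMap ℂ R).toMonoidHom (Units.mk0 ν hT.ne_zero)
  have hc : ∀ k : ℤ, ∀ v : M, (c ^ k) • v = (ν ^ k) • v := fun k v => by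
    rw [Units.smul_def, ← map_zpow, Units.coe_map]
    change algebraMap ℂ R _ • v = _
    rw [algebraMap_smul, Units.val_zpow_eq_zpow_val]
    rfl
  have hcv : ((c * b⁻¹ : Rˣ) : R) = ν • ((b⁻¹ : Rˣ) : R) := by
    rw [Algebra.smul_def]; rfl
  have h1 := zpow_add_zpow_mem (T := T₁) (a := b) (b := c * b⁻¹) (by rw [hcv]; exact hT.sum₁)
    (by
      rw [mul_comm, inv_mul_cancel_right]
      exact (commutantIn R T₁).algebraMap_mem ν) n
  have h2 := apply_smul_eq_zero hq hε₁ hw₁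
    ((commutantIn R T₁).mul_mem (zpow_mem_commutantIn hT.comm₁ m) h1)
  rw [_root_.mul_add, ← Units.val_mul, ← Units.val_mul, add_smul, map_add] at h2
  have e : a ^ m * (c * b⁻¹) ^ n = c ^ n * (a ^ m * b ^ (-n)) := by
    rw [mul_zpow, _root_.inv_zpow', mul_left_comm]
  rw [e, ← Units.smul_def, ← Units.smul_def, mul_smul (c ^ n), hc, ε.map_smul, smul_eq_mul] at h2
  exact eq_neg_of_add_eq_zero_left h2

include hT hq hε₁ hw₁ in
-- An exponent on a wall is fixed by a reflection, so its value equals its own negative. The next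
-- lemmas treat the other walls of type C₂.
theorem alternating_zero (m : ℤ) : ε ((a ^ m * b ^ (0 : ℤ)) • w) = 0 := by
  have h := alternating_inv hT hq hε₁ hw₁ m 0
  rw [_root_.zpow_zero ν, one_mul, neg_zero] at h
  exact self_eq_neg.mp h

include hT hq hε₁ hε₂ hw₁ hw₂ in
theorem alternating_zero' (n : ℤ) : ε ((a ^ (0 : ℤ) * b ^ n) • w) = 0 := by
  rw [alternating_swap hT hq hε₂ hw₂, alternating_zero hT hq hε₁ hw₁, neg_zero]

include hT hq hε₂ hw₂ in
theorem alternating_diag (n : ℤ) : ε ((a ^ n * b ^ n) • w) = 0 :=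
  self_eq_neg.mp (alternating_swap hT hq hε₂ hw₂ n n)

include hT hq hε₁ hε₂ hw₁ hw₂ in
theorem alternating_antidiag (n : ℤ) : ε ((a ^ (-n) * b ^ n) • w) = 0 := by
  rw [alternating_inv hT hq hε₁ hw₁, alternating_diag hT hq hε₂ hw₂, mul_zero, neg_zero]

end Spherical
end TorusAlgebra

/-! ### The spherical vector generates the Iwahori-fixed vectors. -/

section Cyclic

/-- Taking n = 0 or n = -1 isolates one value of the second index, because Φ vanishes when its
second argument is 0. On the lines n = ±1 the function Φ(m, n) vanishes for m = -1, 0, 1 but not for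
m = ±2, so sliding a window of length four gives a triangular system. -/
theorem coeff_eq_zero_of_alternating {ν : ℂ} {Φ : ℤ → ℤ → ℂ}
    (swap : ∀ m n, Φ m n = -Φ n m) (inv : ∀ m n, Φ m n = -(ν ^ n * Φ m (-n))) (h21 : Φ 2 1 ≠ 0)
    (c : Fin 4 × Fin 2 → ℂ)
    (h : ∀ m n : ℤ, -3 ≤ m → -1 ≤ n → ∑ k, c k * Φ (m + (k.1 : ℕ)) (n + (k.2 : ℕ)) = 0) :
    c = 0 := by
  have z : ∀ m, Φ m 0 = 0 := fun m => by
    have := inv m 0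
    rw [_root_.zpow_zero, one_mul, neg_zero] at this
    exact self_eq_neg.mp this
  have z' : ∀ n, Φ 0 n = 0 := fun n => by rw [swap, z, neg_zero]
  have d : ∀ n, Φ n n = 0 := fun n => self_eq_neg.mp (swap n n)
  have d' : ∀ n, Φ n (-n) = 0 := fun n => by rw [inv, neg_neg, d, mul_zero, neg_zero]
  have flip : ∀ m n, Φ m n ≠ 0 → Φ m (-n) ≠ 0 := fun m n h h' => h (by rw [inv, h']; simp)
  have sw : ∀ m n, Φ m n ≠ 0 → Φ n m ≠ 0 := fun m n h h' => h (by rw [swap, h']; simp)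
  have n1 : Φ 2 (-1) ≠ 0 := flip _ _ h21
  have n2 : Φ (-2) 1 ≠ 0 := sw _ _ (flip _ _ (sw _ _ h21))
  have n3 : Φ (-2) (-1) ≠ 0 := flip _ _ n2
  have z1 : Φ (-1) 1 = 0 := by simpa using d' (-1)
  have z2 : Φ 1 (-1) = 0 := d' 1
  have row : ∀ m n : ℤ, -3 ≤ m → -1 ≤ n → ∑ i : Fin 4,
      (c (i, 0) * Φ (m + (i : ℕ)) n + c (i, 1) * Φ (m + (i : ℕ)) (n + 1)) = 0 := fun m n hm hn => by
    rw [← h m n hm hn, Fintype.sum_prod_type]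
    refine Finset.sum_congr rfl fun i _ => ?_
    rw [Fin.sum_univ_two]; simp
  have top : ∀ m : ℤ, -3 ≤ m → c (0, 1) * Φ m 1 + c (1, 1) * Φ (m + 1) 1 + c (2, 1) * Φ (m + 2) 1 +
      c (3, 1) * Φ (m + 3) 1 = 0 := fun m hm => by
    have := row m 0 hm (by norm_num)
    rw [Fin.sum_univ_four] at this
    simpa [z] using this
  have bot : ∀ m : ℤ, -3 ≤ m → c (0, 0) * Φ m (-1) + c (1, 0) * Φ (m + 1) (-1) +
      c (2, 0) * Φ (m + 2) (-1) + c (3, 0) * Φ (m + 3) (-1) = 0 := fun m hm => by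
    have := row m (-1) hm le_rfl
    rw [Fin.sum_univ_four] at this
    simpa [z] using this
  -- The windows starting at -1 and -2 each contain a single possibly nonzero value, at an end; the
  -- windows starting at 0 and -3 then involve one new coefficient each.
  have t3 : c (3, 1) = 0 := by simpa [z1, z', d, h21] using top (-1) (by norm_num)
  have t0 : c (0, 1) = 0 := by simpa [z1, z', d, n2] using top (-2) (by norm_num)
  have t2 : c (2, 1) = 0 := by simpa [z', d, h21, t3, t0] using top 0 (by norm_num)
  have t1 : c (1, 1) = 0 := by simpa [z', d, n2, t3, t0, t2] using top (-3) (by norm_num)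
  have b3 : c (3, 0) = 0 := by simpa [z2, z', d, n1] using bot (-1) (by norm_num)
  have b0 : c (0, 0) = 0 := by simpa [z2, z', d, n3] using bot (-2) (by norm_num)
  have b2 : c (2, 0) = 0 := by simpa [z2, z', d, n1, b3, b0] using bot 0 (by norm_num)
  have b1 : c (1, 0) = 0 := by simpa [z', d, n3, b3, b0, b2] using bot (-3) (by norm_num)
  ext ⟨i, j⟩
  fin_cases i <;> fin_cases j <;> assumption

variable {R M : Type*} [CommRing R] [Algebra ℂ R] [AddCommGroup M] [Module ℂ M] [Module R M]
  [IsScalarTower ℂ R M]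
variable {q ν : ℂ} {a b : Rˣ} {T₁ T₂ : Module.End ℂ M} (hT : TorusRelations ν a b T₁ T₂)
  (hq : q ≠ -1) {ε : M →ₗ[ℂ] ℂ} (hε₁ : ∀ v, ε (T₁ v) = -ε v) (hε₂ : ∀ v, ε (T₂ v) = -ε v)
  {w : M} (hw₁ : T₁ w = q • w) (hw₂ : T₂ w = q • w) (hw : ε ((a ^ 2 * b) • w) ≠ 0)

include hT hq hε₁ hε₂ hw₁ hw₂ hw

theorem coeff_eq_zero (c : Fin 4 × Fin 2 → ℂ)
    (h : ∀ m n : ℤ, -3 ≤ m → -1 ≤ n → ε ((a ^ m * b ^ n) • ∑ k, c k •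
      (a ^ (k.1 : ℕ) * b ^ (k.2 : ℕ)) • w) = 0) : c = 0 := by
  refine coeff_eq_zero_of_alternating (Φ := fun m n => ε ((a ^ m * b ^ n) • w))
    (alternating_swap hT hq hε₂ hw₂) (alternating_inv hT hq hε₁ hw₁) (by simpa using hw) c
    fun m n hm hn => ?_
  rw [← h m n hm hn, Finset.smul_sum, map_sum]
  refine Finset.sum_congr rfl fun k _ => ?_
  rw [smul_comm, ε.map_smul, smul_eq_mul, smul_smul]
  congr 3
  rw [_root_.zpow_add, _root_.zpow_add, zpow_natCast, zpow_natCast]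
  exact mul_mul_mul_comm _ _ _ _

theorem linearIndependent_orbit : LinearIndependent ℂ
    (fun k : Fin 4 × Fin 2 => (a ^ (k.1 : ℕ) * b ^ (k.2 : ℕ)) • w) := by
  rw [Fintype.linearIndependent_iff]
  intro c hc
  refine congrFun (coeff_eq_zero hT hq hε₁ hε₂ hw₁ hw₂ hw c fun m n _ _ => ?_)
  rw [hc, smul_zero, map_zero]

/-- Eight, the order of the Weyl group, is both the number of independent vectors and the bound on
the dimension. -/
theorem span_orbit [Module.Finite ℂ M] (hM : Module.finrank ℂ M ≤ 8) : Submodule.span ℂ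
    (Set.range fun k : Fin 4 × Fin 2 => (a ^ (k.1 : ℕ) * b ^ (k.2 : ℕ)) • w) = ⊤ := by
  have h := linearIndependent_orbit hT hq hε₁ hε₂ hw₁ hw₂ hw
  refine h.span_eq_top_of_card_eq_finrank' (le_antisymm h.fintype_card_le_finrank ?_)
  simpa using hM

/-- Nondegeneracy of the pairing of torus monomials with vectors through ε: v is expanded in the
basis coming from w, and the coefficients are killed by the same triangular system. -/
theorem eq_zero_of_forall_smul [Module.Finite ℂ M] (hM : Module.finrank ℂ M ≤ 8) {v : M}
    (hv : ∀ m n : ℕ, ε ((a ^ m * b ^ n) • v) = 0) : v = 0 := by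
  have h := span_orbit hT hq hε₁ hε₂ hw₁ hw₂ hw hM
  -- The twist by a³b moves the exponents m ≥ -3, n ≥ -1 needed for the coefficients into the range
  -- of natural exponents of the hypothesis.
  have hmem : (a ^ 3 * b) • v ∈ Submodule.span ℂ
    (Set.range fun k : Fin 4 × Fin 2 => (a ^ (k.1 : ℕ) * b ^ (k.2 : ℕ)) • w) := h ▸ trivial
  obtain ⟨c, hc⟩ := (Submodule.mem_span_range_iff_exists_fun ℂ).mp hmem
  have : c = 0 := coeff_eq_zero hT hq hε₁ hε₂ hw₁ hw₂ hw c fun m n hm hn => by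
    obtain ⟨k, hk⟩ := Int.eq_ofNat_of_zero_le (show 0 ≤ m + 3 by omega)
    obtain ⟨l, hl⟩ := Int.eq_ofNat_of_zero_le (show 0 ≤ n + 1 by omega)
    rw [hc, smul_smul, ← hv k l, ← zpow_natCast a k, ← zpow_natCast b l, ← hk, ← hl, _root_.zpow_add,
      _root_.zpow_add_one, zpow_ofNat]
    congr 2
    exact mul_mul_mul_comm _ _ _ _
  rw [this] at hc
  have h0 : (a ^ 3 * b) • v = 0 := by simpa using hc.symm
  simpa using (smul_eq_zero_iff_eq _).mp h0

/-- An element of the torus algebra acting by a scalar on `w` does so on the whole module. -/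
theorem smul_eq_of_smul_generator [Module.Finite ℂ M] (hM : Module.finrank ℂ M ≤ 8) {x : R} {e : ℂ}
    (hx : x • w = e • w) (v : M) : x • v = e • v := by
  have h := span_orbit hT hq hε₁ hε₂ hw₁ hw₂ hw hM
  have hmem : v ∈ Submodule.span ℂ
    (Set.range fun k : Fin 4 × Fin 2 => (a ^ (k.1 : ℕ) * b ^ (k.2 : ℕ)) • w) := h ▸ trivial
  induction hmem using Submodule.span_induction with
  | mem u hu =>
    obtain ⟨k, rfl⟩ := hu
    rw [smul_comm, hx, smul_comm]
  | zero => simp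
  | add u v _ _ hu hv => rw [smul_add, hu, hv, smul_add]
  | smul c u _ hu => rw [smul_comm, hu, smul_comm]

end Cyclic

/-! ### Quartic equations for a and for ab from the Satake relations. -/

section Identities
variable {R : Type*} [CommRing R] {A A' B B' α β γ δ ν : R}

/-- With s = A + ν/A and t = B + ν/B, knowing s + t and st gives (s - (α + δ))(s - (β + γ)) = 0;
multiplying each factor by A splits it into two linear factors. -/
theorem quartic_identity (hA : A * A' = 1) (h₁ : α * δ = ν) (h₂ : β * γ = ν) :
    (A - α) * (A - β) * (A - γ) * (A - δ) =
      A ^ 2 * (A + ν * A') * (A + B + ν * B' + ν * A' - (α + β + γ + δ)) +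
      -A ^ 2 * ((A + ν * A') * (B + ν * B') - (α + δ) * (β + γ)) := by
  have k₁ : A * (A + ν * A' - (α + δ)) = (A - α) * (A - δ) := by
    linear_combination ν * hA - h₁
  have k₂ : A * (A + ν * A' - (β + γ)) = (A - β) * (A - γ) := by
    linear_combination ν * hA - h₂
  calc _ = ((A - α) * (A - δ)) * ((A - β) * (A - γ)) := by ring
    _ = _ := by rw [← k₁, ← k₂]; ring

/-- Put X = AB. The relations give (A + B)(X + ν) = (α + β + γ + δ)X and (A² + ν)(B² + ν) = (α +
δ)(β + γ)X. Since (A² + ν)(B² + ν) = (X - ν)² + ν(A + B)², the expanded quartic in X then cancels.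
-/
theorem quartic_identity_mul (hA : A * A' = 1) (hB : B * B' = 1) (h₁ : α * δ = ν)
    (h₂ : β * γ = ν) :
    (A * B - α * β) * (A * B - γ * δ) * (A * B - α * γ) * (A * B - β * δ) =
      -(ν * A * B * ((A + B) * (A * B + ν) + (α + β + γ + δ) * (A * B))) *
        (A + B + ν * B' + ν * A' - (α + β + γ + δ)) +
      (A * B + ν) ^ 2 * (A * B) * ((A + ν * A') * (B + ν * B') - (α + δ) * (β + γ)) := by
  have k₁ : A * B * (A + B + ν * B' + ν * A' - (α + β + γ + δ)) =
      (A + B) * (A * B + ν) - (α + β + γ + δ) * (A * B) := by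
    linear_combination ν * B * hA + ν * A * hB
  have k₂ : A * B * ((A + ν * A') * (B + ν * B') - (α + δ) * (β + γ)) =
      (A ^ 2 + ν) * (B ^ 2 + ν) - (α + δ) * (β + γ) * (A * B) := by
    linear_combination ν * B * (B + ν * B') * hA + ν * (A ^ 2 + ν) * hB
  have k₃ : (A * B - α * β) * (A * B - γ * δ) * (A * B - α * γ) * (A * B - β * δ) =
      (A * B - ν) ^ 2 * (A * B + ν) ^ 2 + ν * (α + β + γ + δ) ^ 2 * (A * B) ^ 2 -
        (α + δ) * (β + γ) * (A * B) * (A * B + ν) ^ 2 := by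
    generalize A * B = X
    have j₁ : (X - α * β) * (X - γ * δ) = X ^ 2 - (α * β + γ * δ) * X + ν ^ 2 := by
      rw [sq ν]; nth_rw 1 [← h₁]; rw [← h₂]; ring
    have j₂ : (X - α * γ) * (X - β * δ) = X ^ 2 - (α * γ + β * δ) * X + ν ^ 2 := by
      rw [sq ν]; nth_rw 1 [← h₁]; rw [← h₂]; ring
    have j₃ : (α * β + γ * δ) * (α * γ + β * δ) =
        ν * (α ^ 2 + β ^ 2 + γ ^ 2 + δ ^ 2) := by
      linear_combination (β ^ 2 + γ ^ 2) * h₁ + (α ^ 2 + δ ^ 2) * h₂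
    calc _ = ((X - α * β) * (X - γ * δ)) * ((X - α * γ) * (X - β * δ)) := by ring
      _ = _ := by
        rw [j₁, j₂]
        linear_combination X ^ 2 * j₃ - 2 * ν * X ^ 2 * h₁ - 2 * ν * X ^ 2 * h₂
  rw [k₃]
  linear_combination ν * ((A + B) * (A * B + ν) + (α + β + γ + δ) * (A * B)) * k₁ -
    (A * B + ν) ^ 2 * k₂

end Identities

section Ann
variable {R M : Type*} [CommRing R] [AddCommGroup M] [Module R M]

theorem smul_eq_zero_of_eq_mul {x z k : R} {v : M} (hx : x • v = 0) (h : z = k * x) :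
    z • v = 0 := by
  rw [h, mul_smul, hx, smul_zero]

theorem smul_eq_zero_of_eq_add {x y z k l : R} {v : M} (hx : x • v = 0) (hy : y • v = 0)
    (h : z = k * x + l * y) : z • v = 0 := by
  rw [h, add_smul, mul_smul, mul_smul, hx, hy, smul_zero, smul_zero, add_zero]

variable [Algebra ℂ R]

local notation "ι" => algebraMap ℂ R

/-- The Satake relations: the symmetric functions of the torus action act by scalars on `w`. -/
structure SatakeRelations (ν : ℂ) (a b : Rˣ) (α β γ δ : ℂ) (w : M) : Prop where
  outer : α * δ = ν
  inner : β * γ = ν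
  sum : ((a : R) + b + ι ν * (b⁻¹ : Rˣ) + ι ν * (a⁻¹ : Rˣ) - (ι α + ι β + ι γ + ι δ)) • w = 0
  prod : (((a : R) + ι ν * (a⁻¹ : Rˣ)) * (b + ι ν * (b⁻¹ : Rˣ)) - (ι α + ι δ) * (ι β + ι γ)) • w = 0

variable {ν : ℂ} {a b : Rˣ} {α β γ δ : ℂ} {w : M}

theorem SatakeRelations.quartic (hS : SatakeRelations ν a b α β γ δ w) :
    (((a : R) - ι α) * (a - ι β) * (a - ι γ) * (a - ι δ)) • w = 0 :=
  smul_eq_zero_of_eq_add hS.sum hS.prod (quartic_identity a.mul_inv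
    (by rw [← map_mul, hS.outer]) (by rw [← map_mul, hS.inner]))

theorem SatakeRelations.quartic_mul (hS : SatakeRelations ν a b α β γ δ w) :
    (((a : R) * b - ι α * ι β) * (a * b - ι γ * ι δ) * (a * b - ι α * ι γ) * (a * b - ι β * ι δ)) • w
      = 0 :=
  smul_eq_zero_of_eq_add hS.sum hS.prod (quartic_identity_mul a.mul_inv b.mul_inv
    (by rw [← map_mul, hS.outer]) (by rw [← map_mul, hS.inner]))

variable [Module ℂ M] [IsScalarTower ℂ R M]

theorem sub_algebraMap_smul_eq_zero {x : R} {c : ℂ} {v : M} :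
    (x - algebraMap ℂ R c) • v = 0 ↔ x • v = c • v := by
  rw [sub_smul, algebraMap_smul, sub_eq_zero]

theorem apply_pow_smul_eq_zero {x : R} {s t : ℂ} {v : M} {ε : M →ₗ[ℂ] ℂ}
    (h : (x ^ 2 - algebraMap ℂ R s * x + algebraMap ℂ R t) • v = 0) (h0 : ε v = 0)
    (h1 : ε (x • v) = 0) (n : ℕ) : ε (x ^ n • v) = 0 := by
  induction n using Nat.twoStepInduction with
  | zero => simpa using h0
  | one => simpa using h1
  | more n ih1 ih2 =>
    have e : x ^ (n + 2) • v = s • x ^ (n + 1) • v - t • x ^ n • v := by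
      rw [← sub_eq_zero, ← algebraMap_smul R s, ← algebraMap_smul R t, smul_smul, smul_smul,
        ← sub_smul, ← sub_smul]
      exact smul_eq_zero_of_eq_mul h (k := x ^ n) (by ring)
    rw [e, map_sub, ε.map_smul, ε.map_smul, ih1, ih2]; simp

theorem apply_mul_smul {c : ℂ} {x : R} {v : M} (ε : M →ₗ[ℂ] ℂ) :
    ε ((algebraMap ℂ R c * x) • v) = c * ε (x • v) := by
  rw [mul_smul, algebraMap_smul, map_smul, smul_eq_mul]

end Ann

/-! ### Vanishing propagated from ε(a²b w) to the dominant cone. -/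

section Eigen

variable {R M : Type*} [CommRing R] [Algebra ℂ R] [AddCommGroup M] [Module ℂ M] [Module R M]
  [IsScalarTower ℂ R M]

local notation "ι" => algebraMap ℂ R

variable {q ν : ℂ} {a b : Rˣ} {T₁ T₂ : Module.End ℂ M} {α β γ δ : ℂ} {w : M}

variable (hT : TorusRelations ν a b T₁ T₂)
  (hq : q ≠ -1) {ε : M →ₗ[ℂ] ℂ} (hε₁ : ∀ v, ε (T₁ v) = -ε v) (hε₂ : ∀ v, ε (T₂ v) = -ε v)

theorem apply_eq_zero_of_eigen {T : Module.End ℂ M} (hq : q ≠ -1) (hε : ∀ v, ε (T v) = -ε v)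
    {v : M} (hv : T v = q • v) : ε v = 0 := by
  simpa using apply_smul_eq_zero hq hε hv (commutantIn ℂ T).one_mem

variable (hw₁ : T₁ w = q • w) (hw₂ : T₂ w = q • w) (hS : SatakeRelations ν a b α β γ δ w)

include hT hq hε₁ hε₂ hw₁ hw₂ hS in
/-- If the functional `ε(a² b ·)` vanishes on `w`, so do all `ε(aᵐ bⁿ ·)`. -/
theorem apply_smul_eq_zero_of_generator (hw : ε ((a ^ 2 * b) • w) = 0) (m n : ℕ) :
    ε ((a ^ (m + n) * b ^ n) • w) = 0 := by
  have hz := alternating_zero hT hq hε₁ hw₁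
  -- The line with b-exponent 1, starting from a⁻¹: three of the four initial values lie on walls,
  -- the fourth is the hypothesis, and the quartic equation for a does the rest.
  have h1 : ∀ m : ℕ, ε (((a : R) ^ m * (a⁻¹ : Rˣ) * b) • w) = 0 := by
    intro m
    induction m using Nat.strong_induction_on with
    | _ m ih =>
      match m with
      | 0 => simpa [Units.smul_def] using alternating_antidiag hT hq hε₁ hε₂ hw₁ hw₂ 1
      | 1 => simpa [Units.smul_def] using alternating_zero' hT hq hε₁ hε₂ hw₁ hw₂ 1
      | 2 =>
        have := alternating_diag hT hq hε₂ hw₂ 1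
        rw [_root_.zpow_one, _root_.zpow_one, Units.smul_def, Units.val_mul] at this
        rwa [sq, mul_assoc (a : R), a.mul_inv, mul_one]
      | 3 =>
        rw [Units.smul_def, Units.val_mul, Units.val_pow_eq_pow_val] at hw
        rwa [pow_succ, mul_assoc ((a : R) ^ 2), a.mul_inv, mul_one]
      | m + 4 =>
        have h0 := smul_eq_zero_of_eq_mul hS.quartic (z := ((a : R) ^ (m + 4) * (a⁻¹ : Rˣ) * b) -
          ι (α + β + γ + δ) * (a ^ (m + 3) * (a⁻¹ : Rˣ) * b) +
          ι (α * β + α * γ + α * δ + β * γ + β * δ + γ * δ) * (a ^ (m + 2) * (a⁻¹ : Rˣ) * b) -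
          ι (α * β * γ + α * β * δ + α * γ * δ + β * γ * δ) * (a ^ (m + 1) * (a⁻¹ : Rˣ) * b) +
          ι (α * β * γ * δ) * (a ^ m * (a⁻¹ : Rˣ) * b)) (k := a ^ m * (a⁻¹ : Rˣ) * b)
          (by simp only [map_add, map_mul]; ring)
        have h1 := congrArg ε h0
        rw [add_smul, sub_smul, add_smul, sub_smul, map_add, map_sub, map_add, map_sub, map_zero,
          apply_mul_smul, apply_mul_smul, apply_mul_smul, apply_mul_smul, ih m (by omega),
          ih (m + 1) (by omega), ih (m + 2) (by omega), ih (m + 3) (by omega)] at h1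
        simpa using h1
  -- The relation for the sum, multiplied by b, is a second-order recursion in the exponent of b. It
  -- also lowers that of a, and the offset a⁻² is what makes the range of exponents stable under the
  -- recursion.
  have h2 : ∀ n m : ℕ, ε (((a : R) ^ (m + n) * (a⁻¹ : Rˣ) ^ 2 * b ^ n) • w) = 0 := by
    intro n
    induction n using Nat.twoStepInduction with
    | zero =>
      intro m
      rw [← hz (m - 2), Units.smul_def, _root_.zpow_zero, _root_.zpow_sub]
      simp
    | one =>
      intro m
      rw [← h1 m]
      congr 2
      linear_combination (a : R) ^ m * (a⁻¹ : Rˣ) * b * a.mul_inv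
    | more n ih1 ih2 =>
      intro m
      have h0 := smul_eq_zero_of_eq_mul hS.sum
        (z := ((a : R) ^ (m + (n + 2)) * (a⁻¹ : Rˣ) ^ 2 * b ^ (n + 2)) -
          ι (α + β + γ + δ) * (a ^ (m + 1 + (n + 1)) * (a⁻¹ : Rˣ) ^ 2 * b ^ (n + 1)) +
          (a ^ (m + 2 + (n + 1)) * (a⁻¹ : Rˣ) ^ 2 * b ^ (n + 1)) +
          ι ν * (a ^ (m + (n + 1)) * (a⁻¹ : Rˣ) ^ 2 * b ^ (n + 1)) +
          ι ν * (a ^ (m + 2 + n) * (a⁻¹ : Rˣ) ^ 2 * b ^ n))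
        (k := a ^ (m + n + 2) * (a⁻¹ : Rˣ) ^ 2 * b ^ (n + 1))
        (by
          simp only [map_add]
          linear_combination (-ι ν * (a ^ (m + n + 1) * (a⁻¹ : Rˣ) ^ 2 * b ^ (n + 1))) * a.mul_inv -
            ι ν * (a ^ (m + n + 2) * (a⁻¹ : Rˣ) ^ 2 * b ^ n) * b.mul_inv)
      have h1 := congrArg ε h0
      rw [add_smul, add_smul, add_smul, sub_smul, map_add, map_add, map_add, map_sub, map_zero,
        apply_mul_smul, apply_mul_smul, apply_mul_smul, ih2, ih2, ih2, ih1] at h1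
      simpa using h1
  rw [← h2 n (m + 2), Units.smul_def]
  congr 2
  push_cast
  linear_combination (-(a : R) ^ (m + n) * b ^ n * (1 + a * (a⁻¹ : Rˣ))) * a.mul_inv

end Eigen

/-! ### Eigenvectors are determined by one Whittaker value. -/

section Injectivity

variable {R M : Type*} [CommRing R] [Algebra ℂ R] [AddCommGroup M] [Module ℂ M] [Module R M]
  [IsScalarTower ℂ R M]

local notation "ι" => algebraMap ℂ R

theorem pow_smul_of_eigen {x : R} {e : ℂ} {v : M} (h : x • v = e • v) (n : ℕ) :
    x ^ n • v = e ^ n • v := by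
  induction n with
  | zero => simp
  | succ n ih => rw [pow_succ', mul_smul, ih, smul_comm, h, smul_smul, ← pow_succ]

variable {q ν : ℂ} {a b : Rˣ} {T₁ T₂ : Module.End ℂ M} {α β γ δ : ℂ} {v : M} {ε : M →ₗ[ℂ] ℂ}

theorem TorusRelations.outer_ne_zero (hT : TorusRelations ν a b T₁ T₂)
    (hS : SatakeRelations ν a b α β γ δ v) : α ≠ 0 := fun h =>
  hT.ne_zero (by rw [← hS.outer, h, zero_mul])

theorem TorusRelations.inner_ne_zero (hT : TorusRelations ν a b T₁ T₂)
    (hS : SatakeRelations ν a b α β γ δ v) : β ≠ 0 := fun h =>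
  hT.ne_zero (by rw [← hS.inner, h, zero_mul])

/-- On v one has a + ν/a = α + δ, so the relation for the sum leaves b + ν/b = β + γ. -/
theorem quadratic_of_eigen (hS : SatakeRelations ν a b α β γ δ v) (ha : (a : R) • v = α • v) :
    (((b : R) - ι β) * (b - ι γ)) • v = 0 := by
  have h1 : ι α * ι δ = ι ν := by rw [← map_mul, hS.outer]
  have h2 : ι β * ι γ = ι ν := by rw [← map_mul, hS.inner]
  refine smul_eq_zero_of_eq_add hS.sum (sub_algebraMap_smul_eq_zero.mpr ha) (k := (b : R))
    (l := -(b : R) + ι δ * b * (a⁻¹ : Rˣ)) ?_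
  linear_combination (-ι δ * b) * a.mul_inv - ι ν * b.mul_inv + h2 + (b * (a⁻¹ : Rˣ) : R) * h1

/-- Since ν/(αβ) = γ/α, the relation for the sum reads (a + b)(1 + γ/α) = (α + β)(1 + γ/α) on v; the
condition α + γ ≠ 0 allows the division. -/
theorem sum_of_eigen (hT : TorusRelations ν a b T₁ T₂) (hS : SatakeRelations ν a b α β γ δ v)
    (hab : (a * b : R) • v = (α * β) • v) (hαγ : α + γ ≠ 0) :
    ((a : R) + b - ι (α + β)) • v = 0 := by
  have h1 : ι α * ι δ = ι ν := by rw [← map_mul, hS.outer]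
  have h2 : ι β * ι γ = ι ν := by rw [← map_mul, hS.inner]
  have hβ := hT.inner_ne_zero hS
  have h3 : ι (β * (α + γ))⁻¹ * (ι β * (ι α + ι γ)) = 1 := by
    rw [← map_add, ← map_mul, ← map_mul, inv_mul_cancel₀ (mul_ne_zero hβ hαγ), map_one]
  refine smul_eq_zero_of_eq_add hS.sum (sub_algebraMap_smul_eq_zero.mpr hab)
    (k := ι (β * (α + γ))⁻¹ * (a * b))
    (l := ι (β * (α + γ))⁻¹ * (ι α + ι β + ι γ + ι δ - (a + b))) ?_
  rw [map_add, map_mul]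
  generalize ι (β * (α + γ))⁻¹ = r at h3 ⊢
  linear_combination (-(a + b - (ι α + ι β)) : R) * h3 - r * ι ν * b * a.mul_inv
    - r * ι ν * a * b.mul_inv + (r * ι β) * h1 + r * ((a + b : R) - ι β) * h2

variable {w : M} (hT : TorusRelations ν a b T₁ T₂)
  (hq : q ≠ -1) (hε₁ : ∀ v, ε (T₁ v) = -ε v) (hε₂ : ∀ v, ε (T₂ v) = -ε v)
  (hw₁ : T₁ w = q • w) (hw₂ : T₂ w = q • w) (hw : ε ((a ^ 2 * b) • w) ≠ 0)
  (hS : SatakeRelations ν a b α β γ δ w)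
  [Module.Finite ℂ M] (hM : Module.finrank ℂ M ≤ 8)

include hT hq hε₁ hε₂ hw₁ hw₂ hw hS hM

/-- The relations are known on w, and w generates the module over a commutative algebra. -/
theorem satakeRelations_of_generator (v : M) : SatakeRelations ν a b α β γ δ v where
  outer := hS.outer
  inner := hS.inner
  sum := by
    rw [smul_eq_of_smul_generator hT hq hε₁ hε₂ hw₁ hw₂ hw hM (e := 0) (by rw [hS.sum, zero_smul]),
      zero_smul]
  prod := by
    rw [smul_eq_of_smul_generator hT hq hε₁ hε₂ hw₁ hw₂ hw hM (e := 0) (by rw [hS.prod, zero_smul]),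
      zero_smul]

/-- As a acts by α, only ε(bⁿ v) matters. It vanishes for n = 0 because T₁v = qv, for n = 1 by
hypothesis, and afterwards by the quadratic equation for b. -/
theorem siegel_eigen_eq_zero (hv : T₁ v = q • v) (ha : (a : R) • v = α • v)
    (h : ε ((a ^ 2 * b) • v) = 0) : v = 0 := by
  have hSv := satakeRelations_of_generator hT hq hε₁ hε₂ hw₁ hw₂ hw hS hM v
  have hα := hT.outer_ne_zero hSv
  have key : ∀ m n : ℕ, ε ((a ^ m * b ^ n) • v) = α ^ m * ε ((b : R) ^ n • v) := fun m n => by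
    rw [Units.smul_def]
    push_cast
    rw [mul_comm, mul_smul, pow_smul_of_eigen ha, smul_comm, ε.map_smul, smul_eq_mul]
  have h1 := key 2 1
  rw [pow_one, h, pow_one] at h1
  have hb : ε ((b : R) • v) = 0 := by simpa [hα] using h1.symm
  refine eq_zero_of_forall_smul hT hq hε₁ hε₂ hw₁ hw₂ hw hM fun m n => ?_
  rw [key, apply_pow_smul_eq_zero (s := β + γ) (t := β * γ) ?_
    (apply_eq_zero_of_eigen hq hε₁ hv) hb, mul_zero]
  rw [← quadratic_of_eigen hSv ha]
  congr 1
  simp only [map_add, map_mul]; ring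

/-- Here ε(v) = 0 comes from T₂v = qv and ε(av) = 0 from a²b = a · ab. As both a + b and ab act by
scalars, a satisfies a quadratic equation and powers of b reduce to powers of a. -/
theorem klingen_eigen_eq_zero (hαγ : α + γ ≠ 0) (hv : T₂ v = q • v)
    (hab : (a * b : R) • v = (α * β) • v) (h : ε ((a ^ 2 * b) • v) = 0) : v = 0 := by
  have hSv := satakeRelations_of_generator hT hq hε₁ hε₂ hw₁ hw₂ hw hS hM v
  have hα := hT.outer_ne_zero hSv
  have hβ := hT.inner_ne_zero hSv
  have hsum := sum_of_eigen hT hSv hab hαγ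
  have ha1 : ε ((a : R) • v) = 0 := by
    rw [Units.smul_def] at h
    push_cast at h
    rw [sq, mul_assoc, mul_smul, hab, smul_comm, ε.map_smul, smul_eq_mul] at h
    exact (mul_eq_zero.mp h).resolve_left (mul_ne_zero hα hβ)
  have hpow := apply_pow_smul_eq_zero (ε := ε) (x := (a : R)) (s := α + β) (t := α * β) (v := v)
    (smul_eq_zero_of_eq_add hsum (sub_algebraMap_smul_eq_zero.mpr hab) (k := (a : R))
      (l := -1)
      (by ring)) (apply_eq_zero_of_eigen hq hε₂ hv) ha1
  have key : ∀ n m : ℕ, ε (((a : R) ^ m * b ^ n) • v) = 0 := by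
    intro n
    induction n with
    | zero => intro m; simpa using hpow m
    | succ n ih =>
      intro m
      have h0 := smul_eq_zero_of_eq_mul hsum (z := (a : R) ^ m * b ^ (n + 1) -
        ι (α + β) * (a ^ m * b ^ n) + a ^ (m + 1) * b ^ n) (k := a ^ m * b ^ n) (by ring)
      have h1 := congrArg ε h0
      rw [add_smul, sub_smul, map_add, map_sub, map_zero, apply_mul_smul, ih, ih] at h1
      simpa using h1
  refine eq_zero_of_forall_smul hT hq hε₁ hε₂ hw₁ hw₂ hw hM fun m n => ?_
  simpa [Units.smul_def] using key n m

theorem iwahori_eigen_eq_zero (ha : (a : R) • v = α • v)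
    (hab : (a * b : R) • v = (α * β) • v) (h : ε ((a ^ 2 * b) • v) = 0) : v = 0 := by
  have hSv := satakeRelations_of_generator hT hq hε₁ hε₂ hw₁ hw₂ hw hS hM v
  have hα := hT.outer_ne_zero hSv
  have hβ := hT.inner_ne_zero hSv
  have hb : (b : R) • v = β • v := by
    have h1 := hab
    rw [mul_comm, mul_smul, ha, smul_comm, mul_smul] at h1
    exact smul_right_injective M hα h1
  have key : ∀ m n : ℕ, ε ((a ^ m * b ^ n) • v) = α ^ m * (β ^ n * ε v) := fun m n => by
    rw [Units.smul_def]
    push_cast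
    rw [mul_smul, pow_smul_of_eigen hb, smul_comm, pow_smul_of_eigen ha, ε.map_smul, ε.map_smul,
      smul_eq_mul, smul_eq_mul]
    ring
  have h1 := key 2 1
  rw [pow_one, h] at h1
  have h0 : ε v = 0 := by simpa [hα, hβ] using h1.symm
  refine eq_zero_of_forall_smul hT hq hε₁ hε₂ hw₁ hw₂ hw hM fun m n => ?_
  rw [key, h0, mul_zero, mul_zero]

end Injectivity

/-! ### The explicit eigenvectors and their values. -/

section Candidates

variable {R M : Type*} [CommRing R] [Algebra ℂ R] [AddCommGroup M] [Module ℂ M] [Module R M]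

local notation "ι" => algebraMap ℂ R

/-- The element `1 - x / u`. -/
def oneSubInv (x : ℂ) (u : Rˣ) : R := 1 - ι x * (u⁻¹ : Rˣ)

theorem oneSubInv_eq (x : ℂ) (u : Rˣ) : oneSubInv x u = (u⁻¹ : Rˣ) * (u - ι x) := by
  rw [oneSubInv]; linear_combination -u.inv_mul

variable [IsScalarTower ℂ R M]

theorem oneSubInv_smul (x : ℂ) (u : Rˣ) (v : M) :
    oneSubInv x u • v = v - x • (u⁻¹ : Rˣ) • v := by
  rw [oneSubInv, sub_smul, one_smul, mul_smul, algebraMap_smul]; rfl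

theorem smul_eigen {q : ℂ} {T : Module.End ℂ M} {x : R} (hx : x ∈ commutantIn R T) {v : M}
    (hv : T v = q • v) : T (x • v) = q • x • v := by
  rw [hx, hv, smul_comm]

variable {q ν : ℂ} {a b : Rˣ} {T₁ T₂ : Module.End ℂ M} {α β γ δ : ℂ} {w : M} {ε : M →ₗ[ℂ] ℂ}

/-- The torus element producing the Siegel eigenvector out of the spherical vector. -/
def siegelFactor (β γ δ : ℂ) (a : Rˣ) : R := oneSubInv β a * oneSubInv γ a * oneSubInv δ a

/-- The torus element producing the Klingen eigenvector out of the spherical vector. -/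
def klingenFactor (α β γ δ : ℂ) (u : Rˣ) : R :=
  oneSubInv (γ * δ) u * oneSubInv (α * γ) u * oneSubInv (β * δ) u

/-- Multiplied by a - α, the factor becomes a⁻³ times the quartic that annihilates w. The Klingen
case uses the quartic for ab. -/
theorem siegelFactor_eigen (hS : SatakeRelations ν a b α β γ δ w) :
    (a : R) • siegelFactor β γ δ a • w = α • siegelFactor β γ δ a • w := by
  rw [← sub_algebraMap_smul_eq_zero, smul_smul]
  refine smul_eq_zero_of_eq_mul hS.quartic (k := ((a⁻¹ : Rˣ) : R) ^ 3) ?_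
  rw [siegelFactor, oneSubInv_eq, oneSubInv_eq, oneSubInv_eq]
  ring

theorem klingenFactor_eigen (hS : SatakeRelations ν a b α β γ δ w) :
    (a * b : R) • klingenFactor α β γ δ (a * b) • w =
      (α * β) • klingenFactor α β γ δ (a * b) • w := by
  rw [← sub_algebraMap_smul_eq_zero, smul_smul]
  refine smul_eq_zero_of_eq_mul hS.quartic_mul (k := (((a * b)⁻¹ : Rˣ) : R) ^ 3) ?_
  rw [klingenFactor, oneSubInv_eq, oneSubInv_eq, oneSubInv_eq]
  simp only [map_mul, Units.val_mul]
  ring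

section Value

variable (hT : TorusRelations ν a b T₁ T₂) (hq : q ≠ -1) (hε₁ : ∀ v, ε (T₁ v) = -ε v)
  (hε₂ : ∀ v, ε (T₂ v) = -ε v) (hw₁ : T₁ w = q • w) (hw₂ : T₂ w = q • w)

include hT hq hε₁ hε₂ hw₁ hw₂

/-- In the expansion of a²b times the factor, the monomials ab, b and a⁻¹b lie on walls. -/
theorem apply_siegelFactor (β γ δ : ℂ) :
    ε ((a ^ 2 * b) • siegelFactor β γ δ a • w) = ε ((a ^ 2 * b) • w) := by
  have z0 : ε (((a : R) * b) • w) = 0 := by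
    simpa [Units.smul_def] using alternating_diag hT hq hε₂ hw₂ 1
  have z1 : ε ((b : R) • w) = 0 := by
    simpa [Units.smul_def] using alternating_zero' hT hq hε₁ hε₂ hw₁ hw₂ 1
  have z2 : ε (((a⁻¹ : Rˣ) * b : R) • w) = 0 := by
    simpa [Units.smul_def] using alternating_antidiag hT hq hε₁ hε₂ hw₁ hw₂ 1
  have e : ((a ^ 2 * b : Rˣ) : R) * siegelFactor β γ δ a = (a ^ 2 * b : Rˣ) -
      ι (β + γ + δ) * (a * b) + ι (β * γ + β * δ + γ * δ) * b - ι (β * γ * δ) * ((a⁻¹ : Rˣ) * b)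
      := by
    have h := a.mul_inv
    rw [siegelFactor, oneSubInv, oneSubInv, oneSubInv]
    simp only [map_add, map_mul, Units.val_mul, Units.val_pow_eq_pow_val]
    generalize ((a⁻¹ : Rˣ) : R) = A' at h ⊢
    linear_combination (-(ι β + ι γ + ι δ) * a * b + (ι β * ι γ + ι β * ι δ + ι γ * ι δ) * b *
      (a * A' + 1) - ι β * ι γ * ι δ * A' * b * (a * A' + 1)) * h
  rw [Units.smul_def, smul_smul, e, sub_smul, add_smul, sub_smul, map_sub, map_add, map_sub,
    apply_mul_smul, apply_mul_smul, apply_mul_smul, z0, z1, z2, Units.smul_def]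
  simp

/-- The monomials in the expansion are a²b, a, b⁻¹ and a⁻¹b⁻². The middle two lie on walls; the last
is in the Weyl orbit of a²b and produces γ/α. -/
theorem apply_klingenFactor (hS : SatakeRelations ν a b α β γ δ w) :
    ε ((a ^ 2 * b) • klingenFactor α β γ δ (a * b) • w) =
      (1 + γ / α) * ε ((a ^ 2 * b) • w) := by
  have hα := hT.outer_ne_zero hS
  have hν := hT.ne_zero
  have z0 : ε ((a : R) • w) = 0 := by
    simpa [Units.smul_def] using alternating_zero hT hq hε₁ hw₁ 1
  have z1 : ε (((b⁻¹ : Rˣ) : R) • w) = 0 := by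
    simpa [Units.smul_def] using alternating_zero' hT hq hε₁ hε₂ hw₁ hw₂ (-1)
  -- Five reflections lead from (-1, -2) to (2, 1), hence the minus sign; the two inversions among
  -- them contribute ν⁻¹ and ν⁻².
  have z2 : ε (((a⁻¹ : Rˣ) * (b⁻¹ : Rˣ) ^ 2 : R) • w) = -(ν ^ 3)⁻¹ * ε ((a ^ 2 * b) • w) := by
    have h1 := alternating_swap hT hq hε₂ hw₂ (-1) (-2)
    have h2 := alternating_inv hT hq hε₁ hw₁ (-2) (-1)
    have h3 := alternating_swap hT hq hε₂ hw₂ (-2) 1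
    have h4 := alternating_inv hT hq hε₁ hw₁ 1 (-2)
    have h5 := alternating_swap hT hq hε₂ hw₂ 1 2
    simp only [neg_neg] at h2 h4
    rw [h2, h3, h4, h5] at h1
    have e1 : (((a⁻¹ : Rˣ) * (b⁻¹ : Rˣ) ^ 2 : R) • w) = (a ^ (-1 : ℤ) * b ^ (-2 : ℤ)) • w := by
      rw [Units.smul_def]
      congr 1
      simp [_root_.zpow_neg, zpow_ofNat, ← inv_pow]
    have e2 : (a ^ (2 : ℤ) * b ^ (1 : ℤ)) = a ^ 2 * b := by simp [zpow_ofNat]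
    rw [e1, h1, e2]
    simp [_root_.zpow_neg, zpow_ofNat]
    field_simp
  have e : ((a ^ 2 * b : Rˣ) : R) * klingenFactor α β γ δ (a * b) = (a ^ 2 * b : Rˣ) -
      ι (γ * δ + α * γ + β * δ) * a +
      ι (γ * δ * (α * γ) + γ * δ * (β * δ) + α * γ * (β * δ)) * (b⁻¹ : Rˣ) -
      ι (γ * δ * (α * γ) * (β * δ)) * ((a⁻¹ : Rˣ) * (b⁻¹ : Rˣ) ^ 2) := by
    have h := a.mul_inv
    have h' := b.mul_inv
    rw [klingenFactor, oneSubInv, oneSubInv, oneSubInv, mul_inv]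
    simp only [map_add, map_mul, Units.val_mul, Units.val_pow_eq_pow_val]
    generalize ((a⁻¹ : Rˣ) : R) = A' at h ⊢
    generalize ((b⁻¹ : Rˣ) : R) = B' at h' ⊢
    generalize ι γ * ι δ = x
    generalize ι α * ι γ = y
    generalize ι β * ι δ = z
    have k1 : (a : R) ^ 2 * b * (A' * B') = a := by linear_combination a * b * B' * h + a * h'
    have k2 : (a : R) ^ 2 * b * (A' * B') ^ 2 = B' := by
      linear_combination A' * B' * k1 + B' * h
    have k3 : (a : R) ^ 2 * b * (A' * B') ^ 3 = A' * B' ^ 2 := by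
      linear_combination A' * B' * k2
    linear_combination -(x + y + z) * k1 + (x * y + x * z + y * z) * k2 - x * y * z * k3
  have h1 : γ * δ * (α * γ) * (β * δ) * (ν ^ 3)⁻¹ = γ / α := by
    rw [mul_inv_eq_iff_eq_mul₀ (pow_ne_zero 3 hν), div_mul_eq_mul_div, eq_div_iff hα,
      show ν ^ 3 = ν ^ 2 * ν by ring]
    nth_rw 1 [← hS.outer]
    rw [← hS.inner]
    ring
  rw [Units.smul_def, smul_smul, e, sub_smul, add_smul, sub_smul, map_sub, map_add, map_sub,
    apply_mul_smul, apply_mul_smul, apply_mul_smul, z0, z1, z2, Units.smul_def]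
  linear_combination ε (((a ^ 2 * b : Rˣ) : R) • w) * h1

end Value

theorem siegel_to_iwahori_eigen₁ {x : R} {v : M} (ha : (a : R) • v = α • v) :
    (a : R) • x • v = α • x • v := by
  rw [smul_comm, ha, smul_comm]

/-- With a = α on v, (ab - αβ)(ab - αγ) = α²(b - β)(b - γ), which kills v by `quadratic_of_eigen`.
-/
theorem siegel_to_iwahori_eigen₂ {v : M} (hS : SatakeRelations ν a b α β γ δ v)
    (ha : (a : R) • v = α • v) : (a * b : R) • oneSubInv (α * γ) (a * b) • v =
      (α * β) • oneSubInv (α * γ) (a * b) • v := by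
  rw [← sub_algebraMap_smul_eq_zero, smul_smul, oneSubInv_eq]
  refine smul_eq_zero_of_eq_add (quadratic_of_eigen hS ha) (sub_algebraMap_smul_eq_zero.mpr ha)
    (k := ((a * b)⁻¹ : Rˣ) * ι α ^ 2)
    (l := ((a * b)⁻¹ : Rˣ) * ((b : R) * (a * b - ι α * ι γ) + ι α * (b - ι β) * b)) ?_
  simp only [map_mul, Units.val_mul]
  ring

/-- The correction term is a multiple of ε(av) = α ε(v), and ε(v) = 0 because T₁v = qv. -/
theorem apply_siegel_to_iwahori (hq : q ≠ -1) (hε₁ : ∀ v, ε (T₁ v) = -ε v) {v : M}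
    (hv : T₁ v = q • v) (ha : (a : R) • v = α • v) (x : ℂ) :
    ε ((a ^ 2 * b) • oneSubInv x (a * b) • v) = ε ((a ^ 2 * b) • v) := by
  have e : (a ^ 2 * b) * (a * b)⁻¹ = a := by
    rw [mul_inv, sq, mul_mul_mul_comm, mul_inv_cancel, mul_one, mul_inv_cancel_right]
  rw [oneSubInv_smul, smul_sub, smul_comm, smul_smul, e, map_sub, Units.smul_def a, ha,
    ε.map_smul, ε.map_smul, apply_eq_zero_of_eigen hq hε₁ hv]
  simp

/-- (a - α)(a - β) = a(a + b - α - β) - (ab - αβ), and both terms kill v. -/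
theorem klingen_to_iwahori_eigen₁ (hT : TorusRelations ν a b T₁ T₂) {v : M}
    (hS : SatakeRelations ν a b α β γ δ v)
    (hab : (a * b : R) • v = (α * β) • v) (hαγ : α + γ ≠ 0) :
    (a : R) • oneSubInv β a • v = α • oneSubInv β a • v := by
  rw [← sub_algebraMap_smul_eq_zero, smul_smul, oneSubInv_eq]
  refine smul_eq_zero_of_eq_add (sum_of_eigen hT hS hab hαγ) (sub_algebraMap_smul_eq_zero.mpr hab)
    (k := (1 : R)) (l := -(a⁻¹ : Rˣ)) ?_
  simp only [map_mul, map_add]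
  linear_combination (a + b - ι α - ι β : R) * a.mul_inv

theorem klingen_to_iwahori_eigen₂ {x : R} {v : M} (hab : (a * b : R) • v = (α * β) • v) :
    (a * b : R) • x • v = (α * β) • x • v := by
  rw [smul_comm, hab, smul_comm]

theorem apply_klingen_to_iwahori (hq : q ≠ -1) (hε₂ : ∀ v, ε (T₂ v) = -ε v) {v : M}
    (hv : T₂ v = q • v) (hab : (a * b : R) • v = (α * β) • v) (x : ℂ) :
    ε ((a ^ 2 * b) • oneSubInv x a • v) = ε ((a ^ 2 * b) • v) := by
  have e : (a ^ 2 * b) * a⁻¹ = a * b := by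
    rw [sq, mul_right_comm, mul_inv_cancel_right]
  rw [oneSubInv_smul, smul_sub, smul_comm, smul_smul, e, map_sub, Units.smul_def (a * b),
    Units.val_mul, hab, ε.map_smul, ε.map_smul, apply_eq_zero_of_eigen hq hε₂ hv]
  simp

end Candidates

/-! ### From the Iwahori–Hecke relations to commuting torus operators. -/

section GroupIdentities
variable {G : Type*} [Group G] {t₁ t₂ e : G}

/-- Relations between units of the Iwahori–Hecke algebra which only involve monomials. -/
structure MonomialRelations (t₁ t₂ e : G) : Prop where
  braid : t₁ * t₂ * t₁ * t₂ = t₂ * t₁ * t₂ * t₁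
  comm₁ : e * t₁ = t₁ * e
  sq₁ : e * e * t₁ = t₁ * (e * e)
  sq₂ : e * e * t₂ = t₂ * (e * e)
  comm₀ : t₂ * (e * t₂ * e) = (e * t₂ * e) * t₂

variable (h : MonomialRelations t₁ t₂ e)
include h

/-- With `second_mul_first` this shows that, up to scalars, the two torus operators commute and that
their product is the word of the double coset of `d2`. -/
theorem MonomialRelations.first_mul_second : (t₂ * t₁ * t₂ * e) * (t₁ * t₂ * e * t₂⁻¹) =
    t₁ * t₂ * t₁ * e * t₂ * e := by
  calc _ = t₂ * t₁ * t₂ * (e * t₁) * t₂ * e * t₂⁻¹ := by simp only [mul_assoc]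
    _ = (t₂ * t₁ * t₂ * t₁) * (e * t₂ * e) * t₂⁻¹ := by rw [h.comm₁]; simp only [mul_assoc]
    _ = t₁ * t₂ * t₁ * (t₂ * (e * t₂ * e)) * t₂⁻¹ := by rw [← h.braid]; simp only [mul_assoc]
    _ = _ := by rw [h.comm₀]; simp only [mul_assoc, mul_inv_cancel, mul_one]

theorem MonomialRelations.second_mul_first : (t₁ * t₂ * e * t₂⁻¹) * (t₂ * t₁ * t₂ * e) =
    t₁ * t₂ * t₁ * e * t₂ * e := by
  calc _ = t₁ * t₂ * (e * t₁) * t₂ * e := by simp only [mul_assoc, inv_mul_cancel_left]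
    _ = _ := by rw [h.comm₁]; simp only [mul_assoc]

theorem MonomialRelations.comm_first : t₁ * (t₂ * t₁ * t₂ * e) = (t₂ * t₁ * t₂ * e) * t₁ := by
  calc _ = (t₁ * t₂ * t₁ * t₂) * e := by simp only [mul_assoc]
    _ = t₂ * t₁ * t₂ * (t₁ * e) := by rw [h.braid]; simp only [mul_assoc]
    _ = _ := by rw [← h.comm₁]; simp only [mul_assoc]

theorem MonomialRelations.comm_prod : t₂ * (t₁ * t₂ * t₁ * e * t₂ * e) =
    (t₁ * t₂ * t₁ * e * t₂ * e) * t₂ := by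
  calc _ = (t₂ * t₁ * t₂ * t₁) * (e * t₂ * e) := by simp only [mul_assoc]
    _ = t₁ * t₂ * t₁ * (t₂ * (e * t₂ * e)) := by rw [← h.braid]; simp only [mul_assoc]
    _ = _ := by rw [h.comm₀]; simp only [mul_assoc]

theorem MonomialRelations.first_mul_prod :
    (t₂ * t₁ * t₂ * e) * (t₁ * t₂ * t₁ * e * t₂ * e) =
      t₂ * t₁ * t₂ * t₁ * (e * t₂ * e * t₁ * t₂ * e) := by
  calc _ = t₂ * t₁ * t₂ * (e * t₁) * t₂ * (t₁ * e) * t₂ * e := by simp only [mul_assoc]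
    _ = t₂ * t₁ * t₂ * t₁ * (e * t₂ * (e * t₁) * t₂ * e) := by
      rw [← h.comm₁]; nth_rw 1 [h.comm₁]; simp only [mul_assoc]
    _ = _ := by simp only [mul_assoc]

omit h in
theorem MonomialRelations.second_conj : t₂ * (t₁ * t₂ * e * t₂⁻¹) * t₂ = t₂ * t₁ * t₂ * e := by
  simp only [mul_assoc, inv_mul_cancel, mul_one]

omit h in
theorem MonomialRelations.third_conj : t₁ * (t₂ * e * t₂⁻¹ * t₁⁻¹) * t₁ = t₁ * t₂ * e * t₂⁻¹ := by
  simp only [mul_assoc, inv_mul_cancel, mul_one]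

theorem MonomialRelations.third_mul_second :
    (t₂ * e * t₂⁻¹ * t₁⁻¹) * (t₁ * t₂ * e * t₂⁻¹) = e * e := by
  calc _ = t₂ * (e * e) * t₂⁻¹ := by simp only [mul_assoc, inv_mul_cancel_left]
    _ = _ := by rw [← h.sq₂, mul_inv_cancel_right]

end GroupIdentities

section Ring
variable {A : Type*} [Ring A] [Algebra ℂ A] {q ω : ℂ}

/-- The Bernstein relation in symmetric form: if X = TYT, then TX and XT differ only by terms with
YT and TY, and these cancel against q Y T and q T Y. -/
theorem comm_of_quad {T X Y : A} (hT : T * T = (q - 1) • T + q • 1) (h : T * Y * T = X) :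
    T * (X + q • Y) = (X + q • Y) * T := by
  have h1 : T * X = (q - 1) • X + q • (Y * T) := by
    rw [← h, ← mul_assoc, ← mul_assoc, hT]
    simp only [_root_.add_mul, smul_mul_assoc, one_mul]
  have h2 : X * T = (q - 1) • X + q • (T * Y) := by
    rw [← h, mul_assoc, hT]
    simp only [_root_.mul_add, mul_smul_comm, mul_one]
  rw [_root_.mul_add, _root_.add_mul, h1, h2, mul_smul_comm, smul_mul_assoc]
  abel

/-- An operator satisfying the quadratic relation, as a unit. -/
def quadUnit (hq : q ≠ 0) (T : A) (hT : T * T = (q - 1) • T + q • 1) : Aˣ where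
  val := T
  inv := q⁻¹ • (T - (q - 1) • 1)
  val_inv := by
    rw [mul_smul_comm, _root_.mul_sub, hT, mul_smul_comm, mul_one, add_sub_cancel_left, smul_smul,
      inv_mul_cancel₀ hq, one_smul]
  inv_val := by
    rw [smul_mul_assoc, _root_.sub_mul, hT, smul_mul_assoc, one_mul, add_sub_cancel_left, smul_smul,
      inv_mul_cancel₀ hq, one_smul]

/-- An operator whose square is a nonzero scalar, as a unit. -/
def sqUnit (hω : ω ≠ 0) (E : A) (hE : E * E = ω • 1) : Aˣ where
  val := E
  inv := ω⁻¹ • E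
  val_inv := by rw [mul_smul_comm, hE, smul_smul, inv_mul_cancel₀ hω, one_smul]
  inv_val := by rw [smul_mul_assoc, hE, smul_smul, inv_mul_cancel₀ hω, one_smul]

/-- A nonzero scalar, as a unit. -/
def scalarUnit (A : Type*) [Ring A] [Algebra ℂ A] {z : ℂ} (hz : z ≠ 0) : Aˣ :=
  Units.map (algebraMap ℂ A).toMonoidHom (Units.mk0 z hz)

theorem scalarUnit_comm {z : ℂ} (hz : z ≠ 0) (x : Aˣ) :
    scalarUnit A hz * x = x * scalarUnit A hz :=
  Units.ext (Algebra.commutes z (x : A))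

variable {T₁ T₂ E : A} (hR : IwahoriRelations q ω T₁ T₂ E) (hq : q ≠ 0) (hω : ω ≠ 0)

theorem IwahoriRelations.monomial : MonomialRelations (quadUnit hq T₁ hR.quad₁)
    (quadUnit hq T₂ hR.quad₂) (sqUnit hω E hR.sq) where
  braid := Units.ext hR.braid
  comm₁ := Units.ext hR.comm₁
  sq₁ := Units.ext (by
    change E * E * T₁ = T₁ * (E * E)
    rw [hR.sq, smul_mul_assoc, mul_smul_comm, one_mul, mul_one])
  sq₂ := Units.ext (by
    change E * E * T₂ = T₂ * (E * E)
    rw [hR.sq, smul_mul_assoc, mul_smul_comm, one_mul, mul_one])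
  comm₀ := Units.ext hR.comm₀

/-- The torus generator `h T₂ T₁ T₂ E`. -/
def IwahoriRelations.torA {h : ℂ} (hh : h ≠ 0) : Aˣ :=
  scalarUnit A hh * (quadUnit hq T₂ hR.quad₂ * quadUnit hq T₁ hR.quad₁ * quadUnit hq T₂ hR.quad₂ *
    sqUnit hω E hR.sq)

/-- The torus generator `q h T₁ T₂ E T₂⁻¹`. -/
def IwahoriRelations.torB {h : ℂ} (hh : h ≠ 0) : Aˣ :=
  scalarUnit A (mul_ne_zero hq hh) * (quadUnit hq T₁ hR.quad₁ * quadUnit hq T₂ hR.quad₂ *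
    sqUnit hω E hR.sq * (quadUnit hq T₂ hR.quad₂)⁻¹)

variable {h : ℂ} (hh : h ≠ 0)

theorem IwahoriRelations.torA_mul_torB : hR.torA hq hω hh * hR.torB hq hω hh =
    scalarUnit A hh * scalarUnit A (mul_ne_zero hq hh) * (quadUnit hq T₁ hR.quad₁ *
      quadUnit hq T₂ hR.quad₂ * quadUnit hq T₁ hR.quad₁ * sqUnit hω E hR.sq *
      quadUnit hq T₂ hR.quad₂ * sqUnit hω E hR.sq) := by
  rw [← (hR.monomial hq hω).first_mul_second, torA, torB,
    Commute.mul_mul_mul_comm (scalarUnit_comm _ _).symm]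

theorem IwahoriRelations.torB_mul_torA : hR.torB hq hω hh * hR.torA hq hω hh =
    hR.torA hq hω hh * hR.torB hq hω hh := by
  rw [torA_mul_torB, ← (hR.monomial hq hω).second_mul_first, torA, torB,
    Commute.mul_mul_mul_comm (scalarUnit_comm _ _).symm, scalarUnit_comm]

theorem IwahoriRelations.torA_val : (hR.torA hq hω hh : A) = h • (T₂ * T₁ * T₂ * E) := by
  rw [Algebra.smul_def]; rfl

theorem IwahoriRelations.torAB_val : (hR.torA hq hω hh * hR.torB hq hω hh : A) =
    (q * h ^ 2) • (T₁ * T₂ * T₁ * E * T₂ * E) := by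
  rw [← Units.val_mul, torA_mul_torB, Algebra.smul_def]
  change algebraMap ℂ A h * algebraMap ℂ A (q * h) * _ = _
  rw [← map_mul]
  congr 2
  ring

/-- This form separates the word T₂T₁T₂T₁ of the longest Weyl element, on which an alternating
functional takes the sign +1, from a word that matches `whittakerElt` letter by letter. -/
theorem IwahoriRelations.torAAB_val :
    (hR.torA hq hω hh * (hR.torA hq hω hh * hR.torB hq hω hh) : A) =
    (q * h ^ 3) • (T₂ * T₁ * T₂ * T₁ * (E * T₂ * E * T₁ * T₂ * E)) := by
  have := congrArg Units.val (hR.monomial hq hω).first_mul_prod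
  rw [torAB_val, torA_val, smul_mul_smul_comm, show h * (q * h ^ 2) = q * h ^ 3 by ring]
  exact congrArg _ this

theorem IwahoriRelations.torA_comm : T₁ * hR.torA hq hω hh = hR.torA hq hω hh * T₁ := by
  rw [torA_val, mul_smul_comm, smul_mul_assoc]
  exact congrArg _ (congrArg Units.val (hR.monomial hq hω).comm_first)

theorem IwahoriRelations.torAB_comm : T₂ * (hR.torA hq hω hh * hR.torB hq hω hh) =
    (hR.torA hq hω hh * hR.torB hq hω hh) * T₂ := by
  rw [torAB_val, mul_smul_comm, smul_mul_assoc]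
  exact congrArg _ (congrArg Units.val (hR.monomial hq hω).comm_prod)

theorem IwahoriRelations.torB_val : (hR.torB hq hω hh : A) =
    (q * h) • ((quadUnit hq T₁ hR.quad₁ * quadUnit hq T₂ hR.quad₂ *
    sqUnit hω E hR.sq * (quadUnit hq T₂ hR.quad₂)⁻¹ : Aˣ) : A) := by
  rw [Algebra.smul_def]; rfl

theorem IwahoriRelations.torA_add_torB_comm : T₂ * (hR.torA hq hω hh + hR.torB hq hω hh : A) =
    (hR.torA hq hω hh + hR.torB hq hω hh : A) * T₂ := by
  have h1 := comm_of_quad hR.quad₂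
    (congrArg Units.val (MonomialRelations.second_conj (t₁ := quadUnit hq T₁ hR.quad₁)
      (t₂ := quadUnit hq T₂ hR.quad₂) (e := sqUnit hω E hR.sq)))
  have h2 : (hR.torA hq hω hh + hR.torB hq hω hh : A) = h • (T₂ * T₁ * T₂ * E +
      q • ((quadUnit hq T₁ hR.quad₁ * quadUnit hq T₂ hR.quad₂ *
    sqUnit hω E hR.sq * (quadUnit hq T₂ hR.quad₂)⁻¹ : Aˣ) : A)) := by
    rw [torA_val, torB_val, _root_.smul_add, smul_smul, mul_comm q h]
  rw [h2, mul_smul_comm, smul_mul_assoc]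
  exact congrArg _ h1

/-- With ν = q³h²ω, the element ν/b is again a word in the generators, and conjugating it by T₁ as
in `third_conj` gives back b up to a scalar. This is the input of `comm_of_quad` for T₁. -/
theorem IwahoriRelations.torB_inv_val : (q ^ 3 * h ^ 2 * ω) • ((hR.torB hq hω hh)⁻¹ : Aˣ).val =
    (q ^ 2 * h) • ((quadUnit hq T₂ hR.quad₂ * sqUnit hω E hR.sq * (quadUnit hq T₂ hR.quad₂)⁻¹ *
      (quadUnit hq T₁ hR.quad₁)⁻¹ : Aˣ) : A) := by
  have h1 := congrArg Units.val (hR.monomial hq hω).third_mul_second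
  have h2 : (sqUnit hω E hR.sq * sqUnit hω E hR.sq : Aˣ).val = ω • 1 := hR.sq
  rw [h2] at h1
  rw [← Units.mul_left_inj (hR.torB hq hω hh), smul_mul_assoc, Units.inv_mul, torB_val,
    smul_mul_smul_comm, ← Units.val_mul, h1, smul_smul]
  congr 1
  ring

theorem IwahoriRelations.torB_add_inv_comm :
    T₁ * (hR.torB hq hω hh + (q ^ 3 * h ^ 2 * ω) • ((hR.torB hq hω hh)⁻¹ : Aˣ).val : A) =
    (hR.torB hq hω hh + (q ^ 3 * h ^ 2 * ω) • ((hR.torB hq hω hh)⁻¹ : Aˣ).val : A) * T₁ := by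
  have h1 := comm_of_quad hR.quad₁
    (congrArg Units.val (MonomialRelations.third_conj (t₁ := quadUnit hq T₁ hR.quad₁)
      (t₂ := quadUnit hq T₂ hR.quad₂) (e := sqUnit hω E hR.sq)))
  have h2 : (hR.torB hq hω hh + (q ^ 3 * h ^ 2 * ω) • ((hR.torB hq hω hh)⁻¹ : Aˣ).val : A) =
      (q * h) • (((quadUnit hq T₁ hR.quad₁ * quadUnit hq T₂ hR.quad₂ *
    sqUnit hω E hR.sq * (quadUnit hq T₂ hR.quad₂)⁻¹ : Aˣ) : A) +
      q • ((quadUnit hq T₂ hR.quad₂ * sqUnit hω E hR.sq * (quadUnit hq T₂ hR.quad₂)⁻¹ *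
      (quadUnit hq T₁ hR.quad₁)⁻¹ : Aˣ) : A)) := by
    rw [torB_inv_val, torB_val, _root_.smul_add, smul_smul, show q * h * q = q ^ 2 * h by ring]
  rw [h2, mul_smul_comm, smul_mul_assoc]
  exact congrArg _ h1

end Ring

/-- The ring is the subalgebra of endomorphisms generated by a, b and their inverses; it is
commutative since the generators commute, so the eigenspace arguments can be made over a commutative
ring. -/
theorem IwahoriRelations.exists_torus.{u} {M : Type u} [AddCommGroup M] [Module ℂ M] {q ω h : ℂ}
    {T₁ T₂ E : Module.End ℂ M} (hR : IwahoriRelations q ω T₁ T₂ E) (hq : q ≠ 0) (hω : ω ≠ 0)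
    (hh : h ≠ 0) :
    ∃ (R : Type u) (_ : CommRing R) (_ : Algebra ℂ R) (_ : Module R M) (_ : IsScalarTower ℂ R M)
      (a b : Rˣ), (∀ v : M, (a : R) • v = h • (T₂ * T₁ * T₂ * E) v) ∧
      (∀ v : M, (a * b : R) • v = (q * h ^ 2) • (T₁ * T₂ * T₁ * E * T₂ * E) v) ∧
      (∀ v : M, (a ^ 2 * b) • v =
        (q * h ^ 3) • (T₂ * T₁ * T₂ * T₁ * (E * T₂ * E * T₁ * T₂ * E)) v) ∧
      TorusRelations (q ^ 3 * h ^ 2 * ω) a b T₁ T₂ := by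
  set a := hR.torA hq hω hh with ha
  set b := hR.torB hq hω hh with hb
  have hab : Commute a b := (hR.torB_mul_torA hq hω hh).symm
  have hab' : Commute (a : Module.End ℂ M) b := congrArg Units.val hab
  let s : Set (Module.End ℂ M) := {(a : Module.End ℂ M), ((a⁻¹ : (Module.End ℂ M)ˣ) : Module.End ℂ M),
    (b : Module.End ℂ M), ((b⁻¹ : (Module.End ℂ M)ˣ) : Module.End ℂ M)}
  have hs : ∀ x ∈ s, ∀ y ∈ s, x * y = y * x := by
    rintro x (rfl | rfl | rfl | rfl) y (rfl | rfl | rfl | rfl)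
    all_goals first
      | rfl
      | simp only [Units.mul_inv, Units.inv_mul]
      | exact hab'.eq
      | exact hab'.eq.symm
      | exact congrArg Units.val hab.inv_right.eq
      | exact congrArg Units.val hab.inv_right.eq.symm
      | exact congrArg Units.val hab.inv_left.eq
      | exact congrArg Units.val hab.inv_left.eq.symm
      | exact congrArg Units.val hab.inv_inv.eq
      | exact congrArg Units.val hab.inv_inv.eq.symm
  let S := Algebra.adjoin ℂ s
  have hcomm : IsMulCommutative S := Algebra.isMulCommutative_adjoin ℂ hs
  let cr : CommRing S := { S.toRing with mul_comm := hcomm.is_comm.comm }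
  have m1 : (a : Module.End ℂ M) ∈ S := Algebra.subset_adjoin (by simp [s])
  have m2 : ((a⁻¹ : (Module.End ℂ M)ˣ) : Module.End ℂ M) ∈ S := Algebra.subset_adjoin (by simp [s])
  have m3 : (b : Module.End ℂ M) ∈ S := Algebra.subset_adjoin (by simp [s])
  have m4 : ((b⁻¹ : (Module.End ℂ M)ˣ) : Module.End ℂ M) ∈ S := Algebra.subset_adjoin (by simp [s])
  let a' : Sˣ := ⟨⟨a, m1⟩, ⟨_, m2⟩, Subtype.ext a.mul_inv, Subtype.ext a.inv_mul⟩
  let b' : Sˣ := ⟨⟨b, m3⟩, ⟨_, m4⟩, Subtype.ext b.mul_inv, Subtype.ext b.inv_mul⟩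
  refine ⟨S, cr, inferInstance, inferInstance, inferInstance, a', b', ?_, ?_, ?_, ?_⟩
  · intro v
    exact LinearMap.congr_fun (hR.torA_val hq hω hh) v
  · intro v
    exact LinearMap.congr_fun (hR.torAB_val hq hω hh) v
  · intro v
    have := LinearMap.congr_fun (hR.torAAB_val hq hω hh) v
    have e : a' ^ 2 * b' = a' * (a' * b') := by rw [pow_two, mul_assoc]
    exact (congrArg (fun x : Sˣ => x • v) e).trans this
  · refine ⟨mul_ne_zero (mul_ne_zero (pow_ne_zero 3 hq) (pow_ne_zero 2 hh)) hω, ?_, ?_, ?_, ?_⟩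
    · intro v
      exact LinearMap.congr_fun (hR.torA_comm hq hω hh) v
    · intro v
      exact LinearMap.congr_fun (hR.torB_add_inv_comm hq hω hh) v
    · intro v
      exact LinearMap.congr_fun (hR.torA_add_torB_comm hq hω hh) v
    · intro v
      exact LinearMap.congr_fun (hR.torAB_comm hq hω hh) v

/-! ### Satake relations from an eigenfunctional. -/

section Symmetric

variable {R M : Type*} [CommRing R] [Algebra ℂ R] [AddCommGroup M] [Module ℂ M] [Module R M]
  [IsScalarTower ℂ R M] {ν : ℂ} {a b : Rˣ} {T₁ T₂ : Module.End ℂ M}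

local notation "ι" => algebraMap ℂ R

theorem TorusRelations.second_mem₁ (hT : TorusRelations ν a b T₁ T₂) :
    (b + ι ν * (b⁻¹ : Rˣ) : R) ∈ commutantIn R T₁ := by
  rw [← Algebra.smul_def]; exact hT.sum₁

theorem TorusRelations.first_mem₁ (hT : TorusRelations ν a b T₁ T₂) :
    (a + ι ν * (a⁻¹ : Rˣ) : R) ∈ commutantIn R T₁ :=
  Subalgebra.add_mem _ hT.comm₁
    (Subalgebra.mul_mem _ (Subalgebra.algebraMap_mem _ ν) (inv_mem_commutantIn hT.comm₁))

theorem TorusRelations.sum_mem₁ (hT : TorusRelations ν a b T₁ T₂) :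
    ((a : R) + b + ι ν * (b⁻¹ : Rˣ) + ι ν * (a⁻¹ : Rˣ)) ∈ commutantIn R T₁ := by
  have := Subalgebra.add_mem _ hT.first_mem₁ hT.second_mem₁
  convert this using 1
  ring

theorem TorusRelations.prod_mem₁ (hT : TorusRelations ν a b T₁ T₂) :
    (((a : R) + ι ν * (a⁻¹ : Rˣ)) * (b + ι ν * (b⁻¹ : Rˣ))) ∈ commutantIn R T₁ :=
  Subalgebra.mul_mem _ hT.first_mem₁ hT.second_mem₁

theorem TorusRelations.sum_mem₂ (hT : TorusRelations ν a b T₁ T₂) :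
    ((a : R) + b + ι ν * (b⁻¹ : Rˣ) + ι ν * (a⁻¹ : Rˣ)) ∈ commutantIn R T₂ := by
  have := Subalgebra.mul_mem _ hT.sum₂ (Subalgebra.add_mem _ (Subalgebra.one_mem _)
    (Subalgebra.mul_mem _ (Subalgebra.algebraMap_mem _ ν) (inv_mem_commutantIn hT.prod₂)))
  convert this using 1
  rw [mul_inv, Units.val_mul]
  linear_combination (-ι ν * (b⁻¹ : Rˣ) : R) * a.mul_inv - (ι ν * (a⁻¹ : Rˣ) : R) * b.mul_inv

/-- Expanded, the product is a symmetric expression in a and b, hence a polynomial in a + b, ab and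
(ab)⁻¹. -/
theorem TorusRelations.prod_mem₂ (hT : TorusRelations ν a b T₁ T₂) :
    (((a : R) + ι ν * (a⁻¹ : Rˣ)) * (b + ι ν * (b⁻¹ : Rˣ))) ∈ commutantIn R T₂ := by
  have hi := inv_mem_commutantIn hT.prod₂
  have hν := (commutantIn R T₂).algebraMap_mem ν
  have := Subalgebra.add_mem _ (Subalgebra.add_mem _ hT.prod₂
    (Subalgebra.mul_mem _ (Subalgebra.mul_mem _ hν hν) hi)) (Subalgebra.mul_mem _ hν
    (Subalgebra.mul_mem _ (Subalgebra.sub_mem _ (Subalgebra.mul_mem _ hT.sum₂ hT.sum₂)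
      (Subalgebra.add_mem _ hT.prod₂ hT.prod₂)) hi))
  convert this using 1
  rw [mul_inv, Units.val_mul, Units.val_mul]
  linear_combination (-ι ν * a * (b⁻¹ : Rˣ) : R) * a.mul_inv - (ι ν * b * (a⁻¹ : Rˣ) : R) * b.mul_inv

/-- The Satake relations hold for a vector as soon as invariant vectors are determined by a
functional on which the torus acts by a character. -/
theorem satakeRelations_of_functional {q : ℂ} (hT : TorusRelations ν a b T₁ T₂) {α β γ δ x y : ℂ}
    {l : M →ₗ[ℂ] ℂ} (hl : ∀ u, T₁ u = q • u → T₂ u = q • u → l u = 0 → u = 0)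
    (hx : ∀ v, l ((a : R) • v) = x * l v) (hy : ∀ v, l ((a * b : R) • v) = x * y * l v)
    (hx0 : x ≠ 0) (hy0 : y ≠ 0) {w : M} (hw₁ : T₁ w = q • w) (hw₂ : T₂ w = q • w)
    (outer : α * δ = ν) (inner : β * γ = ν)
    (hsum : α + β + γ + δ = x + y + ν / y + ν / x)
    (hprod : (α + δ) * (β + γ) = (x + ν / x) * (y + ν / y)) :
    SatakeRelations ν a b α β γ δ w := by
  have hx' : ∀ v, l (((a⁻¹ : Rˣ) : R) • v) = x⁻¹ * l v := fun v => by
    have := hx (((a⁻¹ : Rˣ) : R) • v)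
    rw [smul_smul, a.mul_inv, one_smul] at this
    rw [this, inv_mul_cancel_left₀ hx0]
  have hb : ∀ v, l ((b : R) • v) = y * l v := fun v => by
    have := hy (((a⁻¹ : Rˣ) : R) • v)
    rw [smul_smul, mul_right_comm, a.mul_inv, one_mul, hx'] at this
    rw [this]; field_simp
  have hb' : ∀ v, l (((b⁻¹ : Rˣ) : R) • v) = y⁻¹ * l v := fun v => by
    have := hb (((b⁻¹ : Rˣ) : R) • v)
    rw [smul_smul, b.mul_inv, one_smul] at this
    rw [this, inv_mul_cancel_left₀ hy0]
  -- An element z commuting with T₁ and T₂ maps w to a vector with the same T-eigenvalues, so z - c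
  -- kills w as soon as l does not see the difference.
  have key : ∀ (z : R) (c : ℂ), z ∈ commutantIn R T₁ → z ∈ commutantIn R T₂ →
      l (z • w) = c * l w → (z - ι c) • w = 0 := by
    intro z c h1 h2 h
    refine hl _ (smul_eigen (Subalgebra.sub_mem _ h1 (Subalgebra.algebraMap_mem _ c)) hw₁)
      (smul_eigen (Subalgebra.sub_mem _ h2 (Subalgebra.algebraMap_mem _ c)) hw₂) ?_
    rw [sub_smul, map_sub, h, algebraMap_smul, l.map_smul, smul_eq_mul, sub_self]
  refine ⟨outer, inner, ?_, ?_⟩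
  · rw [← map_add, ← map_add, ← map_add]
    refine key _ _ hT.sum_mem₁ hT.sum_mem₂ ?_
    rw [add_smul, add_smul, add_smul, map_add, map_add, map_add, apply_mul_smul, apply_mul_smul,
      hx, hb, hb', hx', hsum]
    field_simp
  · rw [← map_add, ← map_add, ← map_mul]
    refine key _ _ hT.prod_mem₁ hT.prod_mem₂ ?_
    rw [mul_smul, add_smul, map_add, apply_mul_smul, hx, hx', add_smul, map_add, apply_mul_smul, hb,
      hb', hprod]
    field_simp

theorem SatakeRelations.map {R' M' : Type*} [CommRing R'] [Algebra ℂ R'] [AddCommGroup M']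
    [Module ℂ M'] [Module R' M'] [IsScalarTower ℂ R' M'] {a' b' : R'ˣ} (f : M →ₗ[ℂ] M')
    (ha : ∀ v, f ((a : R) • v) = (a' : R') • f v)
    (hab : ∀ v, f ((a * b : R) • v) = (a' * b' : R') • f v) {α β γ δ : ℂ} {w : M}
    (h : SatakeRelations ν a b α β γ δ w) : SatakeRelations ν a' b' α β γ δ (f w) := by
  have hai : ∀ v, f (((a⁻¹ : Rˣ) : R) • v) = ((a'⁻¹ : R'ˣ) : R') • f v := fun v => by
    have := ha (((a⁻¹ : Rˣ) : R) • v)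
    rw [smul_smul, a.mul_inv, one_smul] at this
    rw [this, smul_smul, a'.inv_mul, one_smul]
  have hb : ∀ v, f ((b : R) • v) = (b' : R') • f v := fun v => by
    have := hab (((a⁻¹ : Rˣ) : R) • v)
    rw [smul_smul, mul_right_comm, a.mul_inv, one_mul, hai, smul_smul, mul_right_comm, a'.mul_inv,
      one_mul] at this
    exact this
  have hbi : ∀ v, f (((b⁻¹ : Rˣ) : R) • v) = ((b'⁻¹ : R'ˣ) : R') • f v := fun v => by
    have := hb (((b⁻¹ : Rˣ) : R) • v)
    rw [smul_smul, b.mul_inv, one_smul] at this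
    rw [this, smul_smul, b'.inv_mul, one_smul]
  refine ⟨h.outer, h.inner, ?_, ?_⟩
  · have := congrArg f h.sum
    simpa only [sub_smul, add_smul, mul_smul, map_sub, map_add, algebraMap_smul, f.map_smul, ha, hai,
      hb, hbi, map_zero] using this
  · have := congrArg f h.prod
    simpa only [sub_smul, add_smul, mul_smul, map_sub, map_add, algebraMap_smul, f.map_smul, ha, hai,
      hb, hbi, map_zero] using this

end Symmetric

/-! ### Decomposition of GSp₄(ℚ_p) into Borel–Iwahori double cosets. -/

section Decomposition

/-- The vanishing of the other two entries below the diagonal is forced by the symplectic relations,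
as the two middle diagonal entries are nonzero. -/
theorem mem_borel_of_entries {F : Type*} [Field F] {t : GSp4 F} (h30 : toMat t 3 0 = 0)
    (h31 : toMat t 3 1 = 0) (h32 : toMat t 3 2 = 0) (h21 : toMat t 2 1 = 0) :
    t ∈ parabolic F borelBlocks := by
  have h12 : toMat t 1 1 * toMat t 2 2 ≠ 0 := by
    obtain ⟨μ, hμ⟩ := exists_multiplier t
    have h := congrFun (congrFun hμ 1) 2
    rw [eta_four (toMat t), J_smul, J, transpose_four, mul_four, mul_four] at h
    simp [h21, h31, h32] at h
    rw [h]
    exact μ.ne_zero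
  have h1 := col_rel t 0 1 (by simp [J])
  have h2 := col_rel t 0 2 (by simp [J])
  rw [h31, h21, h30] at h1
  rw [h32, h30] at h2
  have h20 : toMat t 2 0 = 0 := by
    have : toMat t 2 0 * toMat t 1 1 = 0 := by linear_combination -h1
    exact (mul_eq_zero.mp this).resolve_right (left_ne_zero_of_mul h12)
  have h10 : toMat t 1 0 = 0 := by
    rw [h20] at h2
    have : toMat t 1 0 * toMat t 2 2 = 0 := by linear_combination h2
    exact (mul_eq_zero.mp this).resolve_right (right_ne_zero_of_mul h12)
  intro i j hij
  fin_cases i <;> fin_cases j <;> first | assumption | exact absurd hij (by decide)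

theorem bottom_row_mul_inv {F : Type*} [Field F] {g x : GSp4 F} {c : F}
    (h : ∀ i, toMat g 3 i = c * toMat x 3 i) {i : Fin 4} (hi : i ≠ 3) :
    toMat (g * x⁻¹) 3 i = 0 := by
  have h1 : toMat x * toMat x⁻¹ = 1 := by rw [← toMat_mul, mul_inv_cancel, toMat_one]
  have h2 := congrFun (congrFun h1 3) i
  rw [Matrix.one_apply_ne hi.symm, Matrix.mul_apply] at h2
  rw [toMat_mul, Matrix.mul_apply]
  simp_rw [h, mul_assoc]
  rw [← Finset.mul_sum, h2, mul_zero]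

theorem row_ne_zero {F : Type*} [Field F] (g : GSp4 F) (i : Fin 4) : ∃ j, toMat g i j ≠ 0 := by
  by_contra! h
  have h1 : toMat g * toMat g⁻¹ = 1 := by rw [← toMat_mul, mul_inv_cancel, toMat_one]
  have h2 := congrFun (congrFun h1 i) i
  rw [Matrix.mul_apply] at h2
  simp [h] at h2

variable {p : ℕ} [Fact p.Prime]

/-- Elements whose second row is `(x, 1, y, z)`. -/
def pivot1 (x y z : ℚ_[p]) : GSp4 ℚ_[p] :=
  ofMat !![1, 0, z, 0; x, 1, y, z; 0, 0, 1, 0; 0, 0, -x, 1] 1 (by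
  rw [J_smul, J, transpose_four, mul_four, mul_four]; apply lit_congr <;> simp [mul_comm])

/-- Elements whose third row is `(x, y, 1, z)`. -/
def pivot2 (x y z : ℚ_[p]) : GSp4 ℚ_[p] :=
  ofMat !![1, -z, 0, 0; 0, 1, 0, 0; x, y, 1, z; 0, x, 0, 1] 1 (by
  rw [J_smul, J, transpose_four, mul_four, mul_four]; apply lit_congr <;> simp
  ring)

/-- Elements whose last row is `(x, y, z, 1)`. -/
def pivot3 (x y z : ℚ_[p]) : GSp4 ℚ_[p] :=
  ofMat !![1, 0, 0, 0; -z, 1, 0, 0; y, 0, 1, 0; x, y, z, 1] 1 (by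
  rw [J_smul, J, transpose_four, mul_four, mul_four]; apply lit_congr <;> simp
  ring)

theorem pivot1_mem {x y z : ℚ_[p]} (hx : ‖x‖ < 1) (hy : ‖y‖ ≤ 1) (hz : ‖z‖ ≤ 1) :
    pivot1 x y z ∈ Iw p := by
  apply mem_Iw_of_lit rfl (norm_det_ofMat (by simp)) <;> simp [*]

theorem pivot2_mem {x y z : ℚ_[p]} (hx : ‖x‖ < 1) (hy : ‖y‖ < 1) (hz : ‖z‖ ≤ 1) :
    pivot2 x y z ∈ Iw p := by
  apply mem_Iw_of_lit rfl (norm_det_ofMat (by simp)) <;> simp [*]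

theorem pivot3_mem {x y z : ℚ_[p]} (hx : ‖x‖ < 1) (hy : ‖y‖ < 1) (hz : ‖z‖ < 1) :
    pivot3 x y z ∈ Iw p := by
  apply mem_Iw_of_lit rfl (norm_det_ofMat (by simp)) <;> simp [*]

/-- Representatives for the quotient of the Weyl group by the reflection in the long simple root. -/
def weylRep (p : ℕ) [Fact p.Prime] : Fin 4 → GSp4 ℚ_[p] := ![1, s1, s1 * s2, s1 * s2 * s1]

theorem exists_pivot (r : Fin 4 → ℚ_[p]) (hr : ∃ j, r j ≠ 0) :
    ∃ j, r j ≠ 0 ∧ (∀ i < j, ‖r i / r j‖ < 1) ∧ ∀ i, ‖r i / r j‖ ≤ 1 := by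
  classical
  obtain ⟨m, -, hm⟩ := Finset.exists_max_image Finset.univ (fun i => ‖r i‖) Finset.univ_nonempty
  -- The pivot is the leftmost entry of maximal norm, so that earlier entries are strictly smaller:
  -- their ratios must lie in pℤ_p to fit an Iwahori matrix.
  let S := Finset.univ.filter fun j => ‖r j‖ = ‖r m‖
  have hS : S.Nonempty := ⟨m, by simp [S]⟩
  have hj : ‖r (S.min' hS)‖ = ‖r m‖ := by
    have := S.min'_mem hS
    simpa [S] using this
  have hpos : 0 < ‖r m‖ := by
    obtain ⟨j, hj⟩ := hr
    exact (norm_pos_iff.mpr hj).trans_le (hm j (Finset.mem_univ j))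
  refine ⟨S.min' hS, norm_pos_iff.mp (hj ▸ hpos), fun i hi => ?_, fun i => ?_⟩
  · rw [norm_div, hj, div_lt_one hpos]
    refine lt_of_le_of_ne (hm i (Finset.mem_univ i)) fun h => ?_
    exact absurd (S.min'_le i (by simp [S, h])) (not_le.mpr hi)
  · rw [norm_div, hj, div_le_one hpos]
    exact hm i (Finset.mem_univ i)

theorem weylRep_mul_row (k : GSp4 ℚ_[p]) (l : Fin 4) :
    toMat (weylRep p 0 * k) 3 l = toMat k 3 l ∧ toMat (weylRep p 1 * k) 3 l = toMat k 2 l ∧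
      toMat (weylRep p 2 * k) 3 l = toMat k 1 l ∧ toMat (weylRep p 3 * k) 3 l = toMat k 0 l := by
  refine ⟨?_, ?_, ?_, ?_⟩
  · simp [weylRep]
  · change toMat (s1 * k) 3 l = _
    rw [toMat_mul, toMat_s1, Matrix.mul_apply, Fin.sum_univ_four]; simp
  · change toMat (s1 * s2 * k) 3 l = _
    rw [toMat_mul, toMat_mul, toMat_s1, toMat_s2, mul_four, Matrix.mul_apply, Fin.sum_univ_four]
    simp
  · change toMat (s1 * s2 * s1 * k) 3 l = _
    rw [toMat_mul, toMat_mul, toMat_mul, toMat_s1, toMat_s2, mul_four, mul_four, Matrix.mul_apply,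
      Fin.sum_univ_four]
    simp

/-- The bottom row determines the coset of the Klingen parabolic. Divided by its pivot, it is the
bottom row of a Weyl representative times an explicit Iwahori element, one for each pivot position.
-/
theorem exists_klingen_decomposition (g : GSp4 ℚ_[p]) :
    ∃ (i : Fin 4) (k : GSp4 ℚ_[p]), k ∈ Iw p ∧
      ∀ l, l ≠ 3 → toMat (g * (weylRep p i * k)⁻¹) 3 l = 0 := by
  obtain ⟨j, hj, hlt, hle⟩ := exists_pivot (toMat g 3) (row_ne_zero g 3)
  fin_cases j
  · refine ⟨3, klingenElt (toMat g 3 1 / toMat g 3 0) (toMat g 3 2 / toMat g 3 0)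
      (toMat g 3 3 / toMat g 3 0 - toMat g 3 1 / toMat g 3 0 * (toMat g 3 2 / toMat g 3 0)),
      klingenElt_mem (hle 1) (hle 2) (norm_sub_le_one (hle 3) (norm_mul_le_one (hle 1) (hle 2))),
      fun l => bottom_row_mul_inv (c := toMat g 3 0) fun l => ?_⟩
    replace hj : toMat g 3 0 ≠ 0 := hj
    rw [(weylRep_mul_row _ l).2.2.2, toMat_klingenElt]
    fin_cases l <;> simp <;> field_simp
  · refine ⟨2, pivot1 (toMat g 3 0 / toMat g 3 1) (toMat g 3 2 / toMat g 3 1)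
      (toMat g 3 3 / toMat g 3 1), pivot1_mem (hlt 0 (by decide)) (hle 2) (hle 3),
      fun l => bottom_row_mul_inv (c := toMat g 3 1) fun l => ?_⟩
    replace hj : toMat g 3 1 ≠ 0 := hj
    rw [(weylRep_mul_row _ l).2.2.1, pivot1, toMat_ofMat]
    fin_cases l <;> simp <;> field_simp
  · refine ⟨1, pivot2 (toMat g 3 0 / toMat g 3 2) (toMat g 3 1 / toMat g 3 2)
      (toMat g 3 3 / toMat g 3 2), pivot2_mem (hlt 0 (by decide)) (hlt 1 (by decide)) (hle 3),
      fun l => bottom_row_mul_inv (c := toMat g 3 2) fun l => ?_⟩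
    replace hj : toMat g 3 2 ≠ 0 := hj
    rw [(weylRep_mul_row _ l).2.1, pivot2, toMat_ofMat]
    fin_cases l <;> simp <;> field_simp
  · refine ⟨0, pivot3 (toMat g 3 0 / toMat g 3 3) (toMat g 3 1 / toMat g 3 3)
      (toMat g 3 2 / toMat g 3 3), pivot3_mem (hlt 0 (by decide)) (hlt 1 (by decide))
        (hlt 2 (by decide)),
      fun l => bottom_row_mul_inv (c := toMat g 3 3) fun l => ?_⟩
    replace hj : toMat g 3 3 ≠ 0 := hj
    rw [(weylRep_mul_row _ l).1, pivot3, toMat_ofMat]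
    fin_cases l <;> simp <;> field_simp

/-- What remains is the middle GL₂ block, treated by comparing the norms of the two entries of its
lower row. -/
theorem exists_borel_of_klingen (g : GSp4 ℚ_[p]) (hg : ∀ l, l ≠ 3 → toMat g 3 l = 0) :
    ∃ t ∈ parabolic ℚ_[p] borelBlocks, (∃ c : ℚ_[p], ‖c‖ < 1 ∧ g = t * m2 c) ∨
      ∃ c : ℚ_[p], ‖c‖ ≤ 1 ∧ g = t * (s2 * n2 c) := by
  have h30 := hg 0 (by decide)
  have h31 := hg 1 (by decide)
  have h32 := hg 2 (by decide)
  by_cases h : ‖toMat g 2 1‖ < ‖toMat g 2 2‖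
  · have h22 : toMat g 2 2 ≠ 0 := fun h0 => by
      rw [h0, norm_zero] at h
      exact absurd h (not_lt.mpr (norm_nonneg _))
    refine ⟨g * (m2 (toMat g 2 1 / toMat g 2 2))⁻¹, ?_, Or.inl ⟨_, ?_,
      (inv_mul_cancel_right _ _).symm⟩⟩
    · have e : toMat (m2 (toMat g 2 1 / toMat g 2 2))⁻¹ =
          !![1, 0, 0, 0; 0, 1, 0, 0; 0, -(toMat g 2 1 / toMat g 2 2), 1, 0; 0, 0, 0, 1] := by
        apply toMat_inv_eq
        rw [toMat_m2, mul_four, one_four]; apply lit_congr <;> ring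
      apply mem_borel_of_entries <;>
        rw [toMat_mul, e, Matrix.mul_apply, Fin.sum_univ_four] <;> simp [h30, h31, h32]
      field_simp
      ring
    · rw [norm_div]
      exact (div_lt_one (norm_pos_iff.mpr h22)).mpr h
  · rw [not_lt] at h
    have h21 : toMat g 2 1 ≠ 0 := fun h0 => by
      rw [h0, norm_zero] at h
      have h22 : toMat g 2 2 = 0 := norm_le_zero_iff.mp h
      obtain ⟨μ, hμ⟩ := exists_multiplier g
      have h' := congrFun (congrFun hμ 1) 2
      rw [eta_four (toMat g), J_smul, J, transpose_four, mul_four, mul_four] at h'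
      simp [h0, h31, h32, h22] at h'
      exact μ.ne_zero h'.symm
    refine ⟨g * (s2 * n2 (toMat g 2 2 / toMat g 2 1))⁻¹, ?_, Or.inr ⟨_, ?_,
      (inv_mul_cancel_right _ _).symm⟩⟩
    · have e : toMat (s2 * n2 (toMat g 2 2 / toMat g 2 1))⁻¹ =
          !![1, 0, 0, 0; 0, toMat g 2 2 / toMat g 2 1, 1, 0; 0, -1, 0, 0; 0, 0, 0, 1] := by
        apply toMat_inv_eq
        rw [toMat_mul, toMat_s2, toMat_n2, mul_four, mul_four, one_four]
        apply lit_congr <;> simp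
      apply mem_borel_of_entries <;>
        rw [toMat_mul, e, Matrix.mul_apply, Fin.sum_univ_four] <;> simp [h30, h31, h32]
      field_simp
      ring
    · rw [norm_div]
      exact (div_le_one (norm_pos_iff.mpr h21)).mpr h

theorem weylRep_mem (i : Fin 4) : weylRep p i ∈ hyperspecial p := by
  have h1 := s1_mem (p := p)
  have h2 := s2_mem (p := p)
  fin_cases i
  · exact (hyperspecial p).one_mem
  · exact h1
  · exact (hyperspecial p).mul_mem h1 h2
  · exact (hyperspecial p).mul_mem ((hyperspecial p).mul_mem h1 h2) h1

theorem weylRep_conj_m2 {c : ℚ_[p]} (hc : ‖c‖ < 1) (i : Fin 4) :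
    (weylRep p i)⁻¹ * m2 c * weylRep p i ∈ Iw p := by
  refine conj_mem_Iw (weylRep_mem i) (norm_det_ofMat (by simp)) fun i j => ?_
  fin_cases i <;> fin_cases j <;> simp [toMat_m2, hc]

theorem s1_conj_n2 (c : ℚ_[p]) : s1⁻¹ * n2 c * s1 = n14 c := by
  apply toMat_injective
  rw [toMat_mul, toMat_mul, toMat_s1_inv, toMat_s1, toMat_n2, toMat_n14, mul_four, mul_four]
  apply lit_congr <;> simp

theorem s2_conj_n14 (c : ℚ_[p]) : s2⁻¹ * n14 c * s2 = n14 c := by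
  apply toMat_injective
  rw [toMat_mul, toMat_mul, toMat_s2_inv, toMat_s2, toMat_n14, mul_four, mul_four]
  apply lit_congr <;> simp

theorem s1_conj_n14 (c : ℚ_[p]) : s1⁻¹ * n14 c * s1 = n2 c := by
  apply toMat_injective
  rw [toMat_mul, toMat_mul, toMat_s1_inv, toMat_s1, toMat_n2, toMat_n14, mul_four, mul_four]
  apply lit_congr <;> simp

/-- The representatives send the positive long simple root to a positive root, so the unipotent
factor moves past them into the Iwahori subgroup. -/
theorem weylRep_conj_n2 {c : ℚ_[p]} (hc : ‖c‖ ≤ 1) (i : Fin 4) :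
    (weylRep p i)⁻¹ * n2 c * weylRep p i ∈ Iw p := by
  fin_cases i
  · change 1⁻¹ * n2 c * 1 ∈ _
    rw [inv_one, one_mul, mul_one]
    exact n2_mem hc
  · change s1⁻¹ * n2 c * s1 ∈ _
    rw [s1_conj_n2]
    exact n14_mem hc
  · change (s1 * s2)⁻¹ * n2 c * (s1 * s2) ∈ _
    have : (s1 * s2)⁻¹ * n2 c * (s1 * s2) = s2⁻¹ * (s1⁻¹ * n2 c * s1) * s2 := by group
    rw [this, s1_conj_n2, s2_conj_n14]
    exact n14_mem hc
  · change (s1 * s2 * s1)⁻¹ * n2 c * (s1 * s2 * s1) ∈ _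
    have : (s1 * s2 * s1)⁻¹ * n2 c * (s1 * s2 * s1) =
      s1⁻¹ * (s2⁻¹ * (s1⁻¹ * n2 c * s1) * s2) * s1 := by group
    rw [this, s1_conj_n2, s2_conj_n14, s1_conj_n14]
    exact n2_mem hc

/-- Representatives of the Weyl group. -/
def weylElt (p : ℕ) [Fact p.Prime] (x : Fin 2 × Fin 4) : GSp4 ℚ_[p] :=
  ![1, s2] x.1 * weylRep p x.2

/-- The decomposition of `GSp₄(ℚ_p)` into cosets of the Borel and the Iwahori subgroup. -/
theorem exists_borel_weyl_iwahori (g : GSp4 ℚ_[p]) :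
    ∃ t ∈ parabolic ℚ_[p] borelBlocks, ∃ x, ∃ k ∈ Iw p, g = t * weylElt p x * k := by
  obtain ⟨i, k, hk, h⟩ := exists_klingen_decomposition g
  obtain ⟨t, ht, ⟨c, hc, e⟩ | ⟨c, hc, e⟩⟩ := exists_borel_of_klingen _ h
  · refine ⟨t, ht, (0, i), (weylRep p i)⁻¹ * m2 c * weylRep p i * k,
      (Iw p).mul_mem (weylRep_conj_m2 hc i) hk, ?_⟩
    rw [mul_inv_eq_iff_eq_mul] at e
    rw [e]
    change _ = t * (1 * weylRep p i) * _
    group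
  · refine ⟨t, ht, (1, i), (weylRep p i)⁻¹ * n2 c * weylRep p i * k,
      (Iw p).mul_mem (weylRep_conj_n2 hc i) hk, ?_⟩
    rw [mul_inv_eq_iff_eq_mul] at e
    rw [e]
    change _ = t * (s2 * weylRep p i) * _
    group

theorem weylElt_mem_closure (x : Fin 2 × Fin 4) :
    weylElt p x ∈ Subgroup.closure {s1, s2} := by
  have h1 : (s1 : GSp4 ℚ_[p]) ∈ Subgroup.closure {s1, s2} := Subgroup.subset_closure (by simp)
  have h2 : (s2 : GSp4 ℚ_[p]) ∈ Subgroup.closure {s1, s2} := Subgroup.subset_closure (by simp)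
  obtain ⟨i, j⟩ := x
  refine Subgroup.mul_mem _ ?_ ?_
  · fin_cases i
    · exact Subgroup.one_mem _
    · exact h2
  · fin_cases j
    · exact Subgroup.one_mem _
    · exact h1
    · exact Subgroup.mul_mem _ h1 h2
    · exact Subgroup.mul_mem _ (Subgroup.mul_mem _ h1 h2) h1

end Decomposition

/-! ### Compactness and finiteness of stabiliser quotients. -/

section Topology
variable {p : ℕ} [Fact p.Prime]

/-- The relation with a given multiplier is closed in pairs (g, μ); the group is the projection of
this compact set, which avoids expressing μ through g. -/
theorem isCompact_GSp4_padicInt : IsCompact ((GSp4 ℤ_[p] : Subgroup _) : Set (GL (Fin 4) ℤ_[p])) := by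
  let S : Set (GL (Fin 4) ℤ_[p] × ℤ_[p]ˣ) := {x |
    (x.1 : Matrix (Fin 4) (Fin 4) ℤ_[p])ᵀ * J ℤ_[p] * x.1 = (x.2 : ℤ_[p]) • J ℤ_[p]}
  have hS : IsClosed S := by
    refine isClosed_eq ?_ ?_
    · have h : Continuous fun x : GL (Fin 4) ℤ_[p] × ℤ_[p]ˣ =>
        (x.1 : Matrix (Fin 4) (Fin 4) ℤ_[p]) := Units.continuous_val.comp continuous_fst
      exact (h.matrix_transpose.matrix_mul continuous_const).matrix_mul h
    · exact (Units.continuous_val.comp continuous_snd).smul continuous_const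
  have : CompactSpace (Matrix (Fin 4) (Fin 4) ℤ_[p]) :=
    inferInstanceAs (CompactSpace (Fin 4 → Fin 4 → ℤ_[p]))
  have : T1Space (Matrix (Fin 4) (Fin 4) ℤ_[p]) :=
    inferInstanceAs (T1Space (Fin 4 → Fin 4 → ℤ_[p]))
  have : CompactSpace (GL (Fin 4) ℤ_[p]) := inferInstanceAs (CompactSpace (Matrix _ _ _)ˣ)
  have : ((GSp4 ℤ_[p] : Subgroup _) : Set (GL (Fin 4) ℤ_[p])) = Prod.fst '' S := by
    ext g
    constructor
    · rintro ⟨μ, hμ⟩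
      exact ⟨(g, μ), hμ, rfl⟩
    · rintro ⟨⟨g, μ⟩, hμ, rfl⟩
      exact ⟨μ, hμ⟩
  rw [this]
  exact hS.isCompact.image continuous_fst

theorem isCompact_hyperspecial : IsCompact (hyperspecial p : Set (GSp4 ℚ_[p])) := by
  have h : Continuous (GSp4.map (algebraMap ℤ_[p] ℚ_[p])) := by
    refine Continuous.subtype_mk ?_ _
    refine Continuous.comp (g := Matrix.GeneralLinearGroup.map (n := Fin 4)
      (algebraMap ℤ_[p] ℚ_[p])) ?_ continuous_subtype_val
    refine Continuous.units_map _ ?_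
    exact continuous_id.matrix_map continuous_subtype_val
  have := isCompact_iff_compactSpace.mp (isCompact_GSp4_padicInt (p := p))
  rw [hyperspecial, MonoidHom.coe_range]
  exact isCompact_range h

theorem finite_hyperspecial_quotient {U : Subgroup (GSp4 ℚ_[p])} (hU : IsOpen (U : Set (GSp4 ℚ_[p]))) :
    Finite (hyperspecial p ⧸ U.subgroupOf (hyperspecial p)) := by
  have := isCompact_iff_compactSpace.mp (isCompact_hyperspecial (p := p))
  exact Subgroup.quotient_finite_of_isOpen _ (hU.preimage continuous_subtype_val)

theorem finite_iwahori_quotient {U : Subgroup (GSp4 ℚ_[p])} (hU : IsOpen (U : Set (GSp4 ℚ_[p]))) :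
    Finite (Iw p ⧸ U.subgroupOf (Iw p)) := by
  have h1 : (U.subgroupOf (hyperspecial p)).FiniteIndex := by
    have := finite_hyperspecial_quotient hU
    exact Subgroup.finiteIndex_of_finite_quotient
  have h2 : U.IsFiniteRelIndex (hyperspecial p) := Subgroup.isFiniteRelIndex_iff_finiteIndex.mpr h1
  have h3 := Subgroup.isFiniteRelIndex_iff_finiteIndex.mp
    (Subgroup.isFiniteRelIndex_of_le_right U (parahoric_le_hyperspecial p borelBlocks))
  exact Subgroup.finite_quotient_of_finiteIndex

end Topology

/-! ### Intertwining maps on fixed vectors. -/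

section Equivariance
variable {p : ℕ} [Fact p.Prime] {V V' : Type*} [AddCommGroup V] [Module ℂ V] [AddCommGroup V']
  [Module ℂ V'] {ρ : Representation ℂ (GSp4 ℚ_[p]) V} {ρ' : Representation ℂ (GSp4 ℚ_[p]) V'}

/-- The map induced on fixed vectors by an intertwining map. -/
def fixedMap (φ : Representation.IntertwiningMap ρ ρ') (K : Subgroup (GSp4 ℚ_[p])) :
    fixedVectors ρ K →ₗ[ℂ] fixedVectors ρ' K :=
  (φ.toLinearMap.comp (fixedVectors ρ K).subtype).codRestrict (fixedVectors ρ' K) fun v k hk => by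
    change ρ' k (φ v.1) = φ v.1
    rw [← φ.isIntertwining, v.2 k hk]

theorem coe_fixedMap (φ : Representation.IntertwiningMap ρ ρ') (K : Subgroup (GSp4 ℚ_[p]))
    (v : fixedVectors ρ K) : (fixedMap φ K v : V') = φ v.1 := rfl

/-- By `apply_s1_heckeOp` the vector T₁u + u = (p + 1)u is fixed by `s1`, hence so is u; the same
holds for `s2`. -/
theorem apply_of_mem_closure {u : fixedVectors ρ (Iw p)} (h1 : heckeOp ρ (Iw p) s1 u = (p : ℂ) • u)
    (h2 : heckeOp ρ (Iw p) s2 u = (p : ℂ) • u) {g : GSp4 ℚ_[p]}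
    (hg : g ∈ Subgroup.closure {(s1 : GSp4 ℚ_[p]), s2}) : ρ g u.1 = u.1 := by
  have hp : (p : ℂ) + 1 ≠ 0 := by exact_mod_cast p.succ_ne_zero
  have k1 := apply_s1_heckeOp ρ u
  have k2 := apply_s2_heckeOp ρ u
  have e : (p : ℂ) • u + u = ((p : ℂ) + 1) • u := by rw [add_smul, one_smul]
  rw [h1, e, Submodule.coe_smul, map_smul] at k1
  rw [h2, e, Submodule.coe_smul, map_smul] at k2
  have k1' := smul_right_injective V hp k1
  have k2' := smul_right_injective V hp k2
  induction hg using Subgroup.closure_induction with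
  | mem x hx =>
    rcases hx with rfl | rfl
    · exact k1'
    · exact k2'
  | one => rw [map_one]; rfl
  | mul x y _ _ hx hy => rw [map_mul, Module.End.mul_apply, hy, hx]
  | inv x _ hx =>
    conv_lhs => rw [← hx]
    rw [← Module.End.mul_apply, ← map_mul, inv_mul_cancel, map_one]; rfl

variable (φ : Representation.IntertwiningMap ρ ρ')

theorem fixedMap_s1 (v : fixedVectors ρ (Iw p)) :
    fixedMap φ (Iw p) (heckeOp ρ (Iw p) s1 v) = heckeOp ρ' (Iw p) s1 (fixedMap φ (Iw p) v) := by
  apply Subtype.ext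
  rw [coe_fixedMap, heckeOp_s1, heckeOp_s1, map_sum, coe_fixedMap]
  simp only [φ.isIntertwining]

theorem fixedMap_s2 (v : fixedVectors ρ (Iw p)) :
    fixedMap φ (Iw p) (heckeOp ρ (Iw p) s2 v) = heckeOp ρ' (Iw p) s2 (fixedMap φ (Iw p) v) := by
  apply Subtype.ext
  rw [coe_fixedMap, heckeOp_s2, heckeOp_s2, map_sum, coe_fixedMap]
  simp only [φ.isIntertwining]

theorem fixedMap_eta (v : fixedVectors ρ (Iw p)) :
    fixedMap φ (Iw p) (heckeOp ρ (Iw p) (etaElt p) v) =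
      heckeOp ρ' (Iw p) (etaElt p) (fixedMap φ (Iw p) v) := by
  apply Subtype.ext
  rw [coe_fixedMap, heckeOp_eta, heckeOp_eta, coe_fixedMap, φ.isIntertwining]

end Equivariance

/-! ### Iwahori-fixed vectors in the principal series. -/

section PrincipalSeries
variable {p : ℕ} [Fact p.Prime] {χ₁ χ₂ σ : ℚ_[p] →*₀ ℂ}
  {N : Subrepresentation (rightTranslation (GSp4 ℚ_[p]))}
  (hN : ∀ f ∈ N, IsPrincipalSeriesFunction χ₁ χ₂ σ f)

theorem apply_toRepresentation (g x : GSp4 ℚ_[p]) (f : N.toSubmodule) :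
    (N.toRepresentation g f : GSp4 ℚ_[p] → ℂ) x = (f : GSp4 ℚ_[p] → ℂ) (x * g) := rfl

/-- Evaluation at a point, on Iwahori fixed vectors. -/
def evalAt (N : Subrepresentation (rightTranslation (GSp4 ℚ_[p]))) (x : GSp4 ℚ_[p]) :
    fixedVectors N.toRepresentation (Iw p) →ₗ[ℂ] ℂ where
  toFun f := (f.1 : GSp4 ℚ_[p] → ℂ) x
  map_add' _ _ := rfl
  map_smul' _ _ := rfl

theorem evalAt_apply (x : GSp4 ℚ_[p]) (f : fixedVectors N.toRepresentation (Iw p)) :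
    evalAt N x f = (f.1 : GSp4 ℚ_[p] → ℂ) x := rfl

include hN

/-- An Iwahori-fixed function is determined by its values at the eight Weyl representatives, which
bounds the dimension by 8. -/
theorem eq_zero_of_evalAt {f : fixedVectors N.toRepresentation (Iw p)}
    (h : ∀ x, evalAt N (weylElt p x) f = 0) : f = 0 := by
  apply Subtype.ext
  apply Subtype.ext
  funext g
  obtain ⟨t, ht, x, k, hk, rfl⟩ := exists_borel_weyl_iwahori g
  have h1 : (f.1 : GSp4 ℚ_[p] → ℂ) (t * weylElt p x * k) =
      (f.1 : GSp4 ℚ_[p] → ℂ) (t * weylElt p x) := by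
    rw [← apply_toRepresentation, f.2 k hk]
  change (f.1 : GSp4 ℚ_[p] → ℂ) (t * weylElt p x * k) = 0
  rw [h1, (hN _ f.1.2).1 t ht, ← evalAt_apply, h, mul_zero]

theorem finite_principalSeries : Module.Finite ℂ (fixedVectors N.toRepresentation (Iw p)) ∧
    Module.finrank ℂ (fixedVectors N.toRepresentation (Iw p)) ≤ 8 := by
  let L : fixedVectors N.toRepresentation (Iw p) →ₗ[ℂ] (Fin 2 × Fin 4 → ℂ) :=
    LinearMap.pi fun x => evalAt N (weylElt p x)
  have hL : Function.Injective L := by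
    rw [injective_iff_map_eq_zero]
    exact fun f hf => eq_zero_of_evalAt hN fun x => congrFun hf x
  refine ⟨Module.Finite.of_injective L hL, ?_⟩
  have := LinearMap.finrank_le_finrank_of_injective hL
  simpa using this

/-- Such a vector is fixed by the Weyl representatives, so its eight values all equal the value at
1. -/
theorem eq_zero_of_invariant {u : fixedVectors N.toRepresentation (Iw p)}
    (h1 : heckeOp N.toRepresentation (Iw p) s1 u = (p : ℂ) • u)
    (h2 : heckeOp N.toRepresentation (Iw p) s2 u = (p : ℂ) • u) (h : evalAt N 1 u = 0) : u = 0 := by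
  refine eq_zero_of_evalAt hN fun x => ?_
  have key := apply_of_mem_closure h1 h2 (weylElt_mem_closure x)
  have e := apply_toRepresentation (weylElt p x) 1 u.1
  rw [key, one_mul] at e
  rw [evalAt_apply, ← e, ← evalAt_apply, h]

end PrincipalSeries

section HalfPow
variable (p : ℕ) [Fact p.Prime]

theorem p_cast_pos : (0 : ℝ) < p := by exact_mod_cast (Fact.out : p.Prime).pos

theorem halfPow_ne_zero (n : ℕ) : halfPow p n ≠ 0 := by
  rw [halfPow, Complex.ofReal_ne_zero]
  exact (Real.rpow_pos_of_pos (p_cast_pos p) _).ne'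

theorem halfPow_sq (n : ℕ) : halfPow p n ^ 2 = (p : ℂ) ^ n := by
  rw [halfPow, ← Complex.ofReal_pow, ← Real.rpow_natCast, ← Real.rpow_mul (p_cast_pos p).le]
  rw [show ((n : ℝ) / 2 * ((2 : ℕ) : ℝ)) = n by push_cast; ring, Real.rpow_natCast]
  push_cast; rfl

theorem halfPow_add_three (n : ℕ) :
    halfPow p n * ((p : ℂ) ^ 3 * (((p : ℝ) ^ (-(3 / 2) : ℝ) : ℝ) : ℂ)) = halfPow p (n + 3) := by
  rw [halfPow, halfPow, ← Complex.ofReal_natCast, ← Complex.ofReal_pow, ← Complex.ofReal_mul,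
    ← Complex.ofReal_mul, ← Real.rpow_natCast, ← Real.rpow_add (p_cast_pos p),
    ← Real.rpow_add (p_cast_pos p)]
  congr 2
  push_cast
  ring

/-- This and the next two lemmas compute the modulus factor |a²b| |c|^(-3/2) at `d1`, `d2` and the
central element. -/
theorem norm_p_rpow_one : ‖(p : ℚ_[p]) ^ 2 * p‖ * ‖(p : ℚ_[p])‖ ^ (-(3 / 2) : ℝ) =
    (p : ℝ) ^ (-(3 / 2) : ℝ) := by
  have h := p_cast_pos p
  rw [norm_mul, norm_pow, Padic.norm_p, Real.inv_rpow h.le, ← Real.rpow_neg h.le, neg_neg,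
    ← pow_succ, inv_pow, ← Real.rpow_natCast, ← Real.rpow_neg h.le, ← Real.rpow_add h]
  congr 1
  push_cast
  norm_num

theorem norm_p_rpow_two : ‖((p : ℚ_[p]) ^ 2) ^ 2 * p‖ * ‖(p : ℚ_[p]) ^ 2‖ ^ (-(3 / 2) : ℝ) =
    ((p : ℝ) ^ 2)⁻¹ := by
  have h := p_cast_pos p
  rw [← pow_mul, ← pow_succ, norm_pow, norm_pow, Padic.norm_p, inv_pow, inv_pow,
    Real.inv_rpow (by positivity), ← Real.rpow_natCast, ← Real.rpow_natCast, ← Real.rpow_mul h.le,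
    ← Real.rpow_neg h.le, ← Real.rpow_neg h.le, ← Real.rpow_neg h.le, ← Real.rpow_add h]
  congr 1
  push_cast
  norm_num

theorem norm_p_rpow_central : ‖(p : ℚ_[p]) ^ 2 * p‖ * ‖(p : ℚ_[p]) ^ 2‖ ^ (-(3 / 2) : ℝ) = 1 := by
  have h := p_cast_pos p
  rw [← pow_succ, norm_pow, norm_pow, Padic.norm_p, inv_pow, inv_pow,
    Real.inv_rpow (by positivity), ← Real.rpow_natCast, ← Real.rpow_natCast, ← Real.rpow_mul h.le,
    ← Real.rpow_neg h.le, ← Real.rpow_neg h.le, ← Real.rpow_add h]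
  rw [← Real.rpow_zero (p : ℝ)]
  congr 1
  push_cast
  norm_num

end HalfPow

section Eigenvalues
variable {p : ℕ} [Fact p.Prime] {χ₁ χ₂ σ : ℚ_[p] →*₀ ℂ}
  {N : Subrepresentation (rightTranslation (GSp4 ℚ_[p]))}
  (hN : ∀ f ∈ N, IsPrincipalSeriesFunction χ₁ χ₂ σ f)

/-- Evaluation of elements of a space of functions at the identity. -/
def evalOne (N : Subrepresentation (rightTranslation (GSp4 ℚ_[p]))) : N.toSubmodule →ₗ[ℂ] ℂ where
  toFun f := (f : GSp4 ℚ_[p] → ℂ) 1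
  map_add' _ _ := rfl
  map_smul' _ _ := rfl

theorem evalOne_apply (f : N.toSubmodule) : evalOne N f = (f : GSp4 ℚ_[p] → ℂ) 1 := rfl

theorem evalAt_one (f : fixedVectors N.toRepresentation (Iw p)) : evalAt N 1 f = evalOne N f.1 := rfl

include hN

theorem evalOne_borel {g : GSp4 ℚ_[p]} (f : N.toSubmodule) {a b c d : ℚ_[p]}
    {x y z u v w : ℚ_[p]}
    (hg : toMat g = !![a, x, y, z; 0, b, u, v; 0, 0, c, w; 0, 0, 0, d]) :
    evalOne N (N.toRepresentation g f) =
      χ₁ a * χ₂ b * σ (a * d) * ((‖a ^ 2 * b‖ * ‖a * d‖ ^ (-(3 / 2) : ℝ) : ℝ) : ℂ) *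
        evalOne N f := by
  have ht : g ∈ parabolic ℚ_[p] borelBlocks := by
    apply mem_borel_of_entries <;> rw [hg] <;> rfl
  have := (hN f.1 f.2).1 g ht 1
  rw [evalOne_apply, apply_toRepresentation, one_mul]
  rw [mul_one, hg] at this
  exact this

/-- The coset representatives are upper triangular with unipotent part on the left, so evaluation at
1 sees the same scalar from each of the p³ cosets. For `d2` there are p⁴ cosets. -/
theorem evalOne_d1 (f : fixedVectors N.toRepresentation (Iw p)) :
    evalAt N 1 (heckeOp N.toRepresentation (Iw p) (d1 p) f) =
      (p : ℂ) ^ 3 * (((p : ℝ) ^ (-(3 / 2) : ℝ) : ℝ) : ℂ) * (σ p * χ₁ p * χ₂ p) * evalAt N 1 f := by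
  rw [evalAt_one, heckeOp_d1 _ (by decide) le_rfl, map_sum, evalAt_one]
  have h : ∀ x : ZMod p × ZMod p × ZMod p, evalOne N (N.toRepresentation (siegelElt (lift x.1)
      (lift x.2.1) (lift x.2.2)) (N.toRepresentation (d1 p) f.1)) =
      (((p : ℝ) ^ (-(3 / 2) : ℝ) : ℝ) : ℂ) * (σ p * χ₁ p * χ₂ p) * evalOne N f.1 := by
    intro x
    have e : toMat (siegelElt (lift x.1) (lift x.2.1) (lift x.2.2) * d1 p) =
        !![(p : ℚ_[p]), 0, lift x.2.1, lift x.2.2; 0, (p : ℚ_[p]), lift x.1, lift x.2.1;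
          0, 0, 1, 0; 0, 0, 0, 1] := by
      rw [toMat_mul, toMat_siegelElt, toMat_d1, mul_four]
      apply lit_congr <;> simp
    rw [← Module.End.mul_apply, ← map_mul, evalOne_borel hN _ e, mul_one, norm_p_rpow_one]
    ring
  rw [Finset.sum_congr rfl fun x _ => h x, Finset.sum_const, Finset.card_univ, nsmul_eq_mul]
  simp only [Fintype.card_prod, ZMod.card]
  push_cast
  ring

theorem evalOne_d2 (f : fixedVectors N.toRepresentation (Iw p)) :
    evalAt N 1 (heckeOp N.toRepresentation (Iw p) (d2 p) f) =
      (p : ℂ) ^ 2 * (σ p ^ 2 * χ₁ p ^ 2 * χ₂ p) * evalAt N 1 f := by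
  rw [evalAt_one, heckeOp_d2 _ (by decide) (by decide) le_rfl, map_sum, evalAt_one]
  have h : ∀ x : ZMod p × ZMod p × ZMod p × ZMod p, evalOne N (N.toRepresentation
      (klingenElt (lift x.1) (lift x.2.1) (lift x.2.2.1 - p * lift x.2.2.2))
      (N.toRepresentation (d2 p) f.1)) =
      ((p : ℂ) ^ 2)⁻¹ * (σ p ^ 2 * χ₁ p ^ 2 * χ₂ p) * evalOne N f.1 := by
    intro x
    generalize lift x.2.2.1 - p * lift x.2.2.2 = t
    have e : toMat (klingenElt (lift x.1) (lift x.2.1) t * d2 p) =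
        !![(p : ℚ_[p]) ^ 2, lift x.1 * p, lift x.2.1 * p, t + lift x.1 * lift x.2.1;
          0, (p : ℚ_[p]), 0, lift x.2.1; 0, 0, (p : ℚ_[p]), -lift x.1; 0, 0, 0, 1] := by
      rw [toMat_mul, toMat_klingenElt, toMat_d2, mul_four]
      apply lit_congr <;> simp
    rw [← Module.End.mul_apply, ← map_mul, evalOne_borel hN _ e, mul_one, norm_p_rpow_two, map_pow,
      map_pow]
    push_cast
    ring
  have hp : (p : ℂ) ≠ 0 := by exact_mod_cast (Fact.out : p.Prime).ne_zero
  rw [Finset.sum_congr rfl fun x _ => h x, Finset.sum_const, Finset.card_univ, nsmul_eq_mul]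
  simp only [Fintype.card_prod, ZMod.card]
  push_cast
  field_simp

theorem central_principalSeries (f : N.toSubmodule) :
    N.toRepresentation (centralP p) f = (χ₁ p * χ₂ p * σ p ^ 2) • f := by
  apply Subtype.ext
  funext g
  have hc : g * centralP p = centralP p * g := by
    apply toMat_injective
    have : toMat (centralP p) = (p : ℚ_[p]) • 1 := by
      rw [toMat_centralP, one_four]
      apply eq_of_entries <;> simp
    rw [toMat_mul, toMat_mul, this, Matrix.mul_smul, Matrix.smul_mul, Matrix.mul_one,
      Matrix.one_mul]
  have ht : centralP p ∈ parabolic ℚ_[p] borelBlocks := by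
    apply mem_borel_of_entries <;> rw [toMat_centralP] <;> rfl
  rw [apply_toRepresentation, hc]
  have := (hN f.1 f.2).1 _ ht g
  rw [toMat_centralP] at this
  refine this.trans ?_
  have e : ((‖(p : ℚ_[p]) ^ 2 * p‖ * ‖(p : ℚ_[p]) * p‖ ^ (-(3 / 2) : ℝ) : ℝ) : ℂ) = 1 := by
    rw [← sq, norm_p_rpow_central, Complex.ofReal_one]
  change χ₁ p * χ₂ p * σ ((p : ℚ_[p]) * p) *
    ((‖(p : ℚ_[p]) ^ 2 * p‖ * ‖(p : ℚ_[p]) * p‖ ^ (-(3 / 2) : ℝ) : ℝ) : ℂ) * f.1 g = _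
  rw [e, map_mul, mul_one, ← sq]
  rfl

end Eigenvalues

/-! ### Comparison of Euler factors and transfer to subquotients. -/

section Coefficients

theorem quartic_expand (a b c d : ℂ) : (1 - C a * X) * (1 - C b * X) * (1 - C c * X) * (1 - C d * X) =
    C 1 + C (-(a + b + c + d)) * X ^ 1 +
      C (a * b + a * c + a * d + b * c + b * d + c * d) * X ^ 2 +
      C (-(a * b * c + a * b * d + a * c * d + b * c * d)) * X ^ 3 + C (a * b * c * d) * X ^ 4 := by
  simp only [map_add, map_mul, map_neg, map_one]; ring

theorem coeff_quartic (e₀ e₁ e₂ e₃ e₄ : ℂ) :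
    (C e₀ + C e₁ * X ^ 1 + C e₂ * X ^ 2 + C e₃ * X ^ 3 + C e₄ * X ^ 4).coeff 1 = e₁ ∧
    (C e₀ + C e₁ * X ^ 1 + C e₂ * X ^ 2 + C e₃ * X ^ 3 + C e₄ * X ^ 4).coeff 2 = e₂ := by
  constructor <;> simp [coeff_C, coeff_X_pow]

theorem coeff_one_of_quartic_eq {a b c d a' b' c' d' : ℂ}
    (h : (1 - C a * X) * (1 - C b * X) * (1 - C c * X) * (1 - C d * X) =
      (1 - C a' * X) * (1 - C b' * X) * (1 - C c' * X) * (1 - C d' * X)) :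
    a + b + c + d = a' + b' + c' + d' := by
  rw [quartic_expand, quartic_expand] at h
  have := congrArg (fun f : ℂ[X] => f.coeff 1) h
  simp only [(coeff_quartic _ _ _ _ _).1] at this
  exact neg_injective this

theorem coeff_two_of_quartic_eq {a b c d a' b' c' d' : ℂ}
    (h : (1 - C a * X) * (1 - C b * X) * (1 - C c * X) * (1 - C d * X) =
      (1 - C a' * X) * (1 - C b' * X) * (1 - C c' * X) * (1 - C d' * X)) :
    a * b + a * c + a * d + b * c + b * d + c * d =
      a' * b' + a' * c' + a' * d' + b' * c' + b' * d' + c' * d' := by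
  rw [quartic_expand, quartic_expand] at h
  have := congrArg (fun f : ℂ[X] => f.coeff 2) h
  simpa only [(coeff_quartic _ _ _ _ _).2] using this

end Coefficients

section Subquotient
variable {p : ℕ} [Fact p.Prime] {V : Type*} [AddCommGroup V] [Module ℂ V]
  {π : Representation ℂ (GSp4 ℚ_[p]) V} {χ₁ χ₂ σ : ℚ_[p] →*₀ ℂ}

theorem isOpen_stabilizer {N : Subrepresentation (rightTranslation (GSp4 ℚ_[p]))}
    (hN : ∀ f ∈ N, IsPrincipalSeriesFunction χ₁ χ₂ σ f) (f : N.toSubmodule)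
    {U : Subgroup (GSp4 ℚ_[p])} (hU : ∀ g, g ∈ U ↔ N.toRepresentation g f = f) :
    IsOpen (U : Set (GSp4 ℚ_[p])) := by
  obtain ⟨U', hU', h⟩ := (hN f.1 f.2).2
  exact Subgroup.isOpen_mono (fun g hg => (hU g).mpr (Subtype.ext (h g hg))) hU'

/-- Averaging over finite quotients lifts Iwahori-fixed vectors, so they are a quotient of those of
the principal series. -/
theorem finite_of_subquotient (h : IsSubquotientOfPrincipalSeries π χ₁ χ₂ σ) :
    Module.Finite ℂ (fixedVectors π (Iw p)) ∧ Module.finrank ℂ (fixedVectors π (Iw p)) ≤ 8 := by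
  obtain ⟨N, hN, φ, hφ⟩ := h
  obtain ⟨hfin, hdim⟩ := finite_principalSeries hN
  have hsurj : Function.Surjective (fixedMap φ (Iw p)) := by
    intro v
    obtain ⟨f, hf⟩ := hφ v.1
    obtain ⟨f', hf', e⟩ := exists_fixed_lift φ (Iw p) f
      (fun U hU => finite_iwahori_quotient (isOpen_stabilizer hN f hU)) (hf ▸ v.2)
    exact ⟨⟨f', hf'⟩, Subtype.ext (e.trans hf)⟩
  refine ⟨Module.Finite.of_surjective _ hsurj, le_trans ?_ hdim⟩
  exact LinearMap.finrank_le_finrank_of_surjective hsurj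

theorem central_of_subquotient (h : IsSubquotientOfPrincipalSeries π χ₁ χ₂ σ) {v : V} (hv : v ≠ 0)
    {ω : ℂ} (hω : π (centralP p) v = ω • v) : ω = χ₁ p * χ₂ p * σ p ^ 2 := by
  obtain ⟨N, hN, φ, hφ⟩ := h
  obtain ⟨f, rfl⟩ := hφ v
  rw [← φ.isIntertwining, central_principalSeries hN, map_smul] at hω
  exact (smul_left_injective ℂ hv hω).symm

/-- The relations for the image of a spherical vector under an intertwining map, from an
eigenfunctional of the two Hecke operators on the source. -/
theorem satakeRelations_of_intertwining {V₀ : Type*} [AddCommGroup V₀] [Module ℂ V₀]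
    {ρ : Representation ℂ (GSp4 ℚ_[p]) V₀} (φ : Representation.IntertwiningMap ρ π)
    {l : fixedVectors ρ (Iw p) →ₗ[ℂ] ℂ} {c₁ c₂ c₃ : ℂ} (h₁ : c₁ ≠ 0) (h₂ : c₂ ≠ 0) (h₃ : c₃ ≠ 0)
    (hω : ∀ v, ρ (centralP p) v = (c₁ * c₂ * c₃ ^ 2) • v)
    (hl : ∀ u, heckeOp ρ (Iw p) s1 u = (p : ℂ) • u → heckeOp ρ (Iw p) s2 u = (p : ℂ) • u →
      l u = 0 → u = 0)
    (hd1 : ∀ u, l (heckeOp ρ (Iw p) (d1 p) u) =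
      (p : ℂ) ^ 3 * (((p : ℝ) ^ (-(3 / 2) : ℝ) : ℝ) : ℂ) * (c₃ * c₁ * c₂) * l u)
    (hd2 : ∀ u, l (heckeOp ρ (Iw p) (d2 p) u) = (p : ℂ) ^ 2 * (c₃ ^ 2 * c₁ ^ 2 * c₂) * l u)
    {f₀ : fixedVectors ρ (Iw p)} (k1 : heckeOp ρ (Iw p) s1 f₀ = (p : ℂ) • f₀)
    (k2 : heckeOp ρ (Iw p) s2 f₀ = (p : ℂ) • f₀) (r : ℕ) {R : Type*} [CommRing R] [Algebra ℂ R]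
    [Module R (fixedVectors π (Iw p))] [IsScalarTower ℂ R (fixedVectors π (Iw p))] {a b : Rˣ}
    (ha : ∀ v : fixedVectors π (Iw p), (a : R) • v = halfPow p r •
      (heckeOp π (Iw p) s2 * heckeOp π (Iw p) s1 * heckeOp π (Iw p) s2 *
        heckeOp π (Iw p) (etaElt p)) v)
    (hab : ∀ v : fixedVectors π (Iw p), (a * b : R) • v = ((p : ℂ) * halfPow p r ^ 2) •
      (heckeOp π (Iw p) s1 * heckeOp π (Iw p) s2 * heckeOp π (Iw p) s1 *
        heckeOp π (Iw p) (etaElt p) * heckeOp π (Iw p) s2 * heckeOp π (Iw p) (etaElt p)) v)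
    {α β γ δ : ℂ} (outer : α * δ = (p : ℂ) ^ (r + 3) * (c₁ * c₂ * c₃ ^ 2))
    (inner : β * γ = (p : ℂ) ^ (r + 3) * (c₁ * c₂ * c₃ ^ 2))
    (hpoly : ((1 - C c₃ * X) * (1 - C (c₃ * c₁) * X) * (1 - C (c₃ * c₂) * X) *
      (1 - C (c₃ * c₁ * c₂) * X)).comp (C (halfPow p (r + 3)) * X) =
      (1 - C α * X) * (1 - C β * X) * (1 - C γ * X) * (1 - C δ * X)) :
    SatakeRelations ((p : ℂ) ^ 3 * halfPow p r ^ 2 * (c₁ * c₂ * c₃ ^ 2)) a b α β γ δ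
      (fixedMap φ (Iw p) f₀) := by
  have hp : (p : ℂ) ≠ 0 := by exact_mod_cast (Fact.out : p.Prime).ne_zero
  have hh := halfPow_ne_zero p r
  have hh3 := halfPow_ne_zero p (r + 3)
  have hsq := halfPow_sq p r
  have hsq3 := halfPow_sq p (r + 3)
  have hνeq : (p : ℂ) ^ 3 * halfPow p r ^ 2 * (c₁ * c₂ * c₃ ^ 2) =
      (p : ℂ) ^ (r + 3) * (c₁ * c₂ * c₃ ^ 2) := by rw [hsq, pow_add]; ring
  have hR := iwahoriRelations ρ hω
  obtain ⟨R₀, _, _, _, _, a₀, b₀, ha₀, hab₀, -, hT₀⟩ := hR.exists_torus hp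
    (mul_ne_zero (mul_ne_zero h₁ h₂) (pow_ne_zero 2 h₃)) hh
  have hpoly' : (1 - C (c₃ * halfPow p (r + 3)) * X) * (1 - C (c₃ * c₁ * halfPow p (r + 3)) * X) *
      (1 - C (c₃ * c₂ * halfPow p (r + 3)) * X) *
      (1 - C (c₃ * c₁ * c₂ * halfPow p (r + 3)) * X) =
      (1 - C α * X) * (1 - C β * X) * (1 - C γ * X) * (1 - C δ * X) := by
    rw [← hpoly]
    simp only [mul_comp, sub_comp, one_comp, C_comp, X_comp, map_mul]
    ring
  have hs1 := coeff_one_of_quartic_eq hpoly'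
  have hs2 := coeff_two_of_quartic_eq hpoly'
  have hS₀ : SatakeRelations ((p : ℂ) ^ 3 * halfPow p r ^ 2 * (c₁ * c₂ * c₃ ^ 2)) a₀ b₀
      α β γ δ f₀ := by
    -- The eigenvalues x and y of a and b, together with ν/y and ν/x, are the four reciprocal roots
    -- of the rescaled Euler factor.
    refine satakeRelations_of_functional hT₀ (l := l)
      (x := halfPow p (r + 3) * (c₃ * c₁ * c₂)) (y := halfPow p (r + 3) * (c₃ * c₁))
      hl ?_ ?_ (mul_ne_zero hh3 (mul_ne_zero (mul_ne_zero h₃ h₁) h₂))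
      (mul_ne_zero hh3 (mul_ne_zero h₃ h₁)) k1 k2 (outer.trans hνeq.symm) (inner.trans hνeq.symm)
      ?_ ?_
    · intro v
      rw [ha₀, ← heckeOp_iwahori_d1, l.map_smul, hd1, smul_eq_mul, ← halfPow_add_three]
      ring
    · intro v
      rw [hab₀, ← heckeOp_iwahori_d2, l.map_smul, hd2, smul_eq_mul]
      have : (p : ℂ) * halfPow p r ^ 2 * (p : ℂ) ^ 2 = halfPow p (r + 3) ^ 2 := by
        rw [hsq, hsq3, pow_add]; ring
      linear_combination (c₃ ^ 2 * c₁ ^ 2 * c₂ * l v) * this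
    · rw [hνeq, ← hsq3, ← hs1]
      field_simp
      ring
    · rw [hνeq, ← hsq3]
      rw [← hsq3] at outer inner
      have o : halfPow p (r + 3) ^ 2 * (c₁ * c₂ * c₃ ^ 2) /
          (halfPow p (r + 3) * (c₃ * c₁ * c₂)) = c₃ * halfPow p (r + 3) := by
        field_simp
      have i : halfPow p (r + 3) ^ 2 * (c₁ * c₂ * c₃ ^ 2) /
          (halfPow p (r + 3) * (c₃ * c₁)) = c₃ * c₂ * halfPow p (r + 3) := by
        field_simp
      rw [o, i]
      -- (α + δ)(β + γ) is the second elementary symmetric function minus αδ and βγ, all of which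
      -- are known.
      linear_combination -hs2 - outer - inner
  exact SatakeRelations.map (fixedMap φ (Iw p)) (a' := a) (b' := b) (fun v => by
    rw [ha₀, ha, (fixedMap φ (Iw p)).map_smul]
    simp only [Module.End.mul_apply, fixedMap_s1, fixedMap_s2, fixedMap_eta]) (fun v => by
    rw [hab₀, hab, (fixedMap φ (Iw p)).map_smul]
    simp only [Module.End.mul_apply, fixedMap_s1, fixedMap_s2, fixedMap_eta]) hS₀

/-- The spherical vector is lifted to the principal series, where evaluation at 1 is an
eigenfunctional, and the relations are pushed forward. -/
theorem satakeRelations_of_subquotient (h : IsSubquotientOfPrincipalSeries π χ₁ χ₂ σ)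
    (w : fixedVectors π (hyperspecial p)) (r : ℕ) {R : Type*} [CommRing R] [Algebra ℂ R]
    [Module R (fixedVectors π (Iw p))] [IsScalarTower ℂ R (fixedVectors π (Iw p))] {a b : Rˣ}
    (ha : ∀ v : fixedVectors π (Iw p), (a : R) • v = halfPow p r •
      (heckeOp π (Iw p) s2 * heckeOp π (Iw p) s1 * heckeOp π (Iw p) s2 *
        heckeOp π (Iw p) (etaElt p)) v)
    (hab : ∀ v : fixedVectors π (Iw p), (a * b : R) • v = ((p : ℂ) * halfPow p r ^ 2) •
      (heckeOp π (Iw p) s1 * heckeOp π (Iw p) s2 * heckeOp π (Iw p) s1 *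
        heckeOp π (Iw p) (etaElt p) * heckeOp π (Iw p) s2 * heckeOp π (Iw p) (etaElt p)) v)
    {α β γ δ : ℂ} (outer : α * δ = (p : ℂ) ^ (r + 3) * (χ₁ p * χ₂ p * σ p ^ 2))
    (inner : β * γ = (p : ℂ) ^ (r + 3) * (χ₁ p * χ₂ p * σ p ^ 2))
    (hpoly : ((1 - C (σ p) * X) * (1 - C (σ p * χ₁ p) * X) * (1 - C (σ p * χ₂ p) * X) *
      (1 - C (σ p * χ₁ p * χ₂ p) * X)).comp (C (halfPow p (r + 3)) * X) =
      (1 - C α * X) * (1 - C β * X) * (1 - C γ * X) * (1 - C δ * X)) :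
    SatakeRelations ((p : ℂ) ^ 3 * halfPow p r ^ 2 * (χ₁ p * χ₂ p * σ p ^ 2)) a b α β γ δ
      (fixedInclusion π (parahoric_le_hyperspecial p borelBlocks) w) := by
  obtain ⟨N, hN, φ, hφ⟩ := h
  have hpp : (p : ℚ_[p]) ≠ 0 := p_ne_zero
  obtain ⟨f, hf⟩ := hφ w.1
  obtain ⟨f', hf', e⟩ := exists_fixed_lift φ (hyperspecial p) f
    (fun U hU => finite_hyperspecial_quotient (isOpen_stabilizer hN f hU)) (hf ▸ w.2)
  have hφf : fixedMap φ (Iw p) (fixedInclusion N.toRepresentation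
      (parahoric_le_hyperspecial p borelBlocks) ⟨f', hf'⟩) =
      fixedInclusion π (parahoric_le_hyperspecial p borelBlocks) w := by
    apply Subtype.ext
    rw [coe_fixedMap, coe_fixedInclusion, coe_fixedInclusion]
    exact e.trans hf
  rw [← hφf]
  exact satakeRelations_of_intertwining φ ((map_ne_zero χ₁).mpr hpp) ((map_ne_zero χ₂).mpr hpp)
    ((map_ne_zero σ).mpr hpp) (central_principalSeries hN) (fun _ => eq_zero_of_invariant hN)
    (evalOne_d1 hN) (evalOne_d2 hN)
    (heckeOp_s1_eq_smul _ (by rw [coe_fixedInclusion]; exact hf' _ s1_mem))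
    (heckeOp_s2_eq_smul _ (by rw [coe_fixedInclusion]; exact hf' _ s2_mem)) r ha hab outer inner
    hpoly

end Subquotient

/-! ### Sums of the additive character over residue classes. -/

section AdditiveCharacter
variable {p : ℕ} [Fact p.Prime] {ψ : AddChar ℚ_[p] ℂ}

/-- The norm is discrete, so ‖c‖ ≥ p, and dividing an element of p⁻¹ℤ_p by c gives an integer. -/
theorem IsUnramifiedAddChar.exists_ne_one (hψ : IsUnramifiedAddChar ψ) {c : ℚ_[p]} (hc : 1 < ‖c‖) :
    ∃ y, ‖y‖ ≤ 1 ∧ ψ (c * y) ≠ 1 := by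
  obtain ⟨x, hx, h⟩ := hψ.2
  have hc0 : c ≠ 0 := fun h0 => by rw [h0, norm_zero] at hc; linarith
  have hcp : (p : ℝ) ≤ ‖c‖ := by
    by_contra! hlt
    have := (Padic.norm_le_pow_iff_norm_lt_pow_add_one c 0).mpr (by simpa using hlt)
    rw [_root_.zpow_zero] at this
    linarith
  refine ⟨x / c, ?_, by rwa [mul_div_cancel₀ _ hc0]⟩
  rw [norm_div]
  exact div_le_one_of_le₀ (hx.trans hcp) (norm_nonneg _)

theorem IsUnramifiedAddChar.map_eq_of_near (hψ : IsUnramifiedAddChar ψ) {c : ℚ_[p]} (hc : ‖c‖ ≤ p)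
    {a b : ℚ_[p]} (hab : ‖a - b‖ < 1) : ψ (c * a) = ψ (c * b) := by
  have h1 : ‖c * (a - b)‖ ≤ 1 := by
    have h2 : ‖a - b‖ ≤ (p : ℝ)⁻¹ := by
      have := (Padic.norm_le_pow_iff_norm_lt_pow_add_one (a - b) (-1)).mpr (by simpa using hab)
      rwa [_root_.zpow_neg_one] at this
    rw [norm_mul]
    calc ‖c‖ * ‖a - b‖ ≤ p * (p : ℝ)⁻¹ := mul_le_mul hc h2 (norm_nonneg _) (p_cast_pos p).le
      _ = 1 := mul_inv_cancel₀ (p_cast_pos p).ne'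
  rw [← sub_add_cancel (c * a) (c * b), ← _root_.mul_sub, AddChar.map_add_eq_mul, hψ.1 _ h1, one_mul]

/-- The full sum of a nontrivial character of ℤ/p is 0, the class of 0 contributes 1, and inversion
permutes the nonzero classes. -/
theorem IsUnramifiedAddChar.sum_eq_neg_one (hψ : IsUnramifiedAddChar ψ) {c : ℚ_[p]} (hc : ‖c‖ = p) :
    ∑ x ∈ Finset.univ.erase (0 : ZMod p), ψ (c * (lift x)⁻¹) = -1 := by
  have h1 : 1 < ‖c‖ := by rw [hc]; exact_mod_cast (Fact.out : p.Prime).one_lt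
  obtain ⟨e, he, hne⟩ := hψ.exists_ne_one h1
  have hF : ∀ a b : ℚ_[p], ‖a‖ ≤ 1 → ‖b‖ ≤ 1 → ‖a - b‖ < 1 → ψ (c * a) = ψ (c * b) :=
    fun a b _ _ hab => hψ.map_eq_of_near hc.le hab
  have h2 := sum_add_const (fun x => ψ (c * x)) hF he
  simp only [_root_.mul_add, AddChar.map_add_eq_mul] at h2
  rw [← Finset.sum_mul] at h2
  have h3 : ∑ x : ZMod p, ψ (c * lift x) = 0 := by
    have : (∑ x : ZMod p, ψ (c * lift x)) * (ψ (c * e) - 1) = 0 := by rw [_root_.mul_sub, h2]; ring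
    exact (mul_eq_zero.mp this).resolve_right (sub_ne_zero.mpr hne)
  have h4 := sum_inv_lift (fun x => ψ (c * x)) hF
  rw [h3, sum_eq_add_ne_zero, lift_zero, _root_.inv_zero, mul_zero, AddChar.map_zero_eq_one] at h4
  linear_combination h4

end AdditiveCharacter

/-! ### Conjugation of root subgroups and the evaluation point `whittakerElt`. -/

section Semiconj
variable {R : Type*} [CommRing R] {p : ℕ} [Fact p.Prime]

theorem s1_semiconj_n13 (z : R) : SemiconjBy (s1 : GSp4 R) (n13 z) (n13 z) := by
  apply toMat_injective
  rw [toMat_mul, toMat_mul, toMat_s1, toMat_n13, mul_four, mul_four]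
  apply lit_congr <;> simp

theorem s2_semiconj_n13 (z : R) : SemiconjBy (s2 : GSp4 R) (n13 z) (n1 (-z)) := by
  apply toMat_injective
  rw [toMat_mul, toMat_mul, toMat_s2, toMat_n13, toMat_n1, mul_four, mul_four]
  apply lit_congr <;> simp

theorem s1_semiconj_n14 (z : R) : SemiconjBy (s1 : GSp4 R) (n14 z) (n2 z) := by
  apply toMat_injective
  rw [toMat_mul, toMat_mul, toMat_s1, toMat_n14, toMat_n2, mul_four, mul_four]
  apply lit_congr <;> simp

theorem s2_semiconj_n14 (z : R) : SemiconjBy (s2 : GSp4 R) (n14 z) (n14 z) := by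
  apply toMat_injective
  rw [toMat_mul, toMat_mul, toMat_s2, toMat_n14, mul_four, mul_four]
  apply lit_congr <;> simp

theorem s2_semiconj_n2 (z : R) : SemiconjBy (s2 : GSp4 R) (n2 z) (m2 (-z)) := by
  apply toMat_injective
  rw [toMat_mul, toMat_mul, toMat_s2, toMat_n2, toMat_m2, mul_four, mul_four]
  apply lit_congr <;> simp

theorem s1_semiconj_n1 (z : R) : SemiconjBy (s1 : GSp4 R) (n1 z) (m1 z) := by
  apply toMat_injective
  rw [toMat_mul, toMat_mul, toMat_s1, toMat_n1, toMat_m1, mul_four, mul_four]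
  apply lit_congr <;> simp

theorem eta_semiconj_n1 (z : ℚ_[p]) : SemiconjBy (etaElt p) (n1 z) (n1 (-z)) := by
  apply toMat_injective
  rw [toMat_mul, toMat_mul, toMat_etaElt, toMat_n1, toMat_n1, mul_four, mul_four]
  apply lit_congr <;> simp [mul_comm]

theorem eta_semiconj_m1 (z : ℚ_[p]) : SemiconjBy (etaElt p) (m1 z) (m1 (-z)) := by
  apply toMat_injective
  rw [toMat_mul, toMat_mul, toMat_etaElt, toMat_m1, toMat_m1, mul_four, mul_four]
  apply lit_congr <;> simp [mul_comm]

theorem eta_semiconj_m2 (z : ℚ_[p]) : SemiconjBy (etaElt p) (m2 z) (n14 (z / p)) := by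
  have := p_ne_zero (p := p)
  apply toMat_injective
  rw [toMat_mul, toMat_mul, toMat_etaElt, toMat_m2, toMat_n14, mul_four, mul_four]
  apply lit_congr <;> simp [this]

theorem eta_semiconj_n14 (z : ℚ_[p]) : SemiconjBy (etaElt p) (n14 z) (m2 (p * z)) := by
  apply toMat_injective
  rw [toMat_mul, toMat_mul, toMat_etaElt, toMat_m2, toMat_n14, mul_four, mul_four]
  apply lit_congr <;> simp

theorem eta_s2_semiconj_m1 (z : ℚ_[p]) : SemiconjBy (etaElt p * s2) (m1 z) (n13 (z / p)) := by
  have := p_ne_zero (p := p)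
  apply toMat_injective
  simp only [toMat_mul, toMat_etaElt, toMat_m1, toMat_s2, toMat_n13, mul_four]
  apply lit_congr <;> simp [this]

theorem eta_s2_s1_semiconj_m2 (z : ℚ_[p]) :
    SemiconjBy (etaElt p * s2 * s1) (m2 z) (n2 (z / p)) := by
  have := p_ne_zero (p := p)
  apply toMat_injective
  simp only [toMat_mul, toMat_etaElt, toMat_m2, toMat_s2, toMat_n2, toMat_s1, mul_four]
  apply lit_congr <;> simp [this]

/-- The element of the extended affine Weyl group at which Whittaker functions are evaluated to get
the functional on Iwahori fixed vectors alternating under the finite Hecke algebra. -/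
def whittakerElt (p : ℕ) [Fact p.Prime] : GSp4 ℚ_[p] :=
  etaElt p * s2 * s1 * etaElt p * s2 * etaElt p

/-- The evaluation point turns both negative simple root subgroups into positive ones scaled by
±1/p, so the generic character becomes nontrivial on ℤ_p but trivial on pℤ_p. -/
theorem whittakerElt_semiconj_m1 (z : ℚ_[p]) :
    SemiconjBy (whittakerElt p) (m1 z) (n1 (-(1 / p) * z)) := by
  have h := ((((eta_semiconj_n1 _).mul_left (s2_semiconj_n13 (-z / p))).mul_left
    (s1_semiconj_n13 _)).mul_left
    (eta_s2_semiconj_m1 (-z))).mul_left (eta_semiconj_m1 z)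
  rw [show -(1 / (p : ℚ_[p])) * z = - -(-z / p) by ring]
  simpa only [whittakerElt, mul_assoc] using h

theorem whittakerElt_semiconj_m2 (z : ℚ_[p]) :
    SemiconjBy (whittakerElt p) (m2 z) (n2 (1 / p * z)) := by
  have hp := p_ne_zero (p := p)
  have h := (((eta_s2_s1_semiconj_m2 _).mul_left (eta_semiconj_n14 _)).mul_left
    (s2_semiconj_n14 _)).mul_left (eta_semiconj_m2 z)
  rw [mul_div_cancel₀ z hp] at h
  rw [one_div_mul_eq_div]
  exact h

theorem eta_chain_semiconj_m2 (z : ℚ_[p]) :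
    SemiconjBy (etaElt p * s2 * s1 * etaElt p) (m2 z) (n14 (-(z / p) / p)) := by
  have h := (((eta_semiconj_m2 _).mul_left (s2_semiconj_n2 _)).mul_left
    (s1_semiconj_n14 _)).mul_left (eta_semiconj_m2 z)
  exact h

end Semiconj

section Unipotent
variable {R : Type*} [CommRing R]

theorem isUpperUnipotent_of_lit {g : GSp4 R} {a01 a02 a03 a12 a13 a23 : R}
    (hg : toMat g = !![1, a01, a02, a03; 0, 1, a12, a13; 0, 0, 1, a23; 0, 0, 0, 1]) :
    IsUpperUnipotent g := by
  refine ⟨fun i j hij => ?_, fun i => ?_⟩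
  · rw [hg]; revert hij
    fin_cases i <;> fin_cases j <;> simp [borelBlocks]
  · rw [hg]; fin_cases i <;> rfl

end Unipotent

/-! ### The alternating Whittaker functional on Iwahori-fixed vectors. -/

section WhittakerFunctions
variable {p : ℕ} [Fact p.Prime] {ψ : AddChar ℚ_[p] ℂ} {f : GSp4 ℚ_[p] → ℂ}

theorem IsWhittakerFunction.n1_mul (hf : IsWhittakerFunction ψ f) (x : ℚ_[p]) (g : GSp4 ℚ_[p]) :
    f (n1 x * g) = ψ x * f g := by
  rw [hf.1 _ (isUpperUnipotent_of_lit (toMat_n1 x))]; simp [toMat_n1]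

theorem IsWhittakerFunction.n2_mul (hf : IsWhittakerFunction ψ f) (x : ℚ_[p]) (g : GSp4 ℚ_[p]) :
    f (n2 x * g) = ψ x * f g := by
  rw [hf.1 _ (isUpperUnipotent_of_lit (toMat_n2 x))]; simp [toMat_n2]

theorem IsWhittakerFunction.n13_mul (hf : IsWhittakerFunction ψ f) (x : ℚ_[p]) (g : GSp4 ℚ_[p]) :
    f (n13 x * g) = f g := by
  rw [hf.1 _ (isUpperUnipotent_of_lit (toMat_n13 x))]; simp [toMat_n13]

theorem IsWhittakerFunction.n14_mul (hf : IsWhittakerFunction ψ f) (x : ℚ_[p]) (g : GSp4 ℚ_[p]) :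
    f (n14 x * g) = f g := by
  rw [hf.1 _ (isUpperUnipotent_of_lit (toMat_n14 x))]; simp [toMat_n14]

end WhittakerFunctions

section WhittakerModel
variable {p : ℕ} [Fact p.Prime] {ψ : AddChar ℚ_[p] ℂ} {V : Type*} [AddCommGroup V] [Module ℂ V]
  {π : Representation ℂ (GSp4 ℚ_[p]) V}
  (W : Representation.IntertwiningMap π (rightTranslation (GSp4 ℚ_[p])))

theorem whittaker_apply (g x : GSp4 ℚ_[p]) (v : V) : W (π x v) g = W v (g * x) := by
  rw [W.isIntertwining]; rfl

/-- Evaluation of Whittaker functions at `g`, on Iwahori fixed vectors. -/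
def whittakerAt (g : GSp4 ℚ_[p]) : fixedVectors π (Iw p) →ₗ[ℂ] ℂ where
  toFun v := W (v : V) g
  map_add' v v' := by
    rw [Submodule.coe_add, map_add]; rfl
  map_smul' c v := by
    rw [Submodule.coe_smul, map_smul]; rfl

theorem whittakerAt_apply (g : GSp4 ℚ_[p]) (v : fixedVectors π (Iw p)) :
    whittakerAt W g v = W (v : V) g := rfl

theorem whittaker_sum {ι : Type*} (s : Finset ι) (F : ι → V) (g : GSp4 ℚ_[p]) :
    W (∑ i ∈ s, F i) g = ∑ i ∈ s, W (F i) g := by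
  rw [map_sum, Finset.sum_apply]

/-- For a nonzero class x, the Bruhat relation replaces the coset of n₁(x)s₁ by that of m₁(x⁻¹),
which g carries to the left as a value of ψ. -/
theorem whittakerAt_s1 {g : GSp4 ℚ_[p]} {c : ℚ_[p]}
    (hg : ∀ y v, W v (g * m1 y) = ψ (c * y) * W v g) (v : fixedVectors π (Iw p)) :
    whittakerAt W g (heckeOp π (Iw p) s1 v) = whittakerAt W (g * s1) v +
      (∑ x ∈ Finset.univ.erase (0 : ZMod p), ψ (c * (lift x)⁻¹)) * whittakerAt W g v := by
  rw [whittakerAt_apply, heckeOp_s1', whittaker_sum, sum_eq_add_ne_zero, lift_zero, n1_zero, one_mul,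
    whittaker_apply, Finset.sum_mul]
  congr 1
  refine Finset.sum_congr rfl fun x hx => ?_
  have hx1 := norm_lift_of_ne_zero (Finset.ne_of_mem_erase hx)
  have h := apply_m1 π v (x := (lift x)⁻¹) (by rw [norm_inv, hx1, inv_one]) 1
  rw [inv_inv, one_mul, one_mul] at h
  rw [← h, whittaker_apply, hg]
  rfl

theorem whittakerAt_s2 {g : GSp4 ℚ_[p]} {c : ℚ_[p]}
    (hg : ∀ y v, W v (g * m2 y) = ψ (c * y) * W v g) (v : fixedVectors π (Iw p)) :
    whittakerAt W g (heckeOp π (Iw p) s2 v) = whittakerAt W (g * s2) v +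
      (∑ x ∈ Finset.univ.erase (0 : ZMod p), ψ (c * (lift x)⁻¹)) * whittakerAt W g v := by
  rw [whittakerAt_apply, heckeOp_s2', whittaker_sum, sum_eq_add_ne_zero, lift_zero, n2_zero, one_mul,
    whittaker_apply, Finset.sum_mul]
  congr 1
  refine Finset.sum_congr rfl fun x hx => ?_
  have hx1 := norm_lift_of_ne_zero (Finset.ne_of_mem_erase hx)
  have h := apply_m2 π v (x := (lift x)⁻¹) (by rw [norm_inv, hx1, inv_one]) 1
  rw [inv_inv, one_mul, one_mul] at h
  rw [← h, whittaker_apply, hg]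
  rfl

theorem sum_psi_zero : ∑ x ∈ Finset.univ.erase (0 : ZMod p), ψ (0 * (lift x)⁻¹) = (p : ℂ) - 1 := by
  simp only [zero_mul, AddChar.map_zero_eq_one, Finset.sum_const, nsmul_eq_mul, mul_one]
  rw [Finset.card_erase_of_mem (Finset.mem_univ _), Finset.card_univ, ZMod.card,
    Nat.cast_sub (Fact.out : p.Prime).one_le, Nat.cast_one]

/-- Here the character sum is p - 1; applying the formula to T₁v and using the quadratic relation
leaves p times the value at g. In this way one letter of the evaluation point is removed together
with one Hecke operator. -/
theorem whittakerAt_mul_s1 {g : GSp4 ℚ_[p]} (hg : ∀ y v, W v (g * m1 y) = W v g)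
    (v : fixedVectors π (Iw p)) :
    whittakerAt W (g * s1) (heckeOp π (Iw p) s1 v) = p * whittakerAt W g v := by
  have hg' : ∀ y v, W v (g * m1 y) = (1 : AddChar ℚ_[p] ℂ) (0 * y) * W v g := fun y v => by
    rw [AddChar.one_apply, one_mul, hg]
  have h2 := whittakerAt_s1 W hg' (heckeOp π (Iw p) s1 v)
  have h3 := congrArg (whittakerAt W g) (LinearMap.congr_fun (heckeOp_s1_quad π) v)
  simp only [Module.End.mul_apply, LinearMap.add_apply, LinearMap.smul_apply, Module.End.one_apply,
    map_add, map_smul, smul_eq_mul] at h3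
  rw [sum_psi_zero] at h2
  linear_combination h3 - h2

theorem whittakerAt_mul_s2 {g : GSp4 ℚ_[p]} (hg : ∀ y v, W v (g * m2 y) = W v g)
    (v : fixedVectors π (Iw p)) :
    whittakerAt W (g * s2) (heckeOp π (Iw p) s2 v) = p * whittakerAt W g v := by
  have hg' : ∀ y v, W v (g * m2 y) = (1 : AddChar ℚ_[p] ℂ) (0 * y) * W v g := fun y v => by
    rw [AddChar.one_apply, one_mul, hg]
  have h2 := whittakerAt_s2 W hg' (heckeOp π (Iw p) s2 v)
  have h3 := congrArg (whittakerAt W g) (LinearMap.congr_fun (heckeOp_s2_quad π) v)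
  simp only [Module.End.mul_apply, LinearMap.add_apply, LinearMap.smul_apply, Module.End.one_apply,
    map_add, map_smul, smul_eq_mul] at h3
  rw [sum_psi_zero] at h2
  linear_combination h3 - h2

theorem whittakerAt_mul_eta {ω : ℂ} (hω : ∀ v, π (centralP p) v = ω • v) (g : GSp4 ℚ_[p])
    (v : fixedVectors π (Iw p)) :
    whittakerAt W (g * etaElt p) (heckeOp π (Iw p) (etaElt p) v) = ω * whittakerAt W g v := by
  rw [whittakerAt_apply, heckeOp_eta, whittaker_apply, mul_assoc, etaElt_sq, ← whittaker_apply, hω,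
    map_smul]
  rfl

variable {W} (hψ : IsUnramifiedAddChar ψ) (hW : ∀ v, IsWhittakerFunction ψ (W v))
include hψ hW

/-- The character sum in `whittakerAt_s1` is -1, and the other term vanishes. -/
theorem whittakerAt_alternating_s1 (v : fixedVectors π (Iw p)) :
    whittakerAt W (whittakerElt p) (heckeOp π (Iw p) s1 v) = -whittakerAt W (whittakerElt p) v := by
  have hc : ‖-(1 / (p : ℚ_[p]))‖ = p := by simp
  have hg : ∀ y v, W v (whittakerElt p * m1 y) = ψ (-(1 / p) * y) * W v (whittakerElt p) :=
    fun y v => by rw [(whittakerElt_semiconj_m1 y).eq, (hW v).n1_mul]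
  obtain ⟨y, hy, hne⟩ := hψ.exists_ne_one (c := -(1 / (p : ℚ_[p])))
    (by rw [hc]; exact_mod_cast (Fact.out : p.Prime).one_lt)
  -- Invariance of v under n₁(y), moved past `s1` and the evaluation point, multiplies the value by
  -- some ψ(-y/p) ≠ 1.
  have h0 : W (v : V) (whittakerElt p * s1) = 0 := by
    have h1 : W (v : V) (whittakerElt p * s1) =
        ψ (-(1 / p) * y) * W (v : V) (whittakerElt p * s1) := by
      conv_lhs => rw [← v.2 _ (n1_mem hy), whittaker_apply, mul_assoc, (s1_semiconj_n1 y).eq,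
        ← mul_assoc, ← whittaker_apply, hg, whittaker_apply]
    have h2 : (1 - ψ (-(1 / p) * y)) * W (v : V) (whittakerElt p * s1) = 0 := by
      linear_combination h1
    exact (mul_eq_zero.mp h2).resolve_left (sub_ne_zero.mpr hne.symm)
  rw [whittakerAt_s1 W hg, hψ.sum_eq_neg_one hc, whittakerAt_apply W _ v, h0]
  ring_nf

theorem whittakerAt_alternating_s2 (v : fixedVectors π (Iw p)) :
    whittakerAt W (whittakerElt p) (heckeOp π (Iw p) s2 v) = -whittakerAt W (whittakerElt p) v := by
  have hc : ‖1 / (p : ℚ_[p])‖ = p := by simp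
  have hg : ∀ y v, W v (whittakerElt p * m2 y) = ψ (1 / p * y) * W v (whittakerElt p) :=
    fun y v => by rw [(whittakerElt_semiconj_m2 y).eq, (hW v).n2_mul]
  obtain ⟨y, hy, hne⟩ := hψ.exists_ne_one (c := 1 / (p : ℚ_[p]))
    (by rw [hc]; exact_mod_cast (Fact.out : p.Prime).one_lt)
  have h0 : W (v : V) (whittakerElt p * s2) = 0 := by
    have h1 : W (v : V) (whittakerElt p * s2) =
        ψ (1 / p * y) * W (v : V) (whittakerElt p * s2) := by
      conv_lhs => rw [← v.2 _ (n2_mem (x := -y) (by rwa [norm_neg])), whittaker_apply, mul_assoc,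
        (s2_semiconj_n2 (-y)).eq, neg_neg,
        ← mul_assoc, ← whittaker_apply, hg, whittaker_apply]
    have h2 : (1 - ψ (1 / p * y)) * W (v : V) (whittakerElt p * s2) = 0 := by
      linear_combination h1
    exact (mul_eq_zero.mp h2).resolve_left (sub_ne_zero.mpr hne.symm)
  rw [whittakerAt_s2 W hg, hψ.sum_eq_neg_one hc, whittakerAt_apply W _ v, h0]
  ring_nf

omit hψ in
-- The letters of `whittakerElt` are stripped from the right, each against one operator: every E
-- gives ω and every Tᵢ gives p, since the shorter evaluation points carry the root subgroups in
-- question to non-simple ones, where ψ is trivial.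
theorem whittakerAt_whittakerElt {ω : ℂ} (hω : ∀ v, π (centralP p) v = ω • v)
    (v : fixedVectors π (Iw p)) :
    whittakerAt W (whittakerElt p) ((heckeOp π (Iw p) (etaElt p) * heckeOp π (Iw p) s2 *
      heckeOp π (Iw p) (etaElt p) * heckeOp π (Iw p) s1 * heckeOp π (Iw p) s2 *
      heckeOp π (Iw p) (etaElt p)) v) = ω ^ 3 * (p : ℂ) ^ 3 * whittakerAt W 1 v := by
  have h1 := whittakerAt_mul_eta W hω 1 v
  rw [one_mul] at h1
  simp only [Module.End.mul_apply]
  rw [whittakerElt, whittakerAt_mul_eta W hω, whittakerAt_mul_s2 W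
    (fun y v => by rw [(eta_chain_semiconj_m2 y).eq, (hW v).n14_mul]), whittakerAt_mul_eta W hω,
    whittakerAt_mul_s1 W (fun y v => by rw [(eta_s2_semiconj_m1 y).eq, (hW v).n13_mul]),
    whittakerAt_mul_s2 W (fun y v => by rw [(eta_semiconj_m2 y).eq, (hW v).n14_mul]),
    h1]
  ring

end WhittakerModel

/-! ### Whittaker functions on dominant torus elements. -/

section Torus
variable {p : ℕ} [Fact p.Prime] {ψ : AddChar ℚ_[p] ℂ} {f : GSp4 ℚ_[p] → ℂ}

theorem diagonal_entry_ne_zero {F : Type*} [Field F] {t : GSp4 F} {d : Fin 4 → F}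
    (ht : toMat t = Matrix.diagonal d) (i : Fin 4) : d i ≠ 0 := by
  have h := det_ne_zero t
  rw [ht, Matrix.det_diagonal] at h
  exact Finset.prod_ne_zero_iff.mp h i (Finset.mem_univ i)

theorem IsWhittakerFunction.mul_of_diagonal (hf : IsWhittakerFunction ψ f) {t n : GSp4 ℚ_[p]}
    {d : Fin 4 → ℚ_[p]} (ht : toMat t = Matrix.diagonal d) (hn : IsUpperUnipotent n) :
    f (t * n) = ψ (d 0 / d 1 * toMat n 0 1 + d 1 / d 2 * toMat n 1 2) * f t := by
  have hB : t ∈ parabolic ℚ_[p] borelBlocks := by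
    change (toMat t).BlockTriangular _
    rw [ht]; exact Matrix.blockTriangular_diagonal d
  have key : ∀ i j, toMat (t * n * t⁻¹) i j = d i * toMat n i j / d j := by
    intro i j
    have h := congrArg (fun M : Matrix (Fin 4) (Fin 4) ℚ_[p] => M i j)
      ((toMat_mul (t * n * t⁻¹) t).symm.trans (congrArg toMat (inv_mul_cancel_right (t * n) t)))
    simp only [toMat_mul t n, ht, Matrix.mul_diagonal, Matrix.diagonal_mul] at h
    rw [eq_div_iff (diagonal_entry_ne_zero ht j), h]
  have hu : IsUpperUnipotent (t * n * t⁻¹) := by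
    refine ⟨Subgroup.mul_mem _ (Subgroup.mul_mem _ hB hn.1) (Subgroup.inv_mem _ hB), fun i => ?_⟩
    rw [key, hn.2, mul_one, div_self (diagonal_entry_ne_zero ht i)]
  rw [← inv_mul_cancel_right (t * n) t, hf.1 _ hu, key, key, mul_div_right_comm, mul_div_right_comm]

theorem isUpperUnipotent_n1 {R : Type*} [CommRing R] (x : R) : IsUpperUnipotent (n1 x) :=
  isUpperUnipotent_of_lit (toMat_n1 x)

theorem isUpperUnipotent_n2 {R : Type*} [CommRing R] (x : R) : IsUpperUnipotent (n2 x) :=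
  isUpperUnipotent_of_lit (toMat_n2 x)

/-- A Whittaker function invariant under the integral simple root subgroups vanishes at
non-dominant torus elements. -/
theorem IsWhittakerFunction.eq_zero_of_not_dominant (hψ : IsUnramifiedAddChar ψ)
    (hf : IsWhittakerFunction ψ f) (h1 : ∀ g y, ‖y‖ ≤ 1 → f (g * n1 y) = f g)
    (h2 : ∀ g y, ‖y‖ ≤ 1 → f (g * n2 y) = f g) {t : GSp4 ℚ_[p]}
    {d : Fin 4 → ℚ_[p]} (ht : toMat t = Matrix.diagonal d) (hd : 1 < ‖d 0 / d 1‖ ∨ 1 < ‖d 1 / d 2‖) :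
    f t = 0 := by
  have key : ∀ c : ℂ, c ≠ 1 → f t = c * f t → f t = 0 := fun c hc h =>
    (mul_eq_zero.mp (show (1 - c) * f t = 0 by linear_combination h)).resolve_left
      (sub_ne_zero.mpr hc.symm)
  obtain hd | hd := hd <;> obtain ⟨y, hy, hne⟩ := hψ.exists_ne_one hd <;> refine key _ hne ?_
  · conv_lhs => rw [← h1 t y hy, hf.mul_of_diagonal ht (isUpperUnipotent_n1 y)]
    simp [toMat_n1]
  · conv_lhs => rw [← h2 t y hy, hf.mul_of_diagonal ht (isUpperUnipotent_n2 y)]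
    simp [toMat_n2]

/-- Dominant elements of the diagonal torus. -/
def IsDominant (t : GSp4 ℚ_[p]) : Prop :=
  ∃ d : Fin 4 → ℚ_[p], toMat t = Matrix.diagonal d ∧ ‖d 0 / d 1‖ ≤ 1 ∧ ‖d 1 / d 2‖ ≤ 1

theorem toMat_d1_diagonal : toMat (d1 p) = Matrix.diagonal ![(p : ℚ_[p]), p, 1, 1] := by
  rw [toMat_d1, diagonal_four]; rfl

theorem toMat_d2_diagonal : toMat (d2 p) = Matrix.diagonal ![(p : ℚ_[p]) ^ 2, p, p, 1] := by
  rw [toMat_d2, diagonal_four]; rfl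

theorem toMat_centralP_diagonal : toMat (centralP p) = Matrix.diagonal fun _ => (p : ℚ_[p]) := by
  rw [toMat_centralP, diagonal_four]

theorem toMat_pow {R : Type*} [CommRing R] (g : GSp4 R) (n : ℕ) : toMat (g ^ n) = toMat g ^ n := by
  induction n with
  | zero => rw [_root_.pow_zero, _root_.pow_zero, toMat_one]
  | succ n ih => rw [_root_.pow_succ, _root_.pow_succ, toMat_mul, ih]

theorem IsDominant.mul_d1 {t : GSp4 ℚ_[p]} (h : IsDominant t) : IsDominant (t * d1 p) := by
  obtain ⟨d, hd, h0, h1⟩ := h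
  have hp := p_ne_zero (p := p)
  refine ⟨_, by rw [toMat_mul, hd, toMat_d1_diagonal, Matrix.diagonal_mul_diagonal], ?_, ?_⟩
  · simpa [mul_div_mul_right, hp] using h0
  · have : d 1 * p / d 2 = d 1 / d 2 * p := by ring
    simpa [this] using mul_le_one₀ h1 (norm_nonneg _) (Padic.norm_p_lt_one (p := p)).le

theorem IsDominant.mul_d2 {t : GSp4 ℚ_[p]} (h : IsDominant t) : IsDominant (t * d2 p) := by
  obtain ⟨d, hd, h0, h1⟩ := h
  have hp := p_ne_zero (p := p)
  refine ⟨_, by rw [toMat_mul, hd, toMat_d2_diagonal, Matrix.diagonal_mul_diagonal], ?_, ?_⟩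
  · have : d 0 * p ^ 2 / (d 1 * p) = d 0 / d 1 * p := by field_simp
    have h2 := mul_le_one₀ h0 (norm_nonneg _) (Padic.norm_p_lt_one (p := p)).le
    rw [← norm_mul, ← this] at h2
    exact h2
  · simpa [mul_div_mul_right, hp] using h1

theorem isDominant_one : IsDominant (1 : GSp4 ℚ_[p]) :=
  ⟨fun _ => 1, by rw [toMat_one, Matrix.diagonal_one], by simp, by simp⟩

/-- A dominant element conjugates the integral simple root coordinates to integral ones, where ψ is
trivial. -/
theorem IsDominant.apply_mul (hψ : IsUnramifiedAddChar ψ) (hf : IsWhittakerFunction ψ f)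
    {t n : GSp4 ℚ_[p]} (ht : IsDominant t) (hn : IsUpperUnipotent n) (h01 : ‖toMat n 0 1‖ ≤ 1)
    (h12 : ‖toMat n 1 2‖ ≤ 1) : f (t * n) = f t := by
  obtain ⟨d, hd, h0, h1⟩ := ht
  rw [hf.mul_of_diagonal hd hn, hψ.1, one_mul]
  exact norm_add_le_one (norm_mul_le_one h0 h01) (norm_mul_le_one h1 h12)

end Torus

section HeckeOnTorus
variable {p : ℕ} [Fact p.Prime] {ψ : AddChar ℚ_[p] ℂ} {V : Type*} [AddCommGroup V] [Module ℂ V]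
  {π : Representation ℂ (GSp4 ℚ_[p]) V}
  {W : Representation.IntertwiningMap π (rightTranslation (GSp4 ℚ_[p]))}
  (hψ : IsUnramifiedAddChar ψ) (hW : ∀ v, IsWhittakerFunction ψ (W v))
include hψ hW

/-- All p³ coset representatives contribute equally at a dominant element, so the Hecke operator
becomes a shift of the torus argument. -/
theorem whittakerAt_d1 {t : GSp4 ℚ_[p]} (ht : IsDominant t) (v : fixedVectors π (Iw p)) :
    whittakerAt W t (heckeOp π (Iw p) (d1 p) v) = (p : ℂ) ^ 3 * whittakerAt W (t * d1 p) v := by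
  rw [whittakerAt_apply, heckeOp_d1 π (by decide) le_rfl, whittaker_sum]
  have h : ∀ x : ZMod p × ZMod p × ZMod p, W (π (siegelElt (lift x.1) (lift x.2.1) (lift x.2.2))
      (π (d1 p) v)) t = whittakerAt W (t * d1 p) v := fun x => by
    rw [whittaker_apply, ht.apply_mul hψ (hW _) (isUpperUnipotent_of_lit (toMat_siegelElt _ _ _)),
      whittaker_apply, whittakerAt_apply]
    · simp [toMat_siegelElt]
    · simpa [toMat_siegelElt] using norm_lift_le x.1
  rw [Finset.sum_congr rfl fun x _ => h x, Finset.sum_const, Finset.card_univ, nsmul_eq_mul]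
  simp only [Fintype.card_prod, ZMod.card]
  push_cast
  ring

theorem whittakerAt_d2 {t : GSp4 ℚ_[p]} (ht : IsDominant t) (v : fixedVectors π (Iw p)) :
    whittakerAt W t (heckeOp π (Iw p) (d2 p) v) = (p : ℂ) ^ 4 * whittakerAt W (t * d2 p) v := by
  rw [whittakerAt_apply, heckeOp_d2 π (by decide) (by decide) le_rfl, whittaker_sum]
  have h : ∀ x : ZMod p × ZMod p × ZMod p × ZMod p, W (π (klingenElt (lift x.1) (lift x.2.1)
      (lift x.2.2.1 - p * lift x.2.2.2)) (π (d2 p) v)) t = whittakerAt W (t * d2 p) v := fun x => by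
    rw [whittaker_apply, ht.apply_mul hψ (hW _) (isUpperUnipotent_of_lit (toMat_klingenElt _ _ _)),
      whittaker_apply, whittakerAt_apply]
    · simpa [toMat_klingenElt] using norm_lift_le x.1
    · simp [toMat_klingenElt]
  rw [Finset.sum_congr rfl fun x _ => h x, Finset.sum_const, Finset.card_univ, nsmul_eq_mul]
  simp only [Fintype.card_prod, ZMod.card]
  push_cast
  ring

theorem whittakerAt_d1_pow (m : ℕ) {t : GSp4 ℚ_[p]} (ht : IsDominant t)
    (v : fixedVectors π (Iw p)) :
    whittakerAt W t ((heckeOp π (Iw p) (d1 p) ^ m) v) =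
      (p : ℂ) ^ (3 * m) * whittakerAt W (t * d1 p ^ m) v := by
  induction m generalizing t with
  | zero => simp
  | succ m ih =>
    rw [pow_succ', Module.End.mul_apply, whittakerAt_d1 hψ hW ht, ih ht.mul_d1, pow_succ' (d1 p),
      ← mul_assoc t]
    ring

theorem whittakerAt_d2_pow (m : ℕ) {t : GSp4 ℚ_[p]} (ht : IsDominant t)
    (v : fixedVectors π (Iw p)) :
    whittakerAt W t ((heckeOp π (Iw p) (d2 p) ^ m) v) =
      (p : ℂ) ^ (4 * m) * whittakerAt W (t * d2 p ^ m) v := by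
  induction m generalizing t with
  | zero => simp
  | succ m ih =>
    rw [pow_succ', Module.End.mul_apply, whittakerAt_d2 hψ hW ht, ih ht.mul_d2, pow_succ' (d2 p),
      ← mul_assoc t]
    ring

theorem whittakerAt_dominant_eq_zero {v : fixedVectors π (Iw p)}
    (h : ∀ m n : ℕ, whittakerAt W 1 ((heckeOp π (Iw p) (d1 p) ^ m)
      ((heckeOp π (Iw p) (d2 p) ^ n) v)) = 0) (m n : ℕ) :
    W (v : V) (d1 p ^ m * d2 p ^ n) = 0 := by
  have hp : (p : ℂ) ≠ 0 := by exact_mod_cast (Fact.out : p.Prime).ne_zero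
  have hd : ∀ m : ℕ, IsDominant (1 * d1 p ^ m) := fun m => by
    induction m with
    | zero => simpa using isDominant_one
    | succ m ih => rw [pow_succ, ← mul_assoc]; exact ih.mul_d1
  have h1 := h m n
  rw [whittakerAt_d1_pow hψ hW m isDominant_one, whittakerAt_d2_pow hψ hW n (hd m), one_mul,
    whittakerAt_apply] at h1
  simpa [hp] using h1

end HeckeOnTorus

/-! ### A spherical Whittaker function is determined by its dominant values. -/

section Spherical
variable {p : ℕ} [Fact p.Prime] {ψ : AddChar ℚ_[p] ℂ} {V : Type*} [AddCommGroup V] [Module ℂ V]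
  {π : Representation ℂ (GSp4 ℚ_[p]) V}
  {W : Representation.IntertwiningMap π (rightTranslation (GSp4 ℚ_[p]))}

theorem exists_unit_mul_zpow {x : ℚ_[p]} (hx : x ≠ 0) :
    ∃ (z : ℤ) (u : ℚ_[p]), ‖u‖ = 1 ∧ x = p ^ z * u := by
  have hp := p_ne_zero (p := p)
  refine ⟨x.valuation, (p : ℚ_[p]) ^ (-x.valuation) * x, ?_, ?_⟩
  · rw [norm_mul, Padic.norm_p_zpow, neg_neg, Padic.norm_eq_zpow_neg_valuation hx,
      ← zpow_add₀ (p_cast_pos p).ne', add_neg_cancel, _root_.zpow_zero]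
  · rw [← mul_assoc, ← zpow_add₀ hp, add_neg_cancel, _root_.zpow_zero, one_mul]

theorem whittaker_mul_of_mem {K : Subgroup (GSp4 ℚ_[p])} (v : fixedVectors π K) (g : GSp4 ℚ_[p])
    {k : GSp4 ℚ_[p]} (hk : k ∈ K) : W (v : V) (g * k) = W (v : V) g := by
  rw [← whittaker_apply, v.2 k hk]

theorem whittaker_mul_centralP_pow {ω : ℂ} (hω : ∀ v, π (centralP p) v = ω • v) (g : GSp4 ℚ_[p])
    (v : V) (n : ℕ) : W v (g * centralP p ^ n) = ω ^ n * W v g := by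
  induction n with
  | zero => simp
  | succ n ih =>
    rw [pow_succ, ← mul_assoc, ← whittaker_apply, hω, map_smul, Pi.smul_apply, ih, smul_eq_mul]
    ring

theorem toMat_centralP_pow (n : ℕ) :
    toMat (centralP p ^ n) = Matrix.diagonal fun _ => (p : ℚ_[p]) ^ n := by
  rw [toMat_pow, toMat_centralP_diagonal, Matrix.diagonal_pow]; rfl

variable (hψ : IsUnramifiedAddChar ψ) (hW : ∀ v, IsWhittakerFunction ψ (W v))
  {ω : ℂ} (hω : ∀ v, π (centralP p) v = ω • v)
  {w : fixedVectors π (hyperspecial p)} (hdom : ∀ m n : ℕ, W (w : V) (d1 p ^ m * d2 p ^ n) = 0)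
include hψ hW hω hdom

theorem whittaker_eq_zero_of_powers {t : GSp4 ℚ_[p]} {i j k l : ℕ} (hsum : i + l = j + k)
    (ht : toMat t = Matrix.diagonal ![(p : ℚ_[p]) ^ i, p ^ j, p ^ k, p ^ l]) :
    W (w : V) t = 0 := by
  have hp := p_ne_zero (p := p)
  have h1p : (1 : ℝ) < p := by exact_mod_cast (Fact.out : p.Prime).one_lt
  have hlt : ∀ {m n : ℕ}, m < n → 1 < ‖(p : ℚ_[p]) ^ m / p ^ n‖ := fun {m n} h => by
    rw [norm_div, norm_pow, norm_pow, Padic.norm_p, inv_pow, inv_pow, inv_div_inv,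
      one_lt_div (pow_pos (p_cast_pos p) _)]
    exact pow_lt_pow_right₀ h1p h
  by_cases hij : i < j
  -- The conditions i ≥ j ≥ k express dominance; what remains is a product of powers of `d1`, `d2`
  -- and the centre, with exponents j - k, i - j and l.
  · exact (hW _).eq_zero_of_not_dominant hψ
      (fun g y hy => whittaker_mul_of_mem w g (Iw_le_hyperspecial (n1_mem hy)))
      (fun g y hy => whittaker_mul_of_mem w g (Iw_le_hyperspecial (n2_mem hy))) ht (Or.inl (hlt hij))
  by_cases hjk : j < k
  · exact (hW _).eq_zero_of_not_dominant hψ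
      (fun g y hy => whittaker_mul_of_mem w g (Iw_le_hyperspecial (n1_mem hy)))
      (fun g y hy => whittaker_mul_of_mem w g (Iw_le_hyperspecial (n2_mem hy))) ht (Or.inr (hlt hjk))
  obtain ⟨m, rfl⟩ := Nat.exists_eq_add_of_le (not_lt.mp hjk)
  obtain ⟨n, rfl⟩ := Nat.exists_eq_add_of_le (not_lt.mp hij)
  obtain rfl : k = l + n := by omega
  have e : t = d1 p ^ m * d2 p ^ n * centralP p ^ l := by
    apply toMat_injective
    rw [ht, toMat_mul, toMat_mul, toMat_centralP_pow, toMat_pow, toMat_pow, toMat_d1_diagonal,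
      toMat_d2_diagonal, Matrix.diagonal_pow, Matrix.diagonal_pow, Matrix.diagonal_mul_diagonal,
      Matrix.diagonal_mul_diagonal]
    congr 1
    funext x
    fin_cases x <;> simp <;> ring
  rw [e, whittaker_mul_centralP_pow hω, hdom, mul_zero]

theorem whittaker_torus_eq_zero (hω0 : ω ≠ 0) {t : GSp4 ℚ_[p]} {a b b' a' : ℚ_[p]ˣ}
    {h : a * a' = b * b'} (ht : t = tor a b b' a' h) : W (w : V) t = 0 := by
  have hp := p_ne_zero (p := p)
  obtain ⟨z0, u0, n0, e0⟩ := exists_unit_mul_zpow a.ne_zero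
  obtain ⟨z1, u1, n1, e1⟩ := exists_unit_mul_zpow b.ne_zero
  obtain ⟨z2, u2, n2, e2⟩ := exists_unit_mul_zpow b'.ne_zero
  obtain ⟨z3, u3, n3, e3⟩ := exists_unit_mul_zpow a'.ne_zero
  have hprod : (p : ℚ_[p]) ^ (z0 + z3) * (u0 * u3) = p ^ (z1 + z2) * (u1 * u2) := by
    have := congrArg Units.val h
    rw [Units.val_mul, Units.val_mul, e0, e1, e2, e3] at this
    rw [zpow_add₀ hp, zpow_add₀ hp]
    linear_combination this
  have hz : z0 + z3 = z1 + z2 := by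
    have h1 := congrArg norm hprod
    rw [norm_mul, norm_mul, norm_mul, norm_mul, n0, n1, n2, n3, mul_one, mul_one, mul_one,
      norm_zpow, norm_zpow] at h1
    exact zpow_right_injective₀ (norm_pos_iff.mpr hp) Padic.norm_p_lt_one.ne h1
  have hu : u0 * u3 = u1 * u2 := by
    rw [hz] at hprod
    exact mul_left_cancel₀ (zpow_ne_zero _ hp) hprod
  -- Multiplication by a large central power makes all exponents of p natural numbers and only
  -- changes the value by a power of ω ≠ 0.
  let N := z0.natAbs + z1.natAbs + z2.natAbs + z3.natAbs
  obtain ⟨i, hi⟩ := Int.eq_ofNat_of_zero_le (show 0 ≤ z0 + N by omega)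
  obtain ⟨j, hj⟩ := Int.eq_ofNat_of_zero_le (show 0 ≤ z1 + N by omega)
  obtain ⟨k, hk⟩ := Int.eq_ofNat_of_zero_le (show 0 ≤ z2 + N by omega)
  obtain ⟨l, hl⟩ := Int.eq_ofNat_of_zero_le (show 0 ≤ z3 + N by omega)
  have key : ∀ {z : ℤ} {i : ℕ} (u : ℚ_[p]), z + N = i → (p : ℚ_[p]) ^ z * u * p ^ N = p ^ i * u :=
    fun {z i} u h => by
      rw [mul_right_comm, ← zpow_natCast, ← zpow_add₀ hp, h, zpow_natCast]
  have m0 := ne_zero_of_norm_eq_one n0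
  have m1 := ne_zero_of_norm_eq_one n1
  have m2 := ne_zero_of_norm_eq_one n2
  have m3 := ne_zero_of_norm_eq_one n3
  let τ : GSp4 ℚ_[p] := tor (Units.mk0 u0 m0) (Units.mk0 u1 m1) (Units.mk0 u2 m2) (Units.mk0 u3 m3)
    (Units.ext hu)
  have hτ : τ ∈ Iw p := tor_mem _ n0 n1 n2 n3
  have hτm : toMat τ = Matrix.diagonal ![u0, u1, u2, u3] := by rw [diagonal_four]; rfl
  have htm : toMat t = Matrix.diagonal ![(a : ℚ_[p]), b, b', a'] := by
    rw [ht, diagonal_four]; rfl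
  have hmat : toMat (t * centralP p ^ N * τ⁻¹) =
      Matrix.diagonal ![(p : ℚ_[p]) ^ i, p ^ j, p ^ k, p ^ l] := by
    have h1 : toMat (t * centralP p ^ N * τ⁻¹) * toMat τ =
        Matrix.diagonal ![(p : ℚ_[p]) ^ i, p ^ j, p ^ k, p ^ l] * toMat τ := by
      rw [← toMat_mul, inv_mul_cancel_right, toMat_mul, toMat_centralP_pow, htm, hτm,
        Matrix.diagonal_mul_diagonal, Matrix.diagonal_mul_diagonal]
      congr 1
      funext x
      fin_cases x
      · simpa [e0] using key u0 hi
      · simpa [e1] using key u1 hj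
      · simpa [e2] using key u2 hk
      · simpa [e3] using key u3 hl
    have h2 := congrArg (fun M : Matrix (Fin 4) (Fin 4) ℚ_[p] => M * toMat τ⁻¹) h1
    simpa only [Matrix.mul_assoc, ← toMat_mul τ, mul_inv_cancel, toMat_one, Matrix.mul_one] using h2
  have h1 := whittaker_eq_zero_of_powers hψ hW hω hdom (show i + l = j + k by omega) hmat
  rw [whittaker_mul_of_mem w _ ((hyperspecial p).inv_mem (Iw_le_hyperspecial hτ)),
    whittaker_mul_centralP_pow hω] at h1
  exact (mul_eq_zero.mp h1).resolve_left (pow_ne_zero _ hω0)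

theorem whittaker_eq_zero_of_dominant (hω0 : ω ≠ 0) : W (w : V) = 0 := by
  funext g
  obtain ⟨t, ht, x, k, hk, rfl⟩ := exists_borel_weyl_iwahori g
  have hx : weylElt p x ∈ hyperspecial p := by
    have hle : Subgroup.closure {s1, s2} ≤ hyperspecial p := by
      rw [Subgroup.closure_le]
      rintro _ (rfl | rfl)
      · exact s1_mem
      · exact s2_mem
    exact hle (weylElt_mem_closure x)
  rw [whittaker_mul_of_mem w _ (Iw_le_hyperspecial hk), whittaker_mul_of_mem w _ hx]
  have hlow : ∀ i j : Fin 4, j < i → toMat t i j = 0 := fun i j hij => ht (borel_lt hij)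
  have hdet := det_ne_zero t
  rw [Matrix.det_of_isUpperTriangular (fun i j hij => hlow i j hij), Fin.prod_univ_four] at hdet
  simp only [mul_ne_zero_iff] at hdet
  obtain ⟨⟨⟨h0, h1⟩, h2⟩, h3⟩ := hdet
  have hrel : toMat t 0 0 * toMat t 3 3 = toMat t 1 1 * toMat t 2 2 := by
    obtain ⟨μ, hμ⟩ := exists_multiplier t
    have e1 := congrFun (congrFun hμ 0) 3
    have e2 := congrFun (congrFun hμ 1) 2
    simp [Matrix.mul_apply, Fin.sum_univ_four, J, hlow 1 0, hlow 2 0, hlow 3 0, hlow 2 1, hlow 3 1,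
      hlow 3 2] at e1 e2
    rw [e1, e2]
  let D : GSp4 ℚ_[p] := tor (Units.mk0 _ h0) (Units.mk0 _ h1) (Units.mk0 _ h2) (Units.mk0 _ h3)
    (Units.ext hrel)
  have hDm : toMat D = Matrix.diagonal fun i => toMat t i i := by rw [diagonal_four]; rfl
  have hD : D ∈ parabolic ℚ_[p] borelBlocks := by
    change (toMat D).BlockTriangular _
    rw [hDm]; exact Matrix.blockTriangular_diagonal _
  have hu : IsUpperUnipotent (t * D⁻¹) := by
    refine ⟨Subgroup.mul_mem _ ht (Subgroup.inv_mem _ hD), fun i => ?_⟩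
    have h := congrArg (fun M : Matrix (Fin 4) (Fin 4) ℚ_[p] => M i i)
      ((toMat_mul (t * D⁻¹) D).symm.trans (congrArg toMat (inv_mul_cancel_right t D)))
    simp only [hDm, Matrix.mul_diagonal] at h
    exact mul_right_cancel₀ (diagonal_entry_ne_zero hDm i) (h.trans (one_mul _).symm)
  rw [← inv_mul_cancel_right t D, (hW _).1 _ hu, whittaker_torus_eq_zero hψ hW hω hdom hω0 rfl,
    mul_zero]
  rfl

end Spherical

/-! ### From the torus algebra to the operators at each level. -/

section Operators

theorem eq_span_singleton_of_functional {k M : Type*} [Field k] [AddCommGroup M] [Module k M]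
    {E : Submodule k M} {w : M} (hw : w ∈ E) {l : M →ₗ[k] k} (hl : l w = 1)
    (h : ∀ v ∈ E, l v = 0 → v = 0) : E = Submodule.span k {w} := by
  refine le_antisymm (fun v hv => ?_) ((Submodule.span_singleton_le_iff_mem _ _).mpr hw)
  have := h (v - l v • w) (E.sub_mem hv (E.smul_mem _ hw)) (by simp [hl])
  rw [sub_eq_zero.mp this]
  exact Submodule.smul_mem _ _ (Submodule.mem_span_singleton_self w)

variable {R M N : Type*} [CommRing R] [Algebra ℂ R] [AddCommGroup M] [Module ℂ M] [Module R M]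
  [IsScalarTower ℂ R M] [AddCommGroup N] [Module ℂ N]

omit [Algebra ℂ R] [IsScalarTower ℂ R M] in
/-- An operator on a finite-dimensional subspace of a module, a multiple of which is the action of
a unit, is invertible. -/
theorem isUnit_of_smul_eq [Module.Finite ℂ N] {i : N →ₗ[ℂ] M} (hi : Function.Injective i)
    {U : Module.End ℂ N} {u : Rˣ} {c : ℂ} (h : ∀ n, i (c • U n) = (u : R) • i n) : IsUnit U := by
  rw [Module.End.isUnit_iff, Function.Bijective]
  have hinj : Function.Injective U := by
    rw [injective_iff_map_eq_zero]
    intro n hn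
    have h1 := h n
    rw [hn, smul_zero, map_zero] at h1
    apply hi
    rw [map_zero, ← one_smul R (i n), ← u.inv_mul, mul_smul, ← h1, smul_zero]
  exact ⟨hinj, LinearMap.surjective_of_injective hinj⟩

/-- When cU corresponds to u, the operator (x/c)/U corresponds to x/u; with c = p^(r₂+1) this
absorbs the denominators in the Klingen and Iwahori formulas. -/
theorem map_oneSubDiv [Module.Finite ℂ N] {i : N →ₗ[ℂ] M} (hi : Function.Injective i)
    {U : Module.End ℂ N} {u : Rˣ} {c : ℂ} (hc : c ≠ 0) (h : ∀ n, i (c • U n) = (u : R) • i n) (x : ℂ)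
    (n : N) : i (oneSubDiv (x / c) U n) = oneSubInv x u • i n := by
  have hU := isUnit_of_smul_eq hi h
  have h1 : U (Ring.inverse U n) = n := by
    rw [← Module.End.mul_apply, Ring.mul_inverse_cancel U hU, Module.End.one_apply]
  have h2 : i (Ring.inverse U n) = c • (u⁻¹ : Rˣ) • i n := by
    have h3 := h (Ring.inverse U n)
    rw [h1, i.map_smul] at h3
    rw [smul_comm, h3, Units.smul_def, smul_smul, u.inv_mul, one_smul]
  rw [oneSubInv_smul, oneSubDiv, LinearMap.sub_apply, LinearMap.smul_apply, Module.End.one_apply,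
    map_sub, i.map_smul, h2, smul_smul, div_mul_cancel₀ _ hc]

end Operators

section WhittakerTorus
variable {p : ℕ} [Fact p.Prime] {ψ : AddChar ℚ_[p] ℂ} {V : Type*} [AddCommGroup V] [Module ℂ V]
  {π : Representation ℂ (GSp4 ℚ_[p]) V}

/-- An action of a commutative algebra on the Iwahori fixed vectors of `π` extending that of the
operators `U₁` and `U₂`, together with its relation to the Whittaker model. -/
structure IsWhittakerTorus (W : Representation.IntertwiningMap π (rightTranslation (GSp4 ℚ_[p])))
    (r₁ r₂ : ℕ) (α β γ δ ν : ℂ) {R : Type*} [CommRing R] [Algebra ℂ R]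
    [Module R (fixedVectors π (Iw p))] [IsScalarTower ℂ R (fixedVectors π (Iw p))] (a b : Rˣ)
    (ε : fixedVectors π (Iw p) →ₗ[ℂ] ℂ) (κ : ℂ) : Prop where
  U1 : ∀ v : fixedVectors π (Iw p), (a : R) • v = U1 π (Iw p) r₁ r₂ v
  U2 : ∀ v : fixedVectors π (Iw p), (a * b : R) • v = (p : ℂ) ^ (r₂ + 1) • U2 π (Iw p) r₁ v
  torus : TorusRelations ν a b (heckeOp π (Iw p) s1) (heckeOp π (Iw p) s2)
  alternating₁ : ∀ v, ε (heckeOp π (Iw p) s1 v) = -ε v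
  alternating₂ : ∀ v, ε (heckeOp π (Iw p) s2 v) = -ε v
  apply_generator : ∀ v : fixedVectors π (Iw p), ε ((a ^ 2 * b) • v) = κ * whittakerAt W 1 v
  ne_zero : κ ≠ 0
  finite : Module.Finite ℂ (fixedVectors π (Iw p))
  finrank_le : Module.finrank ℂ (fixedVectors π (Iw p)) ≤ 8
  satake : ∀ w : fixedVectors π (hyperspecial p), SatakeRelations ν a b α β γ δ
    (fixedInclusion π (parahoric_le_hyperspecial p borelBlocks) w)

/-- All representation theory is gathered here into algebraic data; the scaling h = p^((r₁+r₂)/2)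
makes a equal to U₁ and ν equal to αδ = βγ. -/
theorem exists_whittakerTorus.{u} {V : Type u} [AddCommGroup V] [Module ℂ V]
    {π : Representation ℂ (GSp4 ℚ_[p]) V} (hunr : IsUnramified π)
    {W : Representation.IntertwiningMap π (rightTranslation (GSp4 ℚ_[p]))}
    (hψ : IsUnramifiedAddChar ψ) (hW : ∀ v, IsWhittakerFunction ψ (W v)) {r₁ r₂ : ℕ} {α β γ δ : ℂ} (hpar : IsHeckeParameters π r₁ r₂ α β γ δ) :
    ∃ (R : Type u) (_ : CommRing R) (_ : Algebra ℂ R) (_ : Module R (fixedVectors π (Iw p)))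
      (_ : IsScalarTower ℂ R (fixedVectors π (Iw p))) (a b : Rˣ) (ν : ℂ)
      (ε : fixedVectors π (Iw p) →ₗ[ℂ] ℂ) (κ ω : ℂ), IsWhittakerTorus W r₁ r₂ α β γ δ ν a b ε κ ∧
      (∀ v, π (centralP p) v = ω • v) ∧ ω ≠ 0 := by
  obtain ⟨⟨Q, ⟨χ₁, χ₂, σ, -, -, -, hsub, rfl⟩, hpoly⟩, ω, hω, outer, inner⟩ := hpar
  obtain ⟨v, -, hv⟩ := (Submodule.ne_bot_iff _).mp hunr
  have hp : (p : ℂ) ≠ 0 := by exact_mod_cast (Fact.out : p.Prime).ne_zero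
  have hpp : (p : ℚ_[p]) ≠ 0 := p_ne_zero
  have hω' := central_of_subquotient hsub hv (hω v)
  have hω0 : ω ≠ 0 := by
    rw [hω']
    exact mul_ne_zero (mul_ne_zero ((map_ne_zero χ₁).mpr hpp) ((map_ne_zero χ₂).mpr hpp))
      (pow_ne_zero 2 ((map_ne_zero σ).mpr hpp))
  have hh := halfPow_ne_zero p (r₁ + r₂)
  obtain ⟨R, _, _, _, _, a, b, ha, hab, haab, hT⟩ := (iwahoriRelations π hω).exists_torus hp hω0 hh
  have hfin := finite_of_subquotient hsub
  refine ⟨R, _, _, _, _, a, b, _, whittakerAt W (whittakerElt p),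
    p * halfPow p (r₁ + r₂) ^ 3 * (ω ^ 3 * p ^ 3), ω, ⟨?_, ?_, hT,
    whittakerAt_alternating_s1 hψ hW, whittakerAt_alternating_s2 hψ hW, ?_, ?_, hfin.1, hfin.2, ?_⟩, hω, hω0⟩
  · intro v
    rw [ha, ← heckeOp_iwahori_d1]
    rfl
  · intro v
    rw [hab, ← heckeOp_iwahori_d2, U2, LinearMap.smul_apply, smul_smul, halfPow_sq]
    congr 1
    ring
  · intro v
    rw [haab, LinearMap.map_smul, smul_eq_mul]
    simp only [Module.End.mul_apply]
    -- The four letters of the longest Weyl element contribute (-1)⁴ = 1.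
    rw [whittakerAt_alternating_s2 hψ hW, whittakerAt_alternating_s1 hψ hW,
      whittakerAt_alternating_s2 hψ hW, whittakerAt_alternating_s1 hψ hW]
    have := whittakerAt_whittakerElt (W := W) hW hω v
    simp only [Module.End.mul_apply] at this
    rw [this]
    ring
  · exact mul_ne_zero (mul_ne_zero hp (pow_ne_zero 3 hh))
      (mul_ne_zero (pow_ne_zero 3 hω0) (pow_ne_zero 3 hp))
  · intro w
    rw [hω'] at outer inner ⊢
    exact satakeRelations_of_subquotient hsub w (r₁ + r₂) ha hab outer inner hpoly

end WhittakerTorus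

/-! ### Normalised generators at Siegel, Klingen and Iwahori level. -/

section Levels
variable {p : ℕ} [Fact p.Prime] {ψ : AddChar ℚ_[p] ℂ} {V : Type*} [AddCommGroup V] [Module ℂ V]
  {π : Representation ℂ (GSp4 ℚ_[p]) V}
  {W : Representation.IntertwiningMap π (rightTranslation (GSp4 ℚ_[p]))}
  {r₁ r₂ : ℕ} {α β γ δ ν : ℂ} {R : Type*} [CommRing R] [Algebra ℂ R]
  [Module R (fixedVectors π (Iw p))] [IsScalarTower ℂ R (fixedVectors π (Iw p))] {a b : Rˣ}
  {ε : fixedVectors π (Iw p) →ₗ[ℂ] ℂ} {κ : ℂ}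

theorem fixedInclusion_injective {G V : Type*} [Group G] [AddCommGroup V] [Module ℂ V]
    (ρ : Representation ℂ G V) {K' K : Subgroup G} (h : K' ≤ K) :
    Function.Injective (fixedInclusion ρ h) := fun v w hvw => by
  have := congrArg (Subtype.val : fixedVectors ρ K' → V) hvw
  rw [coe_fixedInclusion, coe_fixedInclusion] at this
  exact Subtype.ext this

theorem fixedInclusion_fixedInclusion {G V : Type*} [Group G] [AddCommGroup V] [Module ℂ V]
    (ρ : Representation ℂ G V) {K₁ K₂ K₃ : Subgroup G} (h₁₂ : K₁ ≤ K₂) (h₂₃ : K₂ ≤ K₃)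
    (h₁₃ : K₁ ≤ K₃) (v : fixedVectors ρ K₃) :
    fixedInclusion ρ h₁₂ (fixedInclusion ρ h₂₃ v) = fixedInclusion ρ h₁₃ v := by
  apply Subtype.ext
  rw [coe_fixedInclusion, coe_fixedInclusion, coe_fixedInclusion]

omit [Fact p.Prime] in
theorem p_ne_neg_one : (p : ℂ) ≠ -1 := fun h => by
  have h1 : ((p + 1 : ℕ) : ℂ) = 0 := by push_cast; rw [h]; ring
  exact Nat.succ_ne_zero p (by exact_mod_cast h1)

theorem p_pow_ne_zero (n : ℕ) : (p : ℂ) ^ n ≠ 0 :=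
  pow_ne_zero _ (by exact_mod_cast (Fact.out : p.Prime).ne_zero)

theorem heckeOp_s1_spherical (w : fixedVectors π (hyperspecial p)) :
    heckeOp π (Iw p) s1 (fixedInclusion π (parahoric_le_hyperspecial p borelBlocks) w) =
      (p : ℂ) • fixedInclusion π (parahoric_le_hyperspecial p borelBlocks) w :=
  heckeOp_s1_eq_smul π (by rw [coe_fixedInclusion]; exact w.2 _ s1_mem)

theorem heckeOp_s2_spherical (w : fixedVectors π (hyperspecial p)) :
    heckeOp π (Iw p) s2 (fixedInclusion π (parahoric_le_hyperspecial p borelBlocks) w) =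
      (p : ℂ) • fixedInclusion π (parahoric_le_hyperspecial p borelBlocks) w :=
  heckeOp_s2_eq_smul π (by rw [coe_fixedInclusion]; exact w.2 _ s2_mem)

namespace IsWhittakerTorus
variable (H : IsWhittakerTorus W r₁ r₂ α β γ δ ν a b ε κ)
include H

theorem apply_eq_zero_iff (v : fixedVectors π (Iw p)) :
    ε ((a ^ 2 * b) • v) = 0 ↔ whittakerAt W 1 v = 0 := by
  rw [H.apply_generator, mul_eq_zero, or_iff_right H.ne_zero]

theorem smul_U1 (v : fixedVectors π (Iw p)) :
    (LinearMap.id : fixedVectors π (Iw p) →ₗ[ℂ] _) ((1 : ℂ) • GSpFour.U1 π (Iw p) r₁ r₂ v) =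
      (a : R) • (LinearMap.id : fixedVectors π (Iw p) →ₗ[ℂ] _) v := by
  rw [one_smul, LinearMap.id_apply, LinearMap.id_apply, H.U1]

theorem smul_U2 (v : fixedVectors π (Iw p)) :
    (LinearMap.id : fixedVectors π (Iw p) →ₗ[ℂ] _)
      ((p : ℂ) ^ (r₂ + 1) • GSpFour.U2 π (Iw p) r₁ v) =
      ((a * b : Rˣ) : R) • (LinearMap.id : fixedVectors π (Iw p) →ₗ[ℂ] _) v := by
  rw [LinearMap.id_apply, LinearMap.id_apply, Units.val_mul, H.U2]

theorem smul_U1_Sieg (v : fixedVectors π (Sieg p)) :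
    fixedInclusion π (Iw_le_Sieg p) ((1 : ℂ) • GSpFour.U1 π (Sieg p) r₁ r₂ v) =
      (a : R) • fixedInclusion π (Iw_le_Sieg p) v := by
  rw [one_smul, fixedInclusion_U1, H.U1]

theorem smul_U2_Kl (v : fixedVectors π (Kl p)) :
    fixedInclusion π (Iw_le_Kl p) ((p : ℂ) ^ (r₂ + 1) • GSpFour.U2 π (Kl p) r₁ v) =
      ((a * b : Rˣ) : R) • fixedInclusion π (Iw_le_Kl p) v := by
  rw [LinearMap.map_smul, fixedInclusion_U2, Units.val_mul, H.U2]

theorem finite_Sieg : Module.Finite ℂ (fixedVectors π (Sieg p)) :=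
  have := H.finite
  Module.Finite.of_injective _ (fixedInclusion_injective π (Iw_le_Sieg p))

theorem finite_Kl : Module.Finite ℂ (fixedVectors π (Kl p)) :=
  have := H.finite
  Module.Finite.of_injective _ (fixedInclusion_injective π (Iw_le_Kl p))

theorem isUnit_U1 : IsUnit (GSpFour.U1 π (Iw p) r₁ r₂) :=
  have := H.finite
  isUnit_of_smul_eq Function.injective_id H.smul_U1

theorem isUnit_U2 : IsUnit (GSpFour.U2 π (Iw p) r₁) :=
  have := H.finite
  isUnit_of_smul_eq Function.injective_id H.smul_U2

theorem isUnit_U1_Sieg : IsUnit (GSpFour.U1 π (Sieg p) r₁ r₂) :=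
  have := H.finite_Sieg
  isUnit_of_smul_eq (fixedInclusion_injective π _) H.smul_U1_Sieg

theorem isUnit_U2_Kl : IsUnit (GSpFour.U2 π (Kl p) r₁) :=
  have := H.finite_Kl
  isUnit_of_smul_eq (fixedInclusion_injective π _) H.smul_U2_Kl

theorem oneSubDiv_U1 (x : ℂ) (v : fixedVectors π (Iw p)) :
    oneSubDiv x (GSpFour.U1 π (Iw p) r₁ r₂) v = oneSubInv x a • v := by
  have := H.finite
  have h := map_oneSubDiv Function.injective_id one_ne_zero H.smul_U1 x v
  rwa [div_one] at h

theorem oneSubDiv_U2 (x : ℂ) (v : fixedVectors π (Iw p)) :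
    oneSubDiv (x / (p : ℂ) ^ (r₂ + 1)) (GSpFour.U2 π (Iw p) r₁) v = oneSubInv x (a * b) • v :=
  have := H.finite
  map_oneSubDiv Function.injective_id (p_pow_ne_zero _) H.smul_U2 x v

theorem oneSubDiv_U1_Sieg (x : ℂ) (v : fixedVectors π (Sieg p)) :
    fixedInclusion π (Iw_le_Sieg p) (oneSubDiv x (GSpFour.U1 π (Sieg p) r₁ r₂) v) =
      oneSubInv x a • fixedInclusion π (Iw_le_Sieg p) v := by
  have := H.finite_Sieg
  have h := map_oneSubDiv (fixedInclusion_injective π (Iw_le_Sieg p)) one_ne_zero H.smul_U1_Sieg x v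
  rwa [div_one] at h

theorem oneSubDiv_U2_Kl (x : ℂ) (v : fixedVectors π (Kl p)) :
    fixedInclusion π (Iw_le_Kl p)
      (oneSubDiv (x / (p : ℂ) ^ (r₂ + 1)) (GSpFour.U2 π (Kl p) r₁) v) =
      oneSubInv x (a * b) • fixedInclusion π (Iw_le_Kl p) v :=
  have := H.finite_Kl
  map_oneSubDiv (fixedInclusion_injective π (Iw_le_Kl p)) (p_pow_ne_zero _) H.smul_U2_Kl x v

theorem fixedInclusion_wSieg (w : fixedVectors π (hyperspecial p)) :
    fixedInclusion π (Iw_le_Sieg p) (wSieg π r₁ r₂ β γ δ w) =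
      siegelFactor β γ δ a •
        fixedInclusion π (parahoric_le_hyperspecial p borelBlocks) w := by
  rw [wSieg, Module.End.mul_apply, Module.End.mul_apply, H.oneSubDiv_U1_Sieg, H.oneSubDiv_U1_Sieg,
    H.oneSubDiv_U1_Sieg, fixedInclusion_fixedInclusion, siegelFactor, mul_smul, mul_smul]

theorem fixedInclusion_wKl (w : fixedVectors π (hyperspecial p)) :
    fixedInclusion π (Iw_le_Kl p) (wKl π r₁ r₂ α β γ δ w) =
      (1 / (1 + γ / α)) • klingenFactor α β γ δ (a * b) •
        fixedInclusion π (parahoric_le_hyperspecial p borelBlocks) w := by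
  rw [wKl, LinearMap.map_smul, Module.End.mul_apply, Module.End.mul_apply, H.oneSubDiv_U2_Kl,
    H.oneSubDiv_U2_Kl, H.oneSubDiv_U2_Kl, fixedInclusion_fixedInclusion, klingenFactor, mul_smul,
    mul_smul]

theorem pow_smul_U1 (m : ℕ) (v : fixedVectors π (Iw p)) :
    (a : R) ^ m • v = (halfPow p (r₁ + r₂) ^ m) • (heckeOp π (Iw p) (d1 p) ^ m) v := by
  induction m generalizing v with
  | zero => simp
  | succ m ih =>
    rw [pow_succ, mul_smul, H.U1, ih, GSpFour.U1, LinearMap.smul_apply, LinearMap.map_smul,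
      smul_smul, ← pow_succ, pow_succ (heckeOp _ _ _), Module.End.mul_apply]

theorem pow_smul_U2 (m : ℕ) (v : fixedVectors π (Iw p)) :
    (a * b : R) ^ m • v =
      (((p : ℂ) ^ (r₂ + 1) * p ^ r₁) ^ m) • (heckeOp π (Iw p) (d2 p) ^ m) v := by
  induction m generalizing v with
  | zero => simp
  | succ m ih =>
    rw [pow_succ, mul_smul, H.U2, ih, GSpFour.U2, LinearMap.smul_apply, smul_smul,
      LinearMap.map_smul, smul_smul, ← pow_succ, pow_succ (heckeOp _ _ _), Module.End.mul_apply]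

theorem whittakerAt_pow_eq_zero {w : fixedVectors π (hyperspecial p)} (hw : W (w : V) 1 = 0)
    (m n : ℕ) : whittakerAt W 1 ((heckeOp π (Iw p) (d1 p) ^ m) ((heckeOp π (Iw p) (d2 p) ^ n)
      (fixedInclusion π (parahoric_le_hyperspecial p borelBlocks) w))) = 0 := by
  set v := fixedInclusion π (parahoric_le_hyperspecial p borelBlocks) w with hv
  have h0 : ε ((a ^ 2 * b) • v) = 0 := (H.apply_eq_zero_iff v).mpr (by
    rw [whittakerAt_apply, hv, coe_fixedInclusion, hw])
  have h1 := apply_smul_eq_zero_of_generator H.torus p_ne_neg_one H.alternating₁ H.alternating₂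
    (heckeOp_s1_spherical w) (heckeOp_s2_spherical w) (H.satake w) h0 (m + 1) (n + 1)
  have e : (a ^ (m + 1 + (n + 1)) * b ^ (n + 1) : Rˣ) • v =
      (a ^ 2 * b) • ((a : R) ^ m • (a * b : R) ^ n • v) := by
    simp only [Units.smul_def, smul_smul]
    congr 1
    push_cast
    ring
  rw [e, H.apply_eq_zero_iff, H.pow_smul_U2, H.pow_smul_U1, LinearMap.map_smul, LinearMap.map_smul,
    LinearMap.map_smul, smul_eq_mul, smul_eq_mul] at h1
  simpa [halfPow_ne_zero p, (Fact.out : p.Prime).ne_zero] using h1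

/-- Vanishing at 1 gives vanishing of ε on all monomials of the dominant cone, hence of the
Whittaker function on dominant elements, hence everywhere; injectivity of the model concludes. -/
theorem spherical_eq_zero (hψ : IsUnramifiedAddChar ψ) (hW : ∀ v, IsWhittakerFunction ψ (W v))
    (hinj : Function.Injective W) {ω : ℂ} (hω : ∀ v, π (centralP p) v = ω • v) (hω0 : ω ≠ 0)
    {w : fixedVectors π (hyperspecial p)} (hw : W (w : V) 1 = 0) : w = 0 := by
  have h1 := whittakerAt_dominant_eq_zero hψ hW (H.whittakerAt_pow_eq_zero hw)
  have h2 := whittaker_eq_zero_of_dominant hψ hW hω (w := w) (fun m n => by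
    rw [← coe_fixedInclusion π (parahoric_le_hyperspecial p borelBlocks), h1]) hω0
  exact Subtype.ext (hinj (h2.trans (map_zero W).symm))

variable {w : fixedVectors π (hyperspecial p)} (hw : W (w : V) 1 = 1)
include hw

theorem apply_spherical : ε ((a ^ 2 * b) •
    fixedInclusion π (parahoric_le_hyperspecial p borelBlocks) w) = κ := by
  rw [H.apply_generator, whittakerAt_apply, coe_fixedInclusion, hw, mul_one]

theorem apply_spherical_ne_zero : ε ((a ^ 2 * b) •
    fixedInclusion π (parahoric_le_hyperspecial p borelBlocks) w) ≠ 0 := by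
  rw [H.apply_spherical hw]; exact H.ne_zero

theorem satakeRelations (v : fixedVectors π (Iw p)) : SatakeRelations ν a b α β γ δ v :=
  have := H.finite
  satakeRelations_of_generator H.torus p_ne_neg_one H.alternating₁ H.alternating₂
    (heckeOp_s1_spherical w) (heckeOp_s2_spherical w) (H.apply_spherical_ne_zero hw) (H.satake w)
    H.finrank_le v

theorem siegel_normalised : IsNormalisedGenerator W
    (Module.End.eigenspace (GSpFour.U1 π (Sieg p) r₁ r₂) α) (wSieg π r₁ r₂ β γ δ w) := by
  have := H.finite
  have hval : W (wSieg π r₁ r₂ β γ δ w : V) 1 = 1 := by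
    have h := apply_siegelFactor H.torus p_ne_neg_one H.alternating₁ H.alternating₂
      (heckeOp_s1_spherical w) (heckeOp_s2_spherical w) β γ δ
    rw [H.apply_spherical hw, ← H.fixedInclusion_wSieg, H.apply_generator, whittakerAt_apply,
      coe_fixedInclusion] at h
    exact mul_left_cancel₀ H.ne_zero (h.trans (mul_one _).symm)
  have heig : ∀ v, v ∈ Module.End.eigenspace (GSpFour.U1 π (Sieg p) r₁ r₂) α ↔
      (a : R) • fixedInclusion π (Iw_le_Sieg p) v = α • fixedInclusion π (Iw_le_Sieg p) v := by
    intro v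
    rw [Module.End.mem_eigenspace_iff, ← (fixedInclusion_injective π (Iw_le_Sieg p)).eq_iff,
      fixedInclusion_U1, H.U1, LinearMap.map_smul]
  refine ⟨eq_span_singleton_of_functional
    (l := (whittakerAt W 1).comp (fixedInclusion π (Iw_le_Sieg p))) ?_ ?_ fun v hv h => ?_, hval⟩
  · rw [heig, H.fixedInclusion_wSieg]
    exact siegelFactor_eigen (H.satake w)
  · rw [LinearMap.comp_apply, whittakerAt_apply, coe_fixedInclusion, hval]
  · apply fixedInclusion_injective π (Iw_le_Sieg p)
    rw [map_zero]
    exact siegel_eigen_eq_zero H.torus p_ne_neg_one H.alternating₁ H.alternating₂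
      (heckeOp_s1_spherical w) (heckeOp_s2_spherical w) (H.apply_spherical_ne_zero hw) (H.satake w)
      H.finrank_le (heckeOp_s1_of_Sieg π v) ((heig v).mp hv) ((H.apply_eq_zero_iff _).mpr h)

omit hw in
theorem U2_eigen_iff (v : fixedVectors π (Iw p)) :
    GSpFour.U2 π (Iw p) r₁ v = (α * β / (p : ℂ) ^ (r₂ + 1)) • v ↔
      (a * b : R) • v = (α * β) • v := by
  have hc := p_pow_ne_zero (p := p) (r₂ + 1)
  rw [H.U2, ← (smul_right_injective _ hc).eq_iff, smul_smul, mul_div_cancel₀ _ hc]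

/-- The factor (1 + γ/α)⁻¹ in the vector exactly cancels the value computed in
`apply_klingenFactor`. -/
theorem wKl_value (hαγ : α + γ ≠ 0) : W (wKl π r₁ r₂ α β γ δ w : V) 1 = 1 := by
  have h := apply_klingenFactor H.torus p_ne_neg_one H.alternating₁ H.alternating₂
    (heckeOp_s1_spherical w) (heckeOp_s2_spherical w) (H.satake w)
  have hα := H.torus.outer_ne_zero (H.satake w)
  have h0 : 1 + γ / α ≠ 0 := by
    rw [one_add_div hα]
    exact div_ne_zero hαγ hα
  have h1 : κ * W (wKl π r₁ r₂ α β γ δ w : V) 1 = κ := by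
    rw [← coe_fixedInclusion π (Iw_le_Kl p), ← whittakerAt_apply, ← H.apply_generator,
      H.fixedInclusion_wKl, smul_comm, ε.map_smul, h, H.apply_spherical hw, smul_eq_mul,
      ← mul_assoc, one_div, inv_mul_cancel₀ h0, one_mul]
  exact mul_left_cancel₀ H.ne_zero (h1.trans (mul_one _).symm)

omit hw in
theorem wKl_eigen : (a * b : R) • fixedInclusion π (Iw_le_Kl p) (wKl π r₁ r₂ α β γ δ w) =
    (α * β) • fixedInclusion π (Iw_le_Kl p) (wKl π r₁ r₂ α β γ δ w) := by
  rw [H.fixedInclusion_wKl, smul_comm, klingenFactor_eigen (H.satake w), smul_comm]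

theorem klingen_normalised (hαγ : α + γ ≠ 0) : IsNormalisedGenerator W
    (Module.End.eigenspace (GSpFour.U2 π (Kl p) r₁) (α * β / (p : ℂ) ^ (r₂ + 1)))
    (wKl π r₁ r₂ α β γ δ w) := by
  have := H.finite
  have hval := H.wKl_value hw hαγ
  have heig : ∀ v, v ∈ Module.End.eigenspace (GSpFour.U2 π (Kl p) r₁)
      (α * β / (p : ℂ) ^ (r₂ + 1)) ↔
      (a * b : R) • fixedInclusion π (Iw_le_Kl p) v = (α * β) • fixedInclusion π (Iw_le_Kl p) v := by
    intro v
    rw [Module.End.mem_eigenspace_iff, ← (fixedInclusion_injective π (Iw_le_Kl p)).eq_iff,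
      fixedInclusion_U2, LinearMap.map_smul, H.U2_eigen_iff]
  refine ⟨eq_span_singleton_of_functional
    (l := (whittakerAt W 1).comp (fixedInclusion π (Iw_le_Kl p))) ?_ ?_ fun v hv h => ?_, hval⟩
  · rw [heig]
    exact H.wKl_eigen
  · rw [LinearMap.comp_apply, whittakerAt_apply, coe_fixedInclusion, hval]
  · apply fixedInclusion_injective π (Iw_le_Kl p)
    rw [map_zero]
    exact klingen_eigen_eq_zero H.torus p_ne_neg_one H.alternating₁ H.alternating₂
      (heckeOp_s1_spherical w) (heckeOp_s2_spherical w) (H.apply_spherical_ne_zero hw) (H.satake w)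
      H.finrank_le hαγ (heckeOp_s2_of_Kl π v) ((heig v).mp hv) ((H.apply_eq_zero_iff _).mpr h)

omit hw in
theorem wSieg_eigen : (a : R) • fixedInclusion π (Iw_le_Sieg p) (wSieg π r₁ r₂ β γ δ w) =
    α • fixedInclusion π (Iw_le_Sieg p) (wSieg π r₁ r₂ β γ δ w) := by
  rw [H.fixedInclusion_wSieg]
  exact siegelFactor_eigen (H.satake w)

theorem iwahori_value : whittakerAt W 1 (oneSubInv (α * γ) (a * b) •
    fixedInclusion π (Iw_le_Sieg p) (wSieg π r₁ r₂ β γ δ w)) = 1 := by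
  have h := apply_siegel_to_iwahori p_ne_neg_one H.alternating₁
    (heckeOp_s1_of_Sieg π (wSieg π r₁ r₂ β γ δ w)) H.wSieg_eigen (b := b) (α * γ)
  rw [H.apply_generator, H.apply_generator] at h
  rw [mul_left_cancel₀ H.ne_zero h, whittakerAt_apply, coe_fixedInclusion,
    (H.siegel_normalised hw).2]

omit hw in
theorem mem_iwahori_eigenspace_iff (v : fixedVectors π (Iw p)) :
    v ∈ Module.End.eigenspace (GSpFour.U1 π (Iw p) r₁ r₂) α ⊓
      Module.End.eigenspace (GSpFour.U2 π (Iw p) r₁) (α * β / (p : ℂ) ^ (r₂ + 1)) ↔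
      (a : R) • v = α • v ∧ (a * b : R) • v = (α * β) • v := by
  rw [Submodule.mem_inf, Module.End.mem_eigenspace_iff, Module.End.mem_eigenspace_iff,
    H.U2_eigen_iff, H.U1]

theorem iwahori_eq_zero {v : fixedVectors π (Iw p)} (h1 : (a : R) • v = α • v)
    (h2 : (a * b : R) • v = (α * β) • v) (h : whittakerAt W 1 v = 0) : v = 0 :=
  have := H.finite
  iwahori_eigen_eq_zero H.torus p_ne_neg_one H.alternating₁ H.alternating₂
    (heckeOp_s1_spherical w) (heckeOp_s2_spherical w) (H.apply_spherical_ne_zero hw) (H.satake w)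
    H.finrank_le h1 h2 ((H.apply_eq_zero_iff _).mpr h)

theorem iwahori_normalised : IsNormalisedGenerator W
    (Module.End.eigenspace (GSpFour.U1 π (Iw p) r₁ r₂) α ⊓
      Module.End.eigenspace (GSpFour.U2 π (Iw p) r₁) (α * β / (p : ℂ) ^ (r₂ + 1)))
    (oneSubDiv (α * γ / (p : ℂ) ^ (r₂ + 1)) (GSpFour.U2 π (Iw p) r₁)
      (fixedInclusion π (Iw_le_Sieg p) (wSieg π r₁ r₂ β γ δ w))) := by
  rw [H.oneSubDiv_U2]
  refine ⟨eq_span_singleton_of_functional (l := whittakerAt W 1) ?_ (H.iwahori_value hw)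
    fun v hv h => ?_, H.iwahori_value hw⟩
  · rw [H.mem_iwahori_eigenspace_iff]
    exact ⟨siegel_to_iwahori_eigen₁ H.wSieg_eigen,
      siegel_to_iwahori_eigen₂ (H.satakeRelations hw _) H.wSieg_eigen⟩
  · rw [H.mem_iwahori_eigenspace_iff] at hv
    exact H.iwahori_eq_zero hw hv.1 hv.2 h

/-- Both vectors lie in the joint eigenspace and have value 1 at the identity, and a vector of that
eigenspace with value 0 is zero. -/
theorem iwahori_eq (hαγ : α + γ ≠ 0) :
    oneSubDiv (α * γ / (p : ℂ) ^ (r₂ + 1)) (GSpFour.U2 π (Iw p) r₁)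
        (fixedInclusion π (Iw_le_Sieg p) (wSieg π r₁ r₂ β γ δ w)) =
      oneSubDiv β (GSpFour.U1 π (Iw p) r₁ r₂)
        (fixedInclusion π (Iw_le_Kl p) (wKl π r₁ r₂ α β γ δ w)) := by
  rw [H.oneSubDiv_U2, H.oneSubDiv_U1, ← sub_eq_zero]
  have hab := H.wKl_eigen (w := w)
  refine H.iwahori_eq_zero hw ?_ ?_ ?_
  · rw [smul_sub, smul_sub, siegel_to_iwahori_eigen₁ H.wSieg_eigen,
      klingen_to_iwahori_eigen₁ H.torus (H.satakeRelations hw _) hab hαγ]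
  · rw [smul_sub, smul_sub,
      siegel_to_iwahori_eigen₂ (H.satakeRelations hw _) H.wSieg_eigen,
      klingen_to_iwahori_eigen₂ hab]
  · have h := apply_klingen_to_iwahori p_ne_neg_one H.alternating₂
      (heckeOp_s2_of_Kl π (wKl π r₁ r₂ α β γ δ w)) hab β
    rw [H.apply_generator, H.apply_generator] at h
    rw [map_sub, H.iwahori_value hw, mul_left_cancel₀ H.ne_zero h, whittakerAt_apply,
      coe_fixedInclusion, H.wKl_value hw hαγ, sub_self]

end IsWhittakerTorus
end Levels

end GSpFour
end

open GSpFour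
theorem mainTheorem8 (p : ℕ) [Fact p.Prime] (r₁ r₂ : ℕ) (hr : r₂ ≤ r₁)
    (ψ : AddChar ℚ_[p] ℂ) (hψ : IsUnramifiedAddChar ψ)
    {V : Type*} [AddCommGroup V] [Module ℂ V] (π : Representation ℂ (GSp4 ℚ_[p]) V)
    (hirr : π.IsIrreducible) (hsm : IsSmooth π) (hunr : IsUnramified π)
    (W : Representation.IntertwiningMap π (rightTranslation (GSp4 ℚ_[p])))
    (hW : IsWhittakerModel ψ W)
    (α β γ δ : ℂ) (hpar : IsHeckeParameters π r₁ r₂ α β γ δ) :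
    -- the normalised spherical vector exists and is unique
    (∃! w : fixedVectors π (hyperspecial p), W (w : V) 1 = 1) ∧
    ∀ wsph : fixedVectors π (hyperspecial p), W (wsph : V) 1 = 1 →
      -- Siegel level
      (IsUnit (U1 π (Sieg p) r₁ r₂) ∧
        IsNormalisedGenerator W (Module.End.eigenspace (U1 π (Sieg p) r₁ r₂) α)
          (wSieg π r₁ r₂ β γ δ wsph)) ∧
      -- Klingen level
      (IsUnit (U2 π (Kl p) r₁) ∧
        (α + γ ≠ 0 →
          IsNormalisedGenerator W
            (Module.End.eigenspace (U2 π (Kl p) r₁) (α * β / (p : ℂ) ^ (r₂ + 1)))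
            (wKl π r₁ r₂ α β γ δ wsph))) ∧
      -- Iwahori level
      (IsUnit (U1 π (Iw p) r₁ r₂) ∧ IsUnit (U2 π (Iw p) r₁) ∧
        IsNormalisedGenerator W
          (Module.End.eigenspace (U1 π (Iw p) r₁ r₂) α ⊓
            Module.End.eigenspace (U2 π (Iw p) r₁) (α * β / (p : ℂ) ^ (r₂ + 1)))
          (oneSubDiv (α * γ / (p : ℂ) ^ (r₂ + 1)) (U2 π (Iw p) r₁)
            (fixedInclusion π (Iw_le_Sieg p) (wSieg π r₁ r₂ β γ δ wsph))) ∧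
        (α + γ ≠ 0 →
          oneSubDiv (α * γ / (p : ℂ) ^ (r₂ + 1)) (U2 π (Iw p) r₁)
              (fixedInclusion π (Iw_le_Sieg p) (wSieg π r₁ r₂ β γ δ wsph)) =
            oneSubDiv β (U1 π (Iw p) r₁ r₂)
              (fixedInclusion π (Iw_le_Kl p) (wKl π r₁ r₂ α β γ δ wsph)))) := by
  obtain ⟨R, _, _, _, _, a, b, ν, ε, κ, ω, H, hω, hω0⟩ := exists_whittakerTorus hunr hψ hW.2 hpar
  have hzero : ∀ w : fixedVectors π (hyperspecial p), W (w : V) 1 = 0 → w = 0 := fun w hw =>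
    H.spherical_eq_zero hψ hW.2 hW.1 hω hω0 hw
  refine ⟨?_, fun w hw => ⟨⟨H.isUnit_U1_Sieg, H.siegel_normalised hw⟩,
    ⟨H.isUnit_U2_Kl, H.klingen_normalised hw⟩, H.isUnit_U1, H.isUnit_U2, H.iwahori_normalised hw,
    H.iwahori_eq hw⟩⟩
  obtain ⟨v, hv, hv0⟩ := (Submodule.ne_bot_iff _).mp hunr
  -- A nonzero spherical vector cannot have value 0 at the identity, so it can be rescaled to value
  -- 1; uniqueness is the same statement for differences.
  have h1 : W v 1 ≠ 0 := fun h => hv0 (congrArg Subtype.val (hzero ⟨v, hv⟩ h))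
  have h2 : W ((W v 1)⁻¹ • v) 1 = 1 := by
    rw [map_smul, Pi.smul_apply, smul_eq_mul, inv_mul_cancel₀ h1]
  refine ⟨⟨(W v 1)⁻¹ • v, Submodule.smul_mem _ _ hv⟩, h2, fun w hw => ?_⟩
  have hw : W (w : V) 1 = 1 := hw
  rw [← sub_eq_zero]
  apply hzero
  rw [Submodule.coe_sub, map_sub, Pi.sub_apply, hw, h2, sub_self]
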